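/- **Setting.** Let $b$ be a prime, $\alpha\ge 2$ an integer, $1\le q\le\infty$ with Hölder conjugate $q'$ ($1/q+1/q'=1$), and let $\boldsymbol\gamma=(\gamma_u)$ be non-negative weights indexed by the finite sets $u\subset\mathbb N$. For $s\in\mathbb N$ let $W_{s,\alpha,\boldsymbol\gamma,q,\infty}$ be the weighted unanchored Sobolev space of dominating mixed smoothness $\alpha$: the continuous $f:[0,1)^s\to\mathbb R$ having integrable (weak) mixed partial derivatives $f^{(\boldsymbol\beta)}$ for all $\boldsymbol\beta\in\{0,\dots,\alpha\}^s$, with finite norm $$\|f\|_{s,\alpha,\boldsymbol\gamma,q,\infty}=\max_{u\subseteq\{1,\dots,s\}}\gamma_u^{-1}\Big(\sum_{v\subseteq u}\ \sum_{\boldsymbol\tau_{u\setminus v}\in\{1,\dots,\alpha\}^{|u\setminus v|}}\int_{[0,1)^{|v|}}\Big|\int_{[0,1)^{s-|v|}}f^{(\boldsymbol\tau_{u\setminus v},\boldsymbol\alpha_v,\boldsymbol 0)}(\boldsymbol x)\,d\boldsymbol x_{-v}\Big|^q d\boldsymbol x_v\Big)^{1/q}$$ (maximum of essential suprema if $q=\infty$;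 if $\gamma_u=0$, the term of $u$ is $0$ when the bracket vanishes and $\infty$ otherwise). Here $(\boldsymbol\tau_{u\setminus v},\boldsymbol\alpha_v,\boldsymbol 0)$ has entry $\tau_j$ for $j\in u\setminus v$, $\alpha$ for $j\in v$, and $0$ for $j\notin u$; $\boldsymbol x_v=(x_j)_{j\in v}$, and $\boldsymbol x_{-v}$ consists of the other coordinates. **Rules.** For $p\in\mathbb F_b[x]$ of degree $n$ and $\boldsymbol g=(g_1,\dots,g_s)$ with $g_j\in\mathbb F_b[x]\setminus\{0\}$, $\deg g_j<n$, let $I(f;P(p,\boldsymbol g))=b^{-n}\sum_{k=0}^{b^n-1}f(\boldsymbol x_k)$, $\boldsymbol x_k=(v_n(k g_1/p),\dots,v_n(k g_s/p))$, where $k=\kappa_0+\kappa_1b+\cdots$ is identified with $\kappa_0+\kappa_1x+\cdots\in\mathbb F_b[x]$ and $v_n:\mathbb F_b((x^{-1}))\to[0,1)$ is $v_n(\sum_{i\ge w}a_ix^{-i})=\sum_{i=\max\{1,w\}}^{n}a_ib^{-i}$. For $m\ge\alpha$, polynomials $p_n$ of degree $n$ and vectors $\boldsymbol g_n$ as above ($m-\alpha+1\le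 n\le m$), the extrapolated polynomial lattice rule is $$Q(f)=\sum_{\tau=1}^{\alpha}a_\tau^{(\alpha)}\,I(f;P(p_{m-\tau+1},\boldsymbol g_{m-\tau+1})),\qquad a_\tau^{(\alpha)}=\prod_{j=1}^{\tau-1}\frac{-1}{b^j-1}\prod_{j=1}^{\alpha-\tau}\frac{b^j}{b^j-1};$$ it uses $N=b^m+b^{m-1}+\cdots+b^{m-\alpha+1}$ function evaluations. Its worst-case error is $\sup\big|Q(f)-\int_{[0,1)^s}f\big|$ over all $f\in W_{s,\alpha,\boldsymbol\gamma,q,\infty}$ with norm at most $1$. **Constants.** For $1/\alpha<\lambda\le1$ put $$J_{s,\lambda,\boldsymbol\gamma}=\Big[\sum_{\emptyset\ne u\subseteq\{1,\dots,s\}}\gamma_u^\lambda C_\alpha^{\lambda|u|}E_{\alpha,\lambda}^{|u|}\Big]^{1/\lambda},\qquad H_{s,\boldsymbol\gamma,q,\infty}=\sum_{u\subseteq\{1,\dots,s\}}\gamma_u(\alpha+1)^{|u|/q'}D_\alpha^{|u|},$$ $$C_\alpha=\max\Big(\tfrac{2}{(2\sin\frac\pi b)^\alpha},\max_{1\le z\le\alpha-1}\tfrac1{(2\sin\frac\pi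 b)^z}\Big)\Big(1+\tfrac1b+\tfrac1{b(b+1)}\Big)^{\alpha-2}\Big(3+\tfrac2b+\tfrac{2b+1}{b-1}\Big),$$ $$E_{\alpha,\lambda}=\sum_{w=1}^{\alpha-1}\prod_{i=1}^{w}\frac{b-1}{b^{\lambda i}-1}+\frac{b^{\lambda\alpha}-1}{b^{\lambda\alpha}-b}\prod_{i=1}^{\alpha}\frac{b-1}{b^{\lambda i}-1},$$ $$D_\alpha=\max\{|b_1(0)|,\dots,|b_{\alpha-1}(0)|,\sup_{x\in[0,1)}|b_\alpha(x)|\},\qquad b_\tau(x)=B_\tau(x)/\tau!,$$ with $B_\tau$ the Bernoulli polynomials. **Claim.** For every $s\ge1$ and every irreducible $p\in\mathbb F_b[x]$ there is a generating vector $\boldsymbol g_{s,p}$ of $s$ nonzero polynomials of degree less than $\deg p$, depending on $b,\alpha,\boldsymbol\gamma,s,p$ but on neither $q$ nor $\lambda$, such that for all $1\le q\le\infty$ and $1/\alpha<\lambda\le 1$ the following holds for the extrapolated polynomial lattice rules with arbitrary irreducible moduli $p_n$ of degree $n$ and $\boldsymbol g_n=\boldsymbol g_{s,p_n}$ ($m-\alpha+1\le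 n\le m$). 1. If $\lim_{s\to\infty}J_{s,\lambda,\boldsymbol\gamma}<\infty$ and $\lim_{s\to\infty}H_{s,\boldsymbol\gamma,q,\infty}<\infty$, there is a constant $K$, independent of $s$, $m$ and the moduli, such that the worst-case error is at most $K N^{-1/\lambda}$ for all $s\ge1$ and $m\ge\alpha$. 2. If for some $\kappa>0$ both $\limsup_{s\to\infty}J_{s,\lambda,\boldsymbol\gamma}/s^{\kappa}<\infty$ and $\limsup_{s\to\infty}H_{s,\boldsymbol\gamma,q,\infty}/s^{\kappa}<\infty$, there are constants $K,t$, independent of $s$, $m$ and the moduli, such that the worst-case error is at most $K s^{t}N^{-1/\lambda}$ for all $s\ge1$ and $m\ge\alpha$. 3. For product weights $\gamma_u=\prod_{j\in u}\gamma_j$ with $\sum_{j=1}^\infty\gamma_j^\lambda<\infty$, the conclusion of 1 holds. 4. For product weights $\gamma_u=\prod_{j\in u}\gamma_j$ with $\limsup_{s\to\infty}\frac{\sum_{j=1}^s\gamma_j^\lambda}{\log(s+1)}<\infty$, the conclusion of 2 holds. -/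

import Mathlib

open Filter Topology MeasureTheory Polynomial
open scoped NNReal ENNReal ContDiff

/-! ### Weighted unanchored Sobolev spaces with dominating mixed smoothness

Coordinates are numbered `0, …, s - 1`; a family of weights is a function `γ : Finset ℕ → ℝ≥0`. -/

/-- The half-open unit cube `[0,1)^ι`. -/
def unitCube (ι : Type*) : Set (ι → ℝ) := Set.pi Set.univ fun _ => Set.Ico 0 1

/-- The open unit cube `(0,1)^ι`. -/
def openUnitCube (ι : Type*) : Set (ι → ℝ) := Set.pi Set.univ fun _ => Set.Ioo 0 1

/-- The classical first partial derivative in direction `j`. -/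
noncomputable def partialDeriv {s : ℕ} (j : Fin s) (φ : (Fin s → ℝ) → ℝ) : (Fin s → ℝ) → ℝ :=
  fun x => fderiv ℝ φ x (Pi.single j 1)

/-- The classical mixed partial derivative of order `β`. -/
noncomputable def mixedPartial {s : ℕ} (β : Fin s → ℕ) (φ : (Fin s → ℝ) → ℝ) :
    (Fin s → ℝ) → ℝ :=
  (List.finRange s).foldr (fun j g => (partialDeriv j)^[β j] g) φ

/-- `g` is an integrable weak mixed derivative of order `β` of `f` on the unit cube. -/
def HasWeakMixedDeriv {s : ℕ} (f : (Fin s → ℝ) → ℝ) (β : Fin s → ℕ) (g : (Fin s → ℝ) → ℝ) :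
    Prop :=
  IntegrableOn g (unitCube (Fin s)) ∧
    ∀ φ : (Fin s → ℝ) → ℝ, ContDiff ℝ ∞ φ → HasCompactSupport φ →
      tsupport φ ⊆ openUnitCube (Fin s) →
      ∫ x in unitCube (Fin s), f x * mixedPartial β φ x =
        (-1) ^ (∑ j, β j) * ∫ x in unitCube (Fin s), g x * φ x

open Classical in
/-- The weak mixed derivative `f^{(β)}` (a chosen representative, unique almost everywhere on the
cube; `0` if there is none). -/
noncomputable def weakMixedDeriv {s : ℕ} (f : (Fin s → ℝ) → ℝ) (β : Fin s → ℕ) :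
    (Fin s → ℝ) → ℝ :=
  if h : ∃ g, HasWeakMixedDeriv f β g then h.choose else 0

/-- `∫_{[0,1)^{s-|v|}} g(x) dx_{-v}` as a function of `x_v`. -/
noncomputable def integrateOut {s : ℕ} (v : Finset (Fin s)) (g : (Fin s → ℝ) → ℝ) :
    ({j // j ∈ v} → ℝ) → ℝ :=
  fun x => ∫ y in unitCube {j // j ∉ v},
    g ((Equiv.piEquivPiSubtypeProd (fun j => j ∈ v) fun _ => ℝ).symm (x, y))

/-- The multi-indices `(τ_{u∖v}, α_v, 0)` with `τ_{u∖v} ∈ {1,…,α}^{|u∖v|}`. -/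
def derivOrders {s : ℕ} (α : ℕ) (u v : Finset (Fin s)) : Finset (Fin s → ℕ) :=
  Fintype.piFinset fun j => if j ∈ v then {α} else if j ∈ u then Finset.Icc 1 α else {0}

/-- The `ℓ^p` norm of a finite family of extended non-negative reals (maximum if `p = ∞`). -/
noncomputable def lpAgg {ι : Type*} (p : ℝ≥0∞) (S : Finset ι) (a : ι → ℝ≥0∞) : ℝ≥0∞ :=
  if p = ⊤ then S.sup a else (∑ i ∈ S, a i ^ p.toReal) ^ (1 / p.toReal)

/-- The norm `‖f‖_{s,α,γ,q,r}`. For `γ_u = 0` the convention is `γ_u⁻¹ = ∞` and `∞ · 0 = 0`. -/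
noncomputable def sobolevNorm {s : ℕ} (α : ℕ) (γ : Finset ℕ → ℝ≥0) (q r : ℝ≥0∞)
    (f : (Fin s → ℝ) → ℝ) : ℝ≥0∞ :=
  lpAgg r (Finset.univ : Finset (Finset (Fin s))) fun u =>
    (γ (u.map Fin.valEmbedding) : ℝ≥0∞)⁻¹ *
      lpAgg q (u.powerset.sigma fun v => derivOrders α u v) fun i =>
        eLpNorm (integrateOut i.1 (weakMixedDeriv f i.2)) q
          (volume.restrict (unitCube {j // j ∈ i.1}))

/-- Membership in `W_{s,α,γ,q,r}`. As point evaluations are used, `f` is the continuous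
representative. -/
def MemSobolev {s : ℕ} (α : ℕ) (γ : Finset ℕ → ℝ≥0) (q r : ℝ≥0∞) (f : (Fin s → ℝ) → ℝ) : Prop :=
  ContinuousOn f (unitCube (Fin s)) ∧
    (∀ β : Fin s → ℕ, (∀ j, β j ≤ α) → ∃ g, HasWeakMixedDeriv f β g) ∧
    sobolevNorm α γ q r f < ⊤

/-! ### Polynomial lattice rules and their extrapolation -/

/-- The embedding of `𝔽_b[x]` into `𝔽_b((x⁻¹))`. The variable of `LaurentSeries` stands for `x⁻¹`,
so `coeff i` is the coefficient of `x^{-i}`. -/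
noncomputable def toLaurentInv {b : ℕ} (g : (ZMod b)[X]) : LaurentSeries (ZMod b) :=
  Polynomial.aeval (HahnSeries.single (-1 : ℤ) (1 : ZMod b) : LaurentSeries (ZMod b)) g

/-- The map `v_m : 𝔽_b((x⁻¹)) → [0,1)`. -/
noncomputable def laurentToUnit {b : ℕ} (m : ℕ) (L : LaurentSeries (ZMod b)) : ℝ :=
  ∑ i ∈ Finset.Icc 1 m, ((L.coeff (i : ℤ)).val : ℝ) / (b : ℝ) ^ i

/-- The polynomial over `𝔽_b` whose coefficients are the first `m` base-`b` digits of `n`. -/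
noncomputable def digitPoly (b m n : ℕ) : (ZMod b)[X] :=
  ∑ i ∈ Finset.range m, C ((n / b ^ i % b : ℕ) : ZMod b) * X ^ i

/-- The node `x_n` of the polynomial lattice point set with modulus `p` and generating
vector `g`. -/
noncomputable def latticePoint {b : ℕ} [Fact b.Prime] {s : ℕ} (p : (ZMod b)[X])
    (g : Fin s → (ZMod b)[X]) (n : ℕ) : Fin s → ℝ :=
  fun j => laurentToUnit p.natDegree
    (toLaurentInv (digitPoly b p.natDegree n * g j) / toLaurentInv p)

/-- The polynomial lattice rule `I(f; P(p, g))`. -/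
noncomputable def latticeRule {b : ℕ} [Fact b.Prime] {s : ℕ} (p : (ZMod b)[X])
    (g : Fin s → (ZMod b)[X]) (f : (Fin s → ℝ) → ℝ) : ℝ :=
  (1 / (b : ℝ) ^ p.natDegree) * ∑ n ∈ Finset.range (b ^ p.natDegree), f (latticePoint p g n)

/-- The Richardson extrapolation coefficient `a_ν^{(τ)}`. -/
noncomputable def richardsonCoeff (b τ ν : ℕ) : ℝ :=
  (∏ j ∈ Finset.Icc 1 (ν - 1), (-1) / ((b : ℝ) ^ j - 1)) *
    ∏ j ∈ Finset.Icc 1 (τ - ν), (b : ℝ) ^ j / ((b : ℝ) ^ j - 1)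

/-- The extrapolated polynomial lattice rule built from the polynomial lattice rules with moduli
`p n` and generating vectors `g n`, `m - α + 1 ≤ n ≤ m`. -/
noncomputable def extrapolatedRule {b : ℕ} [Fact b.Prime] {s : ℕ} (α m : ℕ)
    (p : ℕ → (ZMod b)[X]) (g : ℕ → Fin s → (ZMod b)[X]) (f : (Fin s → ℝ) → ℝ) : ℝ :=
  ∑ τ ∈ Finset.Icc 1 α,
    richardsonCoeff b α τ * latticeRule (p (m - τ + 1)) (g (m - τ + 1)) f

/-- The worst-case error of the extrapolated rule in `W_{s,α,γ,q,r}`. -/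
noncomputable def worstCaseError {b : ℕ} [Fact b.Prime] {s : ℕ} (α : ℕ) (γ : Finset ℕ → ℝ≥0)
    (q r : ℝ≥0∞) (m : ℕ) (p : ℕ → (ZMod b)[X]) (g : ℕ → Fin s → (ZMod b)[X]) : ℝ≥0∞ :=
  ⨆ (f : (Fin s → ℝ) → ℝ) (_ : MemSobolev α γ q r f ∧ sobolevNorm α γ q r f ≤ 1),
    ENNReal.ofReal |extrapolatedRule α m p g f - ∫ x in unitCube (Fin s), f x|

/-- The total number `N = b^m + b^{m-1} + ⋯ + b^{m-α+1}` of function evaluations. -/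
def totalPoints (b α m : ℕ) : ℕ := ∑ n ∈ Finset.Icc (m - α + 1) m, b ^ n

/-! ### The constants -/

/-- The constant `C_α` of the Walsh coefficient bound. -/
noncomputable def walshConst (b α : ℕ) : ℝ :=
  max (2 / (2 * Real.sin (Real.pi / b)) ^ α)
      (⨆ z : Fin (α - 1), 1 / (2 * Real.sin (Real.pi / b)) ^ ((z : ℕ) + 1)) *
    (1 + 1 / (b : ℝ) + 1 / ((b : ℝ) * (b + 1))) ^ (α - 2) *
    (3 + 2 / (b : ℝ) + (2 * b + 1) / ((b : ℝ) - 1))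

/-- The constant `E_{α,λ}`. -/
noncomputable def sumConst (b α : ℕ) (lam : ℝ) : ℝ :=
  ∑ w ∈ Finset.Icc 1 (α - 1), ∏ i ∈ Finset.Icc 1 w, ((b : ℝ) - 1) / ((b : ℝ) ^ (lam * i) - 1) +
    ((b : ℝ) ^ (lam * α) - 1) / ((b : ℝ) ^ (lam * α) - b) *
      ∏ i ∈ Finset.Icc 1 α, ((b : ℝ) - 1) / ((b : ℝ) ^ (lam * i) - 1)

/-- `b_τ(x) = B_τ(x) / τ!` with the Bernoulli polynomial `B_τ`. -/
noncomputable def normBernoulli (τ : ℕ) (x : ℝ) : ℝ :=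
  Polynomial.aeval x (Polynomial.bernoulli τ) / (τ.factorial : ℝ)

/-- `D_α = max {|b_1|, …, |b_{α-1}|, sup_{x ∈ [0,1)} |b_α(x)|}`. -/
noncomputable def bernoulliConst (α : ℕ) : ℝ :=
  max (⨆ τ : Fin (α - 1), |normBernoulli ((τ : ℕ) + 1) 0|)
    (sSup ((fun x => |normBernoulli α x|) '' Set.Ico (0 : ℝ) 1))

/-- `J_{s,λ,γ}`. -/
noncomputable def weightJ (b α : ℕ) (lam : ℝ) (γ : Finset ℕ → ℝ≥0) (s : ℕ) : ℝ :=
  (∑ u ∈ (Finset.range s).powerset.erase ∅,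
    (γ u : ℝ) ^ lam * walshConst b α ^ (lam * (u.card : ℝ)) * sumConst b α lam ^ u.card) ^ (1 / lam)

/-- `H_{s,γ,q,∞}`; here `1 / q' = 1 - 1 / q`. -/
noncomputable def weightH (α : ℕ) (q : ℝ≥0∞) (γ : Finset ℕ → ℝ≥0) (s : ℕ) : ℝ :=
  ∑ u ∈ (Finset.range s).powerset,
    (γ u : ℝ) * ((α : ℝ) + 1) ^ ((u.card : ℝ) * (1 - (q⁻¹).toReal)) * bernoulliConst α ^ u.card

/-- For all dimensions `s`, all `m ≥ α` and all irreducible moduli `p n` of degree `n`,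
`m - α + 1 ≤ n ≤ m`, the extrapolated polynomial lattice rule with generating vectors `g s (p n)`
has worst-case error at most `K s * N^{-1/λ}` in `W_{s,α,γ,q,∞}`. -/
def HasErrorBound {b : ℕ} [Fact b.Prime] (α : ℕ) (γ : Finset ℕ → ℝ≥0) (q : ℝ≥0∞)
    (g : (s : ℕ) → (ZMod b)[X] → Fin s → (ZMod b)[X]) (lam : ℝ) (K : ℕ → ℝ) : Prop :=
  ∀ s : ℕ, 1 ≤ s → ∀ m : ℕ, α ≤ m → ∀ p : ℕ → (ZMod b)[X],
    (∀ n, m - α + 1 ≤ n → n ≤ m → Irreducible (p n) ∧ (p n).natDegree = n) →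
    worstCaseError α γ q ⊤ m p (fun n => g s (p n)) ≤
      ENNReal.ofReal (K s * (totalPoints b α m : ℝ) ^ (-(1 / lam)))

/-! ### Periodized Bernoulli polynomials -/

/-! Everything rests on one pointwise representation of the integrand. Expanding in each variable by
the Euler–Maclaurin (Bernoulli–Taylor) formula, `f` becomes a sum over types `t ∈ {0,…,α+1}^s` of
integrals of a mixed derivative of `f` against a product of one-dimensional kernels: `b_τ(x_j)` when
`t_j = τ ≤ α`, and `-b̃_α(x_j - y_j)`, with `b̃_α` the periodized Bernoulli function, when `t_j = α
+ 1` (`eqOn_sum_kernelIntegral`). The derivatives are only weak, so the formula is first proved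
after pairing with products of test functions and then transferred to points by continuity. A
quadrature rule now only has to be understood on products of kernels.

Apply a lattice rule with `b^n` points to such a product and expand in Walsh series: only the
frequencies in the dual lattice survive. Those whose components all have zero truncation to degree
`< n` form the dual of the full grid with `b^n` points per axis; together they give exactly the
product of the one-dimensional grid averages. So the rule equals a grid part, independent of the
generating vector, plus a sum over proper dual vectors (`norm_lattice_sub_grid_le`).

Grid part: by the multiplication theorem for Bernoulli polynomials the grid average of `b_τ` is
`b_τ(0) b^{-nτ}`, and that of the last kernel is `O(b^{-nα})`. Types of total order below `α` thus
contribute pure powers of `b^{-n}`. The extrapolation coefficients are the Lagrange weights for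
extrapolation to `0`: they keep order `0`, which is the integral, and annihilate orders `1,…,α-1`.
The remainder is `O(b^{-mα})`, and summing over types with Hölder's inequality produces `weightH`
(`ofReal_sum_gridPart_sub_le`).

Proper dual vectors: repeated integration by parts against the primitive of a Walsh function yields
a recursion for the Walsh coefficients of the kernels. The coefficients of `b_τ` vanish when `k` has
more than `τ` nonzero digits, so that in every coordinate the total over all types is at most `C_α
b^{-μ_α(k)}`, where `μ_α` adds up the `α` largest digit positions
(`sum_walshCoeff_add_kernelBound_le`). Summed over the proper dual vectors this is `figureOfMerit`.
For irreducible `p` a fixed vector is properly dual for at most the fraction `1 / (b^n - 1)` of all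
generating vectors, so averaging `λ`-th powers bounds the minimum by `J (b^n - 1)^{-1/λ}`
(`exists_generatingVector`). The minimized quantity involves neither `λ` nor `q`; hence one vector
serves all of them.

Since `λα > 1`, the grid remainder also decays at least like `N^{-1/λ}`, and the error is at most a
constant times `(J + H) N^{-1/λ}`. For product weights `J` and `H` are bounded by exponentials of `∑
γ_j^λ`. -/

lemma normBernoulli_eq (r : ℕ) (x : ℝ) : normBernoulli r x = bernoulliFun r x / (r.factorial : ℝ) := by
  rw [normBernoulli, bernoulliFun, Polynomial.eval_map_algebraMap]

lemma normBernoulli_hasDerivAt (r : ℕ) (x : ℝ) :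
    HasDerivAt (normBernoulli (r + 1)) (normBernoulli r x) x := by
  have h := (hasDerivAt_bernoulliFun (r + 1) x).div_const ((r + 1).factorial : ℝ)
  have e : normBernoulli (r + 1) = fun x => bernoulliFun (r + 1) x / ((r + 1).factorial : ℝ) :=
    funext fun x => normBernoulli_eq _ x
  rw [e, normBernoulli_eq]
  have h1 := Nat.factorial_ne_zero r
  have h2 : ((r + 1 : ℕ) : ℝ) * bernoulliFun (r + 1 - 1) x / ((r + 1).factorial : ℝ) =
      bernoulliFun r x / (r.factorial : ℝ) := by
    rw [Nat.factorial_succ, add_tsub_cancel_right]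
    push_cast
    field_simp
  rwa [h2] at h

lemma continuous_normBernoulli (r : ℕ) : Continuous (normBernoulli r) := by
  have e : normBernoulli r = fun x => bernoulliFun r x / (r.factorial : ℝ) :=
    funext fun x => normBernoulli_eq _ x
  rw [e]
  fun_prop

lemma normBernoulli_zero (x : ℝ) : normBernoulli 0 x = 1 := by
  simp [normBernoulli_eq]

lemma normBernoulli_one (x : ℝ) : normBernoulli 1 x = x - 1 / 2 := by
  simp [normBernoulli_eq]

lemma integral_normBernoulli (r : ℕ) : ∫ x in (0 : ℝ)..1, normBernoulli (r + 1) x = 0 := by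
  simp_rw [normBernoulli_eq]
  rw [intervalIntegral.integral_div, integral_bernoulliFun_eq_zero (by omega), zero_div]

lemma normBernoulli_endpoints (r : ℕ) : normBernoulli (r + 2) 0 = normBernoulli (r + 2) 1 := by
  rw [normBernoulli_eq, normBernoulli_eq, bernoulliFun_endpoints_eq_of_ne_one (by omega)]

/-- The `1`-periodic extension of the normalized Bernoulli polynomial on `[0,1)`. -/
noncomputable def perBernoulli (r : ℕ) (x : ℝ) : ℝ := normBernoulli r (Int.fract x)

lemma perBernoulli_periodic (r : ℕ) : Function.Periodic (perBernoulli r) 1 := by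
  intro x
  simp [perBernoulli]

lemma perBernoulli_of_mem {r : ℕ} {x : ℝ} (hx : x ∈ Set.Ico (0 : ℝ) 1) :
    perBernoulli r x = normBernoulli r x := by
  rw [perBernoulli, Int.fract_eq_self.2 hx]

lemma measurable_perBernoulli (r : ℕ) : Measurable (perBernoulli r) :=
  (continuous_normBernoulli r).measurable.comp measurable_fract

lemma exists_perBernoulli_bound (r : ℕ) : ∃ M : ℝ, 0 ≤ M ∧ ∀ x, |perBernoulli r x| ≤ M := by
  obtain ⟨M, hM⟩ := (isCompact_Icc (a := (0 : ℝ)) (b := 1)).exists_bound_of_continuousOn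
    (continuous_normBernoulli r).continuousOn
  have h : ∀ x, |perBernoulli r x| ≤ M := fun x =>
    hM _ ⟨Int.fract_nonneg x, (Int.fract_lt_one x).le⟩
  exact ⟨M, (abs_nonneg _).trans (h 0), h⟩

/-- From order two on the values at `0` and `1` agree. At order one there is a jump at the integers,
so right derivatives and right continuity are used throughout. -/
lemma continuous_perBernoulli (r : ℕ) : Continuous (perBernoulli (r + 2)) :=
  ContinuousOn.comp_fract'' (continuous_normBernoulli _).continuousOn (normBernoulli_endpoints r)

lemma fract_eventuallyEq_right (x : ℝ) :
    (fun y => Int.fract y) =ᶠ[𝓝[≥] x] fun y => y - ⌊x⌋ := by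
  filter_upwards [Ico_mem_nhdsGE (Int.lt_floor_add_one x)] with y hy
  rw [Int.fract, Int.floor_eq_iff.2 ⟨(Int.floor_le x).trans hy.1, hy.2⟩]

/-- To the right of any point the integer part is locally constant, so a right derivative exists
even at the integers. -/
lemma perBernoulli_hasDerivWithinAt (r : ℕ) (x : ℝ) :
    HasDerivWithinAt (perBernoulli (r + 1)) (perBernoulli r x) (Set.Ici x) x := by
  have h1 : HasDerivAt (fun y : ℝ => normBernoulli (r + 1) (y - ⌊x⌋)) (perBernoulli r x) x := by
    have := (normBernoulli_hasDerivAt r (x - ⌊x⌋)).comp_sub_const x (⌊x⌋ : ℝ)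
    exact this
  refine h1.hasDerivWithinAt.congr_of_eventuallyEq ?_ ?_
  · filter_upwards [fract_eventuallyEq_right x] with y hy
    rw [perBernoulli, hy]
  · rfl

lemma perBernoulli_hasDerivWithinAt_sub (r : ℕ) (x y : ℝ) :
    HasDerivWithinAt (fun z => perBernoulli (r + 1) (z - y)) (perBernoulli r (x - y))
      (Set.Ioi x) x := by
  have h := (perBernoulli_hasDerivWithinAt r (x - y)).scomp x
    (((hasDerivAt_id x).sub_const y).hasDerivWithinAt (s := Set.Ici x))
    (fun z hz => by simpa using hz)
  simpa [Function.comp_def] using h.mono Set.Ioi_subset_Ici_self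

lemma intervalIntegrable_perBernoulli_sub (r : ℕ) (y a c : ℝ) :
    IntervalIntegrable (fun x => perBernoulli r (x - y)) volume a c := by
  obtain ⟨M, _, hM⟩ := exists_perBernoulli_bound r
  have h0 : IntervalIntegrable (fun _ : ℝ => M) volume a c := by simp
  refine h0.mono_fun ?_ ?_
  · exact ((measurable_perBernoulli r).comp (measurable_id.sub_const y)).aestronglyMeasurable
  · refine ae_of_all _ fun x => ?_
    simpa using (hM (x - y)).trans (le_abs_self M)

lemma integral_perBernoulli_sub (r : ℕ) (y : ℝ) :
    ∫ x in (0 : ℝ)..1, perBernoulli (r + 1) (x - y) = 0 := by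
  rw [intervalIntegral.integral_comp_sub_right (perBernoulli (r + 1)) y]
  have h1 : (1 : ℝ) - y = (0 - y) + 1 := by ring
  rw [h1, (perBernoulli_periodic (r + 1)).intervalIntegral_add_eq (0 - y) 0, zero_add]
  refine Eq.trans ?_ (integral_normBernoulli r)
  refine intervalIntegral.integral_congr_ae ?_
  have : ∀ᵐ x : ℝ, x ≠ 1 := by simp [ae_iff]
  filter_upwards [this] with x hx hx'
  rw [Set.uIoc_of_le zero_le_one] at hx'
  exact perBernoulli_of_mem ⟨hx'.1.le, lt_of_le_of_ne hx'.2 hx⟩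

lemma integral_perBernoulli_const_sub (r : ℕ) {x t : ℝ} (ht : 0 ≤ t) :
    ∫ s in (0 : ℝ)..t, perBernoulli (r + 1) (x - s) =
      perBernoulli (r + 2) x - perBernoulli (r + 2) (x - t) := by
  rw [intervalIntegral.integral_comp_sub_left (perBernoulli (r + 1)) x, sub_zero]
  refine intervalIntegral.integral_eq_sub_of_hasDeriv_right_of_le (by linarith)
    (continuous_perBernoulli r).continuousOn
    (fun z _ => (perBernoulli_hasDerivWithinAt (r + 1) z).mono Set.Ioi_subset_Ici_self) ?_
  simpa using intervalIntegrable_perBernoulli_sub (r + 1) 0 (x - t) x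

/-- The multiplication theorem for Bernoulli polynomials. The difference of the two sides has period
`1/M`, so `x` may be taken in `[0, 1/M)`, where no fractional part is active. -/
lemma sum_perBernoulli_grid (r : ℕ) {M : ℕ} (hM : M ≠ 0) (x : ℝ) :
    (1 / (M : ℝ)) * ∑ i ∈ Finset.range M, perBernoulli r (x + i / M) =
      perBernoulli r (M * x) / (M : ℝ) ^ r := by
  have hM' : (M : ℝ) ≠ 0 := Nat.cast_ne_zero.2 hM
  have hMp : (0 : ℝ) < M := by positivity
  have key : Function.Periodic (fun x : ℝ =>
      (1 / (M : ℝ)) * ∑ i ∈ Finset.range M, perBernoulli r (x + i / M) -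
      perBernoulli r (M * x) / (M : ℝ) ^ r) (1 / M) := by
    intro x
    have e1 : ∀ i : ℕ, x + 1 / (M : ℝ) + i / M = x + ((i + 1 : ℕ) : ℝ) / M := by
      intro i; push_cast; field_simp; ring
    have e2 : (M : ℝ) * (x + 1 / M) = M * x + 1 := by field_simp
    have e3 : x + (M : ℝ) / M = x + 1 := by field_simp
    -- The sum of `M + 1` terms is split at either end; the two end terms agree by periodicity, so a
    -- shift by `1/M` leaves the sum unchanged.
    have e4 := Finset.sum_range_succ (fun i : ℕ => perBernoulli r (x + i / M)) M
    rw [Finset.sum_range_succ' (fun i : ℕ => perBernoulli r (x + i / M)) M, e3,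
      perBernoulli_periodic r] at e4
    simp only [Nat.cast_zero, zero_div, add_zero] at e4
    simp only [e1, e2]
    rw [perBernoulli_periodic r, add_right_cancel e4]
  obtain ⟨y, hy, hxy⟩ := key.exists_mem_Ico₀ (by positivity) x
  rw [← sub_eq_zero]
  refine hxy.trans ?_
  have hy1 : (M : ℝ) * y < 1 := by
    have := hy.2; rw [lt_div_iff₀ hMp] at this; linarith
  have hMy : 0 ≤ (M : ℝ) * y := mul_nonneg hMp.le hy.1
  have e1 : ∀ i ∈ Finset.range M, perBernoulli r (y + i / M) = bernoulliFun r (y + i / M) / (r.factorial : ℝ) := by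
    intro i hi
    have hi' : (i : ℝ) + 1 ≤ M := by exact_mod_cast Finset.mem_range.1 hi
    rw [perBernoulli_of_mem, normBernoulli_eq]
    refine ⟨add_nonneg hy.1 (by positivity), ?_⟩
    have h3 : y + i / M = (M * y + i) / M := by field_simp
    rw [h3, div_lt_one hMp]
    linarith
  rw [Finset.sum_congr rfl e1, perBernoulli_of_mem ⟨hMy, hy1⟩, normBernoulli_eq, bernoulliFun_mul r hM,
    ← Finset.sum_div]
  field_simp
  ring

/-! ### Richardson extrapolation -/

/-- Extrapolation to `0` from the nodes `b, b², …, b^α`. The two products in the coefficient are the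
factors of the Lagrange basis polynomial at nodes `j < τ` and `j > τ`, reindexed by the distance to
`τ`. -/
lemma richardsonCoeff_eq_basis {b α τ : ℕ} (hb : 2 ≤ b) (hτ : τ ∈ Finset.Icc 1 α) :
    richardsonCoeff b α τ =
      (Lagrange.basis (Finset.Icc 1 α) (fun j : ℕ => (b : ℝ) ^ j) τ).eval 0 := by
  have hb1 : (1 : ℝ) < b := by exact_mod_cast hb
  have hb0 : (b : ℝ) ≠ 0 := by positivity
  rw [Finset.mem_Icc] at hτ
  have hsplit : (Finset.Icc 1 α).erase τ = Finset.Ico 1 τ ∪ Finset.Ioc τ α := by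
    ext j; simp only [Finset.mem_erase, Finset.mem_Icc, Finset.mem_union, Finset.mem_Ico,
      Finset.mem_Ioc]; omega
  have hdisj : Disjoint (Finset.Ico 1 τ) (Finset.Ioc τ α) := by
    rw [Finset.disjoint_left]; intro j h1 h2
    simp only [Finset.mem_Ico, Finset.mem_Ioc] at h1 h2; omega
  rw [Lagrange.basis, Polynomial.eval_prod, hsplit, Finset.prod_union hdisj, richardsonCoeff]
  have hev : ∀ j, (Lagrange.basisDivisor ((b : ℝ) ^ τ) ((b : ℝ) ^ j)).eval 0 =
      ((b : ℝ) ^ τ - (b : ℝ) ^ j)⁻¹ * (0 - (b : ℝ) ^ j) := by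
    intro j; simp [Lagrange.basisDivisor]
  congr 1
  · refine Finset.prod_bij' (fun i _ => τ - i) (fun i _ => τ - i) ?_ ?_ ?_ ?_ ?_
    · intro i hi; simp only [Finset.mem_Icc, Finset.mem_Ico] at *; omega
    · intro i hi; simp only [Finset.mem_Icc, Finset.mem_Ico] at *; omega
    · intro i hi; simp only [Finset.mem_Icc] at *; omega
    · intro i hi; simp only [Finset.mem_Ico] at *; omega
    · intro i hi
      simp only [Finset.mem_Icc] at hi
      rw [hev]
      have h1 : (b : ℝ) ^ i - 1 ≠ 0 := (sub_pos.2 (one_lt_pow₀ hb1 (by omega))).ne'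
      have h2 : (b : ℝ) ^ τ = b ^ (τ - i) * b ^ i := by rw [← pow_add]; congr 1; omega
      have h3 : (b : ℝ) ^ (τ - i) ≠ 0 := pow_ne_zero _ hb0
      rw [h2, show (b : ℝ) ^ (τ - i) * b ^ i - b ^ (τ - i) = b ^ (τ - i) * (b ^ i - 1) by ring]
      field_simp
      ring
  · refine Finset.prod_bij' (fun i _ => τ + i) (fun i _ => i - τ) ?_ ?_ ?_ ?_ ?_
    · intro i hi; simp only [Finset.mem_Icc, Finset.mem_Ioc] at *; omega
    · intro i hi; simp only [Finset.mem_Icc, Finset.mem_Ioc] at *; omega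
    · intro i hi; simp only [Finset.mem_Icc] at *; omega
    · intro i hi; simp only [Finset.mem_Ioc] at *; omega
    · intro i hi
      simp only [Finset.mem_Icc] at hi
      rw [hev]
      have h1 : (b : ℝ) ^ i - 1 ≠ 0 := (sub_pos.2 (one_lt_pow₀ hb1 (by omega))).ne'
      have h3 : (b : ℝ) ^ τ ≠ 0 := pow_ne_zero _ hb0
      have h4 : 1 - (b : ℝ) ^ i ≠ 0 := by rw [← neg_sub]; exact neg_ne_zero.2 h1
      rw [show (b : ℝ) ^ τ - b ^ (τ + i) = b ^ τ * (1 - b ^ i) by ring, pow_add, zero_sub]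
      rw [mul_inv, div_eq_iff h1]
      field_simp
      ring

/-- Interpolation at `α` nodes reproduces `X^t` for `t < α`; evaluate at `0`. The case `t = 0`
preserves the integral, the others cancel the error terms of order below `α`. -/
lemma sum_richardsonCoeff_mul_pow {b α t : ℕ} (hb : 2 ≤ b) (ht : t < α) :
    ∑ τ ∈ Finset.Icc 1 α, richardsonCoeff b α τ * ((b : ℝ) ^ τ) ^ t = if t = 0 then 1 else 0 := by
  have hb1 : (1 : ℝ) < b := by exact_mod_cast hb
  have hinj : Set.InjOn (fun j : ℕ => (b : ℝ) ^ j) (Finset.Icc 1 α : Finset ℕ) :=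
    fun i _ j _ h => (pow_right_injective₀ (by linarith) hb1.ne') h
  have hdeg : ((Polynomial.X : ℝ[X]) ^ t).degree < (Finset.Icc 1 α).card := by
    rw [Polynomial.degree_X_pow, Nat.card_Icc]
    exact_mod_cast (by omega : t < α + 1 - 1)
  have h := congrArg (Polynomial.eval 0) (Lagrange.eq_interpolate hinj hdeg)
  rw [Lagrange.interpolate_apply, Polynomial.eval_finsetSum] at h
  have h0 : ((Polynomial.X : ℝ[X]) ^ t).eval 0 = if t = 0 then 1 else 0 := by
    rw [Polynomial.eval_pow, Polynomial.eval_X, zero_pow_eq]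
  rw [← h0, h]
  refine Finset.sum_congr rfl fun τ hτ => ?_
  rw [richardsonCoeff_eq_basis hb hτ]
  simp [mul_comm]

/-! ### Walsh functions indexed by polynomials over `ZMod b` -/

/-- The digit of `b^{-(i+1)}` in the base-`b` expansion of `x`. -/
noncomputable def digit (b i : ℕ) (x : ℝ) : ZMod b := ((⌊(b : ℝ) ^ (i + 1) * x⌋ : ℤ) : ZMod b)

/-- The pairing of a polynomial with the digit expansion of a real number. -/
noncomputable def walshPairing {b : ℕ} (k : (ZMod b)[X]) (x : ℝ) : ZMod b :=
  k.sum fun i c => c * digit b i x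

/-- The Walsh function with index `k`. -/
noncomputable def walsh {b : ℕ} [Fact b.Prime] (k : (ZMod b)[X]) (x : ℝ) : ℂ :=
  ZMod.stdAddChar (walshPairing k x)

lemma base_pos {b : ℕ} [hb : Fact b.Prime] : (0 : ℝ) < b := by exact_mod_cast hb.out.pos

lemma two_le_base {b : ℕ} [hb : Fact b.Prime] : (2 : ℝ) ≤ b := by exact_mod_cast hb.out.two_le

section WalshBasic

variable {b : ℕ} [hb : Fact b.Prime]

lemma walshPairing_add (k l : (ZMod b)[X]) (x : ℝ) :
    walshPairing (k + l) x = walshPairing k x + walshPairing l x :=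
  Polynomial.sum_add_index _ _ _ (by simp) (by intros; ring)

lemma walshPairing_monomial (i : ℕ) (c : ZMod b) (x : ℝ) :
    walshPairing (monomial i c) x = c * digit b i x :=
  Polynomial.sum_monomial_index _ _ (by simp)

lemma walshPairing_eq_sum {k : (ZMod b)[X]} {N : ℕ} (hk : k.degree < N) (x : ℝ) :
    walshPairing k x = ∑ i ∈ Finset.range N, k.coeff i * digit b i x := by
  rcases eq_or_ne k 0 with rfl | h0
  · simp [walshPairing]
  · exact Polynomial.sum_over_range' _ (by simp) N ((natDegree_lt_iff_degree_lt h0).2 hk)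

@[simp] lemma walsh_zero (x : ℝ) : walsh (0 : (ZMod b)[X]) x = 1 := by
  simp [walsh, walshPairing]

lemma walsh_add (k l : (ZMod b)[X]) (x : ℝ) : walsh (k + l) x = walsh k x * walsh l x := by
  rw [walsh, walshPairing_add, AddChar.map_add_eq_mul]; rfl

lemma norm_stdAddChar (c : ZMod b) : ‖(ZMod.stdAddChar c : ℂ)‖ = 1 := by
  rw [ZMod.stdAddChar_apply]; exact Circle.norm_coe _

lemma norm_walsh (k : (ZMod b)[X]) (x : ℝ) : ‖walsh k x‖ = 1 := norm_stdAddChar _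

/-- The first `N` digits are encoded in the single integer `⌊b^N x⌋`. Hence Walsh functions of
degree below `N` are step functions of step `b^{-N}`. -/
lemma digit_eq_ediv {i N : ℕ} (hi : i < N) (x : ℝ) :
    digit b i x = ((⌊(b : ℝ) ^ N * x⌋ / (b : ℤ) ^ (N - i - 1) : ℤ) : ZMod b) := by
  have hpos : (0 : ℤ) < (b : ℤ) ^ (N - i - 1) := pow_pos (by exact_mod_cast hb.out.pos) _
  have := Int.mul_cast_floor_div_cancel_of_pos hpos ((b : ℝ) ^ (i + 1) * x)
  rw [digit, ← this]
  have h2 : (b : ℝ) ^ (i + 1) * x * (((b : ℤ) ^ (N - i - 1) : ℤ) : ℝ) = (b : ℝ) ^ N * x := by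
    push_cast
    rw [mul_right_comm, ← pow_add]
    congr 2; omega
  rw [h2]

lemma walsh_congr {k : (ZMod b)[X]} {N : ℕ} (hk : k.degree < N) {x y : ℝ}
    (h : ⌊(b : ℝ) ^ N * x⌋ = ⌊(b : ℝ) ^ N * y⌋) : walsh k x = walsh k y := by
  rw [walsh, walsh, walshPairing_eq_sum hk, walshPairing_eq_sum hk]
  congr 1
  refine Finset.sum_congr rfl fun i hi => ?_
  rw [digit_eq_ediv (Finset.mem_range.1 hi), digit_eq_ediv (Finset.mem_range.1 hi), h]

lemma measurable_walsh (k : (ZMod b)[X]) : Measurable (walsh k) := by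
  have hk : k.degree < ((k.natDegree + 1 : ℕ) : WithBot ℕ) :=
    lt_of_le_of_lt degree_le_natDegree (by exact_mod_cast Nat.lt_succ_self _)
  have e : walsh k = (fun n : ℤ => walsh k (n / (b : ℝ) ^ (k.natDegree + 1))) ∘
      fun x => ⌊(b : ℝ) ^ (k.natDegree + 1) * x⌋ := by
    funext x
    refine walsh_congr hk ?_
    have : (b : ℝ) ^ (k.natDegree + 1) ≠ 0 := (pow_pos base_pos _).ne'
    rw [mul_div_cancel₀ _ this, Int.floor_intCast]
  rw [e]
  exact (measurable_of_countable _).comp (Int.measurable_floor.comp (measurable_const_mul _))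

lemma floor_mul_eventuallyEq_right {c : ℝ} (hc : 0 < c) (x : ℝ) :
    ∀ᶠ y in 𝓝[≥] x, ⌊c * y⌋ = ⌊c * x⌋ := by
  have h1 : x < (⌊c * x⌋ + 1) / c := by
    rw [lt_div_iff₀ hc, mul_comm]; exact Int.lt_floor_add_one _
  filter_upwards [Ico_mem_nhdsGE h1] with y hy
  rw [Int.floor_eq_iff]
  refine ⟨(Int.floor_le _).trans (mul_le_mul_of_nonneg_left hy.1 hc.le), ?_⟩
  have := hy.2
  rwa [lt_div_iff₀ hc, mul_comm] at this

/-! ### The primitive of a Walsh function -/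

lemma degree_lt_natDegree_succ (k : (ZMod b)[X]) : k.degree < ((k.natDegree + 1 : ℕ) : WithBot ℕ) :=
  lt_of_le_of_lt degree_le_natDegree (by exact_mod_cast Nat.lt_succ_self _)

lemma digit_intCast_div {N i : ℕ} (hi : i < N) (n : ℤ) :
    digit b i (n / (b : ℝ) ^ N) = ((n / (b : ℤ) ^ (N - i - 1) : ℤ) : ZMod b) := by
  rw [digit_eq_ediv hi, mul_div_cancel₀ _ (pow_pos base_pos _).ne', Int.floor_intCast]

/-- Splitting off the leading digit. -/
lemma walsh_eq_eraseLead_mul (k : (ZMod b)[X]) (x : ℝ) :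
    walsh k x = walsh k.eraseLead x *
      ZMod.stdAddChar (k.leadingCoeff * digit b k.natDegree x) := by
  conv_lhs => rw [← eraseLead_add_monomial_natDegree_leadingCoeff k]
  rw [walsh_add]
  congr 1
  rw [walsh, walshPairing_monomial]

lemma eraseLead_degree_lt_natDegree (k : (ZMod b)[X]) : k.eraseLead.degree < k.natDegree := by
  rcases eq_or_ne k 0 with rfl | h0
  · simp [bot_lt_iff_ne_bot]
  · rw [← degree_eq_natDegree h0]; exact degree_eraseLead_lt h0

/-- When `b` does not divide `n + 1`, passing from `n` to `n + 1` causes no carry: only the last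
digit changes, and an index of degree below `N` does not see it. -/
lemma walsh_intCast_succ {k : (ZMod b)[X]} {N : ℕ} (hk : k.degree < N) (n : ℤ)
    (hn : ((n + 1 : ℤ) : ZMod b) ≠ 0) :
    walsh k ((n + 1 : ℤ) / (b : ℝ) ^ (N + 1)) = walsh k (n / (b : ℝ) ^ (N + 1)) := by
  rw [walsh, walsh, walshPairing_eq_sum hk, walshPairing_eq_sum hk]
  congr 1
  refine Finset.sum_congr rfl fun i hi => ?_
  have hi := Finset.mem_range.1 hi
  rw [digit_intCast_div (by omega), digit_intCast_div (by omega)]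
  have hbp : (0 : ℤ) < b := by exact_mod_cast hb.out.pos
  have e : (n + 1) / (b : ℤ) = n / b := by
    rw [Ne, ZMod.intCast_zmod_eq_zero_iff_dvd] at hn
    have h1 : (n + 1) % (b : ℤ) ≠ 0 := fun h => hn (Int.dvd_of_emod_eq_zero h)
    have h2 := Int.emod_nonneg (n + 1) hbp.ne'
    have h3 := Int.emod_lt_of_pos (n + 1) hbp
    have h4 := Int.emod_add_mul_ediv (n + 1) (b : ℤ)
    symm
    exact ((Int.ediv_emod_unique (r := (n + 1) % b - 1) hbp).2 ⟨by linarith, by omega, by omega⟩).1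
  have e2 : N + 1 - i - 1 = (N - i - 1) + 1 := by omega
  rw [e2, pow_succ', ← Int.ediv_ediv_of_nonneg hbp.le, ← Int.ediv_ediv_of_nonneg hbp.le, e]

/-- The primitive `x ↦ ∫₀ˣ wal_k` of a Walsh function, in closed form. -/
noncomputable def walshPrimitive (k : (ZMod b)[X]) (x : ℝ) : ℂ :=
  ((b : ℂ) ^ (k.natDegree + 1))⁻¹ *
    ((1 - ZMod.stdAddChar k.leadingCoeff)⁻¹ * (walsh k.eraseLead x - walsh k x) +
      walsh k x * (Int.fract ((b : ℝ) ^ (k.natDegree + 1) * x) : ℝ))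

lemma one_sub_stdAddChar_ne_zero {c : ZMod b} (hc : c ≠ 0) :
    (1 : ℂ) - ZMod.stdAddChar c ≠ 0 := by
  intro h
  apply hc
  apply ZMod.injective_stdAddChar
  rw [AddChar.map_zero_eq_one]
  exact (sub_eq_zero.1 h).symm

/-- The matching condition between neighbouring affine pieces of the primitive. If the last digit
wraps around, both sides vanish, because the values at all `b` digits sum to zero. -/
lemma walsh_eraseLead_sub_succ {k : (ZMod b)[X]} (n : ℤ) :
    walsh k.eraseLead ((n + 1 : ℤ) / (b : ℝ) ^ (k.natDegree + 1)) -
        walsh k ((n + 1 : ℤ) / (b : ℝ) ^ (k.natDegree + 1)) =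
      walsh k.eraseLead (n / (b : ℝ) ^ (k.natDegree + 1)) -
        ZMod.stdAddChar k.leadingCoeff * walsh k (n / (b : ℝ) ^ (k.natDegree + 1)) := by
  have hd : ∀ n : ℤ, digit b k.natDegree (n / (b : ℝ) ^ (k.natDegree + 1)) = (n : ZMod b) := by
    intro n
    rw [digit_intCast_div (Nat.lt_succ_self _)]
    simp
  rw [walsh_eq_eraseLead_mul k, walsh_eq_eraseLead_mul k, hd, hd]
  by_cases hn : ((n + 1 : ℤ) : ZMod b) = 0
  · rw [hn, mul_zero, AddChar.map_zero_eq_one, mul_one, sub_self, mul_left_comm,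
      ← AddChar.map_add_eq_mul]
    have : k.leadingCoeff + k.leadingCoeff * (n : ZMod b) = 0 := by
      push_cast at hn
      linear_combination k.leadingCoeff * hn
    rw [this, AddChar.map_zero_eq_one, mul_one, sub_self]
  · rw [walsh_intCast_succ (eraseLead_degree_lt_natDegree k) n hn, mul_left_comm,
      ← AddChar.map_add_eq_mul]
    push_cast
    rw [mul_add, mul_one, add_comm (k.leadingCoeff * (n : ZMod b))]

/-- The right endpoint is included: there the fractional part drops to `0`, and the jump of the
Walsh terms compensates. Continuity follows by gluing closed cells. -/
lemma walshPrimitive_eq_affine {k : (ZMod b)[X]} (hk : k ≠ 0) (n : ℤ) {x : ℝ}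
    (hx : x ∈ Set.Icc (n / (b : ℝ) ^ (k.natDegree + 1)) ((n + 1) / (b : ℝ) ^ (k.natDegree + 1))) :
    walshPrimitive k x = ((b : ℂ) ^ (k.natDegree + 1))⁻¹ *
      ((1 - ZMod.stdAddChar k.leadingCoeff)⁻¹ * (walsh k.eraseLead (n / (b : ℝ) ^ (k.natDegree + 1))
        - walsh k (n / (b : ℝ) ^ (k.natDegree + 1))) +
      walsh k (n / (b : ℝ) ^ (k.natDegree + 1)) *
        (((b : ℝ) ^ (k.natDegree + 1) * x - n : ℝ) : ℂ)) := by
  have hB : (0 : ℝ) < (b : ℝ) ^ (k.natDegree + 1) := pow_pos base_pos _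
  have hA := one_sub_stdAddChar_ne_zero (leadingCoeff_ne_zero.2 hk)
  rcases hx with ⟨h1, h2⟩
  rw [div_le_iff₀ hB, mul_comm] at h1
  rw [le_div_iff₀ hB, mul_comm] at h2
  rcases h2.lt_or_eq with h2 | h2
  · have hfl : ⌊(b : ℝ) ^ (k.natDegree + 1) * x⌋ = n := Int.floor_eq_iff.2 ⟨h1, h2⟩
    have hfl' : ⌊(b : ℝ) ^ (k.natDegree + 1) * x⌋ =
        ⌊(b : ℝ) ^ (k.natDegree + 1) * (n / (b : ℝ) ^ (k.natDegree + 1))⌋ := by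
      rw [mul_div_cancel₀ _ hB.ne', Int.floor_intCast, hfl]
    rw [walshPrimitive, walsh_congr (degree_lt_natDegree_succ k) hfl',
      walsh_congr ((degree_eraseLead_lt hk).trans (degree_lt_natDegree_succ k)) hfl', Int.fract, hfl]
  · have hx : x = ((n + 1 : ℤ) : ℝ) / (b : ℝ) ^ (k.natDegree + 1) := by
      rw [eq_div_iff hB.ne', mul_comm, h2]; push_cast; rfl
    rw [walshPrimitive, hx, walsh_eraseLead_sub_succ, mul_div_cancel₀ _ hB.ne', Int.fract_intCast]
    congr 1
    push_cast
    field_simp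
    ring

lemma continuous_walshPrimitive {k : (ZMod b)[X]} (hk : k ≠ 0) : Continuous (walshPrimitive k) := by
  have hB : (0 : ℝ) < (b : ℝ) ^ (k.natDegree + 1) := pow_pos base_pos _
  have hcell : ∀ n : ℤ, ContinuousOn (walshPrimitive k)
      (Set.Icc (n / (b : ℝ) ^ (k.natDegree + 1)) ((n + 1) / (b : ℝ) ^ (k.natDegree + 1))) := by
    intro n
    refine ContinuousOn.congr ?_ (fun x hx => walshPrimitive_eq_affine hk n hx)
    exact Continuous.continuousOn (by fun_prop)
  rw [continuous_iff_continuousAt]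
  intro x
  rw [continuousAt_iff_continuous_left_right]
  constructor
  · set n : ℤ := ⌈(b : ℝ) ^ (k.natDegree + 1) * x⌉ - 1
    have hn1 : (n : ℝ) < (b : ℝ) ^ (k.natDegree + 1) * x := by
      have := Int.ceil_lt_add_one ((b : ℝ) ^ (k.natDegree + 1) * x)
      simp only [n]; push_cast; linarith
    have hn2 : (b : ℝ) ^ (k.natDegree + 1) * x ≤ n + 1 := by
      have := Int.le_ceil ((b : ℝ) ^ (k.natDegree + 1) * x)
      simp only [n]; push_cast; linarith
    have h1 : n / (b : ℝ) ^ (k.natDegree + 1) < x := by rw [div_lt_iff₀ hB]; linarith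
    have h2 : x ≤ (n + 1) / (b : ℝ) ^ (k.natDegree + 1) := by rw [le_div_iff₀ hB]; linarith
    refine (hcell n x ⟨h1.le, h2⟩).mono_of_mem_nhdsWithin ?_
    exact mem_of_superset (Icc_mem_nhdsLE h1) (Set.Icc_subset_Icc_right h2)
  · have h1 : ⌊(b : ℝ) ^ (k.natDegree + 1) * x⌋ / (b : ℝ) ^ (k.natDegree + 1) ≤ x := by
      rw [div_le_iff₀ hB]
      have := Int.floor_le ((b : ℝ) ^ (k.natDegree + 1) * x); linarith
    have h2 : x < (⌊(b : ℝ) ^ (k.natDegree + 1) * x⌋ + 1) / (b : ℝ) ^ (k.natDegree + 1) := by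
      rw [lt_div_iff₀ hB]
      have := Int.lt_floor_add_one ((b : ℝ) ^ (k.natDegree + 1) * x); linarith
    refine (hcell _ x ⟨h1, h2.le⟩).mono_of_mem_nhdsWithin ?_
    exact mem_of_superset (Icc_mem_nhdsGE h2) (Set.Icc_subset_Icc_left h1)

lemma walshPrimitive_hasDerivWithinAt {k : (ZMod b)[X]} (hk : k ≠ 0) (x : ℝ) :
    HasDerivWithinAt (walshPrimitive k) (walsh k x) (Set.Ioi x) x := by
  have hB : (0 : ℝ) < (b : ℝ) ^ (k.natDegree + 1) := pow_pos base_pos _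
  have hBc : (b : ℂ) ^ (k.natDegree + 1) ≠ 0 := by exact_mod_cast hB.ne'
  have h0 : HasDerivAt (fun y : ℝ => ((b : ℂ) ^ (k.natDegree + 1))⁻¹ *
    ((1 - ZMod.stdAddChar k.leadingCoeff)⁻¹ * (walsh k.eraseLead x - walsh k x) +
      walsh k x * (((b : ℝ) ^ (k.natDegree + 1) * y - ⌊(b : ℝ) ^ (k.natDegree + 1) * x⌋ : ℝ) : ℂ)))
      (((b : ℂ) ^ (k.natDegree + 1))⁻¹ * (walsh k x * (((b : ℝ) ^ (k.natDegree + 1) * 1 : ℝ) : ℂ))) x := by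
    refine HasDerivAt.const_mul _ (HasDerivAt.const_add _ (HasDerivAt.const_mul _ ?_))
    exact (((hasDerivAt_id x).const_mul _).sub_const _).ofReal_comp
  have e : ((b : ℂ) ^ (k.natDegree + 1))⁻¹ * (walsh k x * (((b : ℝ) ^ (k.natDegree + 1) * 1 : ℝ) : ℂ))
      = walsh k x := by
    push_cast; field_simp
  rw [e] at h0
  refine (h0.hasDerivWithinAt (s := Set.Ici x)).congr_of_eventuallyEq ?_ ?_ |>.mono
    Set.Ioi_subset_Ici_self
  · filter_upwards [floor_mul_eventuallyEq_right hB x] with y hy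
    rw [walshPrimitive, walsh_congr (degree_lt_natDegree_succ k) hy,
      walsh_congr ((degree_eraseLead_lt hk).trans (degree_lt_natDegree_succ k)) hy, Int.fract, hy]
  · rw [walshPrimitive, Int.fract]

lemma digit_intCast (i : ℕ) (n : ℤ) : digit b i n = 0 := by
  rw [digit]
  have : (b : ℝ) ^ (i + 1) * n = (((b : ℤ) ^ (i + 1) * n : ℤ) : ℝ) := by push_cast; rfl
  rw [this, Int.floor_intCast]
  push_cast
  simp [pow_succ]

lemma walsh_intCast (k : (ZMod b)[X]) (n : ℤ) : walsh k n = 1 := by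
  rw [walsh, walshPairing_eq_sum (degree_lt_natDegree_succ k)]
  simp [digit_intCast]

lemma walshPrimitive_intCast (k : (ZMod b)[X]) (n : ℤ) : walshPrimitive k n = 0 := by
  have : (b : ℝ) ^ (k.natDegree + 1) * n = (((b : ℤ) ^ (k.natDegree + 1) * n : ℤ) : ℝ) := by
    push_cast; rfl
  rw [walshPrimitive, walsh_intCast, walsh_intCast, this, Int.fract_intCast]
  simp

end WalshBasic

/-! ### Fourier expansion of digits -/

/-- The constant `1 / (2 sin (π / b))`. -/
noncomputable def cscConst (b : ℕ) : ℝ := 1 / (2 * Real.sin (Real.pi / b))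

lemma sin_pi_div_pos {b : ℕ} [hb : Fact b.Prime] : 0 < Real.sin (Real.pi / b) := by
  have h2 : (2 : ℝ) ≤ b := two_le_base
  refine Real.sin_pos_of_pos_of_lt_pi (by positivity) ?_
  rw [div_lt_iff₀ (by linarith)]
  nlinarith [Real.pi_pos]

lemma cscConst_pos {b : ℕ} [hb : Fact b.Prime] : 0 < cscConst b := by
  have := sin_pi_div_pos (b := b)
  rw [cscConst]; positivity

section WalshCoeff

variable {b : ℕ} [hb : Fact b.Prime]

/-- The modulus is `2 sin(πv/b)` with `v` the residue of `c`; on `1 ≤ v ≤ b - 1` it is smallest at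
the two ends. -/
lemma two_sin_le_norm_one_sub {c : ZMod b} (hc : c ≠ 0) :
    2 * Real.sin (Real.pi / b) ≤ ‖(1 : ℂ) - ZMod.stdAddChar c‖ := by
  have hbp : (0 : ℝ) < b := base_pos
  have hv : c.val ≠ 0 := by rwa [Ne, ZMod.val_eq_zero]
  have hlt : c.val < b := ZMod.val_lt c
  have h1 : (ZMod.stdAddChar c : ℂ) = Complex.exp (Complex.I * ((2 * Real.pi * c.val / b : ℝ) : ℂ)) := by
    have := ZMod.stdAddChar_coe (N := b) (c.val : ℤ)
    have hc' : (((c.val : ℕ) : ℤ) : ZMod b) = c := by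
      rw [Int.cast_natCast]; exact ZMod.natCast_zmod_val c
    rw [hc'] at this
    rw [this]
    congr 1
    push_cast
    ring
  rw [norm_sub_rev, h1, Complex.norm_exp_I_mul_ofReal_sub_one, Real.norm_eq_abs, abs_mul]
  have h2 : 2 * Real.pi * c.val / b / 2 = c.val * (Real.pi / b) := by ring
  rw [h2, abs_two]
  refine mul_le_mul_of_nonneg_left ?_ zero_le_two
  refine le_trans ?_ (le_abs_self _)
  have hpb : 0 < Real.pi / b := by positivity
  have hv1 : (1 : ℝ) ≤ c.val := by exact_mod_cast Nat.one_le_iff_ne_zero.2 hv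
  have hv2 : (c.val : ℝ) + 1 ≤ b := by exact_mod_cast hlt
  have hpi : b * (Real.pi / b) = Real.pi := by field_simp
  rcases le_total (c.val * (Real.pi / b)) (Real.pi / 2) with h | h
  · exact Real.sin_le_sin_of_le_of_le_pi_div_two (by linarith [Real.pi_pos]) h (by nlinarith)
  · rw [← Real.sin_pi_sub (c.val * (Real.pi / b))]
    exact Real.sin_le_sin_of_le_of_le_pi_div_two (by linarith [Real.pi_pos]) (by linarith) (by nlinarith)

lemma norm_inv_one_sub_le {c : ZMod b} (hc : c ≠ 0) :
    ‖((1 : ℂ) - ZMod.stdAddChar c)⁻¹‖ ≤ cscConst b := by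
  have := sin_pi_div_pos (b := b)
  rw [norm_inv, cscConst, one_div]
  exact inv_anti₀ (by positivity) (two_sin_le_norm_one_sub hc)

/-- This is the coefficient of the Walsh function itself in the expansion of its primitive. With `ω`
the character value it equals `-(1 + ω) / (2 (1 - ω))`, and `|1 + ω| ≤ 2`. -/
lemma norm_half_sub_inv_le {c : ZMod b} (hc : c ≠ 0) :
    ‖(1 / 2 : ℂ) - ((1 : ℂ) - ZMod.stdAddChar c)⁻¹‖ ≤ cscConst b := by
  have h0 := one_sub_stdAddChar_ne_zero hc
  have e : (1 / 2 : ℂ) - ((1 : ℂ) - ZMod.stdAddChar c)⁻¹ =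
      -((1 + ZMod.stdAddChar c) / 2) * ((1 : ℂ) - ZMod.stdAddChar c)⁻¹ := by
    field_simp; ring
  rw [e, norm_mul, norm_neg, norm_div]
  have h1 : ‖(1 : ℂ) + ZMod.stdAddChar c‖ ≤ 2 := by
    refine (norm_add_le _ _).trans ?_
    rw [norm_stdAddChar, norm_one]; norm_num
  have h2 : ‖(1 : ℂ) + ZMod.stdAddChar c‖ / ‖(2 : ℂ)‖ ≤ 1 := by
    rw [Complex.norm_ofNat, div_le_one two_pos]; exact h1
  calc _ ≤ 1 * ‖((1 : ℂ) - ZMod.stdAddChar c)⁻¹‖ :=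
        mul_le_mul_of_nonneg_right h2 (norm_nonneg _)
    _ ≤ _ := by rw [one_mul]; exact norm_inv_one_sub_le hc

lemma sum_stdAddChar_mul (t : ZMod b) :
    ∑ θ : ZMod b, (ZMod.stdAddChar (θ * t) : ℂ) = if t = 0 then (b : ℂ) else 0 := by
  have := AddChar.sum_mulShift t (ZMod.isPrimitive_stdAddChar b)
  rw [this, ZMod.card]
  split_ifs <;> simp

lemma sum_val_zmod : ∑ d : ZMod b, (d.val : ℂ) = b * (b - 1) / 2 := by
  obtain ⟨n, rfl⟩ : ∃ n, b = n + 1 := ⟨b - 1, by have := hb.out.pos; omega⟩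
  have h : ∑ d : ZMod (n + 1), (d.val : ℂ) = ∑ i ∈ Finset.range (n + 1), (i : ℂ) :=
    Fin.sum_univ_eq_sum_range (fun i => (i : ℂ)) (n + 1)
  have h2 := Finset.sum_range_id_mul_two (n + 1)
  have h3 : (∑ i ∈ Finset.range (n + 1), (i : ℂ)) * 2 = ((n + 1 : ℕ) : ℂ) * n := by
    have := congrArg (Nat.cast : ℕ → ℂ) h2
    push_cast at this ⊢
    simpa using this
  rw [h]
  push_cast at h3 ⊢
  linear_combination h3 / 2

lemma val_sub_one (d : ZMod b) : ((d - 1).val : ℂ) = d.val - 1 + if d = 0 then (b : ℂ) else 0 := by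
  obtain ⟨n, rfl⟩ : ∃ n, b = n + 1 := ⟨b - 1, by have := hb.out.pos; omega⟩
  split_ifs with h
  · subst h
    simp only [zero_sub, ZMod.val_neg_one, ZMod.val_zero]
    push_cast; ring
  · have h1 : 1 ≤ d.val := Nat.one_le_iff_ne_zero.2 (by rwa [Ne, ZMod.val_eq_zero])
    have h1' : (1 : ZMod (n + 1)).val = 1 := by
      have : Fact (1 < n + 1) := ⟨hb.out.one_lt⟩
      exact ZMod.val_one _
    rw [ZMod.val_sub (by rw [h1']; exact h1), h1', Nat.cast_sub h1]
    simp

/-- Discrete Fourier expansion of a centred digit. -/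
lemma exists_digit_fourier : ∃ f : ZMod b → ℂ, (∀ θ, θ ≠ 0 → ‖f θ‖ ≤ cscConst b) ∧
    ∀ d : ZMod b, (d.val : ℂ) - (b - 1) / 2 =
      ∑ θ ∈ Finset.univ.erase 0, f θ * ZMod.stdAddChar (θ * d) := by
  have hb0 : (b : ℂ) ≠ 0 := by exact_mod_cast hb.out.ne_zero
  set f : ZMod b → ℂ := fun θ => (1 / b) * ∑ e : ZMod b, (e.val : ℂ) * ZMod.stdAddChar (-(θ * e)) with hf
  refine ⟨f, fun θ hθ => ?_, fun d => ?_⟩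
  -- Summation by parts on the cyclic group: shifting `e` leaves the differences of consecutive
  -- digit values, which are `-1` except for the wrap-around at `e = 0`.
  · have h1 : (ZMod.stdAddChar (-θ) - 1) * ∑ e : ZMod b, (e.val : ℂ) * ZMod.stdAddChar (-(θ * e)) = b := by
      rw [sub_mul, one_mul, Finset.mul_sum]
      have e1 : ∑ e : ZMod b, ZMod.stdAddChar (-θ) * ((e.val : ℂ) * ZMod.stdAddChar (-(θ * e))) =
          ∑ e : ZMod b, ((e - 1).val : ℂ) * ZMod.stdAddChar (-(θ * e)) := by
        rw [← (Equiv.subRight (1 : ZMod b)).sum_comp]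
        refine Finset.sum_congr rfl fun e _ => ?_
        rw [mul_left_comm, ← AddChar.map_add_eq_mul]
        congr 2
        simp only [Equiv.subRight_apply]; ring
      rw [e1, ← Finset.sum_sub_distrib]
      have e2 : ∀ e : ZMod b, ((e - 1).val : ℂ) * ZMod.stdAddChar (-(θ * e)) -
          (e.val : ℂ) * ZMod.stdAddChar (-(θ * e)) =
          (if e = 0 then (b : ℂ) else 0) - ZMod.stdAddChar (e * (-θ)) := by
        intro e
        rw [val_sub_one, show e * (-θ) = -(θ * e) by ring]
        split_ifs with h
        · subst h; simp; ring
        · ring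
      rw [Finset.sum_congr rfl fun e _ => e2 e, Finset.sum_sub_distrib, sum_stdAddChar_mul,
        if_neg (neg_ne_zero.2 hθ)]
      simp
    have h2 := one_sub_stdAddChar_ne_zero (neg_ne_zero.2 hθ)
    have h3 : f θ = -(1 - ZMod.stdAddChar (-θ))⁻¹ := by
      rw [hf]
      simp only []
      have h4 : ∑ e : ZMod b, (e.val : ℂ) * ZMod.stdAddChar (-(θ * e)) =
          -(b * (1 - ZMod.stdAddChar (-θ))⁻¹) := by
        field_simp
        linear_combination -h1
      rw [h4]; field_simp
    rw [h3, norm_neg]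
    exact norm_inv_one_sub_le (neg_ne_zero.2 hθ)
  -- The frequency `0` is the mean digit, exactly what centring removes.
  · have h0 : f 0 * ZMod.stdAddChar (0 * d) = (b - 1) / 2 := by
      simp only [hf, zero_mul, neg_zero, AddChar.map_zero_eq_one, mul_one, sum_val_zmod]
      field_simp
    have h1 : ∑ θ : ZMod b, f θ * ZMod.stdAddChar (θ * d) = d.val := by
      have e1 : ∀ θ : ZMod b, f θ * ZMod.stdAddChar (θ * d) =
          ∑ e : ZMod b, (1 / b) * (e.val : ℂ) * ZMod.stdAddChar (θ * (d - e)) := by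
        intro θ
        rw [hf]
        simp only [Finset.mul_sum, Finset.sum_mul]
        refine Finset.sum_congr rfl fun e _ => ?_
        rw [mul_assoc, mul_assoc, ← AddChar.map_add_eq_mul, mul_assoc]
        congr 4; ring
      rw [Finset.sum_congr rfl fun θ _ => e1 θ, Finset.sum_comm]
      simp_rw [← Finset.mul_sum, sum_stdAddChar_mul, sub_eq_zero]
      simp only [mul_ite, mul_zero, Finset.sum_ite_eq, Finset.mem_univ, if_true]
      field_simp
    rw [← h1, ← Finset.add_sum_erase _ _ (Finset.mem_univ (0 : ZMod b)), h0]
    ring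

lemma fract_eq_digit_add (i : ℕ) (x : ℝ) :
    Int.fract ((b : ℝ) ^ i * x) =
      ((digit b i x).val : ℝ) / b + Int.fract ((b : ℝ) ^ (i + 1) * x) / b := by
  have hbp : (0 : ℝ) < b := base_pos
  set z := (b : ℝ) ^ i * x with hz
  have hz' : (b : ℝ) ^ (i + 1) * x = b * z := by rw [hz, pow_succ]; ring
  have hd : digit b i x = ((⌊(b : ℝ) * z⌋ - b * ⌊z⌋ : ℤ) : ZMod b) := by
    rw [digit, hz']; push_cast; simp
  have h0 : 0 ≤ ⌊(b : ℝ) * z⌋ - b * ⌊z⌋ := by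
    rw [sub_nonneg, Int.le_floor]; push_cast
    exact mul_le_mul_of_nonneg_left (Int.floor_le z) hbp.le
  have h1 : ⌊(b : ℝ) * z⌋ - b * ⌊z⌋ < b := by
    rw [sub_lt_iff_lt_add', Int.floor_lt]; push_cast
    nlinarith [Int.lt_floor_add_one z]
  have h2 : ((digit b i x).val : ℝ) = ⌊(b : ℝ) * z⌋ - b * ⌊z⌋ := by
    have h3 : ((digit b i x).val : ℤ) = ⌊(b : ℝ) * z⌋ - b * ⌊z⌋ := by
      rw [hd, ZMod.val_intCast, Int.emod_eq_of_lt h0 h1]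
    have h4 := congrArg (Int.cast : ℤ → ℝ) h3
    push_cast at h4
    exact h4
  rw [h2, hz', Int.fract, Int.fract]
  field_simp
  ring

/-- Finite digit expansion of the centred sawtooth function. -/
lemma fract_sub_half_eq_sum (a M : ℕ) (x : ℝ) :
    Int.fract ((b : ℝ) ^ a * x) - 1 / 2 =
      ∑ c ∈ Finset.range M, ((b : ℝ) ^ (c + 1))⁻¹ * (((digit b (a + c) x).val : ℝ) - (b - 1) / 2) +
        ((b : ℝ) ^ M)⁻¹ * (Int.fract ((b : ℝ) ^ (a + M) * x) - 1 / 2) := by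
  have hbp : (0 : ℝ) < b := base_pos
  induction M with
  | zero => simp
  | succ M ih =>
    rw [ih, Finset.sum_range_succ, fract_eq_digit_add (a + M) x]
    rw [show a + (M + 1) = a + M + 1 by ring, add_assoc (Finset.sum _ _)]
    congr 1
    field_simp
    ring

/-! ### Walsh coefficients of periodized Bernoulli polynomials -/

/-- The Walsh coefficient with index `k` of `x ↦ perBernoulli r (x - y)`. -/
noncomputable def walshCoeff (r : ℕ) (y : ℝ) (k : (ZMod b)[X]) : ℂ :=
  ∫ x in (0 : ℝ)..1, (perBernoulli r (x - y) : ℂ) * walsh k x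

lemma intervalIntegrable_of_bounded {f : ℝ → ℂ} (hf : Measurable f) {C : ℝ} (hC : ∀ x, ‖f x‖ ≤ C)
    (a c : ℝ) : IntervalIntegrable f volume a c := by
  have h0 : IntervalIntegrable (fun _ : ℝ => C) volume a c := by simp
  refine h0.mono_fun hf.aestronglyMeasurable (ae_of_all _ fun x => ?_)
  exact (hC x).trans (le_abs_self C)

lemma intervalIntegrable_perBernoulli_mul {f : ℝ → ℂ} (hf : Measurable f) {C : ℝ}
    (hC : ∀ x, ‖f x‖ ≤ C) (r : ℕ) (y a c : ℝ) :
    IntervalIntegrable (fun x => (perBernoulli r (x - y) : ℂ) * f x) volume a c := by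
  obtain ⟨M, hM0, hM⟩ := exists_perBernoulli_bound r
  refine intervalIntegrable_of_bounded (C := M * C) ?_ (fun x => ?_) a c
  · exact (Complex.measurable_ofReal.comp
      ((measurable_perBernoulli r).comp (measurable_id.sub_const y))).mul hf
  · rw [norm_mul, Complex.norm_real]
    exact mul_le_mul (hM _) (hC x) (norm_nonneg _) hM0

lemma walsh_monomial (i : ℕ) (c : ZMod b) (x : ℝ) :
    walsh (monomial i c) x = ZMod.stdAddChar (c * digit b i x) := by
  rw [walsh, walshPairing_monomial]

lemma walshCoeff_zero (r : ℕ) (y : ℝ) : walshCoeff (r + 1) y (0 : (ZMod b)[X]) = 0 := by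
  simp only [walshCoeff, walsh_zero, mul_one]
  rw [intervalIntegral.integral_ofReal, integral_perBernoulli_sub, Complex.ofReal_zero]

/-- Integration by parts; the boundary terms vanish because the primitive is `0` at integers. Order
at least two is needed for the kernel to be continuous. -/
lemma walshCoeff_succ_eq (r : ℕ) (y : ℝ) {k : (ZMod b)[X]} (hk : k ≠ 0) :
    walshCoeff (r + 2) y k =
      -∫ x in (0 : ℝ)..1, (perBernoulli (r + 1) (x - y) : ℂ) * walshPrimitive k x := by
  have hu' : IntervalIntegrable (fun x => (perBernoulli (r + 1) (x - y) : ℂ)) volume 0 1 := by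
    simpa using intervalIntegrable_perBernoulli_mul (f := fun _ => (1 : ℂ)) measurable_const
      (C := 1) (fun _ => by simp) (r + 1) y 0 1
  have h := intervalIntegral.integral_mul_deriv_eq_deriv_mul_of_hasDeriv_right (a := 0) (b := 1)
    (u := fun x => (perBernoulli (r + 2) (x - y) : ℂ))
    (u' := fun x => (perBernoulli (r + 1) (x - y) : ℂ)) (v := walshPrimitive k) (v' := walsh k)
    (Continuous.continuousOn (Complex.continuous_ofReal.comp
      ((continuous_perBernoulli r).comp (by fun_prop))))
    (continuous_walshPrimitive hk).continuousOn
    (fun x _ => (perBernoulli_hasDerivWithinAt_sub (r + 1) x y).ofReal_comp)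
    (fun x _ => walshPrimitive_hasDerivWithinAt hk x)
    hu'
    (intervalIntegrable_of_bounded (measurable_walsh k) (C := 1) (fun x => (norm_walsh k x).le) _ _)
  have h0 : walshPrimitive k (0 : ℝ) = 0 := by simpa using walshPrimitive_intCast k 0
  have h1 : walshPrimitive k (1 : ℝ) = 0 := by simpa using walshPrimitive_intCast k 1
  rw [walshCoeff, h, h0, h1]
  simp

/-- Finite Walsh expansion of the primitive of a Walsh function. -/
lemma walshPrimitive_eq_sum {f : ZMod b → ℂ} (hf : ∀ d : ZMod b, (d.val : ℂ) - (b - 1) / 2 =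
      ∑ θ ∈ Finset.univ.erase 0, f θ * ZMod.stdAddChar (θ * d)) (k : (ZMod b)[X]) (M : ℕ) (x : ℝ) :
    walshPrimitive k x = ((b : ℂ) ^ (k.natDegree + 1))⁻¹ *
      ((1 - ZMod.stdAddChar k.leadingCoeff)⁻¹ * walsh k.eraseLead x +
        (1 / 2 - (1 - ZMod.stdAddChar k.leadingCoeff)⁻¹) * walsh k x +
        ∑ c ∈ Finset.range M, ((b : ℂ) ^ (c + 1))⁻¹ * ∑ θ ∈ Finset.univ.erase 0,
          f θ * walsh (k + monomial (k.natDegree + 1 + c) θ) x +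
        ((b : ℂ) ^ M)⁻¹ * (walsh k x *
          ((Int.fract ((b : ℝ) ^ (k.natDegree + 1 + M) * x) - 1 / 2 : ℝ) : ℂ))) := by
  have h1 := congrArg (Complex.ofReal) (fract_sub_half_eq_sum (b := b) (k.natDegree + 1) M x)
  have h2 : ((Int.fract ((b : ℝ) ^ (k.natDegree + 1) * x) : ℝ) : ℂ) = 1 / 2 +
      (∑ c ∈ Finset.range M, ((b : ℂ) ^ (c + 1))⁻¹ * ∑ θ ∈ Finset.univ.erase 0,
          f θ * ZMod.stdAddChar (θ * digit b (k.natDegree + 1 + c) x) + ((b : ℂ) ^ M)⁻¹ *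
          ((Int.fract ((b : ℝ) ^ (k.natDegree + 1 + M) * x) - 1 / 2 : ℝ) : ℂ)) := by
    simp_rw [← hf]
    push_cast at h1 ⊢
    linear_combination h1
  rw [walshPrimitive, h2]
  have h3 : ∀ c, ∑ θ ∈ Finset.univ.erase 0, f θ * walsh (k + monomial (k.natDegree + 1 + c) θ) x =
      walsh k x * ∑ θ ∈ Finset.univ.erase 0,
          f θ * ZMod.stdAddChar (θ * digit b (k.natDegree + 1 + c) x) := by
    intro c
    rw [Finset.mul_sum]
    refine Finset.sum_congr rfl fun θ _ => ?_
    rw [walsh_add, walsh_monomial]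
    ring
  simp_rw [h3, mul_left_comm _ (walsh k x), ← Finset.mul_sum]
  ring

end WalshCoeff

/-- The constant `1 + 1/b + 1/(b(b+1))`. -/
noncomputable def rhoConst (b : ℕ) : ℝ := 1 + 1 / (b : ℝ) + 1 / ((b : ℝ) * (b + 1))

/-! ### Decay of Walsh coefficients through a recursive inequality -/

section WalshBound

variable {b : ℕ} [hb : Fact b.Prime]

/-- The three summands are the relative sizes of the three kinds of terms in the recursion: dropping
the leading digit, keeping `k`, and adding a higher digit. -/
lemma rhoConst_eq : rhoConst b = 1 + 1 / (b : ℝ) + 1 / ((b : ℝ) + 1) * (1 / b) := by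
  have : (0 : ℝ) < b := base_pos
  rw [rhoConst]; field_simp

/-- The left side is the total relative size when `k` is a monomial and the term without leading
digit is absent. -/
lemma one_add_le_rhoConst : 1 + 1 / ((b : ℝ) + 1) ≤ rhoConst b := by
  have : (0 : ℝ) < b := base_pos
  have h1 : 1 / ((b : ℝ) + 1) ≤ 1 / b := one_div_le_one_div_of_le this (by linarith)
  have h2 : 0 ≤ 1 / ((b : ℝ) * (b + 1)) := by positivity
  rw [rhoConst]; linarith

lemma one_le_rhoConst : 1 ≤ rhoConst b := by
  have : (0 : ℝ) < b := base_pos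
  have h2 : 0 ≤ 1 / ((b : ℝ) + 1) := by positivity
  linarith [one_add_le_rhoConst (b := b)]

lemma rhoConst_le : rhoConst b ≤ 5 / 3 := by
  have h2 : (2 : ℝ) ≤ b := two_le_base
  have h3 : 1 / (b : ℝ) ≤ 1 / 2 := one_div_le_one_div_of_le (by norm_num) h2
  have h4 : 1 / ((b : ℝ) * (b + 1)) ≤ 1 / 6 := one_div_le_one_div_of_le (by norm_num) (by nlinarith)
  rw [rhoConst]; linarith

/-- Jordan's inequality `sin x ≥ 2x/π`. The bound is what makes the geometric ratio `Sρ/b`, with `S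
= cscConst b` and `ρ = rhoConst b`, at most `1/2` later on. -/
lemma cscConst_le : cscConst b ≤ b / 4 := by
  have h2 : (2 : ℝ) ≤ b := two_le_base
  have hs : 2 / Real.pi * (Real.pi / b) ≤ Real.sin (Real.pi / b) := by
    refine Real.mul_le_sin (by positivity) ?_
    exact div_le_div_of_nonneg_left Real.pi_pos.le (by norm_num) h2
  have e : 2 / Real.pi * (Real.pi / b) = 2 / b := by
    have := Real.pi_pos.ne'; field_simp
  rw [e] at hs
  have h5 : 4 / (b : ℝ) ≤ 2 * Real.sin (Real.pi / b) := by
    have : 4 / (b : ℝ) = 2 * (2 / b) := by ring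
    linarith
  rw [cscConst]
  calc 1 / (2 * Real.sin (Real.pi / b)) ≤ 1 / (4 / (b : ℝ)) :=
        one_div_le_one_div_of_le (by positivity) h5
    _ = b / 4 := by rw [one_div_div]

/-! ### Decay exponents -/

/-- The sum of the `r + 1` largest digit positions of `k`, the smallest one being repeated if there
are too few. -/
noncomputable def nuExp : ℕ → (ZMod b)[X] → ℕ
  | 0, k => k.natDegree + 1
  | r + 1, k => k.natDegree + 1 + if k.eraseLead = 0 then nuExp r k else nuExp r k.eraseLead

/-- The sum of the `r` largest digit positions of `k`. -/
noncomputable def muExp : ℕ → (ZMod b)[X] → ℕ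
  | 0, _ => 0
  | r + 1, k => if k = 0 then 0 else k.natDegree + 1 + muExp r k.eraseLead

lemma muExp_zero_right (r : ℕ) : muExp r (0 : (ZMod b)[X]) = 0 := by
  cases r <;> simp [muExp]

lemma natDegree_eraseLead_lt {k : (ZMod b)[X]} (hk : k.eraseLead ≠ 0) :
    k.eraseLead.natDegree < k.natDegree :=
  (eraseLead_natDegree_lt_or_eraseLead_eq_zero k).resolve_right hk

/-- The list of positions for `k` dominates the one for `k` without its leading digit entry by
entry, and the first entries differ by the gap of the degrees. This gap is the extra decay available
when a higher digit is added. -/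
lemma nuExp_eraseLead (r : ℕ) : ∀ {k : (ZMod b)[X]}, k.eraseLead ≠ 0 →
    nuExp r k.eraseLead + (k.natDegree - k.eraseLead.natDegree) ≤ nuExp r k := by
  induction r with
  | zero =>
    intro k hk
    have := natDegree_eraseLead_lt hk
    simp only [nuExp]; omega
  | succ r ih =>
    intro k hk
    have h1 := natDegree_eraseLead_lt hk
    simp only [nuExp, hk, if_false]
    split_ifs with h
    · omega
    · have := ih h
      omega

/-- Keeping `k` in the recursion instead of dropping its leading digit gains at least one power of
`b`. -/
lemma nuExp_succ_le (r : ℕ) {k : (ZMod b)[X]} (hk : k.eraseLead ≠ 0) :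
    nuExp (r + 1) k + 1 ≤ nuExp r k + (k.natDegree + 1) := by
  have h1 := nuExp_eraseLead r hk
  have h2 := natDegree_eraseLead_lt hk
  simp only [nuExp, hk, if_false]; omega

lemma muExp_le_nuExp (r : ℕ) : ∀ {k : (ZMod b)[X]}, k ≠ 0 → muExp (r + 1) k ≤ nuExp r k := by
  induction r with
  | zero => intro k hk; simp [muExp, nuExp, hk]
  | succ r ih =>
    intro k hk
    rw [muExp, if_neg hk, nuExp]
    split_ifs with h
    · rw [h, muExp_zero_right]; omega
    · have := ih h; omega

/-- When `k` has few digits, the smallest one is repeated, and every repetition adds at least `1`.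
The surplus turns the sum over the orders of the Bernoulli polynomials into a geometric series. -/
lemma muExp_add_le_nuExp (r : ℕ) : ∀ {k : (ZMod b)[X]} (α : ℕ), k ≠ 0 → k.support.card ≤ r + 1 →
    muExp α k + (r + 1) ≤ nuExp r k + k.support.card := by
  induction r with
  | zero =>
    intro k α hk hc
    have h1 := card_support_eraseLead_add_one hk
    have h2 : k.eraseLead = 0 := by rw [← card_support_eq_zero]; omega
    cases α with
    | zero => simp only [muExp, nuExp]; omega
    | succ α => rw [muExp, if_neg hk, h2, muExp_zero_right]; simp only [nuExp]; omega
  | succ r ih =>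
    intro k α hk hc
    have h1 := card_support_eraseLead_add_one hk
    rw [nuExp]
    split_ifs with h
    · have h3 : k.support.card = 1 := by rw [h] at h1; simpa using h1.symm
      have := ih (k := k) α hk (by omega)
      omega
    · cases α with
      | zero =>
        have := ih (k := k.eraseLead) 0 h (by omega)
        rw [muExp] at *; omega
      | succ α =>
        have := ih (k := k.eraseLead) α h (by omega)
        rw [muExp, if_neg hk]; omega

lemma eraseLead_add_monomial (k : (ZMod b)[X]) (c : ℕ) {θ : ZMod b} (hθ : θ ≠ 0) :
    (k + monomial (k.natDegree + 1 + c) θ).eraseLead = k ∧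
      (k + monomial (k.natDegree + 1 + c) θ).natDegree = k.natDegree + 1 + c := by
  have h1 : (monomial (k.natDegree + 1 + c) θ).natDegree = k.natDegree + 1 + c :=
    natDegree_monomial_eq _ hθ
  have h2 : k.natDegree < (monomial (k.natDegree + 1 + c) θ).natDegree := by omega
  constructor
  · rw [eraseLead_add_of_natDegree_lt_right h2, eraseLead_monomial, add_zero]
  · rw [natDegree_add_eq_right_of_natDegree_lt h2, h1]

/-! ### The recursion -/

/-- One factor `b^{-(c+1)}` is the coefficient of the digit in the expansion, the other the decay
gained from the larger degree; `b - 1` counts the nonzero digit values. -/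
lemma sum_inv_sq_pow_le (M : ℕ) : ∑ c ∈ Finset.range M,
    ((b : ℝ) ^ (c + 1))⁻¹ * (((b : ℝ) - 1) * ((b : ℝ) ^ (c + 1))⁻¹) ≤ 1 / ((b : ℝ) + 1) := by
  have h2 : (2 : ℝ) ≤ b := two_le_base
  suffices h : ∑ c ∈ Finset.range M, ((b : ℝ) ^ (c + 1))⁻¹ * (((b : ℝ) - 1) * ((b : ℝ) ^ (c + 1))⁻¹) =
      1 / ((b : ℝ) + 1) * (1 - ((b : ℝ) ^ M)⁻¹ * ((b : ℝ) ^ M)⁻¹) by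
    rw [h]
    have h3 : 0 ≤ ((b : ℝ) ^ M)⁻¹ * ((b : ℝ) ^ M)⁻¹ := by positivity
    have h4 : 0 ≤ 1 / ((b : ℝ) + 1) := by positivity
    nlinarith
  induction M with
  | zero => simp
  | succ M ih =>
    rw [Finset.sum_range_succ, ih]
    have : (b : ℝ) + 1 ≠ 0 := by positivity
    have : (b : ℝ) ≠ 0 := by positivity
    field_simp
    ring

lemma le_of_forall_le_add_inv_pow {x y D : ℝ} (h : ∀ M : ℕ, x ≤ y + ((b : ℝ) ^ M)⁻¹ * D) : x ≤ y := by
  have h2 : (2 : ℝ) ≤ b := two_le_base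
  have h1 : Tendsto (fun M : ℕ => y + ((b : ℝ) ^ M)⁻¹ * D) atTop (𝓝 (y + 0 * D)) :=
    ((tendsto_inv_atTop_zero.comp (tendsto_pow_atTop_atTop_of_one_lt (by linarith))).mul_const
      D).const_add y
  rw [zero_mul, add_zero] at h1
  exact ge_of_tendsto' h1 h

/-- The recursive inequality satisfied by Walsh coefficients of Bernoulli polynomials. -/
structure WalshRecursion (Z : ℕ → (ZMod b)[X] → ℝ) : Prop where
  zero : ∀ r, Z r 0 = 0
  step : ∀ r k, k ≠ 0 → ∃ D, ∀ M : ℕ, Z (r + 1) k ≤ ((b : ℝ) ^ (k.natDegree + 1))⁻¹ *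
    (cscConst b * Z r k.eraseLead + cscConst b * Z r k +
      ∑ c ∈ Finset.range M, ((b : ℝ) ^ (c + 1))⁻¹ * ∑ θ ∈ Finset.univ.erase (0 : ZMod b),
        cscConst b * Z r (k + monomial (k.natDegree + 1 + c) θ) + ((b : ℝ) ^ M)⁻¹ * D)

/-- The expansion of the primitive is integrated in its finite form, so no infinite series has to be
exchanged with the integral. The remainder is controlled by a bound for the kernel. -/
lemma walshRecursion_walshCoeff (y : ℝ) :
    WalshRecursion fun r (k : (ZMod b)[X]) => ‖walshCoeff (r + 1) y k‖ := by
  refine ⟨fun r => by simp [walshCoeff_zero], fun r k hk => ?_⟩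
  obtain ⟨f, hf1, hf2⟩ := exists_digit_fourier (b := b)
  obtain ⟨D, hD0, hD⟩ := exists_perBernoulli_bound (r + 1)
  refine ⟨D, fun M => ?_⟩
  set A := (1 - ZMod.stdAddChar k.leadingCoeff : ℂ)⁻¹ with hA
  set rem : ℝ → ℂ := fun x => walsh k x *
    ((Int.fract ((b : ℝ) ^ (k.natDegree + 1 + M) * x) - 1 / 2 : ℝ) : ℂ) with hrem
  have hremm : Measurable rem := by
    refine (measurable_walsh k).mul (Complex.measurable_ofReal.comp ?_)
    exact (measurable_fract.comp (measurable_const_mul _)).sub_const _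
  have hremb : ∀ x, ‖rem x‖ ≤ 1 := by
    intro x
    rw [hrem]
    simp only []
    rw [norm_mul, norm_walsh, one_mul, Complex.norm_real, Real.norm_eq_abs, abs_le]
    have h1 := Int.fract_nonneg ((b : ℝ) ^ (k.natDegree + 1 + M) * x)
    have h2 := Int.fract_lt_one ((b : ℝ) ^ (k.natDegree + 1 + M) * x)
    constructor <;> linarith
  have hI : ∀ l : (ZMod b)[X], IntervalIntegrable
      (fun x => (perBernoulli (r + 1) (x - y) : ℂ) * walsh l x) volume 0 1 := fun l =>
    intervalIntegrable_perBernoulli_mul (measurable_walsh l) (C := 1)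
      (fun x => (norm_walsh l x).le) _ _ _ _
  have hIr : IntervalIntegrable (fun x => (perBernoulli (r + 1) (x - y) : ℂ) * rem x) volume 0 1 :=
    intervalIntegrable_perBernoulli_mul hremm hremb _ _ _ _
  have hexp : walshCoeff (r + 2) y k = -(((b : ℂ) ^ (k.natDegree + 1))⁻¹ *
      (A * walshCoeff (r + 1) y k.eraseLead + (1 / 2 - A) * walshCoeff (r + 1) y k +
        ∑ c ∈ Finset.range M, ((b : ℂ) ^ (c + 1))⁻¹ * ∑ θ ∈ Finset.univ.erase 0,
          f θ * walshCoeff (r + 1) y (k + monomial (k.natDegree + 1 + c) θ) +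
        ((b : ℂ) ^ M)⁻¹ * ∫ x in (0 : ℝ)..1, (perBernoulli (r + 1) (x - y) : ℂ) * rem x)) := by
    rw [walshCoeff_succ_eq r y hk]
    congr 1
    have e : ∀ x, (perBernoulli (r + 1) (x - y) : ℂ) * walshPrimitive k x =
        ((b : ℂ) ^ (k.natDegree + 1))⁻¹ *
        (A * ((perBernoulli (r + 1) (x - y) : ℂ) * walsh k.eraseLead x) +
          (1 / 2 - A) * ((perBernoulli (r + 1) (x - y) : ℂ) * walsh k x) +
        ∑ c ∈ Finset.range M, ((b : ℂ) ^ (c + 1))⁻¹ * ∑ θ ∈ Finset.univ.erase 0,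
          f θ * ((perBernoulli (r + 1) (x - y) : ℂ) *
            walsh (k + monomial (k.natDegree + 1 + c) θ) x) +
        ((b : ℂ) ^ M)⁻¹ * ((perBernoulli (r + 1) (x - y) : ℂ) * rem x)) := by
      intro x
      rw [walshPrimitive_eq_sum hf2 k M x]
      have e3 : ∀ c, ∑ θ ∈ Finset.univ.erase 0, f θ * ((perBernoulli (r + 1) (x - y) : ℂ) *
            walsh (k + monomial (k.natDegree + 1 + c) θ) x) = (perBernoulli (r + 1) (x - y) : ℂ) *
            ∑ θ ∈ Finset.univ.erase 0, f θ * walsh (k + monomial (k.natDegree + 1 + c) θ) x := by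
        intro c
        rw [Finset.mul_sum]
        exact Finset.sum_congr rfl fun θ _ => by ring
      simp_rw [e3, mul_left_comm _ ((perBernoulli (r + 1) (x - y) : ℂ)), ← Finset.mul_sum]
      ring
    simp_rw [e]
    rw [intervalIntegral.integral_const_mul]
    congr 1
    have hS : IntervalIntegrable (fun x => ∑ c ∈ Finset.range M, ((b : ℂ) ^ (c + 1))⁻¹ *
        ∑ θ ∈ Finset.univ.erase 0, f θ * ((perBernoulli (r + 1) (x - y) : ℂ) *
            walsh (k + monomial (k.natDegree + 1 + c) θ) x)) volume 0 1 := by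
      have := IntervalIntegrable.sum (μ := volume) (a := (0 : ℝ)) (b := 1) (Finset.range M)
        (f := fun c x => ((b : ℂ) ^ (c + 1))⁻¹ *
        ∑ θ ∈ Finset.univ.erase 0, f θ * ((perBernoulli (r + 1) (x - y) : ℂ) *
            walsh (k + monomial (k.natDegree + 1 + c) θ) x)) (fun c _ => by
          refine IntervalIntegrable.const_mul ?_ _
          have := IntervalIntegrable.sum (μ := volume) (a := (0 : ℝ)) (b := 1)
            (Finset.univ.erase (0 : ZMod b)) (f := fun θ x => f θ * ((perBernoulli (r + 1) (x - y) : ℂ) *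
            walsh (k + monomial (k.natDegree + 1 + c) θ) x)) (fun θ _ => (hI _).const_mul _)
          simpa only [Finset.sum_fn] using this)
      simpa only [Finset.sum_fn] using this
    rw [intervalIntegral.integral_add ((((hI _).const_mul _).add ((hI _).const_mul _)).add hS)
        (hIr.const_mul _),
      intervalIntegral.integral_add (((hI _).const_mul _).add ((hI _).const_mul _)) hS,
      intervalIntegral.integral_add ((hI _).const_mul _) ((hI _).const_mul _)]
    simp_rw [intervalIntegral.integral_const_mul]
    congr 2
    rw [intervalIntegral.integral_finsetSum]
    · refine Finset.sum_congr rfl fun c _ => ?_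
      rw [intervalIntegral.integral_const_mul, intervalIntegral.integral_finsetSum
        fun θ _ => (hI _).const_mul _]
      congr 1
      exact Finset.sum_congr rfl fun θ _ => intervalIntegral.integral_const_mul _ _
    · intro c _
      refine IntervalIntegrable.const_mul ?_ _
      have := IntervalIntegrable.sum (μ := volume) (a := (0 : ℝ)) (b := 1)
        (Finset.univ.erase (0 : ZMod b)) (f := fun θ x => f θ * ((perBernoulli (r + 1) (x - y) : ℂ) *
        walsh (k + monomial (k.natDegree + 1 + c) θ) x)) (fun θ _ => (hI _).const_mul _)
      simpa only [Finset.sum_fn] using this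
  have hlc := leadingCoeff_ne_zero.2 hk
  have hremI : ‖∫ x in (0 : ℝ)..1, (perBernoulli (r + 1) (x - y) : ℂ) * rem x‖ ≤ D := by
    have := intervalIntegral.norm_integral_le_of_norm_le_const (a := (0 : ℝ)) (b := 1) (C := D)
      (f := fun x => (perBernoulli (r + 1) (x - y) : ℂ) * rem x) (fun x _ => by
        rw [norm_mul, Complex.norm_real]
        have h1 := mul_le_mul (hD (x - y)) (hremb x) (norm_nonneg _) hD0
        rwa [mul_one] at h1)
    simpa using this
  have hbn : ∀ n : ℕ, ‖((b : ℂ) ^ n)⁻¹‖ = ((b : ℝ) ^ n)⁻¹ := fun n => by simp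
  simp only [hexp]
  rw [norm_neg, norm_mul, hbn]
  refine mul_le_mul_of_nonneg_left ?_ (by positivity)
  refine (norm_add_le _ _).trans (add_le_add ((norm_add_le _ _).trans (add_le_add
    ((norm_add_le _ _).trans (add_le_add ?_ ?_)) ?_)) ?_)
  · rw [norm_mul]
    exact mul_le_mul_of_nonneg_right (norm_inv_one_sub_le hlc) (norm_nonneg _)
  · rw [norm_mul]
    exact mul_le_mul_of_nonneg_right (norm_half_sub_inv_le hlc) (norm_nonneg _)
  · refine (norm_sum_le _ _).trans (Finset.sum_le_sum fun c _ => ?_)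
    rw [norm_mul, hbn]
    refine mul_le_mul_of_nonneg_left ?_ (by positivity)
    refine (norm_sum_le _ _).trans (Finset.sum_le_sum fun θ hθ => ?_)
    rw [norm_mul]
    exact mul_le_mul_of_nonneg_right (hf1 θ (Finset.ne_of_mem_erase hθ)) (norm_nonneg _)
  · rw [norm_mul, hbn]
    exact mul_le_mul_of_nonneg_left hremI (by positivity)

/-! ### Consequences of the recursive inequality -/

namespace WalshRecursion

variable {Z : ℕ → (ZMod b)[X] → ℝ}

lemma card_univ_erase_zero : ((Finset.univ.erase (0 : ZMod b)).card : ℝ) = b - 1 := by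
  rw [Finset.card_erase_of_mem (Finset.mem_univ _), Finset.card_univ, ZMod.card,
    Nat.cast_sub hb.out.one_le, Nat.cast_one]

/-- Induction on `r`. Measured against the target, the terms of the recursion have sizes `1`, `1/b`
and `1/(b(b+1))`, adding up to `ρ`; for a monomial `k` the first one vanishes and the other two
become `1` and `1/(b+1)`. -/
lemma le_of_base (hZ : WalshRecursion Z) {c : ℝ} (hc : 0 ≤ c)
    (hbase : ∀ k, k ≠ 0 → Z 0 k ≤ c * ((b : ℝ) ^ (k.natDegree + 1))⁻¹) (r : ℕ) :
    ∀ k, k ≠ 0 → Z r k ≤ c * (cscConst b * rhoConst b) ^ r * ((b : ℝ) ^ nuExp r k)⁻¹ := by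
  have hbp : (0 : ℝ) < b := base_pos
  have hb1 : (1 : ℝ) ≤ b := by linarith [two_le_base (b := b)]
  have hS : 0 < cscConst b := cscConst_pos
  have hρ : 1 ≤ rhoConst b := one_le_rhoConst
  induction r with
  | zero => intro k hk; simpa [nuExp] using hbase k hk
  | succ r ih =>
    intro k hk
    obtain ⟨D, hD⟩ := hZ.step r k hk
    set T := c * (cscConst b * rhoConst b) ^ r with hT
    have hT0 : 0 ≤ T := by positivity
    have inv_le : ∀ {m n : ℕ}, n ≤ m → ((b : ℝ) ^ m)⁻¹ ≤ ((b : ℝ) ^ n)⁻¹ := fun h =>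
      inv_anti₀ (by positivity) (pow_le_pow_right₀ hb1 h)
    -- The contribution of all added digits. The parameter `e` is the exponent saved on top of the
    -- gap of degrees: `0` for monomials, `1` otherwise.
    have key : ∀ e : ℕ, (∀ c : ℕ, ∀ θ : ZMod b, θ ≠ 0 → nuExp (r + 1) k + (c + 1) + e ≤
          nuExp r (k + monomial (k.natDegree + 1 + c) θ) + (k.natDegree + 1)) → ∀ M : ℕ,
        ((b : ℝ) ^ (k.natDegree + 1))⁻¹ * ∑ c ∈ Finset.range M, ((b : ℝ) ^ (c + 1))⁻¹ *
          ∑ θ ∈ Finset.univ.erase (0 : ZMod b),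
          cscConst b * Z r (k + monomial (k.natDegree + 1 + c) θ) ≤
        cscConst b * T * ((b : ℝ) ^ nuExp (r + 1) k)⁻¹ * (1 / ((b : ℝ) + 1) * ((b : ℝ) ^ e)⁻¹) := by
      intro e he M
      have h1 : ∀ c ∈ Finset.range M, ((b : ℝ) ^ (k.natDegree + 1))⁻¹ * (((b : ℝ) ^ (c + 1))⁻¹ *
          ∑ θ ∈ Finset.univ.erase (0 : ZMod b),
          cscConst b * Z r (k + monomial (k.natDegree + 1 + c) θ)) ≤
          cscConst b * T * ((b : ℝ) ^ nuExp (r + 1) k)⁻¹ * ((b : ℝ) ^ e)⁻¹ * (((b : ℝ) ^ (c + 1))⁻¹ *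
            (((b : ℝ) - 1) * ((b : ℝ) ^ (c + 1))⁻¹)) := by
        intro c _
        have h2 : ∑ θ ∈ Finset.univ.erase (0 : ZMod b),
            cscConst b * Z r (k + monomial (k.natDegree + 1 + c) θ) ≤
            ∑ θ ∈ Finset.univ.erase (0 : ZMod b), cscConst b * (T * ((b : ℝ) ^ (k.natDegree + 1) *
              (((b : ℝ) ^ nuExp (r + 1) k)⁻¹ * ((b : ℝ) ^ e)⁻¹ * ((b : ℝ) ^ (c + 1))⁻¹))) := by
          refine Finset.sum_le_sum fun θ hθ => mul_le_mul_of_nonneg_left ?_ hS.le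
          have hθ := Finset.ne_of_mem_erase hθ
          obtain ⟨g1, g2⟩ := eraseLead_add_monomial k c hθ
          have g3 : k + monomial (k.natDegree + 1 + c) θ ≠ 0 := by
            intro h; rw [h, natDegree_zero] at g2; omega
          refine (ih _ g3).trans (mul_le_mul_of_nonneg_left ?_ hT0)
          have h4 := he c θ hθ
          rw [inv_le_iff_one_le_mul₀ (by positivity)]
          have h5 : (b : ℝ) ^ (nuExp (r + 1) k + (c + 1) + e) ≤
              (b : ℝ) ^ (nuExp r (k + monomial (k.natDegree + 1 + c) θ) + (k.natDegree + 1)) :=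
            pow_le_pow_right₀ hb1 h4
          rw [pow_add, pow_add, pow_add _ _ (k.natDegree + 1)] at h5
          rw [← mul_inv, ← mul_inv, ← div_eq_mul_inv, div_mul_eq_mul_div, le_div_iff₀ (by positivity)]
          nlinarith
        rw [Finset.sum_const, nsmul_eq_mul, card_univ_erase_zero] at h2
        have h3 := mul_le_mul_of_nonneg_left h2
          (by positivity : 0 ≤ ((b : ℝ) ^ (k.natDegree + 1))⁻¹ * ((b : ℝ) ^ (c + 1))⁻¹)
        rw [← mul_assoc]
        refine h3.trans (le_of_eq ?_)
        field_simp
      rw [Finset.mul_sum]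
      refine (Finset.sum_le_sum h1).trans ?_
      rw [← Finset.mul_sum]
      refine (mul_le_mul_of_nonneg_left (sum_inv_sq_pow_le M) (by positivity)).trans (le_of_eq ?_)
      ring
    refine le_of_forall_le_add_inv_pow (b := b) (D := ((b : ℝ) ^ (k.natDegree + 1))⁻¹ * D) fun M => ?_
    refine (hD M).trans ?_
    rw [mul_add, mul_add, mul_add]
    have e1 : c * (cscConst b * rhoConst b) ^ (r + 1) = cscConst b * T * rhoConst b := by
      rw [hT]; ring
    rw [mul_left_comm _ _ D]
    refine add_le_add_left ?_ _
    rw [e1]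
    have hshift : ∀ (l : (ZMod b)[X]) (n : ℕ), l ≠ 0 →
        nuExp (r + 1) k + n ≤ nuExp r l + (k.natDegree + 1) →
        ((b : ℝ) ^ (k.natDegree + 1))⁻¹ * (cscConst b * Z r l) ≤
          cscConst b * T * ((b : ℝ) ^ nuExp (r + 1) k)⁻¹ * ((b : ℝ) ^ n)⁻¹ := by
      intro l n hl hn
      have h1 := mul_le_mul_of_nonneg_left (ih l hl)
        (by positivity : 0 ≤ ((b : ℝ) ^ (k.natDegree + 1))⁻¹ * cscConst b)
      rw [← mul_assoc]
      refine h1.trans ?_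
      have h2 := mul_le_mul_of_nonneg_left (inv_le hn) (by positivity : 0 ≤ cscConst b * T)
      rw [pow_add, pow_add, mul_inv, mul_inv] at h2
      refine le_trans (le_of_eq ?_) (h2.trans (le_of_eq ?_)) <;> ring
    by_cases hk' : k.eraseLead = 0
    · have h1 := hshift k 0 hk (by simp only [nuExp, hk', if_true]; omega)
      have h2 := key 0 (fun c θ hθ => by
        obtain ⟨g1, g2⟩ := eraseLead_add_monomial k c hθ
        have := nuExp_eraseLead r (k := k + monomial (k.natDegree + 1 + c) θ) (by rwa [g1])
        rw [g1, g2] at this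
        simp only [nuExp, hk', if_true]; omega) M
      rw [hk', hZ.zero, mul_zero, mul_zero, zero_add]
      refine (add_le_add h1 h2).trans ?_
      have h3 := one_add_le_rhoConst (b := b)
      have h4 : 0 ≤ cscConst b * T * ((b : ℝ) ^ nuExp (r + 1) k)⁻¹ := by positivity
      have h5 := mul_le_mul_of_nonneg_left h3 h4
      simp only [pow_zero, inv_one, mul_one]
      linarith
    · have h0 := hshift k.eraseLead 0 hk' (by simp only [nuExp, hk', if_false]; omega)
      have h1 := hshift k 1 hk (nuExp_succ_le r hk')
      have h2 := key 1 (fun c θ hθ => by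
        obtain ⟨g1, g2⟩ := eraseLead_add_monomial k c hθ
        have h3 := nuExp_eraseLead r (k := k + monomial (k.natDegree + 1 + c) θ) (by rwa [g1])
        rw [g1, g2] at h3
        have h4 := nuExp_succ_le r hk'
        omega) M
      refine (add_le_add (add_le_add h0 h1) h2).trans (le_of_eq ?_)
      rw [rhoConst_eq]
      ring

/-- Every index on the right of the recursion has at most one nonzero digit fewer than `k`. So each
step enlarges the number of digits on which the quantity can live by at most one. -/
lemma eq_zero_of_base (hZ : WalshRecursion Z) (hnn : ∀ r k, 0 ≤ Z r k)
    (hbase : ∀ k, k.eraseLead ≠ 0 → Z 0 k = 0) (r : ℕ) :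
    ∀ k : (ZMod b)[X], r + 1 < k.support.card → Z r k = 0 := by
  induction r with
  | zero =>
    intro k hk
    refine hbase k fun h => ?_
    have h0 : k ≠ 0 := by rintro rfl; simp at hk
    have := card_support_eraseLead_add_one h0
    rw [h] at this
    simp at this; omega
  | succ r ih =>
    intro k hk
    have h0 : k ≠ 0 := by rintro rfl; simp at hk
    have h1 := card_support_eraseLead_add_one h0
    obtain ⟨D, hD⟩ := hZ.step r k h0
    refine le_antisymm ?_ (hnn _ _)
    refine le_of_forall_le_add_inv_pow (b := b) (D := ((b : ℝ) ^ (k.natDegree + 1))⁻¹ * D) fun M => ?_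
    refine (hD M).trans (le_of_eq ?_)
    rw [ih k.eraseLead (by omega), ih k (by omega)]
    have h3 : ∀ c, ∑ θ ∈ Finset.univ.erase (0 : ZMod b),
        cscConst b * Z r (k + monomial (k.natDegree + 1 + c) θ) = 0 := by
      intro c
      refine Finset.sum_eq_zero fun θ hθ => ?_
      have hθ := Finset.ne_of_mem_erase hθ
      obtain ⟨g1, g2⟩ := eraseLead_add_monomial k c hθ
      have g3 : k + monomial (k.natDegree + 1 + c) θ ≠ 0 := by
        intro h; rw [h, natDegree_zero] at g2; omega
      have := card_support_eraseLead_add_one g3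
      rw [g1] at this
      rw [ih _ (by omega), mul_zero]
    simp [h3]
    ring

end WalshRecursion

end WalshBound

/-! ### Initial values of the recursion and the resulting coefficient bounds -/

section WalshBase

variable {b : ℕ} [hb : Fact b.Prime]

lemma intervalIntegrable_walsh (k : (ZMod b)[X]) (a c : ℝ) :
    IntervalIntegrable (walsh k) volume a c :=
  intervalIntegrable_of_bounded (measurable_walsh k) (C := 1) (fun x => (norm_walsh k x).le) _ _

lemma integral_walsh {k : (ZMod b)[X]} (hk : k ≠ 0) : ∫ x in (0 : ℝ)..1, walsh k x = 0 := by
  rw [intervalIntegral.integral_eq_sub_of_hasDeriv_right_of_le zero_le_one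
    (continuous_walshPrimitive hk).continuousOn
    (fun x _ => walshPrimitive_hasDerivWithinAt hk x) (intervalIntegrable_walsh k 0 1)]
  have h0 : walshPrimitive k (0 : ℝ) = 0 := by simpa using walshPrimitive_intCast k 0
  have h1 : walshPrimitive k (1 : ℝ) = 0 := by simpa using walshPrimitive_intCast k 1
  rw [h0, h1, sub_zero]

/-- The primitive can be rewritten with a convex combination, of weights `1 - t` and `t` for the
fractional part `t`, of two differences of unimodular numbers, each of modulus at most `2`. -/
lemma norm_walshPrimitive_le {k : (ZMod b)[X]} (hk : k ≠ 0) (x : ℝ) :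
    ‖walshPrimitive k x‖ ≤ 2 * cscConst b * ((b : ℝ) ^ (k.natDegree + 1))⁻¹ := by
  have hlc := leadingCoeff_ne_zero.2 hk
  have h0 := one_sub_stdAddChar_ne_zero hlc
  set A := (1 - ZMod.stdAddChar k.leadingCoeff : ℂ)⁻¹ with hA
  have hAn : ‖A‖ ≤ cscConst b := norm_inv_one_sub_le hlc
  set t := Int.fract ((b : ℝ) ^ (k.natDegree + 1) * x) with ht
  have ht0 : 0 ≤ t := Int.fract_nonneg _
  have ht1 : t ≤ 1 := (Int.fract_lt_one _).le
  have e : walshPrimitive k x = ((b : ℂ) ^ (k.natDegree + 1))⁻¹ *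
      (A * (((1 - t : ℝ) : ℂ) * (walsh k.eraseLead x - walsh k x) +
        (t : ℂ) * (walsh k.eraseLead x - ZMod.stdAddChar k.leadingCoeff * walsh k x))) := by
    have hA1 : A * (1 - ZMod.stdAddChar k.leadingCoeff) = 1 := inv_mul_cancel₀ h0
    rw [walshPrimitive]
    congr 1
    push_cast
    linear_combination (-(walsh k x * (t : ℂ))) * hA1
  have hn1 : ‖walsh k.eraseLead x - walsh k x‖ ≤ 2 := by
    refine (norm_sub_le _ _).trans ?_
    rw [norm_walsh, norm_walsh]; norm_num
  have hn2 : ‖walsh k.eraseLead x - ZMod.stdAddChar k.leadingCoeff * walsh k x‖ ≤ 2 := by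
    refine (norm_sub_le _ _).trans ?_
    rw [norm_mul, norm_walsh, norm_walsh, norm_stdAddChar]; norm_num
  have hS := cscConst_pos (b := b)
  rw [e, norm_mul, norm_mul, norm_inv, norm_pow, Complex.norm_natCast, mul_comm]
  refine mul_le_mul_of_nonneg_right ?_ (by positivity)
  rw [mul_comm 2]
  refine mul_le_mul hAn ?_ (norm_nonneg _) hS.le
  refine (norm_add_le _ _).trans ?_
  rw [norm_mul, norm_mul, Complex.norm_real, Complex.norm_real, Real.norm_of_nonneg ht0,
    Real.norm_of_nonneg (by linarith)]
  nlinarith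

/-- The kernel is a sawtooth of slope `1` with one jump, at `x = y`. Integrating by parts on both
sides of it, the jump yields the primitive at `y` and the slope yields minus its mean. -/
lemma walshCoeff_one {k : (ZMod b)[X]} (hk : k ≠ 0) {y : ℝ} (hy : y ∈ Set.Ico (0 : ℝ) 1) :
    walshCoeff 1 y k = walshPrimitive k y - ∫ x in (0 : ℝ)..1, walshPrimitive k x := by
  have hJ : ∀ a c : ℝ, IntervalIntegrable (walshPrimitive k) volume a c := fun a c =>
    (continuous_walshPrimitive hk).intervalIntegrable a c
  have hI : ∀ a c, IntervalIntegrable (fun x => (perBernoulli 1 (x - y) : ℂ) * walsh k x) volume a c :=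
    fun a c => intervalIntegrable_perBernoulli_mul (measurable_walsh k) (C := 1)
      (fun x => (norm_walsh k x).le) _ _ _ _
  have part : ∀ (a c d : ℝ), ∫ x in a..c, ((x - d : ℝ) : ℂ) * walsh k x =
      ((c - d : ℝ) : ℂ) * walshPrimitive k c - ((a - d : ℝ) : ℂ) * walshPrimitive k a -
        ∫ x in a..c, walshPrimitive k x := by
    intro a c d
    have h := intervalIntegral.integral_mul_deriv_eq_deriv_mul_of_hasDeriv_right (a := a) (b := c)
      (u := fun x => ((x - d : ℝ) : ℂ)) (u' := fun _ => ((1 : ℝ) : ℂ)) (v := walshPrimitive k)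
      (v' := walsh k) (by fun_prop) (continuous_walshPrimitive hk).continuousOn
      (fun x _ => (((hasDerivAt_id x).sub_const d).hasDerivWithinAt).ofReal_comp)
      (fun x _ => walshPrimitive_hasDerivWithinAt hk x) (by simp) (intervalIntegrable_walsh k _ _)
    rw [h]
    simp
  have h1 : ∫ x in (0 : ℝ)..y, (perBernoulli 1 (x - y) : ℂ) * walsh k x =
      ∫ x in (0 : ℝ)..y, ((x - (y - 1 / 2) : ℝ) : ℂ) * walsh k x := by
    refine intervalIntegral.integral_congr_ae ?_
    have : ∀ᵐ x : ℝ, x ≠ y := by simp [ae_iff]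
    filter_upwards [this] with x hx hx'
    rw [Set.uIoc_of_le hy.1] at hx'
    have hx2 : x < y := lt_of_le_of_ne hx'.2 hx
    have hp : perBernoulli 1 (x - y) = x - (y - 1 / 2) := by
      rw [← perBernoulli_periodic 1, perBernoulli_of_mem ⟨by linarith [hy.2, hx'.1], by linarith⟩,
        normBernoulli_one]
      ring
    rw [hp]
  have h2 : ∫ x in y..(1 : ℝ), (perBernoulli 1 (x - y) : ℂ) * walsh k x =
      ∫ x in y..(1 : ℝ), ((x - (y + 1 / 2) : ℝ) : ℂ) * walsh k x := by
    refine intervalIntegral.integral_congr_ae ?_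
    have : ∀ᵐ x : ℝ, x ≠ 1 := by simp [ae_iff]
    filter_upwards [this] with x hx hx'
    rw [Set.uIoc_of_le hy.2.le] at hx'
    have hx2 : x < 1 := lt_of_le_of_ne hx'.2 hx
    have hp : perBernoulli 1 (x - y) = x - (y + 1 / 2) := by
      rw [perBernoulli_of_mem ⟨by linarith [hx'.1], by linarith [hy.1]⟩, normBernoulli_one]
      ring
    rw [hp]
  have h1' : walshPrimitive k (1 : ℝ) = 0 := by simpa using walshPrimitive_intCast k 1
  have h0' : walshPrimitive k (0 : ℝ) = 0 := by simpa using walshPrimitive_intCast k 0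
  rw [walshCoeff, ← intervalIntegral.integral_add_adjacent_intervals (hI 0 y) (hI y 1), h1, h2,
    part, part, ← intervalIntegral.integral_add_adjacent_intervals (hJ 0 y) (hJ y 1), h0', h1']
  push_cast
  ring

/-- In the Walsh expansion of the primitive every nonzero index integrates to `0`. Only the index
without leading digit can be zero, and it is so exactly for a monomial. -/
lemma norm_integral_walshPrimitive_le {k : (ZMod b)[X]} (hk : k ≠ 0) :
    ‖∫ x in (0 : ℝ)..1, walshPrimitive k x‖ ≤
      (if k.eraseLead = 0 then cscConst b else 0) * ((b : ℝ) ^ (k.natDegree + 1))⁻¹ := by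
  obtain ⟨f, hf1, hf2⟩ := exists_digit_fourier (b := b)
  have hlc := leadingCoeff_ne_zero.2 hk
  refine le_of_forall_le_add_inv_pow (b := b) (D := ((b : ℝ) ^ (k.natDegree + 1))⁻¹) fun M => ?_
  set A := (1 - ZMod.stdAddChar k.leadingCoeff : ℂ)⁻¹ with hA
  set rem : ℝ → ℂ := fun x => walsh k x *
    ((Int.fract ((b : ℝ) ^ (k.natDegree + 1 + M) * x) - 1 / 2 : ℝ) : ℂ) with hrem
  have hremm : Measurable rem := by
    refine (measurable_walsh k).mul (Complex.measurable_ofReal.comp ?_)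
    exact (measurable_fract.comp (measurable_const_mul _)).sub_const _
  have hremb : ∀ x, ‖rem x‖ ≤ 1 := by
    intro x
    rw [hrem]
    simp only []
    rw [norm_mul, norm_walsh, one_mul, Complex.norm_real, Real.norm_eq_abs, abs_le]
    have h1 := Int.fract_nonneg ((b : ℝ) ^ (k.natDegree + 1 + M) * x)
    have h2 := Int.fract_lt_one ((b : ℝ) ^ (k.natDegree + 1 + M) * x)
    constructor <;> linarith
  have hI : ∀ l : (ZMod b)[X], IntervalIntegrable (walsh l) volume 0 1 := fun l =>
    intervalIntegrable_walsh l 0 1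
  have hIr : IntervalIntegrable rem volume 0 1 := intervalIntegrable_of_bounded hremm hremb _ _
  have hS : IntervalIntegrable (fun x => ∑ c ∈ Finset.range M, ((b : ℂ) ^ (c + 1))⁻¹ *
      ∑ θ ∈ Finset.univ.erase 0, f θ * walsh (k + monomial (k.natDegree + 1 + c) θ) x) volume 0 1 := by
    have := IntervalIntegrable.sum (μ := volume) (a := (0 : ℝ)) (b := 1) (Finset.range M)
      (f := fun c x => ((b : ℂ) ^ (c + 1))⁻¹ *
      ∑ θ ∈ Finset.univ.erase 0, f θ * walsh (k + monomial (k.natDegree + 1 + c) θ) x) (fun c _ => by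
        refine IntervalIntegrable.const_mul ?_ _
        have := IntervalIntegrable.sum (μ := volume) (a := (0 : ℝ)) (b := 1)
          (Finset.univ.erase (0 : ZMod b)) (f := fun θ x => f θ *
          walsh (k + monomial (k.natDegree + 1 + c) θ) x) (fun θ _ => (hI _).const_mul _)
        simpa only [Finset.sum_fn] using this)
    simpa only [Finset.sum_fn] using this
  have hS0 : ∫ x in (0 : ℝ)..1, ∑ c ∈ Finset.range M, ((b : ℂ) ^ (c + 1))⁻¹ *
      ∑ θ ∈ Finset.univ.erase 0, f θ * walsh (k + monomial (k.natDegree + 1 + c) θ) x = 0 := by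
    rw [intervalIntegral.integral_finsetSum]
    · refine Finset.sum_eq_zero fun c _ => ?_
      rw [intervalIntegral.integral_const_mul, intervalIntegral.integral_finsetSum
        fun θ _ => (hI _).const_mul _, Finset.sum_eq_zero, mul_zero]
      intro θ hθ
      obtain ⟨g1, g2⟩ := eraseLead_add_monomial k c (Finset.ne_of_mem_erase hθ)
      have g3 : k + monomial (k.natDegree + 1 + c) θ ≠ 0 := by
        intro h; rw [h, natDegree_zero] at g2; omega
      rw [intervalIntegral.integral_const_mul, integral_walsh g3, mul_zero]
    · intro c _
      refine IntervalIntegrable.const_mul ?_ _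
      have := IntervalIntegrable.sum (μ := volume) (a := (0 : ℝ)) (b := 1)
        (Finset.univ.erase (0 : ZMod b)) (f := fun θ x => f θ *
        walsh (k + monomial (k.natDegree + 1 + c) θ) x) (fun θ _ => (hI _).const_mul _)
      simpa only [Finset.sum_fn] using this
  have hremI : ‖∫ x in (0 : ℝ)..1, rem x‖ ≤ 1 := by
    have := intervalIntegral.norm_integral_le_of_norm_le_const (a := (0 : ℝ)) (b := 1) (C := 1)
      (f := rem) (fun x _ => hremb x)
    simpa using this
  simp_rw [walshPrimitive_eq_sum hf2 k M]
  rw [intervalIntegral.integral_const_mul, intervalIntegral.integral_add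
    ((((hI _).const_mul _).add ((hI _).const_mul _)).add hS) (hIr.const_mul _),
    intervalIntegral.integral_add (((hI _).const_mul _).add ((hI _).const_mul _)) hS,
    intervalIntegral.integral_add ((hI _).const_mul _) ((hI _).const_mul _), hS0,
    intervalIntegral.integral_const_mul, intervalIntegral.integral_const_mul, integral_walsh hk,
    intervalIntegral.integral_const_mul]
  rw [norm_mul, norm_inv, norm_pow, Complex.norm_natCast, mul_zero, add_zero, add_zero, mul_comm]
  rw [← add_mul]
  refine mul_le_mul_of_nonneg_right ?_ (by positivity)
  refine (norm_add_le _ _).trans (add_le_add ?_ ?_)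
  · rw [norm_mul]
    split_ifs with h
    · simp only [h, walsh_zero]
      simpa using norm_inv_one_sub_le hlc
    · rw [integral_walsh h]; simp
  · rw [norm_mul, norm_inv, norm_pow, Complex.norm_natCast]
    exact mul_le_of_le_one_right (by positivity) hremI

/-- The initial constant `3 = 2 + 1` collects the primitive and its mean. -/
lemma norm_walshCoeff_le {y : ℝ} (hy : y ∈ Set.Ico (0 : ℝ) 1) (r : ℕ) {k : (ZMod b)[X]} (hk : k ≠ 0) :
    ‖walshCoeff (r + 1) y k‖ ≤
      3 * cscConst b * (cscConst b * rhoConst b) ^ r * ((b : ℝ) ^ nuExp r k)⁻¹ := by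
  have hS := cscConst_pos (b := b)
  refine (walshRecursion_walshCoeff y).le_of_base (by positivity) (fun k hk => ?_) r k hk
  simp only [zero_add]
  rw [walshCoeff_one hk hy]
  refine (norm_sub_le _ _).trans ((add_le_add (norm_walshPrimitive_le hk y)
    (norm_integral_walshPrimitive_le hk)).trans ?_)
  rw [← add_mul]
  refine mul_le_mul_of_nonneg_right ?_ (by positivity)
  split_ifs <;> linarith

lemma norm_walshCoeff_zero_base {k : (ZMod b)[X]} (hk : k ≠ 0) :
    ‖walshCoeff 1 0 k‖ ≤ (if k.eraseLead = 0 then cscConst b else 0) *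
      ((b : ℝ) ^ (k.natDegree + 1))⁻¹ := by
  have h0' : walshPrimitive k (0 : ℝ) = 0 := by simpa using walshPrimitive_intCast k 0
  rw [walshCoeff_one hk (by simp), h0', zero_sub, norm_neg]
  exact norm_integral_walshPrimitive_le hk

/-- At `y = 0` the primitive vanishes and only its mean is left, so `3` improves to `1`. -/
lemma norm_walshCoeff_zero_le (r : ℕ) {k : (ZMod b)[X]} (hk : k ≠ 0) :
    ‖walshCoeff (r + 1) 0 k‖ ≤
      cscConst b * (cscConst b * rhoConst b) ^ r * ((b : ℝ) ^ nuExp r k)⁻¹ := by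
  have hS := cscConst_pos (b := b)
  refine (walshRecursion_walshCoeff 0).le_of_base hS.le (fun k hk => ?_) r k hk
  refine (norm_walshCoeff_zero_base hk).trans ?_
  refine mul_le_mul_of_nonneg_right ?_ (by positivity)
  split_ifs <;> linarith

/-- At `y = 0` the first-order coefficients live on monomials; each further order permits one more
digit. -/
lemma walshCoeff_zero_eq_zero (r : ℕ) {k : (ZMod b)[X]} (hk : r + 1 < k.support.card) :
    walshCoeff (r + 1) 0 k = 0 := by
  rw [← norm_eq_zero]
  refine (walshRecursion_walshCoeff 0).eq_zero_of_base (fun _ _ => norm_nonneg _) (fun k hk => ?_) r k hk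
  have h0 : k ≠ 0 := by rintro rfl; simp at hk
  refine le_antisymm ((norm_walshCoeff_zero_base h0).trans ?_) (norm_nonneg _)
  rw [if_neg hk, zero_mul]

/-- An upper bound for the Walsh coefficient of the last kernel of the Bernoulli expansion. -/
noncomputable def kernelBound (α : ℕ) (k : (ZMod b)[X]) : ℝ :=
  if k = 0 then 0 else
    3 * cscConst b * (cscConst b * rhoConst b) ^ (α - 1) * ((b : ℝ) ^ muExp α k)⁻¹

lemma norm_walshCoeff_le_kernelBound {α : ℕ} (hα : 1 ≤ α) {y : ℝ} (hy : y ∈ Set.Ico (0 : ℝ) 1)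
    (k : (ZMod b)[X]) : ‖walshCoeff α y k‖ ≤ kernelBound α k := by
  obtain ⟨r, rfl⟩ : ∃ r, α = r + 1 := ⟨α - 1, by omega⟩
  rw [kernelBound]
  split_ifs with hk
  · rw [hk, walshCoeff_zero, norm_zero]
  · have hS := cscConst_pos (b := b)
    have hρ := one_le_rhoConst (b := b)
    have hb1 : (1 : ℝ) ≤ b := by linarith [two_le_base (b := b)]
    refine (norm_walshCoeff_le hy r hk).trans ?_
    refine mul_le_mul_of_nonneg_left ?_ (by positivity)
    exact inv_anti₀ (by positivity) (pow_le_pow_right₀ hb1 (muExp_le_nuExp r hk))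

lemma sum_geometric_half_le {x : ℝ} (h0 : 0 ≤ x) (h1 : x ≤ 1 / 2) (n : ℕ) :
    ∑ i ∈ Finset.range n, x ^ i ≤ 2 := by
  have : ∑ i ∈ Finset.range n, x ^ i ≤ ∑ i ∈ Finset.range n, (1 / 2 : ℝ) ^ i :=
    Finset.sum_le_sum fun i _ => pow_le_pow_left₀ h0 h1 i
  refine this.trans ?_
  have h2 := geom_sum_eq (show (1 / 2 : ℝ) ≠ 1 by norm_num) n
  rw [h2]
  have h3 : (0 : ℝ) ≤ (1 / 2 : ℝ) ^ n := by positivity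
  rw [div_le_iff_of_neg (by norm_num)]
  linarith

/-- The total Walsh coefficient bound of the Bernoulli expansion in one coordinate. -/
lemma sum_walshCoeff_add_kernelBound_le {α : ℕ} (hα : 2 ≤ α) {k : (ZMod b)[X]} (hk : k ≠ 0) :
    ∑ τ ∈ Finset.range α, ‖walshCoeff (τ + 1) 0 k‖ + kernelBound α k ≤
      walshConst b α * ((b : ℝ) ^ muExp α k)⁻¹ := by
  have hS := cscConst_pos (b := b)
  have hρ1 := one_le_rhoConst (b := b)
  have hρ2 := rhoConst_le (b := b)
  have h2 : (2 : ℝ) ≤ b := two_le_base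
  have hb1 : (1 : ℝ) ≤ b := by linarith
  have hsin := sin_pi_div_pos (b := b)
  set S := cscConst b with hSdef
  set ρ := rhoConst b with hρdef
  set Mx := max (2 / (2 * Real.sin (Real.pi / b)) ^ α)
      (⨆ z : Fin (α - 1), 1 / (2 * Real.sin (Real.pi / b)) ^ ((z : ℕ) + 1)) with hMx
  have hM1 : 2 * S ^ α ≤ Mx := by
    refine le_trans (le_of_eq ?_) (le_max_left _ _)
    rw [hSdef, cscConst, div_pow, one_pow]; ring
  have hM2 : ∀ w, 1 ≤ w → w ≤ α - 1 → S ^ w ≤ Mx := by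
    intro w hw1 hw2
    refine le_trans ?_ (le_max_right _ _)
    have hbd : BddAbove (Set.range fun z : Fin (α - 1) =>
        1 / (2 * Real.sin (Real.pi / b)) ^ ((z : ℕ) + 1)) := (Set.finite_range _).bddAbove
    refine le_trans (le_of_eq ?_) (le_ciSup hbd ⟨w - 1, by omega⟩)
    simp only []
    rw [Nat.sub_add_cancel hw1, hSdef, cscConst, div_pow, one_pow]
  have hMx0 : 0 < Mx := lt_of_lt_of_le (by positivity) hM1
  -- The last factor of `walshConst` only needs to be `5`: the Bernoulli polynomials will contribute
  -- `2` and the last kernel at most `(3/2)(5/3) = 5/2`.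
  have hfac : 5 ≤ 3 + 2 / (b : ℝ) + (2 * b + 1) / ((b : ℝ) - 1) := by
    have h3 : (2 : ℝ) ≤ (2 * b + 1) / ((b : ℝ) - 1) := by
      rw [le_div_iff₀ (by linarith)]; linarith
    have h4 : 0 ≤ 2 / (b : ℝ) := by positivity
    linarith
  have hC : 5 * (Mx * ρ ^ (α - 2)) ≤ walshConst b α := by
    have : walshConst b α = Mx * ρ ^ (α - 2) * (3 + 2 / (b : ℝ) + (2 * b + 1) / ((b : ℝ) - 1)) := rfl
    rw [this, mul_comm 5]
    exact mul_le_mul_of_nonneg_left hfac (by positivity)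
  have hρpow : ρ ^ (α - 1) = ρ * ρ ^ (α - 2) := by
    rw [← pow_succ']; congr 1; omega
  have hSpow : S * S ^ (α - 1) = S ^ α := by
    rw [← pow_succ']; congr 1; omega
  set R := ((b : ℝ) ^ muExp α k)⁻¹ with hR
  have hR0 : 0 < R := by rw [hR]; positivity
  have hker : kernelBound α k ≤ 3 / 2 * ρ * (Mx * ρ ^ (α - 2)) * R := by
    rw [kernelBound, if_neg hk]
    refine mul_le_mul_of_nonneg_right ?_ hR0.le
    rw [mul_pow, ← mul_assoc, mul_assoc 3, hSpow, hρpow]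
    have : 0 ≤ ρ * ρ ^ (α - 2) := by positivity
    nlinarith
  have hQ : 0 ≤ Mx * ρ ^ (α - 2) * R := by positivity
  suffices h : ∑ τ ∈ Finset.range α, ‖walshCoeff (τ + 1) 0 k‖ ≤ 2 * (Mx * ρ ^ (α - 2)) * R by
    refine (add_le_add h hker).trans (le_trans ?_ (mul_le_mul_of_nonneg_right hC hR0.le))
    nlinarith
  set w := k.support.card with hw
  have hw1 : 1 ≤ w := Finset.card_pos.2 (nonempty_support_iff.2 hk)
  have hSρ : S * ρ / b ≤ 1 / 2 := by
    rw [div_le_iff₀ (by linarith)]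
    have h3 : S ≤ b / 4 := cscConst_le
    nlinarith
  have hzero : ∀ τ, τ + 1 < w → ‖walshCoeff (τ + 1) 0 k‖ = 0 := fun τ h => by
    rw [walshCoeff_zero_eq_zero τ h, norm_zero]
  -- Only orders `τ + 1 ≥ w`, with `w` the number of nonzero digits, contribute. If `w > α` none is
  -- left.
  rcases lt_or_ge α w with h | h
  · rw [Finset.sum_eq_zero]
    · nlinarith
    · intro τ hτ
      exact hzero τ (by have := Finset.mem_range.1 hτ; omega)
  · have hterm : ∀ i, ‖walshCoeff (w - 1 + i + 1) 0 k‖ ≤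
        S ^ w * ρ ^ (w - 1) * R * (S * ρ / b) ^ i := by
      intro i
      refine (norm_walshCoeff_zero_le (w - 1 + i) hk).trans ?_
      have h3 := muExp_add_le_nuExp (w - 1 + i) α hk (by omega)
      have h4 : muExp α k + i ≤ nuExp (w - 1 + i) k := by omega
      have h5 : ((b : ℝ) ^ nuExp (w - 1 + i) k)⁻¹ ≤ R * ((b : ℝ) ^ i)⁻¹ := by
        rw [hR, ← mul_inv, ← pow_add]
        exact inv_anti₀ (by positivity) (pow_le_pow_right₀ hb1 h4)
      refine (mul_le_mul_of_nonneg_left h5 (by positivity)).trans (le_of_eq ?_)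
      have h6 : S ^ w = S * S ^ (w - 1) := by rw [← pow_succ']; congr 1; omega
      rw [← hSdef, ← hρdef, h6, div_pow, mul_pow, mul_pow, pow_add, pow_add]
      field_simp
    have hsplit : ∑ τ ∈ Finset.range α, ‖walshCoeff (τ + 1) 0 k‖ =
        ∑ i ∈ Finset.range (α - (w - 1)), ‖walshCoeff (w - 1 + i + 1) 0 k‖ := by
      have e : α = (w - 1) + (α - (w - 1)) := by omega
      conv_lhs => rw [e]
      rw [Finset.sum_range_add, Finset.sum_eq_zero, zero_add]
      intro τ hτ
      exact hzero τ (by have := Finset.mem_range.1 hτ; omega)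
    rw [hsplit]
    refine (Finset.sum_le_sum fun i _ => hterm i).trans ?_
    rw [← Finset.mul_sum]
    -- For `w < α` the power `S^w` is covered by the maximum and the geometric sum is at most `2`.
    -- For `w = α` a single term is left, and half of the maximum bounds `S^α`.
    rcases h.lt_or_eq with h | h
    · have h7 := sum_geometric_half_le (by positivity) hSρ (α - (w - 1))
      have h8 : S ^ w * ρ ^ (w - 1) ≤ Mx * ρ ^ (α - 2) :=
        mul_le_mul (hM2 w hw1 (by omega)) (pow_le_pow_right₀ hρ1 (by omega)) (by positivity) hMx0.le
      calc _ ≤ (Mx * ρ ^ (α - 2) * R) * 2 :=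
            mul_le_mul (mul_le_mul_of_nonneg_right h8 hR0.le) h7
              (Finset.sum_nonneg fun i _ => by positivity) hQ
        _ = _ := by ring
    · rw [h, show α - (α - 1) = 1 by omega]
      simp only [Finset.range_one, Finset.sum_singleton, pow_zero, mul_one]
      refine mul_le_mul_of_nonneg_right ?_ hR0.le
      rw [hρpow]
      have : 0 ≤ ρ ^ (α - 2) := by positivity
      have h9 : S ^ α * ρ ≤ 2 * Mx := by nlinarith [pow_pos hS α]
      nlinarith

end WalshBase

/-- The value of `∑ b^{-λ μ(k)}` over the `k` with exactly `w` nonzero digits, `B = b^λ`. -/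
noncomputable def digitProd (b : ℕ) (B : ℝ) (w : ℕ) : ℝ :=
  ∏ i ∈ Finset.Icc 1 w, ((b : ℝ) - 1) / (B ^ i - 1)

lemma digitProd_succ (b : ℕ) (B : ℝ) (w : ℕ) :
    digitProd b B (w + 1) = digitProd b B w * (((b : ℝ) - 1) / (B ^ (w + 1) - 1)) := by
  rw [digitProd, Finset.prod_Icc_succ_top (by omega)]; rfl

/-! ### Generating sums over polynomials, built up one lowest digit at a time -/

section PolyLT

variable {b : ℕ} [hb : Fact b.Prime]

/-- The polynomials over `ZMod b` of degree less than `N`. -/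
noncomputable def polyLT (b : ℕ) [Fact b.Prime] : ℕ → Finset (ZMod b)[X]
  | 0 => {0}
  | N + 1 => (Finset.univ ×ˢ polyLT b N).map
      ⟨fun x => C x.1 + X * x.2, fun x y h => by
        have h0 : (C x.1 + X * x.2).coeff 0 = (C y.1 + X * y.2).coeff 0 := congrArg (coeff · 0) h
        have h1 : ∀ n, (C x.1 + X * x.2).coeff (n + 1) = (C y.1 + X * y.2).coeff (n + 1) :=
          fun n => congrArg (coeff · (n + 1)) h
        ext1
        · simpa using h0
        · ext n
          simpa only [coeff_add, coeff_C_succ, coeff_X_mul, zero_add] using h1 n⟩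

lemma mem_polyLT {N : ℕ} : ∀ {k : (ZMod b)[X]}, k ∈ polyLT b N ↔ k.degree < N := by
  induction N with
  | zero => intro k; simp [polyLT, degree_eq_bot]
  | succ N ih =>
    intro k
    simp only [polyLT, Finset.mem_map, Finset.mem_product, Finset.mem_univ, true_and, Prod.exists]
    constructor
    · rintro ⟨a, q, hq, rfl⟩
      rw [ih] at hq
      rw [degree_lt_iff_coeff_zero] at hq ⊢
      intro m hm
      obtain ⟨m, rfl⟩ : ∃ m', m = m' + 1 := ⟨m - 1, by omega⟩
      change (C a + X * q).coeff (m + 1) = 0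
      rw [coeff_add, coeff_C_succ, coeff_X_mul, zero_add]
      exact hq m (by omega)
    · intro h
      refine ⟨k.coeff 0, k.divX, ?_, by
        change C (k.coeff 0) + X * k.divX = k
        rw [add_comm, X_mul_divX_add]⟩
      rw [ih]
      rw [degree_lt_iff_coeff_zero] at h ⊢
      intro m hm
      rw [coeff_divX]
      exact h _ (by omega)

lemma sum_polyLT_succ {M : Type*} [AddCommMonoid M] (N : ℕ) (F : (ZMod b)[X] → M) :
    ∑ k ∈ polyLT b (N + 1), F k = ∑ a : ZMod b, ∑ k ∈ polyLT b N, F (C a + X * k) := by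
  rw [polyLT, Finset.sum_map, Finset.sum_product]; rfl

lemma card_polyLT (N : ℕ) : (polyLT b N).card = b ^ N := by
  induction N with
  | zero => simp [polyLT]
  | succ N ih =>
    rw [polyLT, Finset.card_map, Finset.card_product, ih, Finset.card_univ, ZMod.card, pow_succ']

lemma zero_mem_polyLT (N : ℕ) : (0 : (ZMod b)[X]) ∈ polyLT b N := by
  rw [mem_polyLT, degree_zero]; exact WithBot.bot_lt_coe N

lemma coeff_C_add_X_mul_succ (a : ZMod b) (k : (ZMod b)[X]) (n : ℕ) :
    (C a + X * k).coeff (n + 1) = k.coeff n := by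
  rw [coeff_add, coeff_C_succ, coeff_X_mul, zero_add]

lemma C_add_X_mul_ne_zero (a : ZMod b) {k : (ZMod b)[X]} (hk : k ≠ 0) : C a + X * k ≠ 0 := by
  intro h
  apply hk
  ext n
  rw [← coeff_C_add_X_mul_succ a k n, h]; simp

lemma natDegree_C_add_X_mul (a : ZMod b) {k : (ZMod b)[X]} (hk : k ≠ 0) :
    (C a + X * k).natDegree = k.natDegree + 1 := by
  rw [natDegree_C_add, natDegree_X_mul hk]

lemma eraseLead_C_add_X_mul (a : ZMod b) {k : (ZMod b)[X]} (hk : k ≠ 0) :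
    (C a + X * k).eraseLead = C a + X * k.eraseLead := by
  ext n
  rw [eraseLead_coeff, natDegree_C_add_X_mul a hk]
  cases n with
  | zero => simp
  | succ n =>
    rw [coeff_C_add_X_mul_succ, coeff_C_add_X_mul_succ, eraseLead_coeff]
    simp

lemma card_support_C_add_X_mul (a : ZMod b) (k : (ZMod b)[X]) :
    (C a + X * k).support.card = k.support.card + if a = 0 then 0 else 1 := by
  have h : (C a + X * k).support =
      (k.support.map ⟨Nat.succ, Nat.succ_injective⟩) ∪ (if a = 0 then ∅ else {0}) := by
    ext n
    cases n with
    | zero => by_cases ha : a = 0 <;> simp [ha]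
    | succ n =>
      rw [mem_support_iff, coeff_C_add_X_mul_succ]
      by_cases ha : a = 0 <;> simp [ha]
  rw [h, Finset.card_union_of_disjoint, Finset.card_map]
  · split_ifs <;> simp
  · split_ifs
    · simp
    · rw [Finset.disjoint_singleton_right]; simp

/-- Multiplication by `X` raises every digit position by one, and a new nonzero constant term sits
at position `1`. So the sum of the `r` largest positions grows by the number of digits it counts
afterwards. -/
lemma muExp_C_add_X_mul (r : ℕ) : ∀ (a : ZMod b) (k : (ZMod b)[X]),
    muExp r (C a + X * k) = muExp r k + min (C a + X * k).support.card r := by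
  induction r with
  | zero => intro a k; simp [muExp]
  | succ r ih =>
    intro a k
    rcases eq_or_ne k 0 with rfl | hk
    · rw [mul_zero, add_zero, muExp_zero_right, muExp]
      split_ifs with ha
      · simp [ha]
      · have ha' : a ≠ 0 := by rintro rfl; simp at ha
        rw [eraseLead_C, muExp_zero_right, natDegree_C, support_C ha']
        simp
    · rw [muExp, if_neg (C_add_X_mul_ne_zero a hk), muExp, if_neg hk, natDegree_C_add_X_mul a hk,
        eraseLead_C_add_X_mul a hk, ih]
      have h1 := card_support_eraseLead_add_one (C_add_X_mul_ne_zero a hk)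
      rw [eraseLead_C_add_X_mul a hk] at h1
      omega

/-! ### Summation of the Walsh coefficient bounds -/

lemma sum_ite_zmod {M : Type*} [AddCommMonoid M] (u v : M) :
    ∑ a : ZMod b, (if a = 0 then u else v) = u + (b - 1) • v := by
  rw [← Finset.add_sum_erase _ _ (Finset.mem_univ (0 : ZMod b)), if_pos rfl,
    Finset.sum_congr rfl (fun a ha => if_neg (Finset.ne_of_mem_erase ha)), Finset.sum_const,
    Finset.card_erase_of_mem (Finset.mem_univ _), Finset.card_univ, ZMod.card]

lemma digitProd_nonneg {B : ℝ} (hB : 1 < B) (w : ℕ) : 0 ≤ digitProd b B w := by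
  have h2 : (2 : ℝ) ≤ b := two_le_base
  refine Finset.prod_nonneg fun i hi => div_nonneg (by linarith) ?_
  exact sub_nonneg.2 (one_le_pow₀ hB.le)

/-- Splitting off the constant term gives `S_w(N+1) = B^{-w} (S_w(N) + (b-1) S_{w-1}(N))`. The
product `digitProd` is the fixed point of this monotone recursion and dominates the initial values.
-/
lemma sum_polyLT_eq_card_le {B : ℝ} (hB : 1 < B) {α : ℕ} (N : ℕ) : ∀ w < α,
    ∑ k ∈ polyLT b N, (if k.support.card = w then (B ^ muExp α k)⁻¹ else 0) ≤ digitProd b B w := by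
  have h2 : (2 : ℝ) ≤ b := two_le_base
  have hB0 : 0 < B := by linarith
  induction N with
  | zero =>
    intro w hw
    rw [polyLT, Finset.sum_singleton]
    split_ifs with h
    · simp at h; subst h; simp [muExp_zero_right, digitProd]
    · exact digitProd_nonneg hB w
  | succ N ih =>
    intro w hw
    rw [sum_polyLT_succ]
    have e : ∀ a : ZMod b, ∑ k ∈ polyLT b N,
        (if (C a + X * k).support.card = w then (B ^ muExp α (C a + X * k))⁻¹ else 0) =
        if a = 0 then (B ^ w)⁻¹ * ∑ k ∈ polyLT b N, (if k.support.card = w then (B ^ muExp α k)⁻¹ else 0)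
        else (B ^ w)⁻¹ * ∑ k ∈ polyLT b N, (if k.support.card + 1 = w then (B ^ muExp α k)⁻¹ else 0) := by
      intro a
      have e1 : ∀ k : (ZMod b)[X], (if (C a + X * k).support.card = w then
          (B ^ muExp α (C a + X * k))⁻¹ else 0) = (B ^ w)⁻¹ *
          (if k.support.card + (if a = 0 then 0 else 1) = w then (B ^ muExp α k)⁻¹ else 0) := by
        intro k
        rw [muExp_C_add_X_mul, card_support_C_add_X_mul]
        by_cases h : k.support.card + (if a = 0 then 0 else 1) = w
        · rw [if_pos h, if_pos h, h, min_eq_left hw.le, pow_add, mul_inv, mul_comm]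
        · rw [if_neg h, if_neg h, mul_zero]
      rw [Finset.sum_congr rfl fun k _ => e1 k, ← Finset.mul_sum]
      split_ifs <;> rfl
    rw [Finset.sum_congr rfl fun a _ => e a, sum_ite_zmod, nsmul_eq_mul,
      Nat.cast_sub hb.out.one_le, Nat.cast_one]
    cases w with
    | zero =>
      have := ih 0 hw
      simp only [pow_zero, inv_one, one_mul, Nat.add_eq_zero_iff, one_ne_zero, and_false, if_false,
        Finset.sum_const_zero, mul_zero, add_zero]
      exact this
    | succ w =>
      have i1 := ih (w + 1) hw
      have i2 := ih w (by omega)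
      simp only [Nat.add_right_cancel_iff]
      rw [mul_left_comm, ← mul_add, inv_mul_le_iff₀ (by positivity)]
      refine (add_le_add i1 (mul_le_mul_of_nonneg_left i2 (by linarith))).trans (le_of_eq ?_)
      have h3 : B ^ (w + 1) - 1 ≠ 0 := (sub_pos.2 (one_lt_pow₀ hB (by omega))).ne'
      rw [digitProd_succ]
      field_simp
      ring

/-- Here the recursion is `T(N+1) = B^{-α} (b T(N) + (b-1) S_{α-1}(N))`: beyond `α` digits the new
one is free. Its multiplier `b B^{-α}` is below `1` by assumption, and the bound is the fixed point.
-/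
lemma sum_polyLT_card_ge_le {B : ℝ} (hB : 1 < B) {α : ℕ} (hα : 1 ≤ α) (hBb : (b : ℝ) < B ^ α) (N : ℕ) :
    ∑ k ∈ polyLT b N, (if α ≤ k.support.card then (B ^ muExp α k)⁻¹ else 0) ≤
      ((b : ℝ) - 1) / (B ^ α - b) * digitProd b B (α - 1) := by
  have h2 : (2 : ℝ) ≤ b := two_le_base
  have hB0 : 0 < B := by linarith
  have hρ : 0 ≤ ((b : ℝ) - 1) / (B ^ α - b) * digitProd b B (α - 1) :=
    mul_nonneg (div_nonneg (by linarith) (by linarith)) (digitProd_nonneg hB _)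
  induction N with
  | zero =>
    rw [polyLT, Finset.sum_singleton, if_neg (by simp; omega)]
    exact hρ
  | succ N ih =>
    rw [sum_polyLT_succ]
    have e : ∀ a : ZMod b, ∑ k ∈ polyLT b N,
        (if α ≤ (C a + X * k).support.card then (B ^ muExp α (C a + X * k))⁻¹ else 0) =
        (B ^ α)⁻¹ * (∑ k ∈ polyLT b N, (if α ≤ k.support.card then (B ^ muExp α k)⁻¹ else 0)) +
        if a = 0 then 0 else
          (B ^ α)⁻¹ * ∑ k ∈ polyLT b N, (if k.support.card = α - 1 then (B ^ muExp α k)⁻¹ else 0) := by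
      intro a
      have e1 : ∀ k : (ZMod b)[X], (if α ≤ (C a + X * k).support.card then
          (B ^ muExp α (C a + X * k))⁻¹ else 0) = (B ^ α)⁻¹ *
          ((if α ≤ k.support.card then (B ^ muExp α k)⁻¹ else 0) +
            if a = 0 then 0 else if k.support.card = α - 1 then (B ^ muExp α k)⁻¹ else 0) := by
        intro k
        rw [muExp_C_add_X_mul, card_support_C_add_X_mul]
        by_cases ha : a = 0
        · simp only [ha, if_true, add_zero]
          split_ifs with h
          · rw [min_eq_right h, pow_add, mul_inv, mul_comm]
          · simp
        · simp only [ha, if_false]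
          by_cases h : α ≤ k.support.card
          · rw [if_pos (by omega), if_pos h, if_neg (by omega), add_zero, min_eq_right (by omega),
              pow_add, mul_inv, mul_comm]
          · rw [if_neg h]
            by_cases h' : k.support.card = α - 1
            · rw [if_pos (by omega), if_pos h', min_eq_right (by omega), zero_add,
                pow_add, mul_inv, mul_comm]
            · rw [if_neg (by omega), if_neg h']; simp
      rw [Finset.sum_congr rfl fun k _ => e1 k, ← Finset.mul_sum, Finset.sum_add_distrib, mul_add]
      congr 1
      split_ifs <;> simp
    rw [Finset.sum_congr rfl fun a _ => e a, Finset.sum_add_distrib, sum_ite_zmod, Finset.sum_const,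
      Finset.card_univ, ZMod.card, zero_add, nsmul_eq_mul, nsmul_eq_mul,
      Nat.cast_sub hb.out.one_le, Nat.cast_one, mul_left_comm, mul_left_comm _ (B ^ α)⁻¹, ← mul_add,
      inv_mul_le_iff₀ (by positivity)]
    have i2 := sum_polyLT_eq_card_le (b := b) hB (α := α) N (α - 1) (by omega)
    refine (add_le_add (mul_le_mul_of_nonneg_left ih (by linarith))
      (mul_le_mul_of_nonneg_left i2 (by linarith))).trans (le_of_eq ?_)
    have h3 : B ^ α - b ≠ 0 := by linarith
    field_simp
    ring

/-- Sort by the number of nonzero digits: each of `1,…,α-1`, or at least `α`. The condition `λ >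
1/α` says exactly `b < B^α` for `B = b^λ`. -/
lemma sum_polyLT_inv_pow_muExp_le {α : ℕ} (hα : 1 ≤ α) {lam : ℝ} (hlam : 1 / (α : ℝ) < lam) (N : ℕ) :
    ∑ k ∈ (polyLT b N).erase 0, (((b : ℝ) ^ lam) ^ muExp α k)⁻¹ ≤ sumConst b α lam := by
  have h2 : (2 : ℝ) ≤ b := two_le_base
  have hα0 : (0 : ℝ) < α := by exact_mod_cast hα
  have hlam0 : 0 < lam := lt_trans (by positivity) hlam
  set B := (b : ℝ) ^ lam with hBdef
  have hB : 1 < B := Real.one_lt_rpow (by linarith) hlam0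
  have hpow : ∀ i : ℕ, (b : ℝ) ^ (lam * i) = B ^ i := fun i => by
    rw [Real.rpow_mul (by linarith), Real.rpow_natCast]
  have hBb : (b : ℝ) < B ^ α := by
    rw [← hpow]
    have h3 : 1 < lam * α := by rwa [div_lt_iff₀ hα0] at hlam
    calc (b : ℝ) = (b : ℝ) ^ (1 : ℝ) := (Real.rpow_one _).symm
      _ < _ := Real.rpow_lt_rpow_of_exponent_lt (by linarith) h3
  -- The last summand of the constant, with its top factor cancelled, is the fixed point for at
  -- least `α` digits.
  have hE : sumConst b α lam = ∑ w ∈ Finset.Icc 1 (α - 1), digitProd b B w +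
      ((b : ℝ) - 1) / (B ^ α - b) * digitProd b B (α - 1) := by
    rw [sumConst]
    simp_rw [hpow]
    congr 1
    change _ * digitProd b B α = _
    obtain ⟨n, rfl⟩ : ∃ n, α = n + 1 := ⟨α - 1, by omega⟩
    rw [digitProd_succ, add_tsub_cancel_right]
    have h3 : B ^ (n + 1) - 1 ≠ 0 := (sub_pos.2 (one_lt_pow₀ hB (by omega))).ne'
    have h4 : B ^ (n + 1) - b ≠ 0 := by linarith
    field_simp
  rw [hE]
  have e : ∀ k ∈ (polyLT b N).erase 0, (B ^ muExp α k)⁻¹ =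
      ∑ w ∈ Finset.Icc 1 (α - 1), (if k.support.card = w then (B ^ muExp α k)⁻¹ else 0) +
        (if α ≤ k.support.card then (B ^ muExp α k)⁻¹ else 0) := by
    intro k hk
    have hk0 := Finset.ne_of_mem_erase hk
    have hw1 : 1 ≤ k.support.card := Finset.card_pos.2 (nonempty_support_iff.2 hk0)
    rw [Finset.sum_ite_eq]
    by_cases h : α ≤ k.support.card
    · rw [if_neg (by rw [Finset.mem_Icc]; omega), if_pos h, zero_add]
    · rw [if_pos (by rw [Finset.mem_Icc]; omega), if_neg h, add_zero]
  rw [Finset.sum_congr rfl e, Finset.sum_add_distrib, Finset.sum_comm]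
  have hnn : ∀ k : (ZMod b)[X], 0 ≤ (B ^ muExp α k)⁻¹ := fun k => by positivity
  refine add_le_add (Finset.sum_le_sum fun w hw => ?_) ?_
  · rw [Finset.mem_Icc] at hw
    refine (Finset.sum_le_sum_of_subset_of_nonneg (Finset.erase_subset _ _) fun k _ _ => ?_).trans
      (sum_polyLT_eq_card_le hB N w (by omega))
    split_ifs; exacts [hnn k, le_rfl]
  · refine (Finset.sum_le_sum_of_subset_of_nonneg (Finset.erase_subset _ _) fun k _ _ => ?_).trans
      (sum_polyLT_card_ge_le hB hα hBb N)
    split_ifs; exacts [hnn k, le_rfl]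

end PolyLT

section Lattice

variable {b : ℕ} [hb : Fact b.Prime]

/-! ### Digits of lattice points -/

lemma digit_add_intCast (i : ℕ) (n : ℤ) (x : ℝ) : digit b i (n + x) = digit b i x := by
  have e : (b : ℝ) ^ (i + 1) * (n + x) = (b : ℝ) ^ (i + 1) * x + (((b : ℤ) ^ (i + 1) * n : ℤ) : ℝ) := by
    push_cast; ring
  rw [digit, digit, e, Int.floor_add_intCast]
  push_cast
  simp [pow_succ]

lemma digit_succ (i : ℕ) (x : ℝ) : digit b (i + 1) x = digit b i (b * x) := by
  rw [digit, digit, pow_succ, mul_assoc]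

/-- The real number with base-`b` digits `d 0, …, d (m - 1)`. -/
noncomputable def ofDigitSeq (m : ℕ) (d : ℕ → ZMod b) : ℝ :=
  ∑ i ∈ Finset.range m, ((d i).val : ℝ) / (b : ℝ) ^ (i + 1)

lemma base_mul_ofDigitSeq_succ (m : ℕ) (d : ℕ → ZMod b) :
    (b : ℝ) * ofDigitSeq (m + 1) d = (((d 0).val : ℤ) : ℝ) + ofDigitSeq m fun i => d (i + 1) := by
  have h0 : (b : ℝ) ≠ 0 := base_pos.ne'
  rw [ofDigitSeq, Finset.sum_range_succ', mul_add, add_comm, Finset.mul_sum, ofDigitSeq]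
  congr 1
  · push_cast; field_simp
  · refine Finset.sum_congr rfl fun i _ => ?_
    rw [pow_succ' _ (i + 1)]; field_simp

lemma ofDigitSeq_mem (m : ℕ) : ∀ d : ℕ → ZMod b, ofDigitSeq m d ∈ Set.Ico (0 : ℝ) 1 := by
  have h0 : (0 : ℝ) < b := base_pos
  induction m with
  | zero => intro d; simp [ofDigitSeq]
  | succ m ih =>
    intro d
    obtain ⟨h1, h2⟩ := ih fun i => d (i + 1)
    have h3 := base_mul_ofDigitSeq_succ m d
    have h4 : ((d 0).val : ℝ) + 1 ≤ b := by exact_mod_cast ZMod.val_lt (d 0)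
    have h5 : (0 : ℝ) ≤ ((d 0).val : ℝ) := Nat.cast_nonneg _
    push_cast at h3
    constructor
    · by_contra h; push Not at h; nlinarith
    · by_contra h; push Not at h; nlinarith

lemma digit_ofDigitSeq (i : ℕ) : ∀ (m : ℕ) (d : ℕ → ZMod b),
    digit b i (ofDigitSeq m d) = if i < m then d i else 0 := by
  induction i with
  | zero =>
    intro m d
    cases m with
    | zero => simp [ofDigitSeq, digit]
    | succ m =>
      have h := ofDigitSeq_mem m fun i => d (i + 1)
      rw [digit, zero_add, pow_one, base_mul_ofDigitSeq_succ, Int.floor_intCast_add,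
        Int.floor_eq_zero_iff.2 h, if_pos (Nat.succ_pos m)]
      push_cast
      rw [ZMod.natCast_zmod_val, add_zero]
  | succ i ih =>
    intro m d
    cases m with
    | zero => simp [ofDigitSeq, digit]
    | succ m =>
      rw [digit_succ, base_mul_ofDigitSeq_succ, digit_add_intCast, ih]
      simp

lemma exists_intCast_div_eq_ofDigitSeq (m : ℕ) : ∀ d : ℕ → ZMod b,
    ∃ i : ℤ, ofDigitSeq m d = i / (b : ℝ) ^ m := by
  have h0 : (b : ℝ) ≠ 0 := base_pos.ne'
  induction m with
  | zero => intro d; exact ⟨0, by simp [ofDigitSeq]⟩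
  | succ m ih =>
    intro d
    obtain ⟨i, hi⟩ := ih fun i => d (i + 1)
    refine ⟨(d 0).val * b ^ m + i, ?_⟩
    have h3 := base_mul_ofDigitSeq_succ m d
    rw [hi] at h3
    rw [eq_div_iff (by positivity), pow_succ', ← mul_assoc, mul_comm _ (b : ℝ), h3]
    push_cast
    field_simp

lemma laurentToUnit_eq (m : ℕ) (L : LaurentSeries (ZMod b)) :
    laurentToUnit m L = ofDigitSeq m fun i => L.coeff ((i : ℤ) + 1) := by
  rw [laurentToUnit, ofDigitSeq]
  refine Finset.sum_nbij' (fun i => i - 1) (fun i => i + 1) ?_ ?_ ?_ ?_ ?_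
  · intro i hi; rw [Finset.mem_Icc] at hi; rw [Finset.mem_range]; omega
  · intro i hi; rw [Finset.mem_range] at hi; rw [Finset.mem_Icc]; omega
  · intro i hi; rw [Finset.mem_Icc] at hi; omega
  · intro i _; omega
  · intro i hi
    rw [Finset.mem_Icc] at hi
    obtain ⟨i, rfl⟩ := Nat.exists_eq_add_of_le' hi.1
    simp

/-- Truncation of a polynomial to the coefficients of degree less than `n`. -/
noncomputable def polyTrunc (n : ℕ) (k : (ZMod b)[X]) : (ZMod b)[X] :=
  ∑ i ∈ Finset.range n, monomial i (k.coeff i)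

lemma coeff_polyTrunc (n : ℕ) (k : (ZMod b)[X]) (i : ℕ) :
    (polyTrunc n k).coeff i = if i < n then k.coeff i else 0 := by
  rw [polyTrunc, finsetSum_coeff]
  simp_rw [coeff_monomial]
  rw [Finset.sum_ite_eq']
  simp

lemma degree_polyTrunc_lt (n : ℕ) (k : (ZMod b)[X]) : (polyTrunc n k).degree < n := by
  rw [degree_lt_iff_coeff_zero]
  intro m hm
  rw [coeff_polyTrunc, if_neg (by omega)]

/-! ### Laurent series -/

lemma algebraMap_laurentSeries (c : ZMod b) :
    algebraMap (ZMod b) (LaurentSeries (ZMod b)) c = HahnSeries.single 0 c := by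
  rw [HahnSeries.algebraMap_apply']
  erw [PowerSeries.algebraMap_apply]
  simp [HahnSeries.ofPowerSeries_C]

lemma toLaurentInv_monomial (i : ℕ) (c : ZMod b) :
    toLaurentInv (monomial i c) = HahnSeries.single (-(i : ℤ)) c := by
  rw [toLaurentInv, aeval_monomial, HahnSeries.single_pow, algebraMap_laurentSeries,
    HahnSeries.single_mul_single]
  simp

lemma toLaurentInv_add (k l : (ZMod b)[X]) :
    toLaurentInv (k + l) = toLaurentInv k + toLaurentInv l := map_add _ _ _

lemma toLaurentInv_mul (k l : (ZMod b)[X]) :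
    toLaurentInv (k * l) = toLaurentInv k * toLaurentInv l := map_mul _ _ _

lemma toLaurentInv_zero : toLaurentInv (0 : (ZMod b)[X]) = 0 := map_zero _

lemma toLaurentInv_sum {ι : Type*} (s : Finset ι) (f : ι → (ZMod b)[X]) :
    toLaurentInv (∑ i ∈ s, f i) = ∑ i ∈ s, toLaurentInv (f i) := map_sum _ _ _

lemma coeff_toLaurentInv (k : (ZMod b)[X]) (m : ℤ) :
    (toLaurentInv k).coeff m = if m ≤ 0 then k.coeff (-m).toNat else 0 := by
  conv_lhs => rw [k.as_sum_range, toLaurentInv_sum]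
  simp_rw [toLaurentInv_monomial]
  rw [HahnSeries.coeff_sum]
  simp_rw [HahnSeries.coeff_single]
  split_ifs with h
  · have : ∀ i : ℕ, (m = -(i : ℤ)) ↔ (-m).toNat = i := fun i => by omega
    simp_rw [this]
    rw [Finset.sum_ite_eq]
    split_ifs with h2
    · rfl
    · rw [coeff_eq_zero_of_natDegree_lt]; simpa using h2
  · refine Finset.sum_eq_zero fun i _ => if_neg (by omega)

lemma toLaurentInv_ne_zero {k : (ZMod b)[X]} (hk : k ≠ 0) : toLaurentInv k ≠ 0 := by
  intro h
  have h1 := coeff_toLaurentInv k (-(k.natDegree : ℤ))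
  rw [h, if_pos (by omega), neg_neg, Int.toNat_natCast] at h1
  exact leadingCoeff_ne_zero.2 hk h1.symm

lemma order_toLaurentInv {k : (ZMod b)[X]} (hk : k ≠ 0) :
    (toLaurentInv k).order = -(k.natDegree : ℤ) := by
  refine le_antisymm (HahnSeries.order_le_of_coeff_ne_zero ?_) ?_
  · rw [coeff_toLaurentInv, if_pos (by omega), neg_neg, Int.toNat_natCast]
    exact leadingCoeff_ne_zero.2 hk
  · by_contra h
    push Not at h
    have h1 : (toLaurentInv k).coeff (toLaurentInv k).order = 0 := by
      rw [coeff_toLaurentInv, if_pos (by omega), coeff_eq_zero_of_natDegree_lt]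
      omega
    exact toLaurentInv_ne_zero hk (HahnSeries.coeff_order_eq_zero.1 h1)

/-- The coefficient of `x^{-1}` of the Laurent series of `A / p`. -/
noncomputable def laurentResidue (p A : (ZMod b)[X]) : ZMod b :=
  (toLaurentInv A / toLaurentInv p).coeff 1

lemma laurentResidue_add (p A B : (ZMod b)[X]) :
    laurentResidue p (A + B) = laurentResidue p A + laurentResidue p B := by
  rw [laurentResidue, toLaurentInv_add, add_div, HahnSeries.coeff_add]; rfl

lemma laurentResidue_zero (p : (ZMod b)[X]) : laurentResidue p 0 = 0 := by
  rw [laurentResidue, toLaurentInv_zero, zero_div, HahnSeries.coeff_zero]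

lemma laurentResidue_sum {ι : Type*} (s : Finset ι) (p : (ZMod b)[X]) (f : ι → (ZMod b)[X]) :
    laurentResidue p (∑ i ∈ s, f i) = ∑ i ∈ s, laurentResidue p (f i) := by
  classical
  induction s using Finset.induction_on with
  | empty => simp [laurentResidue_zero]
  | insert a s ha ih => rw [Finset.sum_insert ha, Finset.sum_insert ha, laurentResidue_add, ih]

lemma laurentResidue_of_dvd {p A : (ZMod b)[X]} (hp : p ≠ 0) (h : p ∣ A) :
    laurentResidue p A = 0 := by
  obtain ⟨B, rfl⟩ := h
  rw [laurentResidue, toLaurentInv_mul, mul_div_cancel_left₀ _ (toLaurentInv_ne_zero hp),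
    coeff_toLaurentInv, if_neg (by norm_num)]

/-- Reduce `A` modulo `p` and multiply by the power of `X` that brings the order of the quotient by
`p` to exactly `1`; then its leading coefficient is the residue. -/
lemma exists_laurentResidue_ne_zero {p A : (ZMod b)[X]} (hp : p ≠ 0) (h : ¬ p ∣ A) :
    ∃ l ∈ polyLT b p.natDegree, laurentResidue p (l * A) ≠ 0 := by
  set r := A % p with hr
  have hr0 : r ≠ 0 := fun h0 => h ((EuclideanDomain.mod_eq_zero).1 h0)
  have hdeg : r.natDegree < p.natDegree := by
    have := EuclideanDomain.mod_lt A hp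
    exact natDegree_lt_natDegree hr0 this
  refine ⟨X ^ (p.natDegree - 1 - r.natDegree), ?_, ?_⟩
  · rw [mem_polyLT, degree_X_pow]
    exact_mod_cast (by omega : p.natDegree - 1 - r.natDegree < p.natDegree)
  · have e : X ^ (p.natDegree - 1 - r.natDegree) * A = X ^ (p.natDegree - 1 - r.natDegree) * r +
        p * (X ^ (p.natDegree - 1 - r.natDegree) * (A / p)) := by
      conv_lhs => rw [← EuclideanDomain.mod_add_div A p]
      ring
    have hR0 : X ^ (p.natDegree - 1 - r.natDegree) * r ≠ 0 :=
      mul_ne_zero (pow_ne_zero _ X_ne_zero) hr0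
    rw [e, laurentResidue_add, laurentResidue_of_dvd hp (dvd_mul_right _ _), add_zero,
      laurentResidue]
    set L := toLaurentInv (X ^ (p.natDegree - 1 - r.natDegree) * r) / toLaurentInv p with hL
    have hL0 : L ≠ 0 := div_ne_zero (toLaurentInv_ne_zero hR0) (toLaurentInv_ne_zero hp)
    have hmul : L * toLaurentInv p = toLaurentInv (X ^ (p.natDegree - 1 - r.natDegree) * r) :=
      div_mul_cancel₀ _ (toLaurentInv_ne_zero hp)
    have hord := congrArg HahnSeries.order hmul
    rw [HahnSeries.order_mul hL0 (toLaurentInv_ne_zero hp), order_toLaurentInv hp,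
      order_toLaurentInv hR0, natDegree_mul (pow_ne_zero _ X_ne_zero) hr0, natDegree_X_pow] at hord
    have h1 : L.order = 1 := by omega
    rw [← h1]
    exact fun h => hL0 (HahnSeries.coeff_order_eq_zero.1 h)

/-! ### Character sums over lattices -/

/-- Orthogonality of characters: if `p ∤ A`, translating the summation by an `l0` on which the
character is nontrivial multiplies the sum by a number other than `1`. -/
lemma sum_stdAddChar_laurentResidue {p A : (ZMod b)[X]} (hp : p ≠ 0) [Decidable (p ∣ A)] :
    ∑ l ∈ polyLT b p.natDegree, (ZMod.stdAddChar (laurentResidue p (l * A)) : ℂ) =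
      if p ∣ A then (b : ℂ) ^ p.natDegree else 0 := by
  split_ifs with h
  · rw [Finset.sum_congr rfl fun l _ => by
      rw [laurentResidue_of_dvd hp (Dvd.dvd.mul_left h l), AddChar.map_zero_eq_one]]
    rw [Finset.sum_const, card_polyLT]; simp
  · obtain ⟨l0, hl0, hne⟩ := exists_laurentResidue_ne_zero hp h
    have h1 := one_sub_stdAddChar_ne_zero hne
    have h2 : ∑ l ∈ polyLT b p.natDegree, (ZMod.stdAddChar (laurentResidue p (l * A)) : ℂ) =
        ∑ l ∈ polyLT b p.natDegree, (ZMod.stdAddChar (laurentResidue p ((l + l0) * A)) : ℂ) := by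
      refine (Finset.sum_nbij' (fun l => l + l0) (fun l => l - l0) ?_ ?_ ?_ ?_ ?_).symm
      · intro l hl
        rw [mem_polyLT] at *
        exact (degree_add_le _ _).trans_lt (max_lt hl hl0)
      · intro l hl
        rw [mem_polyLT] at *
        exact (degree_sub_le _ _).trans_lt (max_lt hl hl0)
      · intro l _; simp
      · intro l _; simp
      · intro l _; rfl
    simp_rw [add_mul, laurentResidue_add, AddChar.map_add_eq_mul, ← Finset.sum_mul] at h2
    have h3 : (∑ l ∈ polyLT b p.natDegree, (ZMod.stdAddChar (laurentResidue p (l * A)) : ℂ)) *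
        (1 - ZMod.stdAddChar (laurentResidue p (l0 * A))) = 0 := by
      rw [mul_sub, mul_one, ← h2, sub_self]
    exact (mul_eq_zero.1 h3).resolve_right h1

lemma digitPoly_succ (m n : ℕ) :
    digitPoly b (m + 1) n = C ((n % b : ℕ) : ZMod b) + X * digitPoly b m (n / b) := by
  rw [digitPoly, Finset.sum_range_succ', digitPoly, Finset.mul_sum, add_comm]
  congr 1
  · simp
  · refine Finset.sum_congr rfl fun i _ => ?_
    rw [Nat.div_div_eq_div_mul, ← pow_succ', pow_succ X]
    ring

lemma sum_digitPoly {M : Type*} [AddCommMonoid M] (m : ℕ) : ∀ F : (ZMod b)[X] → M,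
    ∑ n ∈ Finset.range (b ^ m), F (digitPoly b m n) = ∑ k ∈ polyLT b m, F k := by
  have hbp := hb.out.pos
  induction m with
  | zero => intro F; simp [digitPoly, polyLT]
  | succ m ih =>
    intro F
    rw [sum_polyLT_succ]
    simp_rw [← ih (fun k => F (C _ + X * k))]
    have h1 : ∑ a : ZMod b, ∑ n ∈ Finset.range (b ^ m), F (C a + X * digitPoly b m n) =
        ∑ x ∈ (Finset.univ : Finset (ZMod b)) ×ˢ Finset.range (b ^ m),
          F (C x.1 + X * digitPoly b m x.2) :=
      (Finset.sum_product _ _ fun x : ZMod b × ℕ => F (C x.1 + X * digitPoly b m x.2)).symm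
    rw [h1]
    refine Finset.sum_nbij' (fun n => (((n % b : ℕ) : ZMod b), n / b)) (fun x => x.1.val + b * x.2)
      ?_ ?_ ?_ ?_ ?_
    · intro n hn
      simp only [Finset.mem_product, Finset.mem_univ, true_and, Finset.mem_range] at *
      exact Nat.div_lt_of_lt_mul (by rwa [← pow_succ'])
    · intro x hx
      simp only [Finset.mem_product, Finset.mem_univ, true_and, Finset.mem_range] at *
      have := ZMod.val_lt x.1
      rw [pow_succ']
      calc x.1.val + b * x.2 < b + b * x.2 := by omega
        _ = b * (x.2 + 1) := by ring
        _ ≤ _ := Nat.mul_le_mul_left _ hx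
    · intro n _
      simp only [ZMod.val_natCast, Nat.mod_mod]
      exact Nat.mod_add_div n b
    · intro x _
      have := ZMod.val_lt x.1
      ext1
      · simp [Nat.add_mul_mod_self_left, Nat.mod_eq_of_lt this]
      · simp [Nat.add_mul_div_left _ _ hbp, Nat.div_eq_of_lt this]
    · intro n _
      rw [digitPoly_succ]

/-- The digits of a node are Laurent coefficients, so pairing them with `k` is a convolution, i.e.
the coefficient of `x^{-1}` of a product. As nodes have only `deg p` digits, `k` enters through its
truncation. -/
lemma walsh_latticePoint {s : ℕ} (p : (ZMod b)[X]) (g : Fin s → (ZMod b)[X]) (n : ℕ) (j : Fin s)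
    (k : (ZMod b)[X]) : walsh k (latticePoint p g n j) =
      ZMod.stdAddChar (laurentResidue p
        (digitPoly b p.natDegree n * (polyTrunc p.natDegree k * g j))) := by
  rw [walsh, latticePoint, laurentToUnit_eq]
  congr 1
  set N := k.natDegree + 1 + p.natDegree with hN
  have hk : k.degree < N := lt_of_lt_of_le (degree_lt_natDegree_succ k) (by exact_mod_cast (by omega))
  rw [walshPairing_eq_sum hk]
  simp_rw [digit_ofDigitSeq]
  have e1 : digitPoly b p.natDegree n * (polyTrunc p.natDegree k * g j) =
      polyTrunc p.natDegree k * (digitPoly b p.natDegree n * g j) := by ring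
  rw [e1, laurentResidue, toLaurentInv_mul (polyTrunc _ _), mul_div_assoc]
  set L := toLaurentInv (digitPoly b p.natDegree n * g j) / toLaurentInv p
  rw [polyTrunc, toLaurentInv_sum, Finset.sum_mul, HahnSeries.coeff_sum]
  simp_rw [toLaurentInv_monomial, HahnSeries.coeff_single_mul]
  rw [← Finset.sum_subset (Finset.range_subset_range.2 (by omega : p.natDegree ≤ N))]
  · refine Finset.sum_congr rfl fun i hi => ?_
    rw [if_pos (Finset.mem_range.1 hi)]
    congr 2; ring
  · intro i _ hi
    rw [if_neg (by simpa using hi), mul_zero]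

end Lattice

section Reconstruction

variable {b : ℕ} [hb : Fact b.Prime]

/-! ### Pointwise convergence of Walsh series at grid points -/

lemma walshPairing_X_mul (k : (ZMod b)[X]) (x : ℝ) :
    walshPairing (X * k) x = walshPairing k (b * x) := by
  have h1 := degree_lt_natDegree_succ k
  have h2 : (X * k).degree < ((k.natDegree + 1 + 1 : ℕ) : WithBot ℕ) := by
    rw [degree_lt_iff_coeff_zero] at h1 ⊢
    intro m hm
    obtain ⟨m, rfl⟩ := Nat.exists_eq_add_of_le' (by omega : 1 ≤ m)
    rw [coeff_X_mul]
    exact h1 m (by omega)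
  rw [walshPairing_eq_sum h1, walshPairing_eq_sum h2, Finset.sum_range_succ']
  simp [digit_succ]

lemma walshPairing_neg (k : (ZMod b)[X]) (x : ℝ) : walshPairing (-k) x = -walshPairing k x := by
  have h := walshPairing_add k (-k) x
  rw [add_neg_cancel] at h
  have h0 : walshPairing (0 : (ZMod b)[X]) x = 0 := by simp [walshPairing]
  rw [h0] at h
  exact (neg_eq_of_add_eq_zero_right h.symm).symm

/-- The Walsh–Dirichlet kernel; the index `-k` gives the complex conjugate. In the induction the
constant term of the index meets the first digit, the rest meets the digits of `b x`. -/
lemma sum_walsh_mul_walsh_neg (N : ℕ) : ∀ x y : ℝ,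
    ∑ k ∈ polyLT b N, walsh k y * walsh (-k) x =
      if ∀ i < N, digit b i y = digit b i x then (b : ℂ) ^ N else 0 := by
  induction N with
  | zero => intro x y; simp [polyLT]
  | succ N ih =>
    intro x y
    rw [sum_polyLT_succ]
    have e : ∀ (a : ZMod b) (k : (ZMod b)[X]), walsh (C a + X * k) y * walsh (-(C a + X * k)) x =
        ZMod.stdAddChar (a * (digit b 0 y - digit b 0 x)) *
          (walsh k (b * y) * walsh (-k) (b * x)) := by
      intro a k
      simp only [walsh]
      rw [← AddChar.map_add_eq_mul, ← AddChar.map_add_eq_mul, ← AddChar.map_add_eq_mul]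
      congr 1
      simp only [walshPairing_neg, walshPairing_add, walshPairing_X_mul]
      rw [← monomial_zero_left, walshPairing_monomial, walshPairing_monomial]
      ring
    simp_rw [e, ← Finset.mul_sum, ih, ← Finset.sum_mul, sum_stdAddChar_mul, sub_eq_zero, ← digit_succ]
    have h : (∀ i < N + 1, digit b i y = digit b i x) ↔
        digit b 0 y = digit b 0 x ∧ ∀ i < N, digit b (i + 1) y = digit b (i + 1) x := by
      constructor
      · exact fun h => ⟨h 0 (by omega), fun i hi => h (i + 1) (by omega)⟩
      · rintro ⟨h0, h1⟩ i hi
        cases i with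
        | zero => exact h0
        | succ i => exact h1 i (by omega)
    simp only [h, pow_succ']
    by_cases h0 : digit b 0 y = digit b 0 x <;>
      by_cases h1 : ∀ i < N, digit b (i + 1) y = digit b (i + 1) x <;> simp [h0, h1]

lemma floor_pow_succ_mul (N : ℕ) (x : ℝ) :
    ⌊(b : ℝ) ^ (N + 1) * x⌋ = (b : ℤ) * ⌊(b : ℝ) ^ N * x⌋ + (digit b N x).val := by
  have hpos : (0 : ℤ) < (b : ℤ) := by exact_mod_cast hb.out.pos
  have h1 := Int.mul_cast_floor_div_cancel_of_pos hpos ((b : ℝ) ^ N * x)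
  have h2 : (b : ℝ) ^ N * x * ((b : ℤ) : ℝ) = (b : ℝ) ^ (N + 1) * x := by push_cast; ring
  rw [h2] at h1
  rw [digit, ZMod.val_intCast, ← h1]
  exact (Int.mul_ediv_add_emod _ _).symm

lemma forall_digit_eq_iff (N : ℕ) {x y : ℝ} (h0 : ⌊x⌋ = ⌊y⌋) :
    (∀ i < N, digit b i y = digit b i x) ↔ ⌊(b : ℝ) ^ N * y⌋ = ⌊(b : ℝ) ^ N * x⌋ := by
  constructor
  · intro h
    induction N with
    | zero => simpa using h0.symm
    | succ N ih =>
      rw [floor_pow_succ_mul, floor_pow_succ_mul, ih fun i hi => h i (by omega), h N (by omega)]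
  · intro h i hi
    rw [digit_eq_ediv hi, digit_eq_ediv hi, h]

/-- The Walsh coefficient of a function on the unit interval. -/
noncomputable def walshHat (h : ℝ → ℂ) (k : (ZMod b)[X]) : ℂ :=
  ∫ y in (0 : ℝ)..1, h y * walsh k y

/-- Partial sums over all indices of degree below `N` are averages over the `b`-adic cell containing
`x`. A grid point is the left end of its cell. -/
lemma sum_walshHat_mul {h : ℝ → ℂ} (hm : Measurable h) {M : ℝ} (hM : ∀ x, ‖h x‖ ≤ M) {n : ℕ} {c : ℤ}
    {x : ℝ} (hx : x = c / (b : ℝ) ^ n) (hx1 : x ∈ Set.Ico (0 : ℝ) 1) {N : ℕ} (hN : n ≤ N) :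
    ∑ k ∈ polyLT b N, walshHat h k * walsh (-k) x =
      (b : ℂ) ^ N * ∫ y in x..(x + ((b : ℝ) ^ N)⁻¹), h y := by
  have hb0 : (0 : ℝ) < (b : ℝ) ^ N := pow_pos base_pos _
  have hint : ∀ a d : ℝ, IntervalIntegrable h volume a d := intervalIntegrable_of_bounded hm hM
  have hfloor : (⌊(b : ℝ) ^ N * x⌋ : ℝ) = (b : ℝ) ^ N * x := by
    have : (b : ℝ) ^ N * x = ((c * (b : ℤ) ^ (N - n) : ℤ) : ℝ) := by
      have hbn : (b : ℝ) ^ n ≠ 0 := pow_ne_zero _ base_pos.ne'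
      have e : (b : ℝ) ^ N = (b : ℝ) ^ n * (b : ℝ) ^ (N - n) := by
        rw [← pow_add, Nat.add_sub_cancel' hN]
      rw [hx, e]
      push_cast
      field_simp
    rw [this, Int.floor_intCast]
  have hle : x + ((b : ℝ) ^ N)⁻¹ ≤ 1 := by
    have h1 : (⌊(b : ℝ) ^ N * x⌋ : ℤ) + 1 ≤ (b : ℤ) ^ N := by
      have : (⌊(b : ℝ) ^ N * x⌋ : ℝ) < (b : ℝ) ^ N := by rw [hfloor]; nlinarith [hx1.2]
      exact_mod_cast this
    have h2 : (b : ℝ) ^ N * x + 1 ≤ (b : ℝ) ^ N := by rw [← hfloor]; exact_mod_cast h1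
    have h3 : (x + ((b : ℝ) ^ N)⁻¹) * (b : ℝ) ^ N ≤ 1 * (b : ℝ) ^ N := by
      rw [add_mul, inv_mul_cancel₀ hb0.ne']; linarith
    exact le_of_mul_le_mul_right h3 hb0
  have hinv : 0 < ((b : ℝ) ^ N)⁻¹ := inv_pos.2 hb0
  have hmeas : ∀ k : (ZMod b)[X], IntervalIntegrable (fun y => h y * walsh k y * walsh (-k) x)
      volume 0 1 := fun k =>
    intervalIntegrable_of_bounded ((hm.mul (measurable_walsh k)).mul_const _) (C := M) (fun y => by
      rw [norm_mul, norm_walsh, mul_one, Pi.mul_apply, norm_mul, norm_walsh, mul_one]; exact hM y) _ _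
  have e1 : ∑ k ∈ polyLT b N, walshHat h k * walsh (-k) x =
      ∫ y in (0 : ℝ)..1, ∑ k ∈ polyLT b N, h y * walsh k y * walsh (-k) x := by
    rw [intervalIntegral.integral_finsetSum fun k _ => hmeas k]
    refine Finset.sum_congr rfl fun k _ => ?_
    rw [walshHat, intervalIntegral.integral_mul_const]
  have e2 : ∀ y ∈ Set.Ico (0 : ℝ) 1, ∑ k ∈ polyLT b N, h y * walsh k y * walsh (-k) x =
      (Set.Ico x (x + ((b : ℝ) ^ N)⁻¹)).indicator (fun y => h y * (b : ℂ) ^ N) y := by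
    intro y hy
    simp_rw [mul_assoc, ← Finset.mul_sum]
    rw [sum_walsh_mul_walsh_neg, Set.indicator_apply]
    have h0 : ⌊x⌋ = ⌊y⌋ := by rw [Int.floor_eq_zero_iff.2 hx1, Int.floor_eq_zero_iff.2 hy]
    have hiff : (∀ i < N, digit b i y = digit b i x) ↔ y ∈ Set.Ico x (x + ((b : ℝ) ^ N)⁻¹) := by
      rw [forall_digit_eq_iff N h0, Int.floor_eq_iff, hfloor, Set.mem_Ico]
      have h4 : y < x + ((b : ℝ) ^ N)⁻¹ ↔ (b : ℝ) ^ N * y < (b : ℝ) ^ N * x + 1 := by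
        rw [← mul_lt_mul_iff_right₀ hb0, mul_add, mul_inv_cancel₀ hb0.ne']
      rw [h4, mul_le_mul_iff_right₀ hb0]
    simp only [hiff]
    split_ifs <;> simp
  rw [e1, intervalIntegral.integral_of_le zero_le_one, ← integral_Ico_eq_integral_Ioc,
    setIntegral_congr_fun measurableSet_Ico e2, setIntegral_indicator measurableSet_Ico,
    Set.inter_eq_self_of_subset_right (Set.Ico_subset_Ico hx1.1 hle),
    integral_Ico_eq_integral_Ioc, ← intervalIntegral.integral_of_le (by linarith),
    intervalIntegral.integral_mul_const, mul_comm]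

/-- The averages over `[x, x + b^{-N}]` are difference quotients of an integral and converge by
right continuity. This covers the first-order kernel, which jumps at the grid point `0`. -/
lemma tendsto_sum_walshHat_mul {h : ℝ → ℂ} (hm : Measurable h) {M : ℝ} (hM : ∀ x, ‖h x‖ ≤ M) {n : ℕ}
    {c : ℤ} {x : ℝ} (hx : x = c / (b : ℝ) ^ n) (hx1 : x ∈ Set.Ico (0 : ℝ) 1)
    (hcont : ContinuousWithinAt h (Set.Ici x) x) :
    Tendsto (fun N => ∑ k ∈ polyLT b N, walshHat h k * walsh (-k) x) atTop (𝓝 (h x)) := by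
  have hint : ∀ a d : ℝ, IntervalIntegrable h volume a d := intervalIntegrable_of_bounded hm hM
  have hd : HasDerivWithinAt (fun u => ∫ y in x..u, h y) (h x) (Set.Ici x) x :=
    intervalIntegral.integral_hasDerivWithinAt_right (hint x x)
      (hm.stronglyMeasurable.stronglyMeasurableAtFilter) (hcont.mono Set.Ioi_subset_Ici_self)
  have hs := (hasDerivWithinAt_iff_tendsto_slope' Set.self_notMem_Ioi).1
    (hd.mono Set.Ioi_subset_Ici_self)
  have hu : Tendsto (fun N : ℕ => x + ((b : ℝ) ^ N)⁻¹) atTop (𝓝[>] x) := by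
    refine tendsto_nhdsWithin_iff.2 ⟨?_, Eventually.of_forall fun N => ?_⟩
    · have : Tendsto (fun N : ℕ => ((b : ℝ) ^ N)⁻¹) atTop (𝓝 0) :=
        (tendsto_pow_atTop_atTop_of_one_lt (by linarith [two_le_base (b := b)])).inv_tendsto_atTop
      simpa using this.const_add x
    · have : 0 < ((b : ℝ) ^ N)⁻¹ := inv_pos.2 (pow_pos base_pos _)
      simpa using this
  refine (hs.comp hu).congr' ?_
  filter_upwards [eventually_ge_atTop n] with N hN
  rw [sum_walshHat_mul hm hM hx hx1 hN, Function.comp_apply, slope_def_module,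
    intervalIntegral.integral_same, sub_zero, add_sub_cancel_left, inv_inv, Complex.real_smul]
  push_cast
  rfl

/-- The average of a Walsh function over the equidistant grid. -/
lemma sum_walsh_grid (n : ℕ) (k : (ZMod b)[X]) :
    ∑ i ∈ Finset.range (b ^ n), walsh k ((i : ℝ) / (b : ℝ) ^ n) =
      if polyTrunc n k = 0 then (b : ℂ) ^ n else 0 := by
  have hbn : (0 : ℝ) < (b : ℝ) ^ n := pow_pos base_pos _
  have h1 : ∀ i : ℕ, walsh k ((i : ℝ) / (b : ℝ) ^ n) =
      walsh (polyTrunc n k) ((i : ℝ) / (b : ℝ) ^ n) := by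
    intro i
    simp only [walsh]
    congr 1
    have hk : k.degree < ((k.natDegree + 1 + n : ℕ) : WithBot ℕ) :=
      (degree_lt_natDegree_succ k).trans_le (by exact_mod_cast Nat.le_add_right _ _)
    rw [walshPairing_eq_sum hk, walshPairing_eq_sum (degree_polyTrunc_lt n k)]
    rw [← Finset.sum_subset (Finset.range_subset_range.2 (by omega : n ≤ k.natDegree + 1 + n))]
    · refine Finset.sum_congr rfl fun j hj => ?_
      rw [coeff_polyTrunc, if_pos (Finset.mem_range.1 hj)]
    · intro j _ hj
      rw [Finset.mem_range, not_lt] at hj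
      obtain ⟨l, rfl⟩ := Nat.exists_eq_add_of_le hj
      have : digit b (n + l) ((i : ℝ) / (b : ℝ) ^ n) = 0 := by
        rw [digit]
        have e : (b : ℝ) ^ (n + l + 1) * ((i : ℝ) / (b : ℝ) ^ n) =
            (((b : ℤ) * ((b : ℤ) ^ l * i) : ℤ) : ℝ) := by
          push_cast
          field_simp
          ring
        rw [e, Int.floor_intCast]
        push_cast
        simp
      rw [this, mul_zero]
  simp_rw [h1]
  split_ifs with h
  · simp [h]
  -- The truncated Walsh function is constant on grid cells, so the grid sum is `b^n` times its
  -- integral, which is zero.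
  · have h2 : ∀ i < b ^ n, ∫ x in (((i : ℕ) : ℝ) / (b : ℝ) ^ n)..(((i + 1 : ℕ) : ℝ) / (b : ℝ) ^ n),
        walsh (polyTrunc n k) x = ((b : ℂ) ^ n)⁻¹ * walsh (polyTrunc n k) ((i : ℝ) / (b : ℝ) ^ n) := by
      intro i _
      have hle : ((i : ℕ) : ℝ) / (b : ℝ) ^ n ≤ ((i + 1 : ℕ) : ℝ) / (b : ℝ) ^ n := by
        gcongr; omega
      rw [intervalIntegral.integral_of_le hle, ← integral_Ico_eq_integral_Ioc,
        setIntegral_congr_fun (g := fun _ => walsh (polyTrunc n k) ((i : ℝ) / (b : ℝ) ^ n))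
          measurableSet_Ico, integral_Ico_eq_integral_Ioc, ← intervalIntegral.integral_of_le hle,
        intervalIntegral.integral_const, Complex.real_smul]
      · congr 1
        push_cast
        field_simp
        ring
      · intro x hx
        refine walsh_congr (degree_polyTrunc_lt n k) ?_
        have e : (b : ℝ) ^ n * ((i : ℝ) / (b : ℝ) ^ n) = ((i : ℤ) : ℝ) := by
          push_cast; field_simp
        rw [e, Int.floor_intCast, Int.floor_eq_iff]
        obtain ⟨hx1, hx2⟩ := hx
        rw [div_le_iff₀ hbn] at hx1
        rw [lt_div_iff₀ hbn] at hx2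
        push_cast at *
        constructor <;> linarith
    have h3 := intervalIntegral.sum_integral_adjacent_intervals (f := walsh (polyTrunc n k))
      (μ := volume) (a := fun i : ℕ => (i : ℝ) / (b : ℝ) ^ n) (n := b ^ n)
      fun i _ => intervalIntegrable_walsh _ _ _
    rw [Finset.sum_congr rfl fun i hi => h2 i (Finset.mem_range.1 hi), ← Finset.mul_sum] at h3
    have h4 : (((b ^ n : ℕ) : ℝ) / (b : ℝ) ^ n) = 1 := by push_cast; exact div_self hbn.ne'
    simp only [h4, Nat.cast_zero, zero_div] at h3
    rw [integral_walsh h] at h3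
    have hbc : ((b : ℂ) ^ n)⁻¹ ≠ 0 := inv_ne_zero (pow_ne_zero _ (by exact_mod_cast hb.out.ne_zero))
    exact (mul_eq_zero.1 h3).resolve_left hbc

end Reconstruction

section LatticeError

variable {b : ℕ} [hb : Fact b.Prime]

/-! ### The error of polynomial lattice rules for product functions -/

lemma polyTrunc_neg (n : ℕ) (k : (ZMod b)[X]) : polyTrunc n (-k) = -polyTrunc n k := by
  ext i
  rw [coeff_neg, coeff_polyTrunc, coeff_polyTrunc, coeff_neg]
  split_ifs <;> simp

/-- Membership of `k` in the dual polynomial lattice. -/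
def IsDual {s : ℕ} (p : (ZMod b)[X]) (g k : Fin s → (ZMod b)[X]) : Prop :=
  p ∣ ∑ j, polyTrunc p.natDegree (k j) * g j

/-- `k` is a dual lattice vector which does not belong to the dual of the full grid. -/
def IsProperDual {s : ℕ} (p : (ZMod b)[X]) (g k : Fin s → (ZMod b)[X]) : Prop :=
  IsDual p g k ∧ ∃ j, polyTrunc p.natDegree (k j) ≠ 0

lemma stdAddChar_sum {ι : Type*} (s : Finset ι) (f : ι → ZMod b) :
    (ZMod.stdAddChar (∑ i ∈ s, f i) : ℂ) = ∏ i ∈ s, ZMod.stdAddChar (f i) := by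
  classical
  induction s using Finset.induction_on with
  | empty => simp
  | insert a s ha ih =>
    rw [Finset.sum_insert ha, Finset.prod_insert ha, AddChar.map_add_eq_mul, ih]

open Classical in
lemma sum_prod_walsh_latticePoint {s : ℕ} {p : (ZMod b)[X]} (hp : p ≠ 0)
    (g k : Fin s → (ZMod b)[X]) :
    ∑ n ∈ Finset.range (b ^ p.natDegree), ∏ j, walsh (-(k j)) (latticePoint p g n j) =
      if IsDual p g k then (b : ℂ) ^ p.natDegree else 0 := by
  have h1 : ∀ n, ∏ j, walsh (-(k j)) (latticePoint p g n j) = ZMod.stdAddChar (laurentResidue p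
      (digitPoly b p.natDegree n * -∑ j, polyTrunc p.natDegree (k j) * g j)) := by
    intro n
    simp_rw [walsh_latticePoint]
    rw [← Finset.sum_neg_distrib, Finset.mul_sum, laurentResidue_sum, stdAddChar_sum]
    refine Finset.prod_congr rfl fun j _ => ?_
    rw [polyTrunc_neg, neg_mul]
  simp_rw [h1]
  rw [sum_digitPoly p.natDegree fun l => (ZMod.stdAddChar (laurentResidue p
      (l * -∑ j, polyTrunc p.natDegree (k j) * g j)) : ℂ), sum_stdAddChar_laurentResidue hp]
  simp only [dvd_neg, IsDual]
  congr

open Classical in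
lemma sum_prod_walshSum_latticePoint {s : ℕ} {p : (ZMod b)[X]} (hp : p ≠ 0)
    (g : Fin s → (ZMod b)[X]) (c : Fin s → (ZMod b)[X] → ℂ) (N : ℕ) :
    ((b : ℂ) ^ p.natDegree)⁻¹ * ∑ n ∈ Finset.range (b ^ p.natDegree),
        ∏ j, ∑ k ∈ polyLT b N, c j k * walsh (-k) (latticePoint p g n j) =
      ∑ k ∈ Fintype.piFinset fun _ : Fin s => polyLT b N,
        if IsDual p g k then ∏ j, c j (k j) else 0 := by
  have hb0 : (b : ℂ) ^ p.natDegree ≠ 0 := pow_ne_zero _ (by exact_mod_cast hb.out.ne_zero)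
  simp_rw [Finset.prod_univ_sum, Finset.prod_mul_distrib]
  rw [Finset.sum_comm, Finset.mul_sum]
  refine Finset.sum_congr rfl fun k _ => ?_
  rw [← Finset.mul_sum, sum_prod_walsh_latticePoint hp]
  split_ifs
  · field_simp
  · simp

-- The vectors with all truncations zero are the dual lattice of the full grid with `b^n` points per
-- axis.
open Classical in
lemma prod_sum_walshSum_grid {s : ℕ} (n : ℕ) (c : Fin s → (ZMod b)[X] → ℂ) (N : ℕ) :
    ∏ j, (((b : ℂ) ^ n)⁻¹ * ∑ i ∈ Finset.range (b ^ n),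
        ∑ k ∈ polyLT b N, c j k * walsh (-k) ((i : ℝ) / (b : ℝ) ^ n)) =
      ∑ k ∈ Fintype.piFinset fun _ : Fin s => polyLT b N,
        if ∀ j, polyTrunc n (k j) = 0 then ∏ j, c j (k j) else 0 := by
  have hb0 : (b : ℂ) ^ n ≠ 0 := pow_ne_zero _ (by exact_mod_cast hb.out.ne_zero)
  have h1 : ∀ j, ((b : ℂ) ^ n)⁻¹ * ∑ i ∈ Finset.range (b ^ n),
        ∑ k ∈ polyLT b N, c j k * walsh (-k) ((i : ℝ) / (b : ℝ) ^ n) =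
      ∑ k ∈ polyLT b N, if polyTrunc n k = 0 then c j k else 0 := by
    intro j
    rw [Finset.sum_comm, Finset.mul_sum]
    refine Finset.sum_congr rfl fun k _ => ?_
    rw [← Finset.mul_sum, sum_walsh_grid, polyTrunc_neg]
    simp only [neg_eq_zero]
    split_ifs
    · field_simp
    · simp
  simp_rw [h1, Finset.prod_univ_sum]
  refine Finset.sum_congr rfl fun k _ => ?_
  split_ifs with h
  · exact Finset.prod_congr rfl fun j _ => if_pos (h j)
  · push Not at h
    obtain ⟨j, hj⟩ := h
    exact Finset.prod_eq_zero (Finset.mem_univ j) (if_neg hj)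

lemma latticePoint_eq_div {s : ℕ} (p : (ZMod b)[X]) (g : Fin s → (ZMod b)[X]) (n : ℕ) (j : Fin s) :
    ∃ i : ℤ, latticePoint p g n j = i / (b : ℝ) ^ p.natDegree := by
  rw [latticePoint, laurentToUnit_eq]
  exact exists_intCast_div_eq_ofDigitSeq _ _

lemma latticePoint_mem {s : ℕ} (p : (ZMod b)[X]) (g : Fin s → (ZMod b)[X]) (n : ℕ) (j : Fin s) :
    latticePoint p g n j ∈ Set.Ico (0 : ℝ) 1 := by
  rw [latticePoint, laurentToUnit_eq]
  exact ofDigitSeq_mem _ _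

-- The dual vectors of the full grid belong to every dual lattice and reproduce the product of grid
-- averages exactly, so they cancel. This is an identity for partial Walsh sums; the bound survives
-- the limit because the right side is a sum in `ℝ≥0∞`, and no absolute convergence has to be known.
open Classical in
lemma norm_lattice_sub_grid_le {s : ℕ} {p : (ZMod b)[X]} (hp : p ≠ 0) (g : Fin s → (ZMod b)[X])
    {h : Fin s → ℝ → ℂ} (hm : ∀ j, Measurable (h j)) (hM : ∀ j, ∃ M : ℝ, ∀ x, ‖h j x‖ ≤ M)
    (hc : ∀ j, ∀ x ∈ Set.Ico (0 : ℝ) 1, ContinuousWithinAt (h j) (Set.Ici x) x)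
    {β : Fin s → (ZMod b)[X] → ℝ} (hβ : ∀ j k, ‖walshHat (h j) k‖ ≤ β j k) :
    ENNReal.ofReal ‖((b : ℂ) ^ p.natDegree)⁻¹ * ∑ n ∈ Finset.range (b ^ p.natDegree),
        ∏ j, h j (latticePoint p g n j) -
        ∏ j, (((b : ℂ) ^ p.natDegree)⁻¹ * ∑ i ∈ Finset.range (b ^ p.natDegree),
          h j ((i : ℝ) / (b : ℝ) ^ p.natDegree))‖ ≤
      ∑' k : Fin s → (ZMod b)[X],
        if IsProperDual p g k then ∏ j, ENNReal.ofReal (β j (k j)) else 0 := by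
  have hbn : (0 : ℝ) < (b : ℝ) ^ p.natDegree := pow_pos base_pos _
  have hlim : ∀ j (x : ℝ) (i : ℤ), x = i / (b : ℝ) ^ p.natDegree → x ∈ Set.Ico (0 : ℝ) 1 →
      Tendsto (fun N => ∑ k ∈ polyLT b N, walshHat (h j) k * walsh (-k) x) atTop (𝓝 (h j x)) := by
    intro j x i hx hx1
    obtain ⟨M, hM⟩ := hM j
    exact tendsto_sum_walshHat_mul (hm j) hM hx hx1 (hc j x hx1)
  have h1 : Tendsto (fun N => ((b : ℂ) ^ p.natDegree)⁻¹ * ∑ n ∈ Finset.range (b ^ p.natDegree),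
      ∏ j, (∑ k ∈ polyLT b N, walshHat (h j) k * walsh (-k) (latticePoint p g n j)) -
      ∏ j, (((b : ℂ) ^ p.natDegree)⁻¹ * ∑ i ∈ Finset.range (b ^ p.natDegree),
          ∑ k ∈ polyLT b N, walshHat (h j) k * walsh (-k) ((i : ℝ) / (b : ℝ) ^ p.natDegree))) atTop
      (𝓝 (((b : ℂ) ^ p.natDegree)⁻¹ * ∑ n ∈ Finset.range (b ^ p.natDegree),
        ∏ j, h j (latticePoint p g n j) -
        ∏ j, (((b : ℂ) ^ p.natDegree)⁻¹ * ∑ i ∈ Finset.range (b ^ p.natDegree),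
          h j ((i : ℝ) / (b : ℝ) ^ p.natDegree)))) := by
    refine Tendsto.sub ?_ ?_
    · refine Tendsto.const_mul _ (tendsto_finsetSum _ fun n _ => tendsto_finsetProd _ fun j _ => ?_)
      obtain ⟨i, hi⟩ := latticePoint_eq_div p g n j
      exact hlim j _ i hi (latticePoint_mem p g n j)
    · refine tendsto_finsetProd _ fun j _ => Tendsto.const_mul _ (tendsto_finsetSum _ fun i hi => ?_)
      refine hlim j _ i (by push_cast; rfl) ⟨by positivity, ?_⟩
      rw [div_lt_one hbn]
      exact_mod_cast Finset.mem_range.1 hi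
  have h2 := (ENNReal.continuous_ofReal.tendsto _).comp h1.norm
  refine le_of_tendsto h2 (Eventually.of_forall fun N => ?_)
  rw [Function.comp_apply, sum_prod_walshSum_latticePoint hp, prod_sum_walshSum_grid,
    ← Finset.sum_sub_distrib]
  have hβ0 : ∀ j k, 0 ≤ β j k := fun j k => (norm_nonneg _).trans (hβ j k)
  have h3 : ∀ k : Fin s → (ZMod b)[X],
      ‖(if IsDual p g k then ∏ j, walshHat (h j) (k j) else 0) -
        (if ∀ j, polyTrunc p.natDegree (k j) = 0 then ∏ j, walshHat (h j) (k j) else 0)‖ ≤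
      if IsProperDual p g k then ∏ j, β j (k j) else 0 := by
    intro k
    by_cases h0 : ∀ j, polyTrunc p.natDegree (k j) = 0
    · have hd : IsDual p g k := by simp [IsDual, h0]
      have hnp : ¬ IsProperDual p g k := fun h => by
        obtain ⟨j, hj⟩ := h.2
        exact hj (h0 j)
      simp [hd, h0, hnp]
    · have h0' : ∃ j, polyTrunc p.natDegree (k j) ≠ 0 := by push Not at h0; exact h0
      rw [if_neg h0, sub_zero]
      by_cases hd : IsDual p g k
      · rw [if_pos hd, if_pos (show IsProperDual p g k from ⟨hd, h0'⟩), norm_prod]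
        exact Finset.prod_le_prod (fun j _ => norm_nonneg _) fun j _ => hβ j _
      · rw [if_neg hd, if_neg fun h : IsProperDual p g k => hd h.1, norm_zero]
  calc _ ≤ ENNReal.ofReal (∑ k ∈ Fintype.piFinset fun _ : Fin s => polyLT b N,
        if IsProperDual p g k then ∏ j, β j (k j) else 0) :=
        ENNReal.ofReal_le_ofReal ((norm_sum_le _ _).trans (Finset.sum_le_sum fun k _ => h3 k))
    _ = ∑ k ∈ Fintype.piFinset fun _ : Fin s => polyLT b N,
        if IsProperDual p g k then ∏ j, ENNReal.ofReal (β j (k j)) else 0 := by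
        rw [ENNReal.ofReal_sum_of_nonneg]
        · refine Finset.sum_congr rfl fun k _ => ?_
          split_ifs
          · exact ENNReal.ofReal_prod_of_nonneg fun j _ => hβ0 j _
          · exact ENNReal.ofReal_zero
        · intro k _
          split_ifs
          · exact Finset.prod_nonneg fun j _ => hβ0 j _
          · exact le_rfl
    _ ≤ _ := ENNReal.sum_le_tsum _

end LatticeError

section Averaging

variable {b : ℕ} [hb : Fact b.Prime]

/-! ### Existence of good generating vectors -/

open Classical in
/-- For a prime modulus, a fixed vector is dual to at most the fraction `1 / (b ^ n - 1)` of all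
generating vectors. -/
lemma card_isProperDual_mul_le {s : ℕ} {p : (ZMod b)[X]} (hp : Irreducible p)
    (k : Fin s → (ZMod b)[X]) :
    ((Fintype.piFinset fun _ : Fin s => (polyLT b p.natDegree).erase 0).filter
        fun g => IsProperDual p g k).card * (b ^ p.natDegree - 1) ≤
      (b ^ p.natDegree - 1) ^ s := by
  set S := (polyLT b p.natDegree).erase 0 with hS
  have hcard : S.card = b ^ p.natDegree - 1 := by
    rw [hS, Finset.card_erase_of_mem (zero_mem_polyLT _), card_polyLT]
  by_cases hk : ∃ j, polyTrunc p.natDegree (k j) ≠ 0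
  swap
  · have : (Fintype.piFinset fun _ : Fin s => S).filter (fun g => IsProperDual p g k) = ∅ :=
      Finset.filter_eq_empty_iff.2 fun g _ h => hk h.2
    rw [this]; simp
  obtain ⟨i, hi⟩ := hk
  set T := (Fintype.piFinset fun _ : Fin s => S).filter fun g => IsProperDual p g k
  -- The component `g i` is overwritten by an arbitrary nonzero `c`. Nothing is lost: two candidates
  -- agreeing off `i` have `p` dividing the truncation of `k i` times their difference at `i`; both
  -- have degree below that of the prime `p`, and the truncation is nonzero.
  have hinj : Set.InjOn (fun x : (Fin s → (ZMod b)[X]) × (ZMod b)[X] => Function.update x.1 i x.2)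
      (T ×ˢ S : Finset _) := by
    rintro ⟨g, c⟩ hg ⟨g', c'⟩ hg' h
    simp only [Finset.coe_product, Set.mem_prod, Finset.mem_coe] at hg hg'
    have hc : c = c' := by simpa using congrFun h i
    have hne : ∀ j, j ≠ i → g j = g' j := fun j hj => by
      have := congrFun h j
      simpa [Function.update_of_ne hj] using this
    have hgT := (Finset.mem_filter.1 hg.1)
    have hgT' := (Finset.mem_filter.1 hg'.1)
    have hd : p ∣ polyTrunc p.natDegree (k i) * (g i - g' i) := by
      have h1 := dvd_sub hgT.2.1 hgT'.2.1
      rw [← Finset.sum_sub_distrib, Finset.sum_eq_single i] at h1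
      · rwa [← mul_sub] at h1
      · intro j _ hj
        rw [hne j hj, sub_self]
      · simp
    have hgi := mem_polyLT.1 (Finset.mem_of_mem_erase (Fintype.mem_piFinset.1 hgT.1 i))
    have hgi' := mem_polyLT.1 (Finset.mem_of_mem_erase (Fintype.mem_piFinset.1 hgT'.1 i))
    have hsmall : ∀ q : (ZMod b)[X], q.degree < p.natDegree → p ∣ q → q = 0 := fun q hq hpq =>
      eq_zero_of_dvd_of_degree_lt hpq (by rwa [degree_eq_natDegree hp.ne_zero])
    have hgg : g i = g' i := by
      rcases hp.prime.dvd_or_dvd hd with h2 | h2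
      · exact absurd (hsmall _ (degree_polyTrunc_lt _ _) h2) hi
      · exact sub_eq_zero.1 (hsmall _ ((degree_sub_le _ _).trans_lt (max_lt hgi hgi')) h2)
    have : g = g' := by
      funext j
      by_cases hj : j = i
      · rw [hj, hgg]
      · exact hne j hj
    rw [this, hc]
  have hmaps : Set.MapsTo (fun x : (Fin s → (ZMod b)[X]) × (ZMod b)[X] => Function.update x.1 i x.2)
      (T ×ˢ S : Finset _) (Fintype.piFinset fun _ : Fin s => S : Finset _) := by
    rintro ⟨g, c⟩ hg
    simp only [Finset.coe_product, Set.mem_prod, Finset.mem_coe] at hg ⊢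
    rw [Fintype.mem_piFinset]
    intro j
    by_cases hj : j = i
    · subst hj; simpa using hg.2
    · simpa [Function.update_of_ne hj] using Fintype.mem_piFinset.1 (Finset.mem_filter.1 hg.1).1 j
  have := Finset.card_le_card_of_injOn _ hmaps hinj
  rwa [Finset.card_product, Fintype.card_piFinset_const, hcard] at this

end Averaging

/-- Subadditivity of `x ↦ x^λ` for `λ ≤ 1` on finite sums, then the supremum over them. -/
lemma ENNReal.tsum_rpow_le_tsum_rpow {ι : Type*} (a : ι → ℝ≥0∞) {lam : ℝ} (h0 : 0 < lam)
    (h1 : lam ≤ 1) : (∑' i, a i) ^ lam ≤ ∑' i, a i ^ lam := by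
  have hfin : ∀ T : Finset ι, (∑ i ∈ T, a i) ^ lam ≤ ∑ i ∈ T, a i ^ lam := by
    classical
    intro T
    induction T using Finset.induction_on with
    | empty => simp [h0]
    | insert i T hi ih =>
      rw [Finset.sum_insert hi, Finset.sum_insert hi]
      exact (ENNReal.rpow_add_le_add_rpow _ _ h0.le h1).trans (add_le_add_right ih _)
  have h2 : ∑' i, a i ≤ (∑' i, a i ^ lam) ^ lam⁻¹ := by
    refine ENNReal.summable.tsum_le_of_sum_le fun T => ?_
    rw [ENNReal.le_rpow_inv_iff h0]
    exact (hfin T).trans (ENNReal.sum_le_tsum _)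
  rwa [ENNReal.le_rpow_inv_iff h0] at h2

lemma sum_powerset_range {M : Type*} [AddCommMonoid M] (s : ℕ) (F : Finset ℕ → M) :
    ∑ u ∈ (Finset.range s).powerset, F u = ∑ u : Finset (Fin s), F (u.map Fin.valEmbedding) := by
  symm
  refine Finset.sum_nbij (fun u => u.map Fin.valEmbedding) ?_ ?_ ?_ ?_
  · intro u _
    rw [Finset.mem_powerset]
    intro i hi
    obtain ⟨j, _, rfl⟩ := Finset.mem_map.1 hi
    exact Finset.mem_range.2 j.2
  · intro u _ v _ h
    exact Finset.map_injective _ h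
  · intro u hu
    have hu := Finset.mem_powerset.1 (Finset.mem_coe.1 hu)
    refine ⟨u.attachFin fun n hn => Finset.mem_range.1 (hu hn), Finset.mem_coe.2 (Finset.mem_univ _), ?_⟩
    ext i
    simp only [Finset.mem_map, Finset.mem_attachFin, Fin.valEmbedding_apply]
    constructor
    · rintro ⟨j, hj, rfl⟩; exact hj
    · intro hi; exact ⟨⟨i, Finset.mem_range.1 (hu hi)⟩, hi, rfl⟩
  · intro u _; rfl

/-! ### The quality criterion and its average over generating vectors -/

section FigureOfMerit

variable {b : ℕ} [hb : Fact b.Prime]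

/-- The bound for the Walsh coefficients at `k` of the functions depending on the variables
in `u`. -/
noncomputable def dualTerm {s : ℕ} (α : ℕ) (γ : Finset ℕ → ℝ≥0) (u : Finset (Fin s))
    (k : Fin s → (ZMod b)[X]) : ℝ≥0∞ :=
  (γ (u.map Fin.valEmbedding) : ℝ≥0∞) * ∏ j,
    if j ∈ u then (if k j = 0 then 0 else
      ENNReal.ofReal (walshConst b α * ((b : ℝ) ^ muExp α (k j))⁻¹))
    else if k j = 0 then 1 else 0

open Classical in
/-- The quality criterion for generating vectors. -/
noncomputable def figureOfMerit {s : ℕ} (α : ℕ) (γ : Finset ℕ → ℝ≥0) (p : (ZMod b)[X])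
    (g : Fin s → (ZMod b)[X]) : ℝ≥0∞ :=
  ∑' x : (Fin s → (ZMod b)[X]) × Finset (Fin s),
    if IsProperDual p g x.1 then dualTerm α γ x.2 x.1 else 0

lemma walshConst_nonneg {α : ℕ} (hα : 2 ≤ α) : 0 ≤ walshConst b α := by
  have h1 := sum_walshCoeff_add_kernelBound_le (b := b) hα (one_ne_zero : (1 : (ZMod b)[X]) ≠ 0)
  have h2 := (norm_nonneg _).trans (norm_walshCoeff_le_kernelBound (b := b) (by omega : 1 ≤ α)
    (Set.left_mem_Ico.2 zero_lt_one) 1)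
  have h3 : 0 ≤ walshConst b α * ((b : ℝ) ^ muExp α (1 : (ZMod b)[X]))⁻¹ :=
    le_trans (add_nonneg (Finset.sum_nonneg fun _ _ => norm_nonneg _) h2) h1
  exact nonneg_of_mul_nonneg_left h3 (inv_pos.2 (pow_pos base_pos _))

lemma sumConst_nonneg {α : ℕ} (hα : 1 ≤ α) {lam : ℝ} (hlam : 1 / (α : ℝ) < lam) :
    0 ≤ sumConst b α lam := by
  refine le_trans ?_ (sum_polyLT_inv_pow_muExp_le (b := b) hα hlam 0)
  exact Finset.sum_nonneg fun k _ => inv_nonneg.2 (pow_nonneg (Real.rpow_nonneg base_pos.le _) _)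

/-- A finite set of index vectors lies in a box of polynomials of bounded degree, and over a box the
sum of products factorizes. -/
lemma tsum_pi_prod_le {s : ℕ} (θ : Fin s → (ZMod b)[X] → ℝ≥0∞) (B : Fin s → ℝ≥0∞)
    (h : ∀ j N, ∑ k ∈ polyLT b N, θ j k ≤ B j) :
    ∑' k : Fin s → (ZMod b)[X], ∏ j, θ j (k j) ≤ ∏ j, B j := by
  refine ENNReal.summable.tsum_le_of_sum_le fun T => ?_
  set N := T.sup fun k => Finset.univ.sup fun j => (k j).natDegree + 1 with hN
  have hT : T ⊆ Fintype.piFinset fun _ : Fin s => polyLT b N := by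
    intro k hk
    rw [Fintype.mem_piFinset]
    intro j
    rw [mem_polyLT]
    have h1 : (k j).natDegree + 1 ≤ N :=
      (Finset.le_sup (f := fun j => (k j).natDegree + 1) (Finset.mem_univ j)).trans
        (Finset.le_sup (f := fun k : Fin s → (ZMod b)[X] =>
          Finset.univ.sup fun j => (k j).natDegree + 1) hk)
    exact (degree_lt_natDegree_succ _).trans_le (by exact_mod_cast h1)
  calc _ ≤ ∑ k ∈ Fintype.piFinset fun _ : Fin s => polyLT b N, ∏ j, θ j (k j) :=
        Finset.sum_le_sum_of_subset hT
    _ = ∏ j, ∑ k ∈ polyLT b N, θ j k := (Finset.prod_univ_sum _ _).symm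
    _ ≤ _ := Finset.prod_le_prod' fun j _ => h j N

/-- The sum factorizes: every coordinate in `u` contributes at most `C_α^λ E_{α,λ}`, and every other
coordinate only the index `0`. -/
lemma tsum_dualTerm_rpow_le {s α : ℕ} (hα : 2 ≤ α) {lam : ℝ} (hlam : 1 / (α : ℝ) < lam)
    (γ : Finset ℕ → ℝ≥0) (u : Finset (Fin s)) :
    ∑' k : Fin s → (ZMod b)[X], dualTerm α γ u k ^ lam ≤
      ENNReal.ofReal ((γ (u.map Fin.valEmbedding) : ℝ) ^ lam *
        walshConst b α ^ (lam * (u.card : ℝ)) * sumConst b α lam ^ u.card) := by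
  have h0 : 0 < lam := lt_of_le_of_lt (by positivity) hlam
  have hC := walshConst_nonneg (b := b) hα
  have hE := sumConst_nonneg (b := b) (by omega : 1 ≤ α) hlam
  have e1 : ∀ k : Fin s → (ZMod b)[X], dualTerm α γ u k ^ lam =
      (γ (u.map Fin.valEmbedding) : ℝ≥0∞) ^ lam * ∏ j, (if j ∈ u then (if k j = 0 then 0 else
        ENNReal.ofReal (walshConst b α ^ lam * (((b : ℝ) ^ lam) ^ muExp α (k j))⁻¹))
        else if k j = 0 then 1 else 0) := by
    intro k
    rw [dualTerm, ENNReal.mul_rpow_of_nonneg _ _ h0.le, ← ENNReal.prod_rpow_of_nonneg h0.le]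
    congr 1
    refine Finset.prod_congr rfl fun j _ => ?_
    split_ifs
    · exact ENNReal.zero_rpow_of_pos h0
    · have hb0 : (0 : ℝ) ≤ ((b : ℝ) ^ muExp α (k j))⁻¹ := inv_nonneg.2 (pow_nonneg base_pos.le _)
      rw [ENNReal.ofReal_rpow_of_nonneg (mul_nonneg hC hb0) h0.le, Real.mul_rpow hC hb0,
        Real.inv_rpow (pow_nonneg base_pos.le _), ← Real.rpow_natCast, ← Real.rpow_mul base_pos.le,
        mul_comm _ lam, Real.rpow_mul base_pos.le, Real.rpow_natCast]
    · exact ENNReal.one_rpow _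
    · exact ENNReal.zero_rpow_of_pos h0
  simp_rw [e1]
  rw [ENNReal.tsum_mul_left]
  have h2 := tsum_pi_prod_le (b := b) (s := s) (fun j k => if j ∈ u then (if k = 0 then 0 else
        ENNReal.ofReal (walshConst b α ^ lam * (((b : ℝ) ^ lam) ^ muExp α k)⁻¹))
        else if k = 0 then 1 else 0)
    (fun j => if j ∈ u then ENNReal.ofReal (walshConst b α ^ lam * sumConst b α lam) else 1) ?_
  · refine (mul_le_mul_right h2 _).trans (le_of_eq ?_)
    rw [Finset.prod_ite_mem, Finset.univ_inter, Finset.prod_const,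
      ← ENNReal.ofReal_coe_nnreal, ENNReal.ofReal_rpow_of_nonneg (NNReal.coe_nonneg _) h0.le,
      ← ENNReal.ofReal_pow (mul_nonneg (Real.rpow_nonneg hC _) hE),
      ← ENNReal.ofReal_mul (Real.rpow_nonneg (NNReal.coe_nonneg _) _), mul_pow,
      Real.rpow_mul hC, Real.rpow_natCast, mul_assoc]
  · intro j N
    by_cases hj : j ∈ u
    · simp only [hj, if_true]
      rw [← Finset.add_sum_erase _ _ (zero_mem_polyLT N), if_pos rfl, zero_add,
        Finset.sum_congr rfl fun k hk => if_neg (Finset.ne_of_mem_erase hk),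
        ← ENNReal.ofReal_sum_of_nonneg, ← Finset.mul_sum]
      · exact ENNReal.ofReal_le_ofReal (mul_le_mul_of_nonneg_left
          (sum_polyLT_inv_pow_muExp_le (by omega) hlam N) (Real.rpow_nonneg hC _))
      · intro k _
        exact mul_nonneg (Real.rpow_nonneg hC _)
          (inv_nonneg.2 (pow_nonneg (Real.rpow_nonneg base_pos.le _) _))
    · simp only [hj, if_false]
      rw [Finset.sum_ite_eq', if_pos (zero_mem_polyLT N)]

/-- Proper dual vectors are nonzero, so the empty set contributes nothing; this is why `weightJ` may
leave it out. -/
lemma dualTerm_empty_eq_zero {s α : ℕ} (γ : Finset ℕ → ℝ≥0) {k : Fin s → (ZMod b)[X]} {j : Fin s}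
    (h : k j ≠ 0) : dualTerm α γ ∅ k = 0 := by
  rw [dualTerm, Finset.prod_eq_zero (Finset.mem_univ j), mul_zero]
  simp [h]

lemma IsProperDual.exists_ne_zero {s : ℕ} {p : (ZMod b)[X]} {g k : Fin s → (ZMod b)[X]}
    (h : IsProperDual p g k) : ∃ j, k j ≠ 0 := by
  obtain ⟨j, hj⟩ := h.2
  refine ⟨j, fun h0 => hj ?_⟩
  rw [h0]
  ext i
  rw [coeff_polyTrunc]
  simp

lemma exists_generatingVector {α : ℕ} (hα : 2 ≤ α) (γ : Finset ℕ → ℝ≥0) (s : ℕ) {p : (ZMod b)[X]}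
    (hp : Irreducible p) : ∃ g : Fin s → (ZMod b)[X],
      (∀ j, g j ≠ 0 ∧ (g j).degree < p.degree) ∧
      ∀ lam : ℝ, 1 / (α : ℝ) < lam → lam ≤ 1 → figureOfMerit α γ p g ≤
        ENNReal.ofReal (weightJ b α lam γ s * ((b : ℝ) ^ p.natDegree - 1) ^ (-(1 / lam))) := by
  classical
  have hdeg := hp.natDegree_pos
  set G := Fintype.piFinset fun _ : Fin s => (polyLT b p.natDegree).erase 0 with hG
  have hcardS : ((polyLT b p.natDegree).erase 0).card = b ^ p.natDegree - 1 := by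
    rw [Finset.card_erase_of_mem (zero_mem_polyLT _), card_polyLT]
  have hb1 : 1 < b ^ p.natDegree := Nat.one_lt_pow hdeg.ne' hb.out.one_lt
  have hGcard : G.card = (b ^ p.natDegree - 1) ^ s := by
    rw [hG, Fintype.card_piFinset_const, hcardS]
  have hGpos : 0 < G.card := by rw [hGcard]; exact pow_pos (by omega) _
  -- The minimizer is taken before `λ` is introduced, hence serves all `λ` at once.
  obtain ⟨g, hgG, hmin⟩ := G.exists_min_image (fun g => figureOfMerit α γ p g)
    (Finset.card_pos.1 hGpos)
  refine ⟨g, fun j => ?_, fun lam hlam hlam1 => ?_⟩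
  · have := Finset.mem_erase.1 (Fintype.mem_piFinset.1 hgG j)
    exact ⟨this.1, by rw [degree_eq_natDegree hp.ne_zero]; exact mem_polyLT.1 this.2⟩
  have h0 : 0 < lam := lt_of_le_of_lt (by positivity) hlam
  have hC := walshConst_nonneg (b := b) hα
  have hE := sumConst_nonneg (b := b) (by omega : 1 ≤ α) hlam
  set Js : ℝ := ∑ u ∈ (Finset.range s).powerset.erase ∅,
    (γ u : ℝ) ^ lam * walshConst b α ^ (lam * (u.card : ℝ)) * sumConst b α lam ^ u.card with hJs
  have hterm : ∀ u : Finset ℕ, 0 ≤ (γ u : ℝ) ^ lam * walshConst b α ^ (lam * (u.card : ℝ)) *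
      sumConst b α lam ^ u.card := fun u => mul_nonneg (mul_nonneg
        (Real.rpow_nonneg (NNReal.coe_nonneg _) _) (Real.rpow_nonneg hC _)) (pow_nonneg hE _)
  have hJs0 : 0 ≤ Js := Finset.sum_nonneg fun u _ => hterm u
  have hJ : ∑' x : (Fin s → (ZMod b)[X]) × Finset (Fin s),
      (if x.2 = ∅ then 0 else dualTerm α γ x.2 x.1 ^ lam) ≤ ENNReal.ofReal Js := by
    rw [ENNReal.tsum_prod', ENNReal.tsum_comm, tsum_fintype, hJs,
      ENNReal.ofReal_sum_of_nonneg fun u _ => hterm u]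
    have e : ∑ u ∈ (Finset.range s).powerset.erase ∅, ENNReal.ofReal ((γ u : ℝ) ^ lam *
        walshConst b α ^ (lam * (u.card : ℝ)) * sumConst b α lam ^ u.card) =
        ∑ u ∈ (Finset.range s).powerset, if u = ∅ then 0 else ENNReal.ofReal ((γ u : ℝ) ^ lam *
        walshConst b α ^ (lam * (u.card : ℝ)) * sumConst b α lam ^ u.card) := by
      rw [← Finset.add_sum_erase _ _ (Finset.empty_mem_powerset (Finset.range s)), if_pos rfl,
        zero_add]
      exact Finset.sum_congr rfl fun u hu => (if_neg (Finset.ne_of_mem_erase hu)).symm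
    rw [e, sum_powerset_range]
    refine Finset.sum_le_sum fun u _ => ?_
    simp only [Finset.map_eq_empty, Finset.card_map]
    split_ifs
    · simp
    · exact tsum_dualTerm_rpow_le hα hlam γ u
  have h1 : ∀ g' ∈ G, figureOfMerit α γ p g ^ lam ≤
      ∑' x : (Fin s → (ZMod b)[X]) × Finset (Fin s),
        if IsProperDual p g' x.1 then (if x.2 = ∅ then 0 else dualTerm α γ x.2 x.1 ^ lam) else 0 := by
    intro g' hg'
    refine (ENNReal.rpow_le_rpow (hmin g' hg') h0.le).trans
      ((ENNReal.tsum_rpow_le_tsum_rpow _ h0 hlam1).trans (ENNReal.tsum_le_tsum fun x => ?_))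
    split_ifs with hd hx
    · obtain ⟨j, hj⟩ := hd.exists_ne_zero
      rw [hx, dualTerm_empty_eq_zero γ hj, ENNReal.zero_rpow_of_pos h0]
    · exact le_rfl
    · rw [ENNReal.zero_rpow_of_pos h0]
  -- The minimum is at most the average. After exchanging sums, each vector is counted for at most
  -- `|G| / (b^n - 1)` candidates, and what remains is the unrestricted sum, bounded by `J^λ`.
  have h2 : (G.card : ℝ≥0∞) * (figureOfMerit α γ p g ^ lam * ((b ^ p.natDegree - 1 : ℕ) : ℝ≥0∞)) ≤
      G.card * ENNReal.ofReal Js := by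
    calc _ = (∑ g' ∈ G, figureOfMerit α γ p g ^ lam) * ((b ^ p.natDegree - 1 : ℕ) : ℝ≥0∞) := by
          rw [Finset.sum_const, nsmul_eq_mul, mul_assoc]
      _ ≤ (∑ g' ∈ G, ∑' x : (Fin s → (ZMod b)[X]) × Finset (Fin s),
            if IsProperDual p g' x.1 then (if x.2 = ∅ then 0 else dualTerm α γ x.2 x.1 ^ lam)
            else 0) * ((b ^ p.natDegree - 1 : ℕ) : ℝ≥0∞) :=
          mul_le_mul_left (Finset.sum_le_sum h1) _
      _ = ∑' x : (Fin s → (ZMod b)[X]) × Finset (Fin s),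
            (((G.filter fun g' => IsProperDual p g' x.1).card * (b ^ p.natDegree - 1) : ℕ) : ℝ≥0∞) *
              (if x.2 = ∅ then 0 else dualTerm α γ x.2 x.1 ^ lam) := by
          rw [← Summable.tsum_finsetSum fun _ _ => ENNReal.summable, ← ENNReal.tsum_mul_right]
          refine tsum_congr fun x => ?_
          rw [← Finset.sum_filter, Finset.sum_const, nsmul_eq_mul]
          push_cast
          ring
      _ ≤ ∑' x : (Fin s → (ZMod b)[X]) × Finset (Fin s), (G.card : ℝ≥0∞) *
              (if x.2 = ∅ then 0 else dualTerm α γ x.2 x.1 ^ lam) := by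
          refine ENNReal.tsum_le_tsum fun x => mul_le_mul_left ?_ _
          rw [hGcard]
          exact_mod_cast card_isProperDual_mul_le hp x.1
      _ ≤ _ := by rw [ENNReal.tsum_mul_left]; exact mul_le_mul_right hJ _
  rw [ENNReal.mul_le_mul_iff_right (by exact_mod_cast hGpos.ne') (ENNReal.natCast_ne_top _)] at h2
  have hbr : (0 : ℝ) < (b : ℝ) ^ p.natDegree - 1 := by
    have : (1 : ℝ) < (b : ℝ) ^ p.natDegree := by exact_mod_cast hb1
    linarith
  have hcast : ((b ^ p.natDegree - 1 : ℕ) : ℝ≥0∞) = ENNReal.ofReal ((b : ℝ) ^ p.natDegree - 1) := by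
    rw [← ENNReal.ofReal_natCast, Nat.cast_sub hb1.le]
    push_cast; rfl
  rw [hcast] at h2
  have h3 : figureOfMerit α γ p g ^ lam ≤ ENNReal.ofReal (Js * ((b : ℝ) ^ p.natDegree - 1)⁻¹) := by
    rw [ENNReal.ofReal_mul hJs0, ENNReal.ofReal_inv_of_pos hbr, ← div_eq_mul_inv]
    exact (ENNReal.le_div_iff_mul_le (Or.inl (by simpa using hbr)) (Or.inl ENNReal.ofReal_ne_top)).2 h2
  rw [← ENNReal.le_rpow_inv_iff h0] at h3
  refine h3.trans (le_of_eq ?_)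
  rw [ENNReal.ofReal_rpow_of_nonneg (mul_nonneg hJs0 (inv_nonneg.2 hbr.le)) (inv_nonneg.2 h0.le),
    Real.mul_rpow hJs0 (inv_nonneg.2 hbr.le), weightJ, one_div, Real.rpow_neg hbr.le,
    Real.inv_rpow hbr.le]

end FigureOfMerit

section Tensor

/-! ### Weak derivatives tested against products of univariate functions -/

/-- The tensor product of univariate functions. -/
def tensorProd {s : ℕ} (ψ : Fin s → ℝ → ℝ) (x : Fin s → ℝ) : ℝ := ∏ j, ψ j (x j)

lemma tensorProd_contDiff {s : ℕ} {ψ : Fin s → ℝ → ℝ} (h : ∀ j, ContDiff ℝ ∞ (ψ j)) :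
    ContDiff ℝ ∞ (tensorProd ψ) :=
  contDiff_prod fun j _ => (h j).comp (contDiff_apply ℝ ℝ j)

lemma tensorProd_update {s : ℕ} (ψ : Fin s → ℝ → ℝ) (j : Fin s) (φ : ℝ → ℝ) (x : Fin s → ℝ) :
    tensorProd (Function.update ψ j φ) x = φ (x j) * ∏ i ∈ Finset.univ.erase j, ψ i (x i) := by
  rw [tensorProd, ← Finset.mul_prod_erase _ _ (Finset.mem_univ j), Function.update_self]
  congr 1
  refine Finset.prod_congr rfl fun i hi => ?_
  rw [Function.update_of_ne (Finset.ne_of_mem_erase hi)]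

lemma partialDeriv_tensorProd {s : ℕ} {ψ : Fin s → ℝ → ℝ} (h : ∀ j, ContDiff ℝ ∞ (ψ j)) (j : Fin s) :
    partialDeriv j (tensorProd ψ) = tensorProd (Function.update ψ j (deriv (ψ j))) := by
  funext x
  have hd : ∀ i, HasFDerivAt (fun x : Fin s → ℝ => ψ i (x i))
      ((deriv (ψ i) (x i)) • (ContinuousLinearMap.proj i : (Fin s → ℝ) →L[ℝ] ℝ)) x := fun i => by
    have h1 : HasDerivAt (ψ i) (deriv (ψ i) (x i)) (x i) :=
      ((h i).differentiable (by simp)).differentiableAt.hasDerivAt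
    exact h1.comp_hasFDerivAt x (ContinuousLinearMap.proj i : (Fin s → ℝ) →L[ℝ] ℝ).hasFDerivAt
  have h2 := HasFDerivAt.finsetProd (u := Finset.univ) fun i _ => hd i
  have h3 : fderiv ℝ (tensorProd ψ) x = _ := h2.fderiv
  rw [partialDeriv, h3, tensorProd_update]
  simp only [_root_.sum_apply, _root_.smul_apply,
    ContinuousLinearMap.proj_apply, smul_eq_mul]
  rw [Finset.sum_eq_single j]
  · rw [Pi.single_eq_same]; ring
  · intro i _ hi
    rw [Pi.single_eq_of_ne hi]; ring
  · simp

lemma contDiff_deriv_iterate {φ : ℝ → ℝ} (h : ContDiff ℝ ∞ φ) (n : ℕ) : ContDiff ℝ ∞ (deriv^[n] φ) := by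
  induction n with
  | zero => exact h
  | succ n ih =>
    rw [Function.iterate_succ_apply']
    exact (contDiff_infty_iff_deriv.1 ih).2

lemma contDiff_update_apply {s : ℕ} {ψ : Fin s → ℝ → ℝ} (h : ∀ j, ContDiff ℝ ∞ (ψ j)) (j : Fin s)
    {φ : ℝ → ℝ} (hφ : ContDiff ℝ ∞ φ) (i : Fin s) : ContDiff ℝ ∞ (Function.update ψ j φ i) := by
  by_cases hi : i = j
  · subst hi; simpa using hφ
  · simpa [Function.update_of_ne hi] using h i

lemma partialDeriv_iterate_tensorProd {s : ℕ} {ψ : Fin s → ℝ → ℝ} (h : ∀ j, ContDiff ℝ ∞ (ψ j))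
    (j : Fin s) (n : ℕ) : (partialDeriv j)^[n] (tensorProd ψ) =
      tensorProd (Function.update ψ j (deriv^[n] (ψ j))) := by
  induction n with
  | zero => simp
  | succ n ih =>
    rw [Function.iterate_succ_apply', ih,
      partialDeriv_tensorProd (contDiff_update_apply h j (contDiff_deriv_iterate (h j) n)),
      Function.update_self, Function.update_idem, Function.iterate_succ_apply']

lemma mixedPartial_tensorProd {s : ℕ} (β : Fin s → ℕ) {ψ : Fin s → ℝ → ℝ}
    (h : ∀ j, ContDiff ℝ ∞ (ψ j)) :
    mixedPartial β (tensorProd ψ) = tensorProd fun j => deriv^[β j] (ψ j) := by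
  have key : ∀ l : List (Fin s), l.Nodup →
      l.foldr (fun j g => (partialDeriv j)^[β j] g) (tensorProd ψ) =
        tensorProd fun j => if j ∈ l then deriv^[β j] (ψ j) else ψ j := by
    intro l
    induction l with
    | nil => intro _; simp
    | cons a l ih =>
      intro hl
      rw [List.nodup_cons] at hl
      rw [List.foldr_cons, ih hl.2, partialDeriv_iterate_tensorProd]
      · congr 1
        funext j
        by_cases hj : j = a
        · subst hj; simp [hl.1]
        · simp [hj]
      · intro j
        split_ifs
        · exact contDiff_deriv_iterate (h j) _
        · exact h j
  rw [mixedPartial, key _ (List.nodup_finRange s)]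
  simp

lemma tsupport_tensorProd_subset {s : ℕ} (ψ : Fin s → ℝ → ℝ) :
    tsupport (tensorProd ψ) ⊆ Set.pi Set.univ fun j => tsupport (ψ j) := by
  refine closure_minimal ?_ (isClosed_set_pi fun j _ => isClosed_tsupport _)
  intro x hx j _
  refine subset_tsupport _ fun h0 => hx ?_
  exact Finset.prod_eq_zero (Finset.mem_univ j) h0

/-- Smooth univariate functions with compact support in `(0,1)`. -/
structure IsUnitTest (φ : ℝ → ℝ) : Prop where
  contDiff : ContDiff ℝ ∞ φ
  hasCompactSupport : HasCompactSupport φ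
  tsupport_subset : tsupport φ ⊆ Set.Ioo 0 1

lemma IsUnitTest.deriv {φ : ℝ → ℝ} (h : IsUnitTest φ) : IsUnitTest (deriv φ) :=
  ⟨(contDiff_infty_iff_deriv.1 h.contDiff).2, h.hasCompactSupport.deriv,
    tsupport_deriv_subset.trans h.tsupport_subset⟩

/-- The integral of `G` against a product of univariate functions. -/
noncomputable def tensorPairing {s : ℕ} (G : (Fin s → ℝ) → ℝ) (ψ : Fin s → ℝ → ℝ) : ℝ :=
  ∫ x in unitCube (Fin s), G x * tensorProd ψ x

lemma HasWeakMixedDeriv.pairing_eq {s : ℕ} {f G : (Fin s → ℝ) → ℝ} {β : Fin s → ℕ}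
    (h : HasWeakMixedDeriv f β G) {ψ : Fin s → ℝ → ℝ} (hψ : ∀ j, IsUnitTest (ψ j)) :
    tensorPairing f (fun j => deriv^[β j] (ψ j)) = (-1) ^ (∑ j, β j) * tensorPairing G ψ := by
  have h1 := h.2 (tensorProd ψ) (tensorProd_contDiff fun j => (hψ j).contDiff) ?_ ?_
  · rwa [mixedPartial_tensorProd β fun j => (hψ j).contDiff] at h1
  · exact (isCompact_univ_pi fun j => (hψ j).hasCompactSupport).of_isClosed_subset
      (isClosed_tsupport _) (tsupport_tensorProd_subset ψ)
  · exact (tsupport_tensorProd_subset ψ).trans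
      (Set.pi_mono fun j _ => (hψ j).tsupport_subset)

/-- Both functions are weak derivatives of the same `f`. Testing `G` with the differentiated factor
and `G'` with the original one produces the same derivative of the test function, with signs
differing by one factor `-1`. -/
lemma tensorPairing_deriv {s : ℕ} {f G G' : (Fin s → ℝ) → ℝ} {β : Fin s → ℕ} (j : Fin s)
    (hG : HasWeakMixedDeriv f β G) (hG' : HasWeakMixedDeriv f (Function.update β j (β j + 1)) G')
    {ψ : Fin s → ℝ → ℝ} (hψ : ∀ j, IsUnitTest (ψ j)) :
    tensorPairing G (Function.update ψ j (deriv (ψ j))) = -tensorPairing G' ψ := by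
  have h1 := hG.pairing_eq (ψ := Function.update ψ j (deriv (ψ j))) fun i => by
    by_cases hi : i = j
    · subst hi; simpa using (hψ i).deriv
    · simpa [Function.update_of_ne hi] using hψ i
  have h2 := hG'.pairing_eq hψ
  have e : (fun i => deriv^[β i] (Function.update ψ j (deriv (ψ j)) i)) =
      fun i => deriv^[Function.update β j (β j + 1) i] (ψ i) := by
    funext i
    by_cases hi : i = j
    · subst hi; simp
    · simp [Function.update_of_ne hi]
  rw [e, h2, Finset.sum_update_of_mem (Finset.mem_univ j), Finset.sdiff_singleton_eq_erase,
    add_right_comm, Finset.add_sum_erase _ _ (Finset.mem_univ j), pow_succ] at h1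
  have h3 : ((-1 : ℝ) ^ (∑ i, β i)) ≠ 0 := pow_ne_zero _ (by norm_num)
  have h4 : (-1 : ℝ) ^ (∑ i, β i) * (-tensorPairing G' ψ) =
      (-1) ^ (∑ i, β i) * tensorPairing G (Function.update ψ j (deriv (ψ j))) := by
    rw [← h1]; ring
  exact (mul_left_cancel₀ h3 h4).symm

lemma openUnitCube_subset (s : ℕ) : openUnitCube (Fin s) ⊆ unitCube (Fin s) :=
  Set.pi_mono fun _ _ => Set.Ioo_subset_Ico_self

lemma openUnitCube_ae_eq (s : ℕ) : openUnitCube (Fin s) =ᵐ[volume] unitCube (Fin s) :=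
  (Measure.univ_pi_Ioo_ae_eq_Icc (μ := fun _ : Fin s => volume) (f := fun _ => 0)
    (g := fun _ => 1)).trans (Measure.univ_pi_Ico_ae_eq_Icc (μ := fun _ : Fin s => volume)
      (f := fun _ => 0) (g := fun _ => 1)).symm

lemma measurableSet_unitCube (ι : Type*) [Countable ι] : MeasurableSet (unitCube ι) :=
  MeasurableSet.univ_pi fun _ => measurableSet_Ico

lemma measurableSet_openUnitCube (ι : Type*) [Countable ι] : MeasurableSet (openUnitCube ι) :=
  MeasurableSet.univ_pi fun _ => measurableSet_Ioo

lemma tensorPairing_eq_open {s : ℕ} (G : (Fin s → ℝ) → ℝ) (ψ : Fin s → ℝ → ℝ) :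
    tensorPairing G ψ = ∫ x in openUnitCube (Fin s), G x * tensorProd ψ x := by
  rw [tensorPairing, setIntegral_congr_set (openUnitCube_ae_eq s)]

lemma measurable_tensorProd {s : ℕ} {ψ : Fin s → ℝ → ℝ} (h : ∀ j, Measurable (ψ j)) :
    Measurable (tensorProd ψ) :=
  Finset.measurable_fun_prod _ fun j _ => (h j).comp (measurable_pi_apply j)

lemma tendsto_tensorPairing {s : ℕ} {G : (Fin s → ℝ) → ℝ} (hG : IntegrableOn G (unitCube (Fin s)))
    {ψ : ℕ → Fin s → ℝ → ℝ} {ψ' : Fin s → ℝ → ℝ} (hm : ∀ n j, Measurable (ψ n j))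
    {M : ℝ} (hM : ∀ n j, ∀ x ∈ Set.Ioo (0 : ℝ) 1, |ψ n j x| ≤ M)
    (hlim : ∀ j, ∀ x ∈ Set.Ioo (0 : ℝ) 1, Tendsto (fun n => ψ n j x) atTop (𝓝 (ψ' j x))) :
    Tendsto (fun n => tensorPairing G (ψ n)) atTop (𝓝 (tensorPairing G ψ')) := by
  simp_rw [tensorPairing_eq_open]
  have hG' : IntegrableOn G (openUnitCube (Fin s)) := hG.mono_set (openUnitCube_subset s)
  refine tendsto_integral_of_dominated_convergence (fun x => ‖G x‖ * M ^ s) ?_ ?_ ?_ ?_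
  · intro n
    exact hG'.aestronglyMeasurable.mul (measurable_tensorProd (hm n)).aestronglyMeasurable
  · exact hG'.norm.mul_const _
  · intro n
    filter_upwards [ae_restrict_mem (measurableSet_openUnitCube (Fin s))] with x hx
    rw [norm_mul]
    refine mul_le_mul_of_nonneg_left ?_ (norm_nonneg _)
    rw [tensorProd, norm_prod]
    refine (Finset.prod_le_prod (fun _ _ => norm_nonneg _) fun j _ =>
      hM n j (x j) (hx j (Set.mem_univ j))).trans ?_
    simp
  · filter_upwards [ae_restrict_mem (measurableSet_openUnitCube (Fin s))] with x hx
    exact Tendsto.const_mul _ (tendsto_finsetProd _ fun j _ => hlim j (x j) (hx j (Set.mem_univ j)))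

/-! ### Cutoff functions -/

/-- A smooth function equal to `1` on `[2/n, 1 - 2/n]` and vanishing outside `(1/n, 1 - 1/n)`. -/
noncomputable def unitCutoff (n : ℕ) (t : ℝ) : ℝ :=
  Real.smoothTransition (n * t - 1) * Real.smoothTransition (n * (1 - t) - 1)

lemma unitCutoff_contDiff (n : ℕ) : ContDiff ℝ ∞ (unitCutoff n) := by
  unfold unitCutoff
  exact (Real.smoothTransition.contDiff.comp (by fun_prop)).mul
    (Real.smoothTransition.contDiff.comp (by fun_prop))

lemma unitCutoff_mem (n : ℕ) (t : ℝ) : 0 ≤ unitCutoff n t ∧ unitCutoff n t ≤ 1 :=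
  ⟨mul_nonneg (Real.smoothTransition.nonneg _) (Real.smoothTransition.nonneg _),
    mul_le_one₀ (Real.smoothTransition.le_one _) (Real.smoothTransition.nonneg _)
      (Real.smoothTransition.le_one _)⟩

lemma unitCutoff_mul_isUnitTest {n : ℕ} (hn : 0 < n) {ψ : ℝ → ℝ} (hψ : ContDiff ℝ ∞ ψ) :
    IsUnitTest fun t => unitCutoff n t * ψ t := by
  have hn0 : (0 : ℝ) < n := by exact_mod_cast hn
  have hsub : tsupport (fun t => unitCutoff n t * ψ t) ⊆ Set.Icc (1 / n : ℝ) (1 - 1 / n) := by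
    refine closure_minimal (fun t ht => ?_) isClosed_Icc
    by_contra h
    refine ht ?_
    rw [Set.mem_Icc, not_and_or, not_le, not_le] at h
    have : unitCutoff n t = 0 := by
      rcases h with h | h
      · rw [unitCutoff, Real.smoothTransition.zero_of_nonpos, zero_mul]
        rw [lt_div_iff₀ hn0] at h; linarith
      · rw [unitCutoff, Real.smoothTransition.zero_of_nonpos (x := n * (1 - t) - 1), mul_zero]
        have h2 : 1 - t < 1 / n := by linarith
        rw [lt_div_iff₀ hn0] at h2; linarith
    simp [this]
  refine ⟨(unitCutoff_contDiff n).mul hψ, isCompact_Icc.of_isClosed_subset (isClosed_tsupport _) hsub,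
    hsub.trans (Set.Icc_subset_Ioo (by positivity) ?_)⟩
  have : (0 : ℝ) < 1 / n := by positivity
  linarith

/-- Equality in a neighbourhood, not just at `t`, so that derivatives of cut-off functions converge
as well. -/
lemma unitCutoff_eventually_one {t : ℝ} (ht : t ∈ Set.Ioo (0 : ℝ) 1) :
    ∀ᶠ n : ℕ in atTop, unitCutoff n =ᶠ[𝓝 t] fun _ => 1 := by
  obtain ⟨h0, h1⟩ := ht
  have hlim1 : Tendsto (fun n : ℕ => (n : ℝ) * (t / 2)) atTop atTop :=
    tendsto_natCast_atTop_atTop.atTop_mul_const (by linarith)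
  have hlim2 : Tendsto (fun n : ℕ => (n : ℝ) * ((1 - t) / 2)) atTop atTop :=
    tendsto_natCast_atTop_atTop.atTop_mul_const (by linarith)
  filter_upwards [hlim1.eventually_ge_atTop 2, hlim2.eventually_ge_atTop 2] with n hn1 hn2
  filter_upwards [Ioo_mem_nhds (show t / 2 < t by linarith) (show t < (1 + t) / 2 by linarith)]
    with u hu
  have hn0 : (0 : ℝ) ≤ n := Nat.cast_nonneg n
  rw [unitCutoff, Real.smoothTransition.one_of_one_le, Real.smoothTransition.one_of_one_le, mul_one]
  · nlinarith [hu.2]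
  · nlinarith [hu.1]

lemma exists_deriv_smoothTransition_bound :
    ∃ M : ℝ, 0 ≤ M ∧ ∀ x, |deriv Real.smoothTransition x| ≤ M := by
  have hc : Continuous (deriv Real.smoothTransition) :=
    (Real.smoothTransition.contDiff (n := 1)).continuous_deriv le_rfl
  obtain ⟨M, hM⟩ := (isCompact_Icc (a := (0 : ℝ)) (b := 1)).exists_bound_of_continuousOn hc.continuousOn
  refine ⟨max M 0, le_max_right _ _, fun x => ?_⟩
  by_cases hx : x ∈ Set.Icc (0 : ℝ) 1
  · exact (hM x hx).trans (le_max_left _ _)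
  · have : deriv Real.smoothTransition x = 0 := by
      rw [Set.mem_Icc, not_and_or, not_le, not_le] at hx
      rcases hx with hx | hx
      · have : Real.smoothTransition =ᶠ[𝓝 x] fun _ => 0 := by
          filter_upwards [Iio_mem_nhds hx] with y hy
          exact Real.smoothTransition.zero_of_nonpos (le_of_lt hy)
        rw [this.deriv_eq, deriv_const]
      · have : Real.smoothTransition =ᶠ[𝓝 x] fun _ => 1 := by
          filter_upwards [Ioi_mem_nhds hx] with y hy
          exact Real.smoothTransition.one_of_one_le (le_of_lt hy)
        rw [this.deriv_eq, deriv_const]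
    rw [this, abs_zero]; exact le_max_right _ _

lemma deriv_smoothTransition_of_one_lt {x : ℝ} (hx : 1 < x) : deriv Real.smoothTransition x = 0 := by
  have : Real.smoothTransition =ᶠ[𝓝 x] fun _ => 1 := by
    filter_upwards [Ioi_mem_nhds hx] with y hy
    exact Real.smoothTransition.one_of_one_le (le_of_lt hy)
  rw [this.deriv_eq, deriv_const]

lemma hasDerivAt_unitCutoff (n : ℕ) (t : ℝ) : HasDerivAt (unitCutoff n)
    (deriv Real.smoothTransition (n * t - 1) * n * Real.smoothTransition (n * (1 - t) - 1) +
      Real.smoothTransition (n * t - 1) * (deriv Real.smoothTransition (n * (1 - t) - 1) * -n)) t := by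
  have hd : ∀ x, HasDerivAt Real.smoothTransition (deriv Real.smoothTransition x) x := fun x =>
    ((Real.smoothTransition.contDiff (n := 1)).differentiable (by simp)).differentiableAt.hasDerivAt
  have h1 : HasDerivAt (fun t : ℝ => (n : ℝ) * t - 1) n t := by
    simpa using ((hasDerivAt_id t).const_mul (n : ℝ)).sub_const 1
  have h2 : HasDerivAt (fun t : ℝ => (n : ℝ) * (1 - t) - 1) (-n) t := by
    simpa using (((hasDerivAt_id t).const_sub 1).const_mul (n : ℝ)).sub_const 1
  exact ((hd _).comp t h1).mul ((hd _).comp t h2)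

/-- The derivative of the cutoff is `O(n)` but lives at distance at most `2/n` from the boundary,
where `ψ`, being Lipschitz with boundary value `0`, is `O(1/n)`. -/
lemma exists_deriv_cutoff_mul_bound {ψ : ℝ → ℝ} (hψ : ContDiff ℝ ∞ ψ) (h0 : ψ 0 = 0) (h1 : ψ 1 = 0) :
    ∃ M : ℝ, ∀ n : ℕ, ∀ t ∈ Set.Ioo (0 : ℝ) 1, |deriv (fun t => unitCutoff n t * ψ t) t| ≤ M := by
  obtain ⟨A, hA0, hA⟩ := exists_deriv_smoothTransition_bound
  have hdψ : Continuous (deriv ψ) := hψ.continuous_deriv (by simp)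
  obtain ⟨L, hL⟩ := (isCompact_Icc (a := (0 : ℝ)) (b := 1)).exists_bound_of_continuousOn hdψ.continuousOn
  have hdiff : ∀ x, DifferentiableAt ℝ ψ x := fun x => (hψ.differentiable (by simp)).differentiableAt
  have hL0 : 0 ≤ L := (norm_nonneg _).trans (hL 0 (by simp))
  have hlip : ∀ x ∈ Set.Icc (0 : ℝ) 1, ∀ y ∈ Set.Icc (0 : ℝ) 1, ‖ψ y - ψ x‖ ≤ L * ‖y - x‖ :=
    fun x hx y hy => (convex_Icc (0 : ℝ) 1).norm_image_sub_le_of_norm_deriv_le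
      (fun z _ => hdiff z) hL hx hy
  refine ⟨2 * A * L + 2 * A * L + L, fun n t ht => ?_⟩
  have htI : t ∈ Set.Icc (0 : ℝ) 1 := Set.Ioo_subset_Icc_self ht
  have hn0 : (0 : ℝ) ≤ n := Nat.cast_nonneg n
  have b0 : |ψ t| ≤ L * t := by
    have := hlip 0 (by simp) t htI
    rwa [h0, sub_zero, sub_zero, Real.norm_eq_abs, Real.norm_eq_abs, abs_of_pos ht.1] at this
  have b1 : |ψ t| ≤ L * (1 - t) := by
    have := hlip 1 (by simp) t htI
    rwa [h1, sub_zero, Real.norm_eq_abs, Real.norm_eq_abs, abs_of_neg (show t - 1 < 0 by linarith [ht.2]),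
      neg_sub] at this
  have hd := (hasDerivAt_unitCutoff n t).mul (hdiff t).hasDerivAt
  have hd' : deriv (fun t => unitCutoff n t * ψ t) t = _ := hd.deriv
  rw [hd']
  have hS : ∀ x, |Real.smoothTransition x| ≤ 1 := fun x => by
    rw [abs_of_nonneg (Real.smoothTransition.nonneg _)]; exact Real.smoothTransition.le_one _
  have c1 : |deriv Real.smoothTransition (n * t - 1)| * (n * |ψ t|) ≤ 2 * A * L := by
    by_cases h : 1 < n * t - 1
    · rw [deriv_smoothTransition_of_one_lt h, abs_zero, zero_mul]; positivity
    · have : n * |ψ t| ≤ 2 * L := by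
        calc n * |ψ t| ≤ n * (L * t) := mul_le_mul_of_nonneg_left b0 hn0
          _ = L * (n * t) := by ring
          _ ≤ L * 2 := mul_le_mul_of_nonneg_left (by linarith) hL0
          _ = 2 * L := by ring
      calc _ ≤ A * (2 * L) := mul_le_mul (hA _) this (by positivity) hA0
        _ = _ := by ring
  have c2 : |deriv Real.smoothTransition (n * (1 - t) - 1)| * (n * |ψ t|) ≤ 2 * A * L := by
    by_cases h : 1 < n * (1 - t) - 1
    · rw [deriv_smoothTransition_of_one_lt h, abs_zero, zero_mul]; positivity
    · have : n * |ψ t| ≤ 2 * L := by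
        calc n * |ψ t| ≤ n * (L * (1 - t)) := mul_le_mul_of_nonneg_left b1 hn0
          _ = L * (n * (1 - t)) := by ring
          _ ≤ L * 2 := mul_le_mul_of_nonneg_left (by linarith) hL0
          _ = 2 * L := by ring
      calc _ ≤ A * (2 * L) := mul_le_mul (hA _) this (by positivity) hA0
        _ = _ := by ring
  have c3 : |unitCutoff n t| * |deriv ψ t| ≤ L := by
    have h5 : |unitCutoff n t| ≤ 1 := by
      rw [abs_of_nonneg (unitCutoff_mem n t).1]; exact (unitCutoff_mem n t).2
    calc _ ≤ 1 * L := mul_le_mul h5 (hL t htI) (abs_nonneg _) zero_le_one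
      _ = L := one_mul _
  rw [add_mul]
  refine (abs_add_three _ _ _).trans (add_le_add (add_le_add ?_ ?_) ?_)
  · calc _ = |deriv Real.smoothTransition (n * t - 1)| * (n * |ψ t|) *
          |Real.smoothTransition (n * (1 - t) - 1)| := by
          rw [abs_mul, abs_mul, abs_mul, abs_of_nonneg hn0]; ring
      _ ≤ 2 * A * L * 1 := mul_le_mul c1 (hS _) (abs_nonneg _) (by positivity)
      _ = _ := mul_one _
  · calc _ = |deriv Real.smoothTransition (n * (1 - t) - 1)| * (n * |ψ t|) *
          |Real.smoothTransition (n * t - 1)| := by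
          rw [abs_mul, abs_mul, abs_mul, abs_neg, abs_of_nonneg hn0]; ring
      _ ≤ 2 * A * L * 1 := mul_le_mul c2 (hS _) (abs_nonneg _) (by positivity)
      _ = _ := mul_one _
  · rw [abs_mul]; exact c3

lemma exists_bound_on_unitInterval {ψ : ℝ → ℝ} (hψ : Continuous ψ) :
    ∃ M : ℝ, ∀ t ∈ Set.Icc (0 : ℝ) 1, |ψ t| ≤ M :=
  isCompact_Icc.exists_bound_of_continuousOn hψ.continuousOn

/-- Integration by parts in one variable, for smooth factors which need not vanish near the
boundary except for the one which is differentiated. -/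
lemma tensorPairing_deriv_of_boundary {s : ℕ} {f G G' : (Fin s → ℝ) → ℝ} {β : Fin s → ℕ} (j : Fin s)
    (hG : HasWeakMixedDeriv f β G) (hG' : HasWeakMixedDeriv f (Function.update β j (β j + 1)) G')
    {ψ : Fin s → ℝ → ℝ} (hψ : ∀ j, ContDiff ℝ ∞ (ψ j)) (h0 : ψ j 0 = 0) (h1 : ψ j 1 = 0) :
    tensorPairing G (Function.update ψ j (deriv (ψ j))) = -tensorPairing G' ψ := by
  -- All factors are cut off, the identity for genuine test functions is applied, and the cutoff is
  -- removed by dominated convergence. The boundary zeros of `ψ j` keep the differentiated factor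
  -- bounded.
  set χ : ℕ → Fin s → ℝ → ℝ := fun n i t => unitCutoff (n + 1) t * ψ i t with hχ
  have hχt : ∀ n i, IsUnitTest (χ n i) := fun n i => unitCutoff_mul_isUnitTest n.succ_pos (hψ i)
  have hev : ∀ t ∈ Set.Ioo (0 : ℝ) 1, ∀ᶠ n : ℕ in atTop, unitCutoff (n + 1) =ᶠ[𝓝 t] fun _ => 1 :=
    fun t ht => (tendsto_add_atTop_nat 1).eventually (unitCutoff_eventually_one ht)
  have hχlim : ∀ i, ∀ t ∈ Set.Ioo (0 : ℝ) 1, Tendsto (fun n => χ n i t) atTop (𝓝 (ψ i t)) := by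
    intro i t ht
    refine tendsto_const_nhds.congr' ?_
    filter_upwards [hev t ht] with n hn
    simp [hχ, hn.self_of_nhds]
  choose B hB using fun i => exists_bound_on_unitInterval (hψ i).continuous
  obtain ⟨M, hM⟩ := exists_deriv_cutoff_mul_bound (hψ j) h0 h1
  set M' := max M (∑ i, |B i|) with hM'
  have hbd : ∀ n i, ∀ t ∈ Set.Ioo (0 : ℝ) 1, |χ n i t| ≤ M' := by
    intro n i t ht
    have h5 := unitCutoff_mem (n + 1) t
    calc |χ n i t| = |unitCutoff (n + 1) t| * |ψ i t| := abs_mul _ _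
      _ ≤ 1 * B i := mul_le_mul (by rw [abs_of_nonneg h5.1]; exact h5.2)
          (hB i t (Set.Ioo_subset_Icc_self ht)) (abs_nonneg _) zero_le_one
      _ ≤ |B i| := by rw [one_mul]; exact le_abs_self _
      _ ≤ ∑ i, |B i| := Finset.single_le_sum (f := fun i => |B i|) (fun _ _ => abs_nonneg _)
          (Finset.mem_univ i)
      _ ≤ M' := le_max_right _ _
  have hlim1 := tendsto_tensorPairing hG'.1 (fun n i => (hχt n i).contDiff.continuous.measurable)
    hbd hχlim
  have hlim2 : Tendsto (fun n => tensorPairing G (Function.update (χ n) j (deriv (χ n j)))) atTop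
      (𝓝 (tensorPairing G (Function.update ψ j (deriv (ψ j))))) := by
    refine tendsto_tensorPairing (M := M') hG.1 (fun n i => ?_) (fun n i t ht => ?_) fun i t ht => ?_
    · by_cases hi : i = j
      · subst hi; simpa using (hχt n i).deriv.contDiff.continuous.measurable
      · simpa [Function.update_of_ne hi] using (hχt n i).contDiff.continuous.measurable
    · by_cases hi : i = j
      · subst hi
        rw [Function.update_self]
        exact (hM (n + 1) t ht).trans (le_max_left _ _)
      · rw [Function.update_of_ne hi]
        exact hbd n i t ht
    · by_cases hi : i = j
      · subst hi
        simp only [Function.update_self]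
        refine tendsto_const_nhds.congr' ?_
        filter_upwards [hev t ht] with n hn
        have : χ n i =ᶠ[𝓝 t] ψ i := by
          filter_upwards [hn] with u hu
          simp [hχ, hu]
        exact this.deriv_eq.symm
      · simp only [Function.update_of_ne hi]
        exact hχlim i t ht
  refine tendsto_nhds_unique hlim2 (hlim1.neg.congr fun n => ?_)
  exact (tensorPairing_deriv j hG hG' (hχt n)).symm

end Tensor

section SmoothKernels

/-! ### Expansion in one variable -/

/-- Iterated primitives of a function, each corrected by its mean. -/
noncomputable def bernoulliPrimitive (φ : ℝ → ℝ) : ℕ → ℝ → ℝ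
  | 0 => φ
  | r + 1 => fun t => ∫ x in (0 : ℝ)..t,
      ((∫ y in (0 : ℝ)..1, bernoulliPrimitive φ r y) - bernoulliPrimitive φ r x)

/-- The mean of the iterated primitives. -/
noncomputable def bernoulliMean (φ : ℝ → ℝ) (r : ℕ) : ℝ :=
  ∫ y in (0 : ℝ)..1, bernoulliPrimitive φ r y

lemma bernoulliPrimitive_succ (φ : ℝ → ℝ) (r : ℕ) (t : ℝ) : bernoulliPrimitive φ (r + 1) t =
    ∫ x in (0 : ℝ)..t, (bernoulliMean φ r - bernoulliPrimitive φ r x) := rfl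

lemma bernoulliPrimitive_hasDerivAt_aux {φ : ℝ → ℝ} {r : ℕ} (h : Continuous (bernoulliPrimitive φ r))
    (t : ℝ) : HasDerivAt (bernoulliPrimitive φ (r + 1))
      (bernoulliMean φ r - bernoulliPrimitive φ r t) t := by
  have h1 : Continuous fun x => bernoulliMean φ r - bernoulliPrimitive φ r x := continuous_const.sub h
  exact intervalIntegral.integral_hasDerivAt_right (h1.intervalIntegrable _ _)
    h1.stronglyMeasurable.stronglyMeasurableAtFilter h1.continuousAt

lemma bernoulliPrimitive_contDiff {φ : ℝ → ℝ} (h : ContDiff ℝ ∞ φ) (r : ℕ) :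
    ContDiff ℝ ∞ (bernoulliPrimitive φ r) := by
  induction r with
  | zero => exact h
  | succ r ih =>
    have hd := bernoulliPrimitive_hasDerivAt_aux ih.continuous
    rw [contDiff_infty_iff_deriv]
    refine ⟨fun t => (hd t).differentiableAt, ?_⟩
    rw [funext fun t => (hd t).deriv]
    exact contDiff_const.sub ih

lemma deriv_bernoulliPrimitive {φ : ℝ → ℝ} (h : ContDiff ℝ ∞ φ) (r : ℕ) :
    deriv (bernoulliPrimitive φ (r + 1)) = fun t => bernoulliMean φ r - bernoulliPrimitive φ r t :=
  funext fun t => (bernoulliPrimitive_hasDerivAt_aux (bernoulliPrimitive_contDiff h r).continuous t).deriv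

lemma bernoulliPrimitive_succ_zero (φ : ℝ → ℝ) (r : ℕ) : bernoulliPrimitive φ (r + 1) 0 = 0 :=
  intervalIntegral.integral_same

/-- The mean correction makes the primitive vanish at `1` as well as at `0`, so it can be used in
the integration by parts without boundary terms. -/
lemma bernoulliPrimitive_succ_one {φ : ℝ → ℝ} (h : ContDiff ℝ ∞ φ) (r : ℕ) :
    bernoulliPrimitive φ (r + 1) 1 = 0 := by
  rw [bernoulliPrimitive_succ, intervalIntegral.integral_sub (by simp)
    ((bernoulliPrimitive_contDiff h r).continuous.intervalIntegrable _ _)]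
  simp [bernoulliMean]

lemma intervalIntegral_swap_of_bounded {F : ℝ → ℝ → ℝ} (hF : Measurable (Function.uncurry F))
    {t M : ℝ} (ht0 : 0 ≤ t) (hM : ∀ s ∈ Set.Icc (0 : ℝ) t, ∀ x ∈ Set.Icc (0 : ℝ) 1, |F s x| ≤ M) :
    ∫ s in (0 : ℝ)..t, ∫ x in (0 : ℝ)..1, F s x = ∫ x in (0 : ℝ)..1, ∫ s in (0 : ℝ)..t, F s x := by
  simp_rw [intervalIntegral.integral_of_le (zero_le_one : (0 : ℝ) ≤ 1)]
  refine intervalIntegral_integral_swap ?_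
  rw [Set.uIoc_of_le ht0, Measure.prod_restrict]
  refine Measure.integrableOn_of_bounded (M := M) ?_ hF.aestronglyMeasurable ?_
  · rw [Measure.prod_prod]
    exact ENNReal.mul_ne_top (by simp) (by simp)
  · filter_upwards [ae_restrict_mem (measurableSet_Ioc.prod measurableSet_Ioc)] with z hz
    exact hM _ (Set.Ioc_subset_Icc_self hz.1) _ (Set.Ioc_subset_Icc_self hz.2)

lemma perBernoulli_eq_ae (r : ℕ) : ∀ x ∈ Set.Ioo (0 : ℝ) 1, perBernoulli r x = normBernoulli r x :=
  fun _ hx => perBernoulli_of_mem (Set.Ioo_subset_Ico_self hx)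

/-- A joint induction. Averaging the formula for the primitive over `t` gives the next mean, because
the periodized kernel has mean zero; integrating mean minus primitive over `[0, t]` raises the order
of the kernel and gives the next primitive. -/
lemma perBernoulli_integral_formula {φ : ℝ → ℝ} (h : ContDiff ℝ ∞ φ) (r : ℕ) :
    bernoulliMean φ r = ∫ x in (0 : ℝ)..1, φ x * normBernoulli r x ∧
    ∀ t ∈ Set.Icc (0 : ℝ) 1, bernoulliPrimitive φ (r + 1) t =
      ∫ x in (0 : ℝ)..1, φ x * (normBernoulli (r + 1) x - perBernoulli (r + 1) (x - t)) := by
  obtain ⟨B, hB⟩ := exists_bound_on_unitInterval h.continuous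
  have hφm := h.continuous.measurable
  have hint : ∀ r t, IntervalIntegrable (fun x => φ x * perBernoulli r (x - t)) volume 0 1 :=
    fun r t => (intervalIntegrable_perBernoulli_sub r t 0 1).continuousOn_mul h.continuous.continuousOn
  have hintn : ∀ r, IntervalIntegrable (fun x => φ x * normBernoulli r x) volume 0 1 :=
    fun r => (h.continuous.mul (continuous_normBernoulli r)).intervalIntegrable _ _
  -- the formula for the primitive gives the formula for the next mean
  have hmean : ∀ r, (∀ t ∈ Set.Icc (0 : ℝ) 1, bernoulliPrimitive φ (r + 1) t =
      ∫ x in (0 : ℝ)..1, φ x * (normBernoulli (r + 1) x - perBernoulli (r + 1) (x - t))) →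
      bernoulliMean φ (r + 1) = ∫ x in (0 : ℝ)..1, φ x * normBernoulli (r + 1) x := by
    intro r hr
    obtain ⟨M, hM0, hM⟩ := exists_perBernoulli_bound (r + 1)
    have hm : Measurable (Function.uncurry fun s x : ℝ => φ x * perBernoulli (r + 1) (x - s)) :=
      (hφm.comp measurable_snd).mul
        ((measurable_perBernoulli _).comp (measurable_snd.sub measurable_fst))
    have hsw := intervalIntegral_swap_of_bounded hm zero_le_one (M := B * M) fun s _ x hx => by
      rw [abs_mul]
      exact mul_le_mul (hB x hx) (hM _) (abs_nonneg _) ((abs_nonneg _).trans (hB x hx))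
    have hz : ∀ x : ℝ, ∫ s in (0 : ℝ)..1, φ x * perBernoulli (r + 1) (x - s) = 0 := fun x => by
      rw [intervalIntegral.integral_const_mul, integral_perBernoulli_const_sub r zero_le_one,
        ← perBernoulli_periodic (r + 2) (x - 1)]
      simp
    simp_rw [hz, intervalIntegral.integral_zero] at hsw
    have e1 : Set.EqOn (bernoulliPrimitive φ (r + 1)) (fun t =>
        (∫ x in (0 : ℝ)..1, φ x * normBernoulli (r + 1) x) -
          ∫ x in (0 : ℝ)..1, φ x * perBernoulli (r + 1) (x - t)) (Set.uIcc 0 1) := by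
      intro t ht
      rw [Set.uIcc_of_le zero_le_one] at ht
      simp only
      rw [hr t ht, ← intervalIntegral.integral_sub (hintn _) (hint _ _)]
      simp_rw [mul_sub]
    have hcont : ContinuousOn (fun t => ∫ x in (0 : ℝ)..1, φ x * perBernoulli (r + 1) (x - t))
        (Set.uIcc 0 1) := by
      have h6 : ContinuousOn (fun t => (∫ x in (0 : ℝ)..1, φ x * normBernoulli (r + 1) x) -
          bernoulliPrimitive φ (r + 1) t) (Set.uIcc 0 1) :=
        (continuous_const.sub (bernoulliPrimitive_contDiff h _).continuous).continuousOn
      refine h6.congr fun t ht => ?_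
      simp only
      rw [e1 ht]; ring
    rw [bernoulliMean, intervalIntegral.integral_congr e1, intervalIntegral.integral_sub (by simp)
      hcont.intervalIntegrable, hsw]
    simp
  induction r with
  | zero =>
    have hm0 : bernoulliMean φ 0 = ∫ x in (0 : ℝ)..1, φ x * normBernoulli 0 x := by
      simp [bernoulliMean, bernoulliPrimitive, normBernoulli_zero]
    refine ⟨hm0, fun t ht => ?_⟩
    -- At order one, `b_1(x) - b̃_1(x - t) = t - 1_{x < t}`.
    have e : Set.EqOn (fun x => φ x * (normBernoulli (0 + 1) x - perBernoulli (0 + 1) (x - t)))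
        (fun x => φ x * t - (Set.Iio t).indicator φ x) (Set.Ioo 0 1) := by
      intro x hx
      simp only [zero_add, perBernoulli, normBernoulli_one]
      by_cases hxt : x < t
      · rw [Set.indicator_of_mem (Set.mem_Iio.2 hxt)]
        have : Int.fract (x - t) = x - t + 1 := by
          rw [Int.fract_eq_iff]
          exact ⟨by linarith [hx.1, ht.2], by linarith, -1, by push_cast; ring⟩
        rw [this]; ring
      · rw [Set.indicator_of_notMem (by simpa using hxt)]
        have : Int.fract (x - t) = x - t := by
          rw [Int.fract_eq_self]
          exact ⟨by linarith, by linarith [hx.2, ht.1]⟩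
        rw [this]; ring
    have hi : IntervalIntegrable ((Set.Iio t).indicator φ) volume 0 1 := by
      rw [intervalIntegrable_iff_integrableOn_Ioc_of_le zero_le_one]
      exact ((intervalIntegrable_iff_integrableOn_Ioc_of_le zero_le_one).1
        (h.continuous.intervalIntegrable 0 1)).indicator measurableSet_Iio
    rw [intervalIntegral.integral_congr_Ioo_of_le zero_le_one e, intervalIntegral.integral_sub
      ((h.continuous.intervalIntegrable 0 1).mul_const t) hi,
      bernoulliPrimitive_succ, intervalIntegral.integral_sub (by simp)
        ((bernoulliPrimitive_contDiff h 0).continuous.intervalIntegrable _ _), hm0]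
    congr 1
    · simp [normBernoulli_zero, mul_comm]
    · have e2 : ∫ x in (0 : ℝ)..1, (Set.Iio t).indicator φ x = ∫ x in (0 : ℝ)..t, φ x := by
        rw [intervalIntegral.integral_of_le zero_le_one, ← integral_Ico_eq_integral_Ioc,
          setIntegral_indicator measurableSet_Iio, intervalIntegral.integral_of_le ht.1,
          ← integral_Ico_eq_integral_Ioc]
        congr 2
        ext x
        simp only [Set.mem_inter_iff, Set.mem_Ico, Set.mem_Iio]
        constructor
        · rintro ⟨⟨h1, _⟩, h3⟩; exact ⟨h1, h3⟩
        · rintro ⟨h1, h3⟩; exact ⟨⟨h1, h3.trans_le ht.2⟩, h3⟩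
      rw [e2]; rfl
  | succ r ih =>
    refine ⟨hmean r ih.2, fun t ht => ?_⟩
    obtain ⟨M, hM0, hM⟩ := exists_perBernoulli_bound (r + 1)
    have hm : Measurable (Function.uncurry fun s x : ℝ => φ x * perBernoulli (r + 1) (x - s)) :=
      (hφm.comp measurable_snd).mul
        ((measurable_perBernoulli _).comp (measurable_snd.sub measurable_fst))
    have hsw := intervalIntegral_swap_of_bounded hm ht.1 (M := B * M) fun s _ x hx => by
      rw [abs_mul]
      exact mul_le_mul (hB x hx) (hM _) (abs_nonneg _) ((abs_nonneg _).trans (hB x hx))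
    have e1 : Set.EqOn (fun s => bernoulliMean φ (r + 1) - bernoulliPrimitive φ (r + 1) s)
        (fun s => ∫ x in (0 : ℝ)..1, φ x * perBernoulli (r + 1) (x - s)) (Set.uIcc 0 t) := by
      intro s hs
      rw [Set.uIcc_of_le ht.1] at hs
      simp only
      rw [hmean r ih.2, ih.2 s ⟨hs.1, hs.2.trans ht.2⟩, ← intervalIntegral.integral_sub (hintn _)]
      · refine intervalIntegral.integral_congr fun x _ => ?_
        ring
      · simp_rw [mul_sub]; exact (hintn _).sub (hint _ _)
    rw [bernoulliPrimitive_succ, intervalIntegral.integral_congr e1, hsw]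
    refine intervalIntegral.integral_congr_Ioo_of_le zero_le_one fun x hx => ?_
    rw [intervalIntegral.integral_const_mul, integral_perBernoulli_const_sub r ht.1,
      perBernoulli_eq_ae _ x hx]

/-- The kernels of the expansion in one variable. -/
noncomputable def sobolevKernel (α t : ℕ) (x y : ℝ) : ℝ :=
  if t ≤ α then normBernoulli t x else -perBernoulli α (x - y)

/-- The functionals of the expansion in one variable. -/
noncomputable def sobolevFactor (α t : ℕ) (φ : ℝ → ℝ) (y : ℝ) : ℝ :=
  if t ≤ α then bernoulliMean φ t else bernoulliPrimitive φ α y - bernoulliMean φ α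

lemma sobolevFactor_eq {α : ℕ} (hα : 1 ≤ α) (t : ℕ) {φ : ℝ → ℝ} (h : ContDiff ℝ ∞ φ) {y : ℝ}
    (hy : y ∈ Set.Icc (0 : ℝ) 1) :
    sobolevFactor α t φ y = ∫ x in (0 : ℝ)..1, φ x * sobolevKernel α t x y := by
  unfold sobolevFactor sobolevKernel
  split_ifs
  · exact (perBernoulli_integral_formula h t).1
  · obtain ⟨r, rfl⟩ := Nat.exists_eq_add_of_le' hα
    rw [(perBernoulli_integral_formula h r).2 y hy, (perBernoulli_integral_formula h (r + 1)).1,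
      ← intervalIntegral.integral_sub]
    · refine intervalIntegral.integral_congr fun x _ => ?_
      ring
    · simp_rw [mul_sub]
      exact ((h.continuous.mul (continuous_normBernoulli _)).intervalIntegrable _ _).sub
        ((intervalIntegrable_perBernoulli_sub _ y 0 1).continuousOn_mul h.continuous.continuousOn)
    · exact (h.continuous.mul (continuous_normBernoulli _)).intervalIntegrable _ _

lemma sobolevFactor_contDiff (α t : ℕ) {φ : ℝ → ℝ} (h : ContDiff ℝ ∞ φ) :
    ContDiff ℝ ∞ (sobolevFactor α t φ) := by
  unfold sobolevFactor
  split_ifs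
  · exact contDiff_const
  · exact (bernoulliPrimitive_contDiff h α).sub contDiff_const

end SmoothKernels

section Expansion

/-! ### Expansion in all variables -/

lemma integrable_mul_tensorProd {s : ℕ} {G : (Fin s → ℝ) → ℝ} (hG : IntegrableOn G (unitCube (Fin s)))
    {ψ : Fin s → ℝ → ℝ} (hm : ∀ j, Measurable (ψ j))
    (hM : ∀ j, ∃ M : ℝ, ∀ x ∈ Set.Icc (0 : ℝ) 1, |ψ j x| ≤ M) :
    IntegrableOn (fun x => G x * tensorProd ψ x) (unitCube (Fin s)) := by
  choose M hM using hM
  refine hG.mul_bdd (c := ∏ j, M j) (measurable_tensorProd hm).aestronglyMeasurable ?_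
  filter_upwards [ae_restrict_mem (measurableSet_unitCube (Fin s))] with x hx
  rw [tensorProd, norm_prod]
  exact Finset.prod_le_prod (fun _ _ => norm_nonneg _) fun j _ =>
    hM j (x j) (Set.Ico_subset_Icc_self (hx j (Set.mem_univ j)))

lemma tensorPairing_update_sub {s : ℕ} {G : (Fin s → ℝ) → ℝ} (hG : IntegrableOn G (unitCube (Fin s)))
    {ψ : Fin s → ℝ → ℝ} (h : ∀ j, ContDiff ℝ ∞ (ψ j)) (j : Fin s) (c : ℝ) {φ : ℝ → ℝ}
    (hφ : ContDiff ℝ ∞ φ) :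
    tensorPairing G (Function.update ψ j fun t => c - φ t) =
      tensorPairing G (Function.update ψ j fun _ => c) - tensorPairing G (Function.update ψ j φ) := by
  have hi : ∀ φ : ℝ → ℝ, ContDiff ℝ ∞ φ → IntegrableOn
      (fun x => G x * tensorProd (Function.update ψ j φ) x) (unitCube (Fin s)) := fun φ hφ =>
    integrable_mul_tensorProd hG (fun i => (contDiff_update_apply h j hφ i).continuous.measurable)
      fun i => exists_bound_on_unitInterval (contDiff_update_apply h j hφ i).continuous
  rw [tensorPairing, tensorPairing, tensorPairing, ← integral_sub (hi _ contDiff_const) (hi _ hφ)]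
  congr 1
  funext x
  rw [tensorProd_update, tensorProd_update, tensorProd_update]
  ring

variable {s : ℕ} {α : ℕ} {f : (Fin s → ℝ) → ℝ} {G : (Fin s → ℕ) → (Fin s → ℝ) → ℝ}

/-- The `r`-th primitive is its mean minus the derivative of the next primitive. Moving that
derivative onto the function raises the order of differentiation by one. -/
lemma tensorPairing_expand_aux (hG : ∀ β : Fin s → ℕ, (∀ j, β j ≤ α) → HasWeakMixedDeriv f β (G β))
    {β : Fin s → ℕ} (hβ : ∀ j, β j ≤ α) {j : Fin s} (hβj : β j = 0) {ψ : Fin s → ℝ → ℝ}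
    (h : ∀ j, ContDiff ℝ ∞ (ψ j)) (m : ℕ) (hm : m ≤ α) :
    tensorPairing (G β) ψ = ∑ r ∈ Finset.range m, tensorPairing (G (Function.update β j r))
        (Function.update ψ j fun _ => bernoulliMean (ψ j) r) +
      tensorPairing (G (Function.update β j m)) (Function.update ψ j (bernoulliPrimitive (ψ j) m)) := by
  have hupd : ∀ r ≤ α, ∀ i, Function.update β j r i ≤ α := by
    intro r hr i
    by_cases hi : i = j
    · subst hi; simpa using hr
    · simpa [Function.update_of_ne hi] using hβ i
  induction m with
  | zero =>
    have e : Function.update β j 0 = β := by rw [← hβj, Function.update_eq_self]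
    simp [bernoulliPrimitive, e]
  | succ m ih =>
    rw [ih (by omega), Finset.sum_range_succ, add_assoc]
    congr 1
    have h1 := tensorPairing_deriv_of_boundary j (hG _ (hupd m (by omega)))
      (G' := G (Function.update β j (m + 1)))
      (by simpa using hG _ (hupd (m + 1) hm))
      (ψ := Function.update ψ j (bernoulliPrimitive (ψ j) (m + 1)))
      (contDiff_update_apply h j (bernoulliPrimitive_contDiff (h j) _))
      (by rw [Function.update_self, bernoulliPrimitive_succ_zero])
      (by rw [Function.update_self, bernoulliPrimitive_succ_one (h j)])
    rw [Function.update_idem, Function.update_self, deriv_bernoulliPrimitive (h j),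
      tensorPairing_update_sub (hG _ (hupd m (by omega))).1 h j _ (bernoulliPrimitive_contDiff (h j) m)]
      at h1
    linarith

/-- The last primitive is split once more into its mean and a remainder. These are the types `α` and
`α + 1`; both carry the order `α`, whence `min t α`. -/
lemma tensorPairing_expand (hG : ∀ β : Fin s → ℕ, (∀ j, β j ≤ α) → HasWeakMixedDeriv f β (G β))
    {β : Fin s → ℕ} (hβ : ∀ j, β j ≤ α) {j : Fin s} (hβj : β j = 0) {ψ : Fin s → ℝ → ℝ}
    (h : ∀ j, ContDiff ℝ ∞ (ψ j)) :
    tensorPairing (G β) ψ = ∑ t : Fin (α + 2), tensorPairing (G (Function.update β j (min (t : ℕ) α)))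
        (Function.update ψ j (sobolevFactor α t (ψ j))) := by
  have hupd : ∀ i, Function.update β j α i ≤ α := by
    intro i
    by_cases hi : i = j
    · subst hi; simp
    · simpa [Function.update_of_ne hi] using hβ i
  rw [tensorPairing_expand_aux hG hβ hβj h α le_rfl,
    Fin.sum_univ_eq_sum_range (fun t => tensorPairing (G (Function.update β j (min t α)))
      (Function.update ψ j (sobolevFactor α t (ψ j)))) (α + 2), Finset.sum_range_succ,
    Finset.sum_range_succ, add_assoc]
  congr 1
  · refine Finset.sum_congr rfl fun r hr => ?_
    have hr := Finset.mem_range.1 hr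
    rw [min_eq_left hr.le]
    congr 2
    funext y
    rw [sobolevFactor, if_pos hr.le]
  · have e1 : sobolevFactor α α (ψ j) = fun _ => bernoulliMean (ψ j) α := by
      funext y; rw [sobolevFactor, if_pos le_rfl]
    have e2 : bernoulliPrimitive (ψ j) α =
        fun t => bernoulliMean (ψ j) α - (-sobolevFactor α (α + 1) (ψ j) t) := by
      funext y; rw [sobolevFactor, if_neg (by omega)]; ring
    have e3 : ∀ φ : ℝ → ℝ, tensorPairing (G (Function.update β j α)) (Function.update ψ j fun t => -φ t) =
        -tensorPairing (G (Function.update β j α)) (Function.update ψ j φ) := by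
      intro φ
      rw [tensorPairing, tensorPairing, ← integral_neg]
      congr 1; funext x
      rw [tensorProd_update, tensorProd_update]; ring
    rw [min_self, min_eq_right (by omega : α ≤ α + 1), e1]
    conv_lhs => rw [e2]
    rw [tensorPairing_update_sub (hG _ hupd).1 h j _ (sobolevFactor_contDiff α (α + 1) (h j)).neg, e3,
      sub_neg_eq_add]

/-- Here `none` marks a coordinate not yet expanded; an identity for one such coordinate, valid
whatever the state of the others, is iterated over all of them. -/
lemma sum_option_expand {τ M : Type*} [Fintype τ] [AddCommMonoid M] : ∀ {s : ℕ}
    (F : (Fin s → Option τ) → M),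
    (∀ x j, x j = none → F x = ∑ t, F (Function.update x j (some t))) →
    F (fun _ => none) = ∑ t : Fin s → τ, F fun j => some (t j) := by
  intro s
  induction s with
  | zero =>
    intro F _
    rw [Fintype.sum_unique]
    congr 1
    funext j; exact j.elim0
  | succ s ih =>
    intro F hF
    have h1 : F (fun _ => none) = F (Fin.cons none fun _ => none) := by
      congr 1; funext j; refine Fin.cases ?_ (fun i => ?_) j <;> simp
    have h2 := ih (fun x => F (Fin.cons none x)) fun x j hj => by
      have := hF (Fin.cons none x) j.succ (by simpa using hj)
      simpa [Fin.cons_update] using this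
    rw [h1, h2]
    have h3 : ∀ t : Fin s → τ, F (Fin.cons none fun j => some (t j)) =
        ∑ t0 : τ, F (Fin.cons (some t0) fun j => some (t j)) := fun t => by
      have := hF (Fin.cons none fun j => some (t j)) 0 (by simp)
      simpa [Fin.update_cons_zero] using this
    simp_rw [h3]
    rw [Finset.sum_comm, ← Fintype.sum_prod_type']
    refine Fintype.sum_equiv (Fin.consEquiv fun _ => τ) _ _ fun x => ?_
    congr 1; funext j; refine Fin.cases ?_ (fun i => ?_) j <;> simp [Fin.consEquiv]

/-- The order of differentiation belonging to a type. -/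
def typeOrder {s : ℕ} (α : ℕ) (t : Fin s → Fin (α + 2)) : Fin s → ℕ := fun j => min (t j : ℕ) α

lemma tensorPairing_eq_sum (hG : ∀ β : Fin s → ℕ, (∀ j, β j ≤ α) → HasWeakMixedDeriv f β (G β))
    {φ : Fin s → ℝ → ℝ} (hφ : ∀ j, IsUnitTest (φ j)) :
    tensorPairing f φ = ∑ t : Fin s → Fin (α + 2), tensorPairing (G (typeOrder α t))
      fun j => sobolevFactor α (t j) (φ j) := by
  have h0 : tensorPairing f φ = tensorPairing (G 0) φ := by
    have := (hG 0 fun _ => Nat.zero_le _).pairing_eq hφ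
    simpa using this
  set ordOf : Option (Fin (α + 2)) → ℕ := fun o => o.elim 0 fun t => min (t : ℕ) α with hord
  set funOf : Option (Fin (α + 2)) → (ℝ → ℝ) → ℝ → ℝ :=
    fun o φ => o.elim φ fun t => sobolevFactor α t φ with hfun
  have hsmooth : ∀ o j, ContDiff ℝ ∞ (funOf o (φ j)) := by
    intro o j
    cases o with
    | none => exact (hφ j).contDiff
    | some t => exact sobolevFactor_contDiff α t (hφ j).contDiff
  have hordle : ∀ o, ordOf o ≤ α := by
    intro o
    cases o with
    | none => exact Nat.zero_le _
    | some t => exact min_le_right _ _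
  have key := sum_option_expand (s := s) (τ := Fin (α + 2)) (fun x =>
    tensorPairing (G fun j => ordOf (x j)) fun j => funOf (x j) (φ j)) ?_
  · rw [h0]; exact key
  · intro x j hj
    have h1 := tensorPairing_expand hG (β := fun j => ordOf (x j)) (fun j => hordle _) (j := j)
      (by simp [hj, hord]) (ψ := fun j => funOf (x j) (φ j)) fun j => hsmooth _ j
    rw [h1]
    refine Finset.sum_congr rfl fun t _ => ?_
    congr 2
    · funext i
      by_cases hi : i = j
      · subst hi; simp [hord]
      · simp [Function.update_of_ne hi]
    · funext i
      by_cases hi : i = j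
      · subst hi; simp [hfun, hj]
      · simp [Function.update_of_ne hi]

end Expansion

section Representation

/-! ### The pointwise representation of functions in the Sobolev space -/

lemma measurable_sobolevKernel (α t : ℕ) :
    Measurable fun z : ℝ × ℝ => sobolevKernel α t z.1 z.2 := by
  unfold sobolevKernel
  split_ifs
  · exact (continuous_normBernoulli t).measurable.comp measurable_fst
  · exact ((measurable_perBernoulli α).comp (measurable_fst.sub measurable_snd)).neg

lemma exists_sobolevKernel_bound (α t : ℕ) :
    ∃ M : ℝ, ∀ x ∈ Set.Icc (0 : ℝ) 1, ∀ y, |sobolevKernel α t x y| ≤ M := by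
  unfold sobolevKernel
  split_ifs
  · obtain ⟨M, hM⟩ := exists_bound_on_unitInterval (continuous_normBernoulli t)
    exact ⟨M, fun x hx _ => hM x hx⟩
  · obtain ⟨M, _, hM⟩ := exists_perBernoulli_bound α
    exact ⟨M, fun x _ y => by rw [abs_neg]; exact hM _⟩

lemma continuous_sobolevKernel {α : ℕ} (hα : 2 ≤ α) (t : ℕ) (y : ℝ) :
    Continuous fun x => sobolevKernel α t x y := by
  unfold sobolevKernel
  split_ifs
  · exact continuous_normBernoulli t
  · obtain ⟨r, rfl⟩ := Nat.exists_eq_add_of_le' hα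
    exact ((continuous_perBernoulli r).comp (continuous_id.sub continuous_const)).neg

instance isFiniteMeasure_restrict_unitCube (ι : Type*) [Fintype ι] :
    IsFiniteMeasure ((volume : Measure (ι → ℝ)).restrict (unitCube ι)) := by
  constructor
  rw [Measure.restrict_apply_univ, unitCube, volume_pi_pi]
  simp

variable {s : ℕ} {α : ℕ}

/-- The integral of `G` against a product of one-dimensional kernels. -/
noncomputable def kernelIntegral (α : ℕ) (t : Fin s → Fin (α + 2)) (G : (Fin s → ℝ) → ℝ)
    (x : Fin s → ℝ) : ℝ :=
  ∫ y in unitCube (Fin s), G y * ∏ j, sobolevKernel α (t j) (x j) (y j)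

lemma exists_prod_kernel_bound (t : Fin s → Fin (α + 2)) : ∃ M : ℝ, ∀ x ∈ unitCube (Fin s), ∀ y : Fin s → ℝ,
    |∏ j, sobolevKernel α (t j) (x j) (y j)| ≤ M := by
  choose M hM using fun j => exists_sobolevKernel_bound α (t j)
  refine ⟨∏ j, M j, fun x hx y => ?_⟩
  rw [Finset.abs_prod]
  exact Finset.prod_le_prod (fun _ _ => abs_nonneg _) fun j _ =>
    hM j (x j) (Set.Ico_subset_Icc_self (hx j (Set.mem_univ j))) _

lemma measurable_prod_kernel (t : Fin s → Fin (α + 2)) (x : Fin s → ℝ) :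
    Measurable fun y : Fin s → ℝ => ∏ j, sobolevKernel α (t j) (x j) (y j) :=
  Finset.measurable_fun_prod _ fun j _ => (measurable_sobolevKernel α (t j)).comp
    (g := fun z : ℝ × ℝ => sobolevKernel α (t j) z.1 z.2) (f := fun y : Fin s → ℝ => (x j, y j))
    (measurable_const.prodMk (measurable_pi_apply j))

/-- For `α ≥ 2` every kernel is continuous in `x`, so dominated convergence applies. Continuity lets
the weak identity be read at every point. -/
lemma continuousOn_kernelIntegral (hα : 2 ≤ α) (t : Fin s → Fin (α + 2)) {G : (Fin s → ℝ) → ℝ}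
    (hG : IntegrableOn G (unitCube (Fin s))) :
    ContinuousOn (kernelIntegral α t G) (unitCube (Fin s)) := by
  obtain ⟨M, hM⟩ := exists_prod_kernel_bound t
  refine continuousOn_of_dominated (bound := fun y => ‖G y‖ * M) (fun x _ => ?_) (fun x hx => ?_)
    (hG.norm.mul_const _) (ae_of_all _ fun y => ?_)
  · exact hG.aestronglyMeasurable.mul (measurable_prod_kernel t x).aestronglyMeasurable
  · refine ae_of_all _ fun y => ?_
    rw [norm_mul]
    exact mul_le_mul_of_nonneg_left (hM x hx y) (norm_nonneg _)
  · refine (continuous_const.mul (continuous_finsetProd _ fun j _ => ?_)).continuousOn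
    exact (continuous_sobolevKernel hα (t j) (y j)).comp (continuous_apply j)

lemma volume_restrict_unitCube (ι : Type*) [Fintype ι] :
    (volume : Measure (ι → ℝ)).restrict (unitCube ι) =
      Measure.pi fun _ => (volume : Measure ℝ).restrict (Set.Ico 0 1) := by
  rw [unitCube, volume_pi, Measure.restrict_pi_pi]

/-- Fubini: the functionals acting on the test functions are the transposes of the kernels acting on
`G`. -/
lemma tensorPairing_sobolevFactor (hα : 1 ≤ α) (t : Fin s → Fin (α + 2)) {G : (Fin s → ℝ) → ℝ}
    (hG : IntegrableOn G (unitCube (Fin s))) {φ : Fin s → ℝ → ℝ} (hφ : ∀ j, ContDiff ℝ ∞ (φ j)) :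
    tensorPairing G (fun j => sobolevFactor α (t j) (φ j)) =
      ∫ x in unitCube (Fin s), tensorProd φ x * kernelIntegral α t G x := by
  have h1 : ∀ y ∈ unitCube (Fin s), tensorProd (fun j => sobolevFactor α (t j) (φ j)) y =
      ∫ x in unitCube (Fin s), ∏ j, (φ j (x j) * sobolevKernel α (t j) (x j) (y j)) := by
    intro y hy
    rw [volume_restrict_unitCube, integral_fintype_prod_eq_prod
      (fun j x => φ j x * sobolevKernel α (t j) x (y j)), tensorProd]
    refine Finset.prod_congr rfl fun j _ => ?_
    rw [sobolevFactor_eq hα _ (hφ j) (Set.Ico_subset_Icc_self (hy j (Set.mem_univ j))),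
      intervalIntegral.integral_of_le zero_le_one, integral_Ico_eq_integral_Ioc]
  have h2 : tensorPairing G (fun j => sobolevFactor α (t j) (φ j)) =
      ∫ y in unitCube (Fin s), ∫ x in unitCube (Fin s),
        G y * ∏ j, (φ j (x j) * sobolevKernel α (t j) (x j) (y j)) := by
    rw [tensorPairing]
    refine setIntegral_congr_fun (measurableSet_unitCube _) fun y hy => ?_
    rw [h1 y hy, integral_const_mul]
  rw [h2, integral_integral_swap]
  · refine setIntegral_congr_fun (measurableSet_unitCube _) fun x _ => ?_
    rw [kernelIntegral, ← integral_const_mul]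
    congr 1
    funext y
    rw [Finset.prod_mul_distrib, tensorProd]
    ring
  · choose B hB using fun j => exists_bound_on_unitInterval (hφ j).continuous
    obtain ⟨M, hM⟩ := exists_prod_kernel_bound t
    have hGp : Integrable (fun z : (Fin s → ℝ) × (Fin s → ℝ) => G z.1)
        ((volume.restrict (unitCube (Fin s))).prod (volume.restrict (unitCube (Fin s)))) :=
      Integrable.comp_fst hG _
    refine hGp.mul_bdd (c := (∏ j, B j) * M) ?_ ?_
    · refine (Finset.measurable_fun_prod _ fun j _ => ?_).aestronglyMeasurable
      refine ((hφ j).continuous.measurable.comp ((measurable_pi_apply j).comp measurable_snd)).mul ?_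
      exact (measurable_sobolevKernel α (t j)).comp
        (g := fun z : ℝ × ℝ => sobolevKernel α (t j) z.1 z.2)
        (f := fun z : (Fin s → ℝ) × (Fin s → ℝ) => (z.2 j, z.1 j))
        (((measurable_pi_apply j).comp measurable_snd).prodMk
          ((measurable_pi_apply j).comp measurable_fst))
    · rw [Measure.prod_restrict]
      filter_upwards [ae_restrict_mem
        ((measurableSet_unitCube (Fin s)).prod (measurableSet_unitCube (Fin s)))] with z hz
      rw [Finset.prod_mul_distrib, norm_mul]
      have hB' : ‖∏ j, φ j (z.2 j)‖ ≤ ∏ j, B j := by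
        rw [norm_prod]
        exact Finset.prod_le_prod (fun _ _ => norm_nonneg _) fun j _ =>
          hB j _ (Set.Ico_subset_Icc_self (hz.2 j (Set.mem_univ j)))
      exact mul_le_mul hB' (hM _ hz.2 _) (norm_nonneg _) ((norm_nonneg _).trans hB')

lemma isOpen_openUnitCube : IsOpen (openUnitCube (Fin s)) :=
  isOpen_set_pi Set.finite_univ fun _ _ => isOpen_Ioo

lemma unitCube_subset_closure : unitCube (Fin s) ⊆ closure (openUnitCube (Fin s)) := by
  rw [openUnitCube, closure_pi_set]
  refine Set.pi_mono fun _ _ => ?_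
  rw [closure_Ioo zero_ne_one]
  exact Set.Ico_subset_Icc_self

lemma integrableOn_mul_test {D : (Fin s → ℝ) → ℝ} (hD : ContinuousOn D (unitCube (Fin s)))
    {φ : Fin s → ℝ → ℝ} (hφ : ∀ j, IsUnitTest (φ j)) :
    IntegrableOn (fun x => D x * tensorProd φ x) (unitCube (Fin s)) := by
  have hK : IsCompact (tsupport (tensorProd φ)) :=
    (isCompact_univ_pi fun j => (hφ j).hasCompactSupport).of_isClosed_subset
      (isClosed_tsupport _) (tsupport_tensorProd_subset φ)
  have hsub : tsupport (tensorProd φ) ⊆ unitCube (Fin s) :=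
    (tsupport_tensorProd_subset φ).trans
      (Set.pi_mono fun j _ => (hφ j).tsupport_subset.trans Set.Ioo_subset_Ico_self)
  have hc : ContinuousOn (fun x => D x * tensorProd φ x) (tsupport (tensorProd φ)) :=
    (hD.mono hsub).mul (tensorProd_contDiff fun j => (hφ j).contDiff).continuous.continuousOn
  refine Integrable.integrableOn ((integrableOn_iff_integrable_of_support_subset fun y hy => ?_).1
    (hc.integrableOn_compact hK))
  exact subset_tsupport _ (right_ne_zero_of_mul hy)

/-- A continuous function on the cube which is orthogonal to all products of test functions
vanishes. -/
lemma eqOn_zero_of_tensorPairing {D : (Fin s → ℝ) → ℝ} (hD : ContinuousOn D (unitCube (Fin s)))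
    (h : ∀ φ : Fin s → ℝ → ℝ, (∀ j, IsUnitTest (φ j)) → tensorPairing D φ = 0) :
    Set.EqOn D 0 (unitCube (Fin s)) := by
  have hopen : Set.EqOn D 0 (openUnitCube (Fin s)) := by
    intro x hx
    by_contra hne
    have hDo : ContinuousOn D (openUnitCube (Fin s)) := hD.mono (openUnitCube_subset s)
    have hpos : 0 < D x * D x := mul_self_pos.2 hne
    have hev : ∀ᶠ y in 𝓝 x, y ∈ openUnitCube (Fin s) ∧ 0 < D x * D y := by
      have h1 := isOpen_openUnitCube.mem_nhds hx
      have h2 : ContinuousAt (fun y => D x * D y) x :=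
        continuousAt_const.mul (hDo.continuousAt h1)
      exact (eventually_mem_set.2 h1).and (h2.eventually (lt_mem_nhds hpos))
    obtain ⟨δ, hδ, hball⟩ := Metric.eventually_nhds_iff_ball.1 hev
    -- In the sup norm a product of one-dimensional bumps is supported in a ball; inside the larger
    -- ball of radius `δ` the function `D` keeps its sign.
    set bump : ∀ j : Fin s, ContDiffBump (x j) := fun j => ⟨δ / 3, δ / 2, by positivity, by linarith⟩
    have hcb : Metric.closedBall x (δ / 2) ⊆ Metric.ball x δ := Metric.closedBall_subset_ball (by linarith)
    have htest : ∀ j, IsUnitTest (bump j) := by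
      intro j
      refine ⟨(bump j).contDiff, (bump j).hasCompactSupport, ?_⟩
      rw [(bump j).tsupport_eq]
      intro z hz
      have hy : Function.update x j z ∈ Metric.ball x δ := by
        refine hcb ?_
        rw [mem_closedBall_iff_norm, pi_norm_le_iff_of_nonneg (by positivity)]
        intro i
        by_cases hi : i = j
        · subst hi
          simpa [Real.dist_eq] using hz
        · simp [Function.update_of_ne hi]; positivity
      have := (hball _ hy).1 j (Set.mem_univ j)
      simpa using this
    have hzero : ∀ y, y ∉ Metric.closedBall x (δ / 2) → tensorProd (fun j => bump j) y = 0 := by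
      intro y hy
      rw [mem_closedBall_iff_norm, pi_norm_le_iff_of_nonneg (by positivity)] at hy
      push Not at hy
      obtain ⟨j, hj⟩ := hy
      refine Finset.prod_eq_zero (Finset.mem_univ j) ((bump j).zero_of_le_dist ?_)
      rw [Real.dist_eq]
      exact hj.le
    have hposb : ∀ y ∈ Metric.ball x (δ / 2), 0 < tensorProd (fun j => bump j) y := by
      intro y hy
      refine Finset.prod_pos fun j _ => (bump j).pos_of_mem_ball ?_
      rw [Metric.mem_ball] at hy ⊢
      exact (dist_le_pi_dist y x j).trans_lt hy
    set F : (Fin s → ℝ) → ℝ := fun y => (D x * D y) * tensorProd (fun j => bump j) y with hF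
    have hFint : IntegrableOn F (unitCube (Fin s)) := by
      have h6 := (integrableOn_mul_test hD htest).const_mul (D x)
      refine h6.congr (ae_of_all _ fun y => ?_)
      simp only [hF]; ring
    have hFnn : ∀ y, y ∈ unitCube (Fin s) → 0 ≤ F y := by
      intro y _
      by_cases hy : y ∈ Metric.closedBall x (δ / 2)
      · exact mul_nonneg (hball y (hcb hy)).2.le
          (Finset.prod_nonneg fun j _ => (bump j).nonneg)
      · simp only [hF]; rw [hzero y hy, mul_zero]
    have hFpos : 0 < ∫ y in unitCube (Fin s), F y := by
      rw [setIntegral_pos_iff_support_of_nonneg_ae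
        (by filter_upwards [ae_restrict_mem (measurableSet_unitCube (Fin s))] with y hy using hFnn y hy)
        hFint]
      refine lt_of_lt_of_le (Metric.measure_ball_pos volume x (half_pos hδ)) (measure_mono ?_)
      intro y hy
      have hy' := hball y (hcb (Metric.ball_subset_closedBall hy))
      exact ⟨(mul_pos hy'.2 (hposb y hy)).ne', openUnitCube_subset s hy'.1⟩
    have hz : ∫ y in unitCube (Fin s), F y = D x * tensorPairing D fun j => bump j := by
      rw [tensorPairing, ← integral_const_mul]
      congr 1; funext y; simp only [hF]; ring
    rw [hz, h _ htest, mul_zero] at hFpos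
    exact lt_irrefl _ hFpos
  exact hopen.of_subset_closure hD continuousOn_const (openUnitCube_subset s) unitCube_subset_closure

/-- Both sides are continuous and have the same pairing with every product of test functions. -/
lemma eqOn_sum_kernelIntegral (hα : 2 ≤ α) {f : (Fin s → ℝ) → ℝ} (hf : ContinuousOn f (unitCube (Fin s)))
    {G : (Fin s → ℕ) → (Fin s → ℝ) → ℝ}
    (hG : ∀ β : Fin s → ℕ, (∀ j, β j ≤ α) → HasWeakMixedDeriv f β (G β)) :
    Set.EqOn f (fun x => ∑ t : Fin s → Fin (α + 2), kernelIntegral α t (G (typeOrder α t)) x)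
      (unitCube (Fin s)) := by
  have hGi : ∀ t : Fin s → Fin (α + 2), IntegrableOn (G (typeOrder α t)) (unitCube (Fin s)) :=
    fun t => (hG _ fun _ => min_le_right _ _).1
  have hR := fun t => continuousOn_kernelIntegral hα t (hGi t)
  have hRs : ContinuousOn (fun x => ∑ t : Fin s → Fin (α + 2),
      kernelIntegral α t (G (typeOrder α t)) x) (unitCube (Fin s)) :=
    continuousOn_finsetSum _ fun t _ => hR t
  have key := eqOn_zero_of_tensorPairing (hf.sub hRs) fun φ hφ => by
    have h1 := tensorPairing_eq_sum hG hφ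
    have h2 : ∀ t : Fin s → Fin (α + 2),
        tensorPairing (G (typeOrder α t)) (fun j => sobolevFactor α (t j) (φ j)) =
        ∫ x in unitCube (Fin s), kernelIntegral α t (G (typeOrder α t)) x * tensorProd φ x := by
      intro t
      rw [tensorPairing_sobolevFactor (by omega) t (hGi t) fun j => (hφ j).contDiff]
      simp_rw [mul_comm]
    simp_rw [h2] at h1
    rw [← integral_finsetSum _ fun t _ => integrableOn_mul_test (hR t) hφ] at h1
    have h3 := integral_sub (integrableOn_mul_test hf hφ) (integrableOn_mul_test hRs hφ)
    simp_rw [← sub_mul, Finset.sum_mul] at h3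
    rw [← h1, tensorPairing, sub_self] at h3
    rw [← h3, tensorPairing]
    congr 1
  intro x hx
  exact sub_eq_zero.1 (key hx)

end Representation

section IntegrateOut

/-! ### Integrating out variables -/

instance isProbabilityMeasure_restrict_unitCube (ι : Type*) [Fintype ι] :
    IsProbabilityMeasure ((volume : Measure (ι → ℝ)).restrict (unitCube ι)) := by
  constructor
  rw [Measure.restrict_apply_univ, unitCube, volume_pi_pi]
  simp

variable {s : ℕ}

lemma setIntegral_unitCube_eq_prod (v : Finset (Fin s)) {F : (Fin s → ℝ) → ℝ}
    (hF : IntegrableOn F (unitCube (Fin s))) :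
    IntegrableOn (fun x => ∫ y in unitCube {j // j ∉ v},
      F ((Equiv.piEquivPiSubtypeProd (fun j => j ∈ v) fun _ => ℝ).symm (x, y))) (unitCube {j // j ∈ v}) ∧
    ∫ x in unitCube (Fin s), F x = ∫ x in unitCube {j // j ∈ v}, ∫ y in unitCube {j // j ∉ v},
      F ((Equiv.piEquivPiSubtypeProd (fun j => j ∈ v) fun _ => ℝ).symm (x, y)) := by
  set e := MeasurableEquiv.piEquivPiSubtypeProd (fun _ : Fin s => ℝ) (fun j => j ∈ v) with he
  have hmp : MeasurePreserving e.symm volume volume := by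
    convert (volume_preserving_piEquivPiSubtypeProd (fun _ : Fin s => ℝ) (fun j => j ∈ v)).symm <;> rfl
  have hpre : e.symm ⁻¹' unitCube (Fin s) = unitCube {j // j ∈ v} ×ˢ unitCube {j // j ∉ v} := by
    ext z
    simp only [Set.mem_preimage, unitCube, Set.mem_prod, Set.mem_pi, Set.mem_univ, true_implies]
    constructor
    · intro h
      refine ⟨fun j => ?_, fun j => ?_⟩
      · have := h j.1
        simpa [he, MeasurableEquiv.piEquivPiSubtypeProd, Equiv.piEquivPiSubtypeProd, j.2] using this
      · have := h j.1
        simpa [he, MeasurableEquiv.piEquivPiSubtypeProd, Equiv.piEquivPiSubtypeProd, j.2] using this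
    · rintro ⟨h1, h2⟩ j
      by_cases hj : j ∈ v
      · simpa [he, MeasurableEquiv.piEquivPiSubtypeProd, Equiv.piEquivPiSubtypeProd, hj] using h1 ⟨j, hj⟩
      · simpa [he, MeasurableEquiv.piEquivPiSubtypeProd, Equiv.piEquivPiSubtypeProd, hj] using h2 ⟨j, hj⟩
  have h1 := hmp.setIntegral_preimage_emb e.symm.measurableEmbedding F (unitCube (Fin s))
  have h2 : IntegrableOn (F ∘ e.symm) (e.symm ⁻¹' unitCube (Fin s)) :=
    (hmp.integrableOn_comp_preimage e.symm.measurableEmbedding).2 hF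
  rw [hpre] at h1 h2
  have h3 : Integrable (F ∘ e.symm) ((volume.restrict (unitCube {j // j ∈ v})).prod
      (volume.restrict (unitCube {j // j ∉ v}))) := by
    rw [Measure.prod_restrict]; exact h2
  refine ⟨h3.integral_prod_left, ?_⟩
  rw [← h1]
  exact setIntegral_prod (fun z => F (e.symm z)) h2

lemma integrableOn_integrateOut (v : Finset (Fin s)) {G : (Fin s → ℝ) → ℝ}
    (hG : IntegrableOn G (unitCube (Fin s))) :
    IntegrableOn (integrateOut v G) (unitCube {j // j ∈ v}) :=
  (setIntegral_unitCube_eq_prod v hG).1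

/-- As `h` depends only on the variables in `v`, Fubini integrates `G` over the others first. The
cube has measure `1`, so the `L^1` norm is at most the `L^q` norm. -/
lemma ofReal_abs_integral_mul_le (v : Finset (Fin s)) {G : (Fin s → ℝ) → ℝ}
    (hG : IntegrableOn G (unitCube (Fin s))) {h : (Fin s → ℝ) → ℝ} (hm : Measurable h)
    (hdep : ∀ y z, (∀ j ∈ v, y j = z j) → h y = h z) {B : ℝ}
    (hB : ∀ y ∈ unitCube (Fin s), |h y| ≤ B) {q : ℝ≥0∞} (hq : 1 ≤ q) :
    ENNReal.ofReal |∫ y in unitCube (Fin s), G y * h y| ≤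
      ENNReal.ofReal B * eLpNorm (integrateOut v G) q (volume.restrict (unitCube {j // j ∈ v})) := by
  have hint : IntegrableOn (fun y => G y * h y) (unitCube (Fin s)) :=
    hG.mul_bdd (c := B) hm.aestronglyMeasurable
      (by filter_upwards [ae_restrict_mem (measurableSet_unitCube (Fin s))] with y hy using hB y hy)
  set e := (Equiv.piEquivPiSubtypeProd (fun j : Fin s => j ∈ v) fun _ => ℝ) with he
  have hh : ∀ x y, h (e.symm (x, y)) = h (e.symm (x, 0)) := fun x y => hdep _ _ fun j hj => by
    simp [he, Equiv.piEquivPiSubtypeProd, hj]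
  have h1 : ∫ y in unitCube (Fin s), G y * h y =
      ∫ x in unitCube {j // j ∈ v}, integrateOut v G x * h (e.symm (x, 0)) := by
    rw [(setIntegral_unitCube_eq_prod v hint).2]
    congr 1
    funext x
    simp_rw [← he, hh x]
    rw [integral_mul_const]
    rfl
  rw [h1, ← Real.enorm_eq_ofReal_abs]
  calc _ ≤ ∫⁻ x in unitCube {j // j ∈ v}, ‖integrateOut v G x * h (e.symm (x, 0))‖ₑ :=
        enorm_integral_le_lintegral_enorm _
    _ ≤ ∫⁻ x in unitCube {j // j ∈ v}, ENNReal.ofReal B * ‖integrateOut v G x‖ₑ := by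
        refine lintegral_mono_ae ?_
        filter_upwards [ae_restrict_mem (measurableSet_unitCube _)] with x hx
        rw [enorm_mul, mul_comm]
        refine mul_le_mul_left ?_ _
        rw [Real.enorm_eq_ofReal_abs]
        refine ENNReal.ofReal_le_ofReal (hB _ fun j _ => ?_)
        by_cases hj : j ∈ v
        · simpa [he, Equiv.piEquivPiSubtypeProd, hj] using hx ⟨j, hj⟩ (Set.mem_univ _)
        · simp [he, Equiv.piEquivPiSubtypeProd, hj]
    _ = ENNReal.ofReal B * eLpNorm (integrateOut v G) 1 (volume.restrict (unitCube {j // j ∈ v})) := by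
        rw [lintegral_const_mul' _ _ ENNReal.ofReal_ne_top, eLpNorm_one_eq_lintegral_enorm]
    _ ≤ _ := mul_le_mul_right (eLpNorm_le_eLpNorm_of_exponent_le hq
        (integrableOn_integrateOut v hG).aestronglyMeasurable) _

end IntegrateOut

section LpAgg

/-! ### Finite `ℓ^p` norms -/

lemma le_lpAgg {ι : Type*} {p : ℝ≥0∞} (hp : 1 ≤ p) {S : Finset ι} {a : ι → ℝ≥0∞} {i : ι} (hi : i ∈ S) :
    a i ≤ lpAgg p S a := by
  unfold lpAgg
  split_ifs with h
  · exact Finset.le_sup hi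
  · have hp0 : 0 < p.toReal := ENNReal.toReal_pos (zero_lt_one.trans_le hp).ne' h
    rw [one_div, ENNReal.le_rpow_inv_iff hp0]
    exact Finset.single_le_sum (f := fun i => a i ^ p.toReal) (fun _ _ => zero_le) hi

/-- Hölder's inequality for a finite sum; the injection `F` embeds its terms into the family
defining the norm. -/
lemma sum_le_card_rpow_mul_lpAgg {ι κ : Type*} {p : ℝ≥0∞} (hp : 1 ≤ p) {S : Finset ι} {a : ι → ℝ≥0∞}
    {T : Finset κ} (F : κ → ι) (hF : ∀ t ∈ T, F t ∈ S) (hinj : Set.InjOn F T) {N : ℕ} (hN : T.card ≤ N) :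
    ∑ t ∈ T, a (F t) ≤ ((N : ℝ≥0∞) ^ (1 - (p⁻¹).toReal)) * lpAgg p S a := by
  by_cases h : p = ⊤
  · subst h
    simp only [lpAgg, if_true, ENNReal.inv_top, ENNReal.toReal_zero, sub_zero, ENNReal.rpow_one]
    calc _ ≤ ∑ t ∈ T, S.sup a := Finset.sum_le_sum fun t ht => Finset.le_sup (hF t ht)
      _ = T.card * S.sup a := by rw [Finset.sum_const, nsmul_eq_mul]
      _ ≤ _ := by gcongr
  · have hp1 : 1 ≤ p.toReal := by
      rw [← ENNReal.toReal_one]; exact ENNReal.toReal_mono h hp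
    have hp0 : 0 < p.toReal := by linarith
    rw [lpAgg, if_neg h]
    have h1 := ENNReal.rpow_sum_le_const_mul_sum_rpow T (fun t => a (F t)) hp1
    have h2 : ∑ t ∈ T, a (F t) ^ p.toReal ≤ ∑ i ∈ S, a i ^ p.toReal := by
      classical
      rw [← Finset.sum_image (f := fun i => a i ^ p.toReal) hinj]
      exact Finset.sum_le_sum_of_subset fun i hi => by
        obtain ⟨t, ht, rfl⟩ := Finset.mem_image.1 hi
        exact hF t ht
    have h3 : (∑ t ∈ T, a (F t)) ^ p.toReal ≤
        (N : ℝ≥0∞) ^ (p.toReal - 1) * ∑ i ∈ S, a i ^ p.toReal := by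
      refine h1.trans (mul_le_mul' (ENNReal.rpow_le_rpow (by exact_mod_cast hN) (by linarith)) h2)
    rw [← ENNReal.le_rpow_inv_iff hp0, ENNReal.mul_rpow_of_nonneg _ _ (inv_nonneg.2 hp0.le),
      ← ENNReal.rpow_mul] at h3
    refine h3.trans (le_of_eq ?_)
    rw [ENNReal.toReal_inv, one_div]
    congr 2
    field_simp

end LpAgg

section NormBounds

/-! ### Bounds following from the Sobolev norm -/

variable {s α : ℕ}

/-- The variables a type depends on. -/
def typeSupport (t : Fin s → Fin (α + 2)) : Finset (Fin s) := Finset.univ.filter fun j => t j ≠ 0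

/-- The variables in which a type has a full kernel. -/
def typeFull (t : Fin s → Fin (α + 2)) : Finset (Fin s) :=
  Finset.univ.filter fun j => (t j : ℕ) = α + 1

/-- All types with a given support. -/
def typesOn (α : ℕ) (u : Finset (Fin s)) : Finset (Fin s → Fin (α + 2)) :=
  Fintype.piFinset fun j => if j ∈ u then Finset.univ.erase 0 else {0}

lemma mem_typesOn {u : Finset (Fin s)} {t : Fin s → Fin (α + 2)} :
    t ∈ typesOn α u ↔ typeSupport t = u := by
  rw [typesOn, Fintype.mem_piFinset, Finset.ext_iff]
  refine forall_congr' fun j => ?_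
  by_cases hj : j ∈ u <;> simp [typeSupport, hj]

lemma sum_types_eq {M : Type*} [AddCommMonoid M] (F : (Fin s → Fin (α + 2)) → M) :
    ∑ t, F t = ∑ u : Finset (Fin s), ∑ t ∈ typesOn α u, F t := by
  rw [← Finset.sum_fiberwise Finset.univ typeSupport F]
  refine Finset.sum_congr rfl fun u _ => Finset.sum_congr ?_ fun _ _ => rfl
  ext t
  simp [mem_typesOn]

lemma card_typesOn (u : Finset (Fin s)) : (typesOn α u).card = (α + 1) ^ u.card := by
  rw [typesOn, Fintype.card_piFinset]
  have : ∀ j : Fin s, (if j ∈ u then Finset.univ.erase (0 : Fin (α + 2)) else {0}).card =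
      if j ∈ u then α + 1 else 1 := by
    intro j
    split_ifs <;> simp
  simp_rw [this]
  rw [Finset.prod_ite_mem, Finset.univ_inter, Finset.prod_const]

lemma typeFull_subset (t : Fin s → Fin (α + 2)) : typeFull t ⊆ typeSupport t := by
  intro j hj
  simp only [typeFull, typeSupport, Finset.mem_filter, Finset.mem_univ, true_and] at *
  intro h
  rw [h] at hj
  simp at hj

lemma typeOrder_mem_derivOrders (t : Fin s → Fin (α + 2)) :
    typeOrder α t ∈ derivOrders α (typeSupport t) (typeFull t) := by
  rw [derivOrders, Fintype.mem_piFinset]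
  intro j
  have hlt := (t j).2
  by_cases h1 : j ∈ typeFull t
  · rw [if_pos h1]
    simp only [typeFull, Finset.mem_filter, Finset.mem_univ, true_and] at h1
    simp [typeOrder, h1]
  · rw [if_neg h1]
    simp only [typeFull, Finset.mem_filter, Finset.mem_univ, true_and] at h1
    by_cases h2 : j ∈ typeSupport t
    · rw [if_pos h2]
      simp only [typeSupport, Finset.mem_filter, Finset.mem_univ, true_and] at h2
      have h3 : (t j : ℕ) ≠ 0 := fun h => h2 (Fin.ext h)
      rw [Finset.mem_Icc, typeOrder]
      omega
    · rw [if_neg h2]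
      simp only [typeSupport, Finset.mem_filter, Finset.mem_univ, true_and, not_not] at h2
      simp [typeOrder, h2]

/-- The order of differentiation confuses `α` with `α + 1`; the set of full kernels tells them
apart. So different types use different terms of the norm. -/
lemma typeOrder_injOn :
    Function.Injective fun t : Fin s → Fin (α + 2) =>
      (⟨typeFull t, typeOrder α t⟩ : (_ : Finset (Fin s)) × (Fin s → ℕ)) := by
  intro t t' h
  simp only [Sigma.mk.injEq, heq_eq_eq] at h
  funext j
  have h1 : j ∈ typeFull t ↔ j ∈ typeFull t' := by rw [h.1]
  have h2 := congrFun h.2 j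
  simp only [typeFull, Finset.mem_filter, Finset.mem_univ, true_and] at h1
  simp only [typeOrder] at h2
  have := (t j).2
  have := (t' j).2
  apply Fin.ext
  omega

/-- The contribution of a type to the norm. -/
noncomputable def typeNorm (q : ℝ≥0∞) (f : (Fin s → ℝ) → ℝ) (t : Fin s → Fin (α + 2)) : ℝ≥0∞ :=
  eLpNorm (integrateOut (typeFull t) (weakMixedDeriv f (typeOrder α t))) q
    (volume.restrict (unitCube {j // j ∈ typeFull t}))

lemma lpAgg_le_of_sobolevNorm_le {γ : Finset ℕ → ℝ≥0} {q : ℝ≥0∞} {f : (Fin s → ℝ) → ℝ}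
    (h : sobolevNorm α γ q ⊤ f ≤ 1) (u : Finset (Fin s)) :
    lpAgg q (u.powerset.sigma fun v => derivOrders α u v) (fun i =>
        eLpNorm (integrateOut i.1 (weakMixedDeriv f i.2)) q
          (volume.restrict (unitCube {j // j ∈ i.1}))) ≤ γ (u.map Fin.valEmbedding) := by
  rw [sobolevNorm, lpAgg, if_pos rfl] at h
  have h1 := (Finset.le_sup (f := fun u : Finset (Fin s) => (γ (u.map Fin.valEmbedding) : ℝ≥0∞)⁻¹ *
      lpAgg q (u.powerset.sigma fun v => derivOrders α u v) fun i =>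
        eLpNorm (integrateOut i.1 (weakMixedDeriv f i.2)) q
          (volume.restrict (unitCube {j // j ∈ i.1}))) (Finset.mem_univ u)).trans h
  -- For a zero weight the inverse is `∞`, and a finite norm forces the whole bracket to vanish.
  by_cases h0 : (γ (u.map Fin.valEmbedding) : ℝ≥0∞) = 0
  · simp only [h0, ENNReal.inv_zero] at h1
    rw [h0, nonpos_iff_eq_zero]
    by_contra hne
    rw [ENNReal.top_mul hne] at h1
    exact absurd h1 (by simp)
  · have h2 := mul_le_mul_right h1 (γ (u.map Fin.valEmbedding) : ℝ≥0∞)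
    rwa [← mul_assoc, ENNReal.mul_inv_cancel h0 ENNReal.coe_ne_top, one_mul, mul_one] at h2

lemma typeNorm_le {γ : Finset ℕ → ℝ≥0} {q : ℝ≥0∞} (hq : 1 ≤ q) {f : (Fin s → ℝ) → ℝ}
    (h : sobolevNorm α γ q ⊤ f ≤ 1) (t : Fin s → Fin (α + 2)) :
    typeNorm q f t ≤ γ ((typeSupport t).map Fin.valEmbedding) := by
  refine le_trans ?_ (lpAgg_le_of_sobolevNorm_le h (typeSupport t))
  exact le_lpAgg (i := (⟨typeFull t, typeOrder α t⟩ : (_ : Finset (Fin s)) × (Fin s → ℕ))) hq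
    (Finset.mem_sigma.2 ⟨Finset.mem_powerset.2 (typeFull_subset t), typeOrder_mem_derivOrders t⟩)

/-- Hölder over the `(α + 1)^{|u|}` types with support `u`; this is the origin of that factor in
`weightH`. -/
lemma sum_typeNorm_le {γ : Finset ℕ → ℝ≥0} {q : ℝ≥0∞} (hq : 1 ≤ q) {f : (Fin s → ℝ) → ℝ}
    (h : sobolevNorm α γ q ⊤ f ≤ 1) (u : Finset (Fin s)) :
    ∑ t ∈ typesOn α u, typeNorm q f t ≤
      (((α + 1) ^ u.card : ℕ) : ℝ≥0∞) ^ (1 - (q⁻¹).toReal) * γ (u.map Fin.valEmbedding) := by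
  refine le_trans ?_ (mul_le_mul_right (lpAgg_le_of_sobolevNorm_le h u) _)
  refine sum_le_card_rpow_mul_lpAgg (a := fun i : (_ : Finset (Fin s)) × (Fin s → ℕ) =>
    eLpNorm (integrateOut i.1 (weakMixedDeriv f i.2)) q
      (volume.restrict (unitCube {j // j ∈ i.1}))) hq
    (fun t => ⟨typeFull t, typeOrder α t⟩) (fun t ht => ?_) (typeOrder_injOn.injOn)
    (card_typesOn u).le
  rw [← mem_typesOn.1 ht]
  exact Finset.mem_sigma.2
    ⟨Finset.mem_powerset.2 (typeFull_subset t), typeOrder_mem_derivOrders t⟩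

end NormBounds

section GridAverage

variable {b : ℕ} [hb : Fact b.Prime]

/-! ### Averages of the kernels over the equidistant grid -/

/-- The periodic version of the one-dimensional kernels. -/
noncomputable def periodicKernel (α t : ℕ) (x y : ℝ) : ℝ :=
  if t ≤ α then perBernoulli t x else -perBernoulli α (x - y)

lemma periodicKernel_eq {α t : ℕ} {x : ℝ} (hx : x ∈ Set.Ico (0 : ℝ) 1) (y : ℝ) :
    periodicKernel α t x y = sobolevKernel α t x y := by
  unfold periodicKernel sobolevKernel
  rw [perBernoulli_of_mem hx]

/-- The average of a one-dimensional kernel over the equidistant grid with `b ^ n` points. -/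
noncomputable def gridAvg (b α n t : ℕ) (y : ℝ) : ℝ :=
  (1 / (b : ℝ) ^ n) * ∑ i ∈ Finset.range (b ^ n), periodicKernel α t ((i : ℝ) / (b : ℝ) ^ n) y

/-- The multiplication theorem at the point `0`: a pure power of the mesh width, independent of `y`.
This exactness is what extrapolation exploits. -/
lemma gridAvg_of_le {α n t : ℕ} (ht : t ≤ α) (y : ℝ) :
    gridAvg b α n t y = normBernoulli t 0 * ((b : ℝ) ^ n)⁻¹ ^ t := by
  have h := sum_perBernoulli_grid t (pow_ne_zero n hb.out.ne_zero) 0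
  push_cast at h
  simp only [zero_add, mul_zero] at h
  simp only [gridAvg, periodicKernel, if_pos ht]
  rw [h, perBernoulli_of_mem (by simp), div_eq_mul_inv, inv_pow]

/-- The multiplication theorem at `-y`: the coefficient depends on `y`, but the order is already
`α`. -/
lemma gridAvg_of_lt {α n t : ℕ} (ht : α < t) (y : ℝ) :
    gridAvg b α n t y = -perBernoulli α ((b : ℝ) ^ n * -y) * ((b : ℝ) ^ n)⁻¹ ^ α := by
  have h := sum_perBernoulli_grid α (pow_ne_zero n hb.out.ne_zero) (-y)
  push_cast at h
  simp only [gridAvg, periodicKernel, if_neg (not_le.2 ht)]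
  rw [Finset.sum_neg_distrib, mul_neg, neg_mul, inv_pow, ← div_eq_mul_inv, ← h]
  simp_rw [neg_add_eq_sub]

lemma abs_normBernoulli_zero_le {α t : ℕ} (h1 : 1 ≤ t) (h2 : t ≤ α) :
    |normBernoulli t 0| ≤ bernoulliConst α ∧ ∀ x, |perBernoulli α x| ≤ bernoulliConst α := by
  obtain ⟨M, hM⟩ := exists_bound_on_unitInterval (continuous_normBernoulli α)
  have hbdd : BddAbove ((fun x => |normBernoulli α x|) '' Set.Ico (0 : ℝ) 1) := by
    refine ⟨M, ?_⟩
    rintro _ ⟨x, hx, rfl⟩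
    exact hM x (Set.Ico_subset_Icc_self hx)
  have hper : ∀ x, |perBernoulli α x| ≤ bernoulliConst α := fun x =>
    (le_csSup hbdd ⟨Int.fract x, ⟨Int.fract_nonneg x, Int.fract_lt_one x⟩, rfl⟩).trans (le_max_right _ _)
  refine ⟨?_, hper⟩
  rcases h2.lt_or_eq with h | rfl
  · have h3 := le_ciSup (f := fun τ : Fin (α - 1) => |normBernoulli ((τ : ℕ) + 1) 0|)
      (Set.finite_range _).bddAbove ⟨t - 1, by omega⟩
    simp only [Nat.sub_add_cancel h1] at h3
    exact h3.trans (le_max_left _ _)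
  · have := hper 0
    rwa [perBernoulli_of_mem (by simp)] at this

lemma bernoulliConst_nonneg {α : ℕ} (hα : 1 ≤ α) : 0 ≤ bernoulliConst α :=
  (abs_nonneg _).trans (abs_normBernoulli_zero_le hα le_rfl).1

lemma abs_gridAvg_le {α n t : ℕ} (hα : 1 ≤ α) (ht : t ≠ 0) (y : ℝ) :
    |gridAvg b α n t y| ≤ bernoulliConst α * ((b : ℝ) ^ n)⁻¹ ^ (min t α) := by
  have hpos : (0 : ℝ) ≤ ((b : ℝ) ^ n)⁻¹ := inv_nonneg.2 (pow_nonneg base_pos.le _)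
  rcases le_or_gt t α with h | h
  · rw [gridAvg_of_le h, abs_mul, min_eq_left h, abs_of_nonneg (pow_nonneg hpos _)]
    exact mul_le_mul_of_nonneg_right (abs_normBernoulli_zero_le (by omega) h).1 (pow_nonneg hpos _)
  · rw [gridAvg_of_lt h, abs_mul, abs_neg, min_eq_right h.le, abs_of_nonneg (pow_nonneg hpos _)]
    exact mul_le_mul_of_nonneg_right ((abs_normBernoulli_zero_le hα le_rfl).2 _) (pow_nonneg hpos _)

lemma gridAvg_zero (α n : ℕ) (y : ℝ) : gridAvg b α n 0 y = 1 := by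
  rw [gridAvg_of_le (Nat.zero_le _), normBernoulli_zero]; simp

lemma measurable_gridAvg (α n t : ℕ) : Measurable (gridAvg b α n t) := by
  rcases le_or_gt t α with h | h
  · rw [_root_.funext (gridAvg_of_le h)]; exact measurable_const
  · rw [_root_.funext (gridAvg_of_lt h)]
    exact (((measurable_perBernoulli α).comp (measurable_id.neg.const_mul _)).neg).mul_const _

/-- Bounds for the Walsh coefficients of the one-dimensional kernels. -/
noncomputable def typeBound (α t : ℕ) (k : (ZMod b)[X]) : ℝ :=
  if t = 0 then (if k = 0 then 1 else 0) else if t ≤ α then ‖walshCoeff t 0 k‖ else kernelBound α k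

lemma norm_walshHat_periodicKernel_le {α : ℕ} (hα : 1 ≤ α) (t : ℕ) {y : ℝ} (hy : y ∈ Set.Ico (0 : ℝ) 1)
    (k : (ZMod b)[X]) :
    ‖walshHat (fun x => (periodicKernel α t x y : ℂ)) k‖ ≤ typeBound α t k := by
  unfold typeBound periodicKernel walshHat
  by_cases h0 : t = 0
  · subst h0
    by_cases hk : k = 0
    · subst hk
      simp [perBernoulli, normBernoulli_zero]
    · simp [perBernoulli, normBernoulli_zero, integral_walsh hk, hk]
  · by_cases h1 : t ≤ α
    · simp [h0, h1, walshCoeff]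
    · simp only [if_neg h0, if_neg h1]
      have e : ∫ x in (0 : ℝ)..1, ((-perBernoulli α (x - y) : ℝ) : ℂ) * walsh k x =
          -walshCoeff α y k := by
        rw [walshCoeff, ← intervalIntegral.integral_neg]
        congr 1; funext x; push_cast; ring
      rw [e, norm_neg]
      exact norm_walshCoeff_le_kernelBound hα hy k

lemma continuousWithinAt_perBernoulli (t : ℕ) (x : ℝ) :
    ContinuousWithinAt (perBernoulli t) (Set.Ici x) x := by
  cases t with
  | zero =>
    have : perBernoulli 0 = fun _ => 1 := funext fun x => normBernoulli_zero _
    rw [this]; exact continuousWithinAt_const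
  | succ r => exact (perBernoulli_hasDerivWithinAt r x).continuousWithinAt

lemma continuousWithinAt_periodicKernel {α : ℕ} (hα : 2 ≤ α) (t : ℕ) (x y : ℝ) :
    ContinuousWithinAt (fun x => (periodicKernel α t x y : ℂ)) (Set.Ici x) x := by
  refine Complex.continuous_ofReal.continuousAt.comp_continuousWithinAt ?_
  unfold periodicKernel
  split_ifs
  · exact continuousWithinAt_perBernoulli t x
  · obtain ⟨r, rfl⟩ := Nat.exists_eq_add_of_le' hα
    exact ((continuous_perBernoulli r).comp
      (continuous_id.sub continuous_const)).neg.continuousWithinAt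

lemma measurable_periodicKernel (α t : ℕ) (y : ℝ) : Measurable fun x => periodicKernel α t x y := by
  unfold periodicKernel
  split_ifs
  · exact measurable_perBernoulli t
  · exact ((measurable_perBernoulli α).comp (measurable_id.sub_const y)).neg

lemma exists_periodicKernel_bound (α t : ℕ) (y : ℝ) : ∃ M : ℝ, ∀ x, ‖(periodicKernel α t x y : ℂ)‖ ≤ M := by
  unfold periodicKernel
  split_ifs
  · obtain ⟨M, _, hM⟩ := exists_perBernoulli_bound t
    exact ⟨M, fun x => by rw [Complex.norm_real]; exact hM x⟩
  · obtain ⟨M, _, hM⟩ := exists_perBernoulli_bound α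
    exact ⟨M, fun x => by rw [Complex.norm_real, norm_neg]; exact hM _⟩

variable {s : ℕ}

open Classical in
/-- The sum of the Walsh coefficient bounds of a type over the dual lattice. -/
noncomputable def typeDual {α : ℕ} (p : (ZMod b)[X]) (g : Fin s → (ZMod b)[X])
    (t : Fin s → Fin (α + 2)) : ℝ≥0∞ :=
  ∑' k : Fin s → (ZMod b)[X],
    if IsProperDual p g k then ∏ j, ENNReal.ofReal (typeBound α (t j) (k j)) else 0

/-- The bound does not depend on `y`, so it can be taken out of the integral against a derivative of
`f`. -/
lemma lattice_sub_grid_le {α : ℕ} (hα : 2 ≤ α) {p : (ZMod b)[X]} (hp : p ≠ 0)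
    (g : Fin s → (ZMod b)[X]) (t : Fin s → Fin (α + 2)) {y : Fin s → ℝ} (hy : y ∈ unitCube (Fin s)) :
    ENNReal.ofReal |latticeRule p g (fun x => ∏ j, sobolevKernel α (t j) (x j) (y j)) -
      ∏ j, gridAvg b α p.natDegree (t j) (y j)| ≤ typeDual p g t := by
  have h := norm_lattice_sub_grid_le hp g
    (h := fun j x => (periodicKernel α (t j) x (y j) : ℂ))
    (fun j => Complex.measurable_ofReal.comp (measurable_periodicKernel α (t j) (y j)))
    (fun j => exists_periodicKernel_bound α (t j) (y j))
    (fun j x _ => continuousWithinAt_periodicKernel hα (t j) x (y j))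
    (β := fun j k => typeBound α (t j) k)
    (fun j k => norm_walshHat_periodicKernel_le (by omega) (t j) (hy j (Set.mem_univ j)) k)
  refine le_trans (le_of_eq ?_) h
  rw [← Real.norm_eq_abs, ← Complex.norm_real]
  congr 2
  simp only [latticeRule, gridAvg]
  push_cast
  simp only [one_div]
  congr 2
  refine Finset.sum_congr rfl fun n _ => Finset.prod_congr rfl fun j _ => ?_
  rw [periodicKernel_eq (latticePoint_mem p g n j)]

lemma typeBound_nonneg {α : ℕ} (hα : 1 ≤ α) (t : ℕ) (k : (ZMod b)[X]) : 0 ≤ typeBound α t k :=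
  (norm_nonneg _).trans (norm_walshHat_periodicKernel_le hα t (Set.left_mem_Ico.2 zero_lt_one) k)

lemma sum_typeBound_le {α : ℕ} (hα : 2 ≤ α) (k : (ZMod b)[X]) :
    ∑ t ∈ Finset.univ.erase (0 : Fin (α + 2)), ENNReal.ofReal (typeBound α t k) ≤
      if k = 0 then 0 else ENNReal.ofReal (walshConst b α * ((b : ℝ) ^ muExp α k)⁻¹) := by
  have h1 : ∑ t ∈ Finset.univ.erase (0 : Fin (α + 2)), typeBound α t k =
      ∑ τ ∈ Finset.range α, ‖walshCoeff (τ + 1) 0 k‖ + kernelBound α k := by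
    have h2 := Finset.add_sum_erase Finset.univ (fun t : Fin (α + 2) => typeBound α t k)
      (Finset.mem_univ 0)
    rw [Fin.sum_univ_succ] at h2
    rw [add_left_cancel h2, Fin.sum_univ_eq_sum_range (fun t => typeBound α (t + 1) k) (α + 1) |>
      fun h => (Finset.sum_congr rfl fun t _ => by rw [Fin.val_succ]).trans h, Finset.sum_range_succ]
    congr 1
    · refine Finset.sum_congr rfl fun τ hτ => ?_
      have := Finset.mem_range.1 hτ
      rw [typeBound, if_neg (by omega), if_pos (by omega)]
    · rw [typeBound, if_neg (by omega), if_neg (by omega)]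
  rw [← ENNReal.ofReal_sum_of_nonneg fun t _ => typeBound_nonneg (by omega) _ _, h1]
  split_ifs with h0
  · subst h0
    rw [Finset.sum_eq_zero fun τ _ => by rw [walshCoeff_zero, norm_zero], kernelBound]
    simp
  · exact ENNReal.ofReal_le_ofReal (sum_walshCoeff_add_kernelBound_le hα h0)

/-- For a fixed dual vector the sum over types with support `u` factorizes, and each factor is the
one-dimensional total over all kernels. Summing over types costs nothing beyond `C_α`, and `q` plays
no role. -/
lemma sum_typeDual_le {α : ℕ} (hα : 2 ≤ α) (γ : Finset ℕ → ℝ≥0) (p : (ZMod b)[X])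
    (g : Fin s → (ZMod b)[X]) :
    ∑ t : Fin s → Fin (α + 2), (γ ((typeSupport t).map Fin.valEmbedding) : ℝ≥0∞) * typeDual p g t ≤
      figureOfMerit α γ p g := by
  classical
  have h1 : ∀ k : Fin s → (ZMod b)[X], ∀ u : Finset (Fin s),
      ∑ t ∈ typesOn α u, (γ ((typeSupport t).map Fin.valEmbedding) : ℝ≥0∞) *
        ∏ j, ENNReal.ofReal (typeBound α (t j) (k j)) ≤ dualTerm α γ u k := by
    intro k u
    rw [Finset.sum_congr rfl fun t ht => by rw [mem_typesOn.1 ht], ← Finset.mul_sum, dualTerm]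
    refine mul_le_mul_right ?_ _
    rw [typesOn, ← Finset.prod_univ_sum (fun j => if j ∈ u then Finset.univ.erase (0 : Fin (α + 2))
      else {0}) fun j t => ENNReal.ofReal (typeBound α t (k j))]
    refine Finset.prod_le_prod' fun j _ => ?_
    by_cases hj : j ∈ u
    · simp only [hj, if_true]
      exact sum_typeBound_le hα (k j)
    · simp only [hj, if_false, Finset.sum_singleton]
      rw [typeBound]
      simp only [Fin.val_zero, if_true]
      split_ifs <;> simp
  rw [figureOfMerit, ENNReal.tsum_prod']
  simp_rw [typeDual, ← ENNReal.tsum_mul_left, tsum_fintype]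
  rw [← Summable.tsum_finsetSum fun _ _ => ENNReal.summable]
  refine ENNReal.tsum_le_tsum fun k => ?_
  by_cases hk : IsProperDual p g k
  · simp only [hk, if_true]
    rw [sum_types_eq]
    exact Finset.sum_le_sum fun u _ => h1 k u
  · simp [hk]

end GridAverage

section SingleRule

variable {b : ℕ} [hb : Fact b.Prime] {s α : ℕ}

/-! ### The error of a single polynomial lattice rule -/

lemma MemSobolev.hasWeakMixedDeriv {γ : Finset ℕ → ℝ≥0} {q r : ℝ≥0∞} {f : (Fin s → ℝ) → ℝ}
    (h : MemSobolev α γ q r f) (β : Fin s → ℕ) (hβ : ∀ j, β j ≤ α) :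
    HasWeakMixedDeriv f β (weakMixedDeriv f β) := by
  have h1 := h.2.1 β hβ
  rw [weakMixedDeriv, dif_pos h1]
  exact h1.choose_spec

/-- The part of a function on which a lattice rule acts like the equidistant grid. -/
noncomputable def gridPart (b α n : ℕ) (f : (Fin s → ℝ) → ℝ) : ℝ :=
  ∑ t : Fin s → Fin (α + 2), ∫ y in unitCube (Fin s),
    weakMixedDeriv f (typeOrder α t) y * ∏ j, gridAvg b α n (t j) (y j)

lemma latticeRule_kernelIntegral (p : (ZMod b)[X]) (g : Fin s → (ZMod b)[X])
    (t : Fin s → Fin (α + 2)) {G : (Fin s → ℝ) → ℝ} (hG : IntegrableOn G (unitCube (Fin s))) :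
    latticeRule p g (kernelIntegral α t G) = ∫ y in unitCube (Fin s),
      G y * latticeRule p g (fun x => ∏ j, sobolevKernel α (t j) (x j) (y j)) := by
  obtain ⟨M, hM⟩ := exists_prod_kernel_bound t
  have hmem : ∀ n, latticePoint p g n ∈ unitCube (Fin s) := fun n j _ => latticePoint_mem p g n j
  have hint : ∀ n, IntegrableOn (fun y => G y * ∏ j, sobolevKernel α (t j) (latticePoint p g n j) (y j))
      (unitCube (Fin s)) := fun n =>
    hG.mul_bdd (c := M) (measurable_prod_kernel t _).aestronglyMeasurable
      (ae_of_all _ fun y => hM _ (hmem n) y)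
  simp only [latticeRule, kernelIntegral]
  rw [← integral_finsetSum _ fun n _ => hint n, ← integral_const_mul]
  congr 1
  funext y
  rw [← Finset.mul_sum]
  ring

lemma exists_gridAvg_prod_bound (hα : 1 ≤ α) (n : ℕ) (t : Fin s → Fin (α + 2)) (y : Fin s → ℝ) :
    |∏ j, gridAvg b α n (t j) (y j)| ≤ bernoulliConst α ^ (typeSupport t).card *
      ((b : ℝ) ^ n)⁻¹ ^ ∑ j, typeOrder α t j := by
  have hpos : (0 : ℝ) ≤ ((b : ℝ) ^ n)⁻¹ := inv_nonneg.2 (pow_nonneg base_pos.le _)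
  have e : bernoulliConst α ^ (typeSupport t).card * ((b : ℝ) ^ n)⁻¹ ^ ∑ j, typeOrder α t j =
      ∏ j, ((if j ∈ typeSupport t then bernoulliConst α else 1) * ((b : ℝ) ^ n)⁻¹ ^ typeOrder α t j) := by
    rw [Finset.prod_mul_distrib, Finset.prod_ite_mem, Finset.univ_inter, Finset.prod_const,
      Finset.prod_pow_eq_pow_sum]
  rw [e, Finset.abs_prod]
  refine Finset.prod_le_prod (fun _ _ => abs_nonneg _) fun j _ => ?_
  by_cases hj : t j = 0
  · have : j ∉ typeSupport t := by simp [typeSupport, hj]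
    simp [this, typeOrder, hj, gridAvg_zero]
  · have h1 : j ∈ typeSupport t := by simp [typeSupport, hj]
    rw [if_pos h1]
    exact abs_gridAvg_le hα (fun h => hj (Fin.ext h)) _

lemma measurable_gridAvg_prod (n : ℕ) (t : Fin s → Fin (α + 2)) :
    Measurable fun y : Fin s → ℝ => ∏ j, gridAvg b α n (t j) (y j) :=
  Finset.measurable_fun_prod _ fun j _ => (measurable_gridAvg α n (t j)).comp (measurable_pi_apply j)

/-- Only full kernels involve `y`; the other variables of the derivative can be integrated out, as
in the norm. -/
lemma gridAvg_prod_congr (n : ℕ) (t : Fin s → Fin (α + 2)) {y z : Fin s → ℝ}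
    (h : ∀ j ∈ typeFull t, y j = z j) :
    ∏ j, gridAvg b α n (t j) (y j) = ∏ j, gridAvg b α n (t j) (z j) := by
  refine Finset.prod_congr rfl fun j _ => ?_
  by_cases hj : j ∈ typeFull t
  · rw [h j hj]
  · have : (t j : ℕ) ≤ α := by
      simp only [typeFull, Finset.mem_filter, Finset.mem_univ, true_and] at hj
      have := (t j).2
      omega
    rw [gridAvg_of_le this, gridAvg_of_le this]

lemma sobolevKernel_prod_congr (t : Fin s → Fin (α + 2)) (x : Fin s → ℝ) {y z : Fin s → ℝ}
    (h : ∀ j ∈ typeFull t, y j = z j) :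
    ∏ j, sobolevKernel α (t j) (x j) (y j) = ∏ j, sobolevKernel α (t j) (x j) (z j) := by
  refine Finset.prod_congr rfl fun j _ => ?_
  by_cases hj : j ∈ typeFull t
  · rw [h j hj]
  · have : (t j : ℕ) ≤ α := by
      simp only [typeFull, Finset.mem_filter, Finset.mem_univ, true_and] at hj
      have := (t j).2
      omega
    rw [sobolevKernel, sobolevKernel, if_pos this, if_pos this]

/-- Insert the representation of `f`. Each type contributes its part of the norm, at most the weight
of its support, times the sum of its Walsh bounds over the proper dual vectors. -/
lemma ofReal_latticeRule_sub_gridPart_le (hα : 2 ≤ α) {γ : Finset ℕ → ℝ≥0} {q : ℝ≥0∞} (hq : 1 ≤ q)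
    {f : (Fin s → ℝ) → ℝ} (hf : MemSobolev α γ q ⊤ f) (hf1 : sobolevNorm α γ q ⊤ f ≤ 1)
    {p : (ZMod b)[X]} (hp : p ≠ 0) (g : Fin s → (ZMod b)[X]) :
    ENNReal.ofReal |latticeRule p g f - gridPart b α p.natDegree f| ≤ figureOfMerit α γ p g := by
  have hG := hf.hasWeakMixedDeriv
  have hGi : ∀ t : Fin s → Fin (α + 2), IntegrableOn (weakMixedDeriv f (typeOrder α t))
      (unitCube (Fin s)) := fun t => (hG _ fun _ => min_le_right _ _).1
  have hrep := eqOn_sum_kernelIntegral hα hf.1 hG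
  have hmem : ∀ n, latticePoint p g n ∈ unitCube (Fin s) := fun n j _ => latticePoint_mem p g n j
  by_cases htop : figureOfMerit α γ p g = ⊤
  · rw [htop]; exact le_top
  set h : (Fin s → Fin (α + 2)) → (Fin s → ℝ) → ℝ := fun t y =>
    latticeRule p g (fun x => ∏ j, sobolevKernel α (t j) (x j) (y j)) -
      ∏ j, gridAvg b α p.natDegree (t j) (y j) with hh
  have hlm : ∀ t : Fin s → Fin (α + 2), Measurable fun y : Fin s → ℝ =>
      latticeRule p g (fun x => ∏ j, sobolevKernel α (t j) (x j) (y j)) := fun t =>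
    (Finset.measurable_fun_sum _ fun n _ => measurable_prod_kernel t _).const_mul _
  have hmeas : ∀ t, Measurable (h t) := fun t => (hlm t).sub (measurable_gridAvg_prod _ t)
  have hint1 : ∀ t : Fin s → Fin (α + 2), IntegrableOn (fun y => weakMixedDeriv f (typeOrder α t) y *
      latticeRule p g (fun x => ∏ j, sobolevKernel α (t j) (x j) (y j))) (unitCube (Fin s)) := by
    intro t
    obtain ⟨M, hM⟩ := exists_prod_kernel_bound t
    refine (hGi t).mul_bdd (c := (1 / (b : ℝ) ^ p.natDegree) * ∑ n ∈ Finset.range (b ^ p.natDegree), M)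
      (hlm t).aestronglyMeasurable (ae_of_all _ fun y => ?_)
    rw [latticeRule, norm_mul, Real.norm_of_nonneg (by positivity)]
    refine mul_le_mul_of_nonneg_left ((norm_sum_le _ _).trans (Finset.sum_le_sum fun n _ => ?_))
      (by positivity)
    exact hM _ (hmem n) y
  have hint2 : ∀ t : Fin s → Fin (α + 2), IntegrableOn (fun y => weakMixedDeriv f (typeOrder α t) y *
      ∏ j, gridAvg b α p.natDegree (t j) (y j)) (unitCube (Fin s)) := fun t =>
    (hGi t).mul_bdd (measurable_gridAvg_prod _ t).aestronglyMeasurable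
      (ae_of_all _ fun y => exists_gridAvg_prod_bound (by omega) _ t y)
  have e1 : latticeRule p g f - gridPart b α p.natDegree f =
      ∑ t : Fin s → Fin (α + 2), ∫ y in unitCube (Fin s), weakMixedDeriv f (typeOrder α t) y * h t y := by
    have e2 : latticeRule p g f = ∑ t : Fin s → Fin (α + 2),
        latticeRule p g (kernelIntegral α t (weakMixedDeriv f (typeOrder α t))) := by
      simp only [latticeRule]
      rw [Finset.sum_congr rfl fun n _ => hrep (hmem n), Finset.sum_comm, Finset.mul_sum]
    rw [e2, gridPart, ← Finset.sum_sub_distrib]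
    refine Finset.sum_congr rfl fun t _ => ?_
    rw [latticeRule_kernelIntegral p g t (hGi t), ← integral_sub (hint1 t) (hint2 t)]
    congr 1; funext y; simp only [hh]; ring
  have hbound : ∀ t : Fin s → Fin (α + 2),
      ENNReal.ofReal |∫ y in unitCube (Fin s), weakMixedDeriv f (typeOrder α t) y * h t y| ≤
        γ ((typeSupport t).map Fin.valEmbedding) * typeDual p g t := by
    intro t
    -- The product `0 · ∞`: as the total is finite, an infinite dual sum forces the weight to
    -- vanish. Then the derivative contributes nothing, and any finite bound for the kernel
    -- suffices.
    by_cases hd : typeDual p g t = ⊤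
    · have h0 : (γ ((typeSupport t).map Fin.valEmbedding) : ℝ≥0∞) = 0 := by
        by_contra hne
        refine htop (top_le_iff.1 (le_trans ?_ (sum_typeDual_le hα γ p g)))
        refine le_trans ?_ (Finset.single_le_sum (f := fun t : Fin s → Fin (α + 2) =>
          (γ ((typeSupport t).map Fin.valEmbedding) : ℝ≥0∞) * typeDual p g t)
          (fun _ _ => zero_le) (Finset.mem_univ t))
        rw [hd, ENNReal.mul_top hne]
      have hN : typeNorm q f t = 0 := le_antisymm ((typeNorm_le hq hf1 t).trans h0.le) zero_le
      obtain ⟨M, hM⟩ := exists_prod_kernel_bound t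
      have h3 := ofReal_abs_integral_mul_le (typeFull t) (hGi t) (hmeas t)
        (B := (1 / (b : ℝ) ^ p.natDegree) * ∑ n ∈ Finset.range (b ^ p.natDegree), M +
          bernoulliConst α ^ (typeSupport t).card *
            ((b : ℝ) ^ p.natDegree)⁻¹ ^ ∑ j, typeOrder α t j) ?_ ?_ hq
      · refine h3.trans ?_
        change _ * typeNorm q f t ≤ _
        rw [hN, mul_zero]; exact zero_le
      · intro y z hyz
        simp only [hh]
        rw [gridAvg_prod_congr _ t hyz, funext fun x => sobolevKernel_prod_congr t x hyz]
      · intro y _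
        refine (abs_sub _ _).trans (add_le_add ?_ (exists_gridAvg_prod_bound (by omega) _ t y))
        rw [latticeRule, abs_mul, abs_of_nonneg (by positivity : (0 : ℝ) ≤ 1 / (b : ℝ) ^ p.natDegree)]
        refine mul_le_mul_of_nonneg_left ((Finset.abs_sum_le_sum_abs _ _).trans
          (Finset.sum_le_sum fun n _ => ?_)) (by positivity)
        exact hM _ (hmem n) y
    · have h3 := ofReal_abs_integral_mul_le (typeFull t) (hGi t) (hmeas t)
        (B := (typeDual p g t).toReal) ?_ ?_ hq
      · rw [ENNReal.ofReal_toReal hd, mul_comm] at h3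
        exact h3.trans (mul_le_mul_left (typeNorm_le hq hf1 t) _)
      · intro y z hyz
        simp only [hh]
        rw [gridAvg_prod_congr _ t hyz, funext fun x => sobolevKernel_prod_congr t x hyz]
      · intro y hy
        exact (ENNReal.ofReal_le_iff_le_toReal hd).1 (lattice_sub_grid_le hα hp g t hy)
  rw [e1]
  calc _ ≤ ENNReal.ofReal (∑ t : Fin s → Fin (α + 2),
        |∫ y in unitCube (Fin s), weakMixedDeriv f (typeOrder α t) y * h t y|) :=
        ENNReal.ofReal_le_ofReal (Finset.abs_sum_le_sum_abs _ _)
    _ = ∑ t : Fin s → Fin (α + 2), ENNReal.ofReal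
        |∫ y in unitCube (Fin s), weakMixedDeriv f (typeOrder α t) y * h t y| :=
        ENNReal.ofReal_sum_of_nonneg fun _ _ => abs_nonneg _
    _ ≤ ∑ t : Fin s → Fin (α + 2), γ ((typeSupport t).map Fin.valEmbedding) * typeDual p g t :=
        Finset.sum_le_sum fun t _ => hbound t
    _ ≤ _ := sum_typeDual_le hα γ p g

end SingleRule

section Extrapolation

variable {b : ℕ} [hb : Fact b.Prime] {s α : ℕ}

/-! ### The error of the extrapolated rule -/

/-- All kernels except the constant one have mean zero in `x`. -/
lemma sobolevFactor_one (hα : 1 ≤ α) (t : ℕ) {y : ℝ} (hy : y ∈ Set.Icc (0 : ℝ) 1) :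
    sobolevFactor α t (fun _ => 1) y = if t = 0 then 1 else 0 := by
  rw [sobolevFactor_eq hα t contDiff_const hy]
  simp only [one_mul, sobolevKernel]
  split_ifs with h1 h2 h2
  · subst h2; simp [normBernoulli_zero]
  · obtain ⟨r, rfl⟩ := Nat.exists_eq_succ_of_ne_zero h2
    exact integral_normBernoulli r
  · omega
  · obtain ⟨r, rfl⟩ := Nat.exists_eq_add_of_le' hα
    rw [intervalIntegral.integral_neg, integral_perBernoulli_sub, neg_zero]

/-- Integrating the representation term by term, every type other than zero contains a kernel of
mean zero. -/
lemma integral_eq_integral_weakMixedDeriv (hα : 2 ≤ α) {γ : Finset ℕ → ℝ≥0} {q : ℝ≥0∞}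
    {f : (Fin s → ℝ) → ℝ} (hf : MemSobolev α γ q ⊤ f) :
    ∫ x in unitCube (Fin s), f x = ∫ x in unitCube (Fin s),
      weakMixedDeriv f (typeOrder α (0 : Fin s → Fin (α + 2))) x := by
  have hG := hf.hasWeakMixedDeriv
  have hGi : ∀ t : Fin s → Fin (α + 2), IntegrableOn (weakMixedDeriv f (typeOrder α t))
      (unitCube (Fin s)) := fun t => (hG _ fun _ => min_le_right _ _).1
  have hRi : ∀ t : Fin s → Fin (α + 2), IntegrableOn
      (kernelIntegral α t (weakMixedDeriv f (typeOrder α t))) (unitCube (Fin s)) := by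
    intro t
    obtain ⟨M, hM⟩ := exists_prod_kernel_bound t
    have hfin : IsFiniteMeasure (volume.restrict (unitCube (Fin s))) := ⟨by
      rw [Measure.restrict_apply_univ, unitCube, volume_pi_pi]; simp⟩
    refine Integrable.of_bound
      ((continuousOn_kernelIntegral hα t (hGi t)).aestronglyMeasurable (measurableSet_unitCube _))
      (∫ y in unitCube (Fin s), ‖weakMixedDeriv f (typeOrder α t) y‖ * M) ?_
    filter_upwards [ae_restrict_mem (measurableSet_unitCube (Fin s))] with x hx
    refine norm_integral_le_of_norm_le ((hGi t).norm.mul_const _) (ae_of_all _ fun y => ?_)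
    rw [norm_mul]
    exact mul_le_mul_of_nonneg_left (hM x hx y) (norm_nonneg _)
  rw [setIntegral_congr_fun (measurableSet_unitCube _) (eqOn_sum_kernelIntegral hα hf.1 hG),
    integral_finsetSum _ fun t _ => hRi t]
  have h1 : ∀ t : Fin s → Fin (α + 2), ∫ x in unitCube (Fin s),
      kernelIntegral α t (weakMixedDeriv f (typeOrder α t)) x =
      ∫ y in unitCube (Fin s), if t = 0 then weakMixedDeriv f (typeOrder α t) y else 0 := by
    intro t
    have h2 := tensorPairing_sobolevFactor (by omega : 1 ≤ α) t (hGi t)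
      (φ := fun _ _ => 1) fun _ => contDiff_const
    simp only [tensorProd, Finset.prod_const_one, one_mul] at h2
    rw [← h2, tensorPairing]
    refine setIntegral_congr_fun (measurableSet_unitCube _) fun y hy => ?_
    have h3 : ∀ j, sobolevFactor α (t j) (fun _ => 1) (y j) = if t j = 0 then 1 else 0 := fun j => by
      rw [sobolevFactor_one (by omega) _ (Set.Ico_subset_Icc_self (hy j (Set.mem_univ j)))]
      have h4 : (t j : ℕ) = 0 ↔ t j = 0 := ⟨fun h => Fin.ext h, fun h => by rw [h]; rfl⟩
      simp only [h4]
    simp only [tensorProd, h3]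
    split_ifs with ht
    · simp [ht]
    · obtain ⟨j, hj⟩ : ∃ j, t j ≠ 0 := by
        by_contra hcon
        push Not at hcon
        exact ht (funext hcon)
      rw [Finset.prod_eq_zero (Finset.mem_univ j) (if_neg hj), mul_zero]
  rw [Finset.sum_congr rfl fun t _ => h1 t, Finset.sum_eq_single (0 : Fin s → Fin (α + 2))]
  · simp
  · intro t _ ht
    simp [ht]
  · simp

/-- The sum of the absolute values of the extrapolation coefficients. -/
noncomputable def richardsonSum (b α : ℕ) : ℝ := ∑ τ ∈ Finset.Icc 1 α, |richardsonCoeff b α τ|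

lemma richardsonSum_nonneg (b α : ℕ) : 0 ≤ richardsonSum b α :=
  Finset.sum_nonneg fun _ _ => abs_nonneg _

/-- Extrapolation annihilates the leading terms of the grid error of each kernel. -/
lemma abs_sum_richardson_gridAvg_le (hα : 2 ≤ α) {m : ℕ} (hm : α ≤ m) {t : Fin s → Fin (α + 2)}
    (ht : t ≠ 0) (y : Fin s → ℝ) :
    |∑ τ ∈ Finset.Icc 1 α, richardsonCoeff b α τ * ∏ j, gridAvg b α (m - τ + 1) (t j) (y j)| ≤
      richardsonSum b α * ((b : ℝ) ^ (α - 1) / (b : ℝ) ^ m) ^ α *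
        bernoulliConst α ^ (typeSupport t).card := by
  have hD := bernoulliConst_nonneg (by omega : 1 ≤ α)
  have hb1 : (1 : ℝ) ≤ b := by linarith [two_le_base (b := b)]
  have hb0 : (0 : ℝ) < b := base_pos
  rcases le_or_gt α (∑ j, typeOrder α t j) with h | h
  -- Total order at least `α`: no cancellation is needed. The coarsest grid has exponent `m - α +
  -- 1`, hence the mesh width `b^{α-1} / b^m`.
  · have h1 : ∀ τ ∈ Finset.Icc 1 α, |∏ j, gridAvg b α (m - τ + 1) (t j) (y j)| ≤
        bernoulliConst α ^ (typeSupport t).card * ((b : ℝ) ^ (α - 1) / (b : ℝ) ^ m) ^ α := by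
      intro τ hτ
      have hτ := Finset.mem_Icc.1 hτ
      refine (exists_gridAvg_prod_bound (by omega) _ t y).trans
        (mul_le_mul_of_nonneg_left ?_ (pow_nonneg hD _))
      have hinv : ((b : ℝ) ^ (m - τ + 1))⁻¹ ≤ 1 := inv_le_one_of_one_le₀ (one_le_pow₀ hb1)
      refine (pow_le_pow_of_le_one (by positivity) hinv h).trans (pow_le_pow_left₀ (by positivity) ?_ _)
      rw [inv_le_iff_one_le_mul₀ (by positivity), div_mul_eq_mul_div, le_div_iff₀ (by positivity), one_mul,
        ← pow_add]
      exact pow_le_pow_right₀ hb1 (by omega)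
    refine (Finset.abs_sum_le_sum_abs _ _).trans ?_
    rw [richardsonSum, Finset.sum_mul, Finset.sum_mul]
    refine Finset.sum_le_sum fun τ hτ => ?_
    rw [abs_mul, mul_assoc, mul_comm ((_ / _) ^ α)]
    exact mul_le_mul_of_nonneg_left (h1 τ hτ) (abs_nonneg _)
  -- Total order below `α` excludes full kernels, each of which has order `α` by itself, so the grid
  -- averages are exact powers.
  · have hle : ∀ j, (t j : ℕ) ≤ α := by
      intro j
      by_contra hcon
      have h2 := Finset.single_le_sum (f := fun j => typeOrder α t j) (fun _ _ => Nat.zero_le _)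
        (Finset.mem_univ j)
      simp only [typeOrder] at h2 h
      omega
    have hzero : ∑ τ ∈ Finset.Icc 1 α, richardsonCoeff b α τ *
        ∏ j, gridAvg b α (m - τ + 1) (t j) (y j) = 0 := by
      have hpos : (∑ j, typeOrder α t j) ≠ 0 := by
        obtain ⟨j, hj⟩ : ∃ j, t j ≠ 0 := by
          by_contra hcon
          push Not at hcon
          exact ht (_root_.funext hcon)
        intro h0
        have := (Finset.sum_eq_zero_iff.1 h0) j (Finset.mem_univ j)
        have hj' : (t j : ℕ) ≠ 0 := fun h => hj (Fin.ext h)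
        simp only [typeOrder] at this
        omega
      have hR := sum_richardsonCoeff_mul_pow (hb.out.two_le) h
      rw [if_neg hpos] at hR
      have e : ∀ τ ∈ Finset.Icc 1 α, richardsonCoeff b α τ *
          ∏ j, gridAvg b α (m - τ + 1) (t j) (y j) =
          (∏ j, normBernoulli (t j) 0) * ((b : ℝ) ^ (m + 1))⁻¹ ^ (∑ j, typeOrder α t j) *
            (richardsonCoeff b α τ * ((b : ℝ) ^ τ) ^ ∑ j, typeOrder α t j) := by
        intro τ hτ
        have hτ := Finset.mem_Icc.1 hτ
        -- The mesh widths are proportional to `b^τ`, the interpolation nodes of the extrapolation.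
        have h4 : ((b : ℝ) ^ (m - τ + 1))⁻¹ = ((b : ℝ) ^ (m + 1))⁻¹ * (b : ℝ) ^ τ := by
          have h5 : (b : ℝ) ^ (m + 1) = (b : ℝ) ^ (m - τ + 1) * (b : ℝ) ^ τ := by
            rw [← pow_add]; congr 1; omega
          rw [h5, mul_inv, mul_assoc, inv_mul_cancel₀ (by positivity), mul_one]
        have h6 : ∀ j, gridAvg b α (m - τ + 1) (t j) (y j) =
            normBernoulli (t j) 0 * (((b : ℝ) ^ (m + 1))⁻¹ * (b : ℝ) ^ τ) ^ typeOrder α t j := by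
          intro j
          rw [gridAvg_of_le (hle j), h4, typeOrder, min_eq_left (hle j)]
        simp_rw [h6]
        rw [Finset.prod_mul_distrib, Finset.prod_pow_eq_pow_sum, mul_pow]
        ring
      rw [Finset.sum_congr rfl e, ← Finset.mul_sum, hR, mul_zero]
    rw [hzero, abs_zero]
    exact mul_nonneg (mul_nonneg (richardsonSum_nonneg _ _) (by positivity)) (pow_nonneg hD _)

/-- Type zero gives the integral because the coefficients sum to `1`; every other type has the
extrapolated order `α`, and summation over types yields `weightH`. -/
lemma ofReal_sum_gridPart_sub_le (hα : 2 ≤ α) {m : ℕ} (hm : α ≤ m) {γ : Finset ℕ → ℝ≥0} {q : ℝ≥0∞}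
    (hq : 1 ≤ q) {f : (Fin s → ℝ) → ℝ} (hf : MemSobolev α γ q ⊤ f) (hf1 : sobolevNorm α γ q ⊤ f ≤ 1) :
    ENNReal.ofReal |∑ τ ∈ Finset.Icc 1 α, richardsonCoeff b α τ * gridPart b α (m - τ + 1) f -
        ∫ x in unitCube (Fin s), f x| ≤
      ENNReal.ofReal (richardsonSum b α * ((b : ℝ) ^ (α - 1) / (b : ℝ) ^ m) ^ α * weightH α q γ s) := by
  have hD := bernoulliConst_nonneg (by omega : 1 ≤ α)
  have hb0 : (0 : ℝ) < b := base_pos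
  have hG := hf.hasWeakMixedDeriv
  have hGi : ∀ t : Fin s → Fin (α + 2), IntegrableOn (weakMixedDeriv f (typeOrder α t))
      (unitCube (Fin s)) := fun t => (hG _ fun _ => min_le_right _ _).1
  set c : ℝ := richardsonSum b α * ((b : ℝ) ^ (α - 1) / (b : ℝ) ^ m) ^ α with hc
  have hc0 : 0 ≤ c := mul_nonneg (richardsonSum_nonneg _ _) (by positivity)
  set h : (Fin s → Fin (α + 2)) → (Fin s → ℝ) → ℝ := fun t y =>
    ∑ τ ∈ Finset.Icc 1 α, richardsonCoeff b α τ * ∏ j, gridAvg b α (m - τ + 1) (t j) (y j) with hh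
  have hmeas : ∀ t, Measurable (h t) := fun t =>
    Finset.measurable_fun_sum _ fun τ _ => (measurable_gridAvg_prod _ t).const_mul _
  have e1 : ∑ τ ∈ Finset.Icc 1 α, richardsonCoeff b α τ * gridPart b α (m - τ + 1) f =
      ∑ t : Fin s → Fin (α + 2), ∫ y in unitCube (Fin s), weakMixedDeriv f (typeOrder α t) y * h t y := by
    simp only [gridPart]
    simp_rw [Finset.mul_sum]
    rw [Finset.sum_comm]
    refine Finset.sum_congr rfl fun t _ => ?_
    have hi : ∀ τ, IntegrableOn (fun y => weakMixedDeriv f (typeOrder α t) y *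
        (richardsonCoeff b α τ * ∏ j, gridAvg b α (m - τ + 1) (t j) (y j))) (unitCube (Fin s)) := by
      intro τ
      refine (hGi t).mul_bdd (c := |richardsonCoeff b α τ| * (bernoulliConst α ^ (typeSupport t).card *
        ((b : ℝ) ^ (m - τ + 1))⁻¹ ^ ∑ j, typeOrder α t j))
        ((measurable_gridAvg_prod _ t).const_mul _).aestronglyMeasurable (ae_of_all _ fun y => ?_)
      rw [norm_mul]
      exact mul_le_mul_of_nonneg_left (exists_gridAvg_prod_bound (by omega) _ t y) (abs_nonneg _)
    simp only [hh, Finset.mul_sum]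
    rw [integral_finsetSum _ fun τ _ => hi τ]
    refine Finset.sum_congr rfl fun τ _ => ?_
    rw [← integral_const_mul]
    congr 1; funext y; ring
  have hzero : ∫ y in unitCube (Fin s), weakMixedDeriv f (typeOrder α (0 : Fin s → Fin (α + 2))) y *
      h 0 y = ∫ x in unitCube (Fin s), f x := by
    rw [integral_eq_integral_weakMixedDeriv hα hf]
    congr 1; funext y
    have hR := sum_richardsonCoeff_mul_pow (α := α) (t := 0) (hb.out.two_le) (by omega)
    simp only [pow_zero, mul_one, if_true] at hR
    simp [hh, gridAvg_zero, hR]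
  have e2 : ∑ τ ∈ Finset.Icc 1 α, richardsonCoeff b α τ * gridPart b α (m - τ + 1) f -
      ∫ x in unitCube (Fin s), f x = ∑ t ∈ Finset.univ.erase (0 : Fin s → Fin (α + 2)),
        ∫ y in unitCube (Fin s), weakMixedDeriv f (typeOrder α t) y * h t y := by
    rw [e1, ← Finset.add_sum_erase _ _ (Finset.mem_univ (0 : Fin s → Fin (α + 2))), hzero,
      add_sub_cancel_left]
  have hterm : ∀ t ∈ Finset.univ.erase (0 : Fin s → Fin (α + 2)),
      ENNReal.ofReal |∫ y in unitCube (Fin s), weakMixedDeriv f (typeOrder α t) y * h t y| ≤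
        ENNReal.ofReal (c * bernoulliConst α ^ (typeSupport t).card) * typeNorm q f t := by
    intro t ht
    refine ofReal_abs_integral_mul_le (typeFull t) (hGi t) (hmeas t) ?_ ?_ hq
    · intro y z hyz
      simp only [hh]
      exact Finset.sum_congr rfl fun τ _ => by rw [gridAvg_prod_congr _ t hyz]
    · intro y _
      exact abs_sum_richardson_gridAvg_le hα hm (Finset.ne_of_mem_erase ht) y
  rw [e2]
  calc _ ≤ ENNReal.ofReal (∑ t ∈ Finset.univ.erase (0 : Fin s → Fin (α + 2)),
        |∫ y in unitCube (Fin s), weakMixedDeriv f (typeOrder α t) y * h t y|) :=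
        ENNReal.ofReal_le_ofReal (Finset.abs_sum_le_sum_abs _ _)
    _ = ∑ t ∈ Finset.univ.erase (0 : Fin s → Fin (α + 2)), ENNReal.ofReal
        |∫ y in unitCube (Fin s), weakMixedDeriv f (typeOrder α t) y * h t y| :=
        ENNReal.ofReal_sum_of_nonneg fun _ _ => abs_nonneg _
    _ ≤ ∑ t ∈ Finset.univ.erase (0 : Fin s → Fin (α + 2)),
        ENNReal.ofReal (c * bernoulliConst α ^ (typeSupport t).card) * typeNorm q f t :=
        Finset.sum_le_sum hterm
    _ ≤ ∑ t, ENNReal.ofReal (c * bernoulliConst α ^ (typeSupport t).card) * typeNorm q f t :=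
        Finset.sum_le_sum_of_subset (Finset.erase_subset _ _)
    _ = ∑ u : Finset (Fin s), ENNReal.ofReal (c * bernoulliConst α ^ u.card) *
        ∑ t ∈ typesOn α u, typeNorm q f t := by
        rw [sum_types_eq]
        refine Finset.sum_congr rfl fun u _ => ?_
        rw [Finset.mul_sum]
        exact Finset.sum_congr rfl fun t ht => by rw [mem_typesOn.1 ht]
    _ ≤ ∑ u : Finset (Fin s), ENNReal.ofReal (c * bernoulliConst α ^ u.card) *
        ((((α + 1) ^ u.card : ℕ) : ℝ≥0∞) ^ (1 - (q⁻¹).toReal) * γ (u.map Fin.valEmbedding)) :=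
        Finset.sum_le_sum fun u _ => mul_le_mul_right (sum_typeNorm_le hq hf1 u) _
    _ = ENNReal.ofReal (c * weightH α q γ s) := by
        rw [weightH, sum_powerset_range, Finset.mul_sum, ENNReal.ofReal_sum_of_nonneg]
        · refine Finset.sum_congr rfl fun u _ => ?_
          have hN : (0 : ℝ) < ((α + 1) ^ u.card : ℕ) := by positivity
          rw [← ENNReal.ofReal_natCast, ENNReal.ofReal_rpow_of_pos hN, ← ENNReal.ofReal_coe_nnreal,
            ← ENNReal.ofReal_mul (by positivity),
            ← ENNReal.ofReal_mul (mul_nonneg hc0 (pow_nonneg hD _)), Finset.card_map]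
          congr 1
          push_cast
          rw [← Real.rpow_natCast ((α : ℝ) + 1), ← Real.rpow_mul (by positivity)]
          ring
        · intro u _
          exact mul_nonneg hc0 (mul_nonneg (by positivity) (pow_nonneg hD _))

lemma worstCaseError_le (hα : 2 ≤ α) {m : ℕ} (hm : α ≤ m) (γ : Finset ℕ → ℝ≥0) {q : ℝ≥0∞}
    (hq : 1 ≤ q) {p : ℕ → (ZMod b)[X]}
    (hp : ∀ n, m - α + 1 ≤ n → n ≤ m → Irreducible (p n) ∧ (p n).natDegree = n)
    (g : ℕ → Fin s → (ZMod b)[X]) :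
    worstCaseError α γ q ⊤ m p g ≤
      ∑ τ ∈ Finset.Icc 1 α, ENNReal.ofReal |richardsonCoeff b α τ| *
        figureOfMerit α γ (p (m - τ + 1)) (g (m - τ + 1)) +
      ENNReal.ofReal (richardsonSum b α * ((b : ℝ) ^ (α - 1) / (b : ℝ) ^ m) ^ α * weightH α q γ s) := by
  refine iSup₂_le fun f hf => ?_
  have e : extrapolatedRule α m p g f - ∫ x in unitCube (Fin s), f x =
      ∑ τ ∈ Finset.Icc 1 α, richardsonCoeff b α τ *
        (latticeRule (p (m - τ + 1)) (g (m - τ + 1)) f - gridPart b α (m - τ + 1) f) +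
      (∑ τ ∈ Finset.Icc 1 α, richardsonCoeff b α τ * gridPart b α (m - τ + 1) f -
        ∫ x in unitCube (Fin s), f x) := by
    rw [extrapolatedRule]
    simp_rw [mul_sub]
    rw [Finset.sum_sub_distrib]
    ring
  rw [e]
  refine (ENNReal.ofReal_le_ofReal (abs_add_le _ _)).trans
    (ENNReal.ofReal_add_le.trans (add_le_add ?_ (ofReal_sum_gridPart_sub_le hα hm hq hf.1 hf.2)))
  refine (ENNReal.ofReal_le_ofReal (Finset.abs_sum_le_sum_abs _ _)).trans ?_
  rw [ENNReal.ofReal_sum_of_nonneg fun _ _ => abs_nonneg _]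
  refine Finset.sum_le_sum fun τ hτ => ?_
  have hτ := Finset.mem_Icc.1 hτ
  obtain ⟨hirr, hdeg⟩ := hp (m - τ + 1) (by omega) (by omega)
  rw [abs_mul, ENNReal.ofReal_mul (abs_nonneg _)]
  refine mul_le_mul_right ?_ _
  have := ofReal_latticeRule_sub_gridPart_le hα hq hf.1 hf.2 hirr.ne_zero (g (m - τ + 1))
  rwa [hdeg] at this

end Extrapolation

section Rate

variable {b : ℕ} [hb : Fact b.Prime] {α : ℕ}

/-! ### The convergence rate -/

lemma weightJ_nonneg (hα : 2 ≤ α) {lam : ℝ} (hlam : 1 / (α : ℝ) < lam) (γ : Finset ℕ → ℝ≥0) (s : ℕ) :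
    0 ≤ weightJ b α lam γ s :=
  Real.rpow_nonneg (Finset.sum_nonneg fun u _ => mul_nonneg (mul_nonneg
    (Real.rpow_nonneg (NNReal.coe_nonneg _) _) (Real.rpow_nonneg (walshConst_nonneg (b := b) hα) _))
    (pow_nonneg (sumConst_nonneg (b := b) (by omega) hlam) _)) _

lemma weightH_nonneg (hα : 1 ≤ α) (q : ℝ≥0∞) (γ : Finset ℕ → ℝ≥0) (s : ℕ) : 0 ≤ weightH α q γ s :=
  Finset.sum_nonneg fun u _ => mul_nonneg (by positivity) (pow_nonneg (bernoulliConst_nonneg hα) _)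

lemma totalPoints_bounds (hα : 1 ≤ α) {m : ℕ} (hm : α ≤ m) :
    0 < (totalPoints b α m : ℝ) ∧ (totalPoints b α m : ℝ) ≤ α * (b : ℝ) ^ m := by
  have hb1 : (1 : ℝ) ≤ b := by linarith [two_le_base (b := b)]
  have hb0 : (0 : ℝ) < b := base_pos
  rw [totalPoints]
  push_cast
  constructor
  · exact Finset.sum_pos (fun _ _ => pow_pos hb0 _) ⟨m, Finset.mem_Icc.2 ⟨by omega, le_rfl⟩⟩
  · refine (Finset.sum_le_card_nsmul _ _ ((b : ℝ) ^ m) fun n hn =>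
      pow_le_pow_right₀ hb1 (Finset.mem_Icc.1 hn).2).trans (le_of_eq ?_)
    rw [Nat.card_Icc, nsmul_eq_mul]
    congr 2
    omega

/-- The constant in the general error bound. -/
noncomputable def rateConst (b α : ℕ) (lam : ℝ) : ℝ :=
  richardsonSum b α * (2 * α * (b : ℝ) ^ (α - 1)) ^ (1 / lam)

/-- Both error terms are compared with `(N/c)^{-1/λ}` for one constant `c`. All moduli have degree
at least `m - α + 1`, which is comparable with `N` up to constants depending on `b` and `α`. -/
lemma hasErrorBound_of_figureOfMerit_le (hα : 2 ≤ α) (γ : Finset ℕ → ℝ≥0) {q : ℝ≥0∞} (hq : 1 ≤ q)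
    {g : (s : ℕ) → (ZMod b)[X] → Fin s → (ZMod b)[X]} {lam : ℝ} (hlam : 1 / (α : ℝ) < lam)
    (hg : ∀ s (p : (ZMod b)[X]), Irreducible p → figureOfMerit α γ p (g s p) ≤
      ENNReal.ofReal (weightJ b α lam γ s * ((b : ℝ) ^ p.natDegree - 1) ^ (-(1 / lam)))) :
    HasErrorBound α γ q g lam fun s => rateConst b α lam * (weightJ b α lam γ s + weightH α q γ s) := by
  intro s _ m hm p hp
  have hα0 : (0 : ℝ) < α := by exact_mod_cast (by omega : 0 < α)
  have h0 : 0 < lam := lt_of_le_of_lt (by positivity) hlam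
  have hb1 : (1 : ℝ) ≤ b := by linarith [two_le_base (b := b)]
  have hb2 : (2 : ℝ) ≤ b := two_le_base
  have hb0 : (0 : ℝ) < b := base_pos
  have hJ := weightJ_nonneg (b := b) hα hlam γ s
  have hH := weightH_nonneg (by omega : 1 ≤ α) q γ s
  obtain ⟨hN0, hN⟩ := totalPoints_bounds (b := b) (by omega : 1 ≤ α) hm
  set N : ℝ := (totalPoints b α m : ℝ) with hNdef
  -- The factor `α b^{α-1}` compares `N ≤ α b^m` with the smallest number of points `b^{m-α+1}`; the
  -- factor `2` absorbs the `-1`, since `b^n - 1 ≥ b^n / 2`.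
  set c : ℝ := 2 * α * (b : ℝ) ^ (α - 1) with hc
  have hc0 : 0 < c := by positivity
  have hNc : N / c ≤ (b : ℝ) ^ m / (b : ℝ) ^ (α - 1) / 2 := by
    rw [div_le_iff₀ hc0]
    refine hN.trans (le_of_eq ?_)
    rw [hc]; field_simp
  have hrate : (N / c) ^ (-(1 / lam)) = c ^ (1 / lam) * N ^ (-(1 / lam)) := by
    rw [Real.div_rpow hN0.le hc0.le, Real.rpow_neg hc0.le, div_inv_eq_mul, mul_comm]
  have hneg : -(1 / lam) ≤ 0 := by
    have : 0 < 1 / lam := by positivity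
    linarith
  refine (worstCaseError_le hα hm γ hq hp _).trans ?_
  have h1 : ∑ τ ∈ Finset.Icc 1 α, ENNReal.ofReal |richardsonCoeff b α τ| *
      figureOfMerit α γ (p (m - τ + 1)) (g s (p (m - τ + 1))) ≤
      ENNReal.ofReal (richardsonSum b α * (weightJ b α lam γ s * (c ^ (1 / lam) * N ^ (-(1 / lam))))) := by
    rw [richardsonSum, Finset.sum_mul, ENNReal.ofReal_sum_of_nonneg fun τ _ =>
      mul_nonneg (abs_nonneg _) (mul_nonneg hJ (by positivity))]
    refine Finset.sum_le_sum fun τ hτ => ?_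
    have hτ := Finset.mem_Icc.1 hτ
    obtain ⟨hirr, hdeg⟩ := hp (m - τ + 1) (by omega) (by omega)
    rw [ENNReal.ofReal_mul (abs_nonneg _)]
    refine mul_le_mul_right ((hg s _ hirr).trans (ENNReal.ofReal_le_ofReal
      (mul_le_mul_of_nonneg_left ?_ hJ))) _
    rw [← hrate, hdeg]
    refine Real.rpow_le_rpow_of_nonpos (by positivity) (hNc.trans ?_) hneg
    have h2 : (b : ℝ) ^ m / (b : ℝ) ^ (α - 1) ≤ (b : ℝ) ^ (m - τ + 1) := by
      rw [div_le_iff₀ (by positivity), ← pow_add]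
      exact pow_le_pow_right₀ hb1 (by omega)
    have h3 : (2 : ℝ) ≤ (b : ℝ) ^ (m - τ + 1) :=
      hb2.trans (le_self_pow₀ hb1 (by omega))
    linarith
  have h2 : ((b : ℝ) ^ (α - 1) / (b : ℝ) ^ m) ^ α ≤ c ^ (1 / lam) * N ^ (-(1 / lam)) := by
    set z : ℝ := (b : ℝ) ^ m / (b : ℝ) ^ (α - 1) with hz
    have hz1 : 1 ≤ z := by
      rw [hz, le_div_iff₀ (by positivity), one_mul]
      exact pow_le_pow_right₀ hb1 (by omega)
    have e : ((b : ℝ) ^ (α - 1) / (b : ℝ) ^ m) ^ α = z ^ (-(α : ℝ)) := by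
      rw [Real.rpow_neg (by positivity), Real.rpow_natCast, ← inv_pow, hz, inv_div]
    rw [e, ← hrate]
    -- This is where the order `α` of the grid remainder beats the target rate.
    have h4 : 1 / lam < α := by
      rw [div_lt_iff₀ hα0] at hlam
      rw [div_lt_iff₀ h0]; linarith
    refine (Real.rpow_le_rpow_of_exponent_le hz1 (by linarith)).trans
      (Real.rpow_le_rpow_of_nonpos (by positivity) (hNc.trans ?_) hneg)
    linarith
  have h3 : richardsonSum b α * ((b : ℝ) ^ (α - 1) / (b : ℝ) ^ m) ^ α * weightH α q γ s ≤
      richardsonSum b α * (c ^ (1 / lam) * N ^ (-(1 / lam))) * weightH α q γ s :=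
    mul_le_mul_of_nonneg_right (mul_le_mul_of_nonneg_left h2 (richardsonSum_nonneg _ _)) hH
  refine (add_le_add h1 (ENNReal.ofReal_le_ofReal h3)).trans (le_of_eq ?_)
  have hA := richardsonSum_nonneg b α
  rw [← ENNReal.ofReal_add (by positivity) (by positivity), rateConst]
  congr 1
  ring

lemma HasErrorBound.mono {γ : Finset ℕ → ℝ≥0} {q : ℝ≥0∞}
    {g : (s : ℕ) → (ZMod b)[X] → Fin s → (ZMod b)[X]} {lam : ℝ} {K K' : ℕ → ℝ}
    (h : HasErrorBound α γ q g lam K) (hK : ∀ s, 1 ≤ s → K s ≤ K' s) :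
    HasErrorBound α γ q g lam K' := fun s hs m hm p hp =>
  (h s hs m hm p hp).trans (ENNReal.ofReal_le_ofReal
    (mul_le_mul_of_nonneg_right (hK s hs) (by positivity)))

lemma rateConst_nonneg (b α : ℕ) (lam : ℝ) : 0 ≤ rateConst b α lam :=
  mul_nonneg (richardsonSum_nonneg _ _) (by positivity)

end Rate

/-! ### Dependence on the dimension -/

/-- The `limsup` controls all large `s`; the finitely many others are absorbed into the constant. -/
lemma exists_le_mul_of_limsup_lt_top {F D : ℕ → ℝ} (hD : ∀ s, 1 ≤ s → 0 < D s)
    (h : limsup (fun s : ℕ => ((F s / D s : ℝ) : EReal)) atTop < ⊤) :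
    ∃ B : ℝ, 0 ≤ B ∧ ∀ s, 1 ≤ s → F s ≤ B * D s := by
  obtain ⟨B, hB, -⟩ := EReal.lt_iff_exists_real_btwn.1 h
  obtain ⟨S, hS⟩ := eventually_atTop.1 (eventually_lt_of_limsup_lt hB)
  have hsum : 0 ≤ ∑ i ∈ Finset.range S, |F i / D i| := Finset.sum_nonneg fun _ _ => abs_nonneg _
  refine ⟨|B| + ∑ i ∈ Finset.range S, |F i / D i|, by positivity, fun s hs => ?_⟩
  rw [← div_le_iff₀ (hD s hs)]
  rcases lt_or_ge s S with hlt | hge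
  · have h1 := Finset.single_le_sum (f := fun i => |F i / D i|) (fun _ _ => abs_nonneg _)
      (Finset.mem_range.2 hlt)
    have h2 := le_abs_self (F s / D s)
    have h3 := abs_nonneg B
    linarith
  · have h1 : F s / D s < B := EReal.coe_lt_coe_iff.1 (hS s hge)
    have h2 := le_abs_self B
    linarith

/-- From `(1 + x)^λ ≤ 1 + x^λ ≤ exp(x^λ)`. It brings in `λ`-th powers, as needed for `weightH`,
whose weights occur to the first power while the hypotheses concern `γ_j^λ`. -/
lemma one_add_le_exp_rpow_div {lam x : ℝ} (h0 : 0 < lam) (h1 : lam ≤ 1) (hx : 0 ≤ x) :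
    1 + x ≤ Real.exp (x ^ lam / lam) := by
  have h2 : (1 + x) ^ lam ≤ Real.exp (x ^ lam) := by
    have h3 := Real.rpow_add_le_add_rpow zero_le_one hx h0.le h1
    rw [Real.one_rpow] at h3
    linarith [Real.add_one_le_exp (x ^ lam)]
  have h4 := Real.rpow_le_rpow (by positivity) h2 (by positivity : 0 ≤ lam⁻¹)
  rwa [Real.rpow_rpow_inv (by positivity) h0.ne', ← Real.exp_mul, ← div_eq_mul_inv] at h4

/-! ### Product weights: exponential bounds in the sum of the `λ`-th powers -/

section ProductWeights

variable {b : ℕ} [hb : Fact b.Prime] {α : ℕ} {γ : Finset ℕ → ℝ≥0} {w : ℕ → ℝ≥0}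

/-- The sum over subsets is the expansion of `∏ (1 + c γ_j^λ)`, bounded by an exponential. -/
lemma weightJ_le_of_product (hα : 2 ≤ α) {lam : ℝ} (hlam : 1 / (α : ℝ) < lam)
    (hγ : ∀ u : Finset ℕ, γ u = ∏ j ∈ u, w j) (s : ℕ) :
    weightJ b α lam γ s ≤ Real.exp (walshConst b α ^ lam * sumConst b α lam / lam *
      ∑ j ∈ Finset.range s, (w j : ℝ) ^ lam) := by
  have h0 : 0 < lam := lt_of_le_of_lt (by positivity) hlam
  have hC := walshConst_nonneg (b := b) hα
  have hE := sumConst_nonneg (b := b) (by omega : 1 ≤ α) hlam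
  set c : ℝ := walshConst b α ^ lam * sumConst b α lam with hc
  have hc0 : 0 ≤ c := mul_nonneg (Real.rpow_nonneg hC _) hE
  have hterm : ∀ u : Finset ℕ, (γ u : ℝ) ^ lam * walshConst b α ^ (lam * (u.card : ℝ)) *
      sumConst b α lam ^ u.card = ∏ j ∈ u, c * (w j : ℝ) ^ lam := fun u => by
    rw [hγ, NNReal.coe_prod, ← Real.finsetProd_rpow _ _ fun _ _ => NNReal.coe_nonneg _,
      Finset.prod_mul_distrib, Finset.prod_const, Real.rpow_mul hC, Real.rpow_natCast, hc, mul_pow]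
    ring
  have hsum : ∑ u ∈ (Finset.range s).powerset.erase ∅, ∏ j ∈ u, c * (w j : ℝ) ^ lam ≤
      Real.exp (∑ j ∈ Finset.range s, c * (w j : ℝ) ^ lam) := by
    calc _ ≤ ∑ u ∈ (Finset.range s).powerset, ∏ j ∈ u, c * (w j : ℝ) ^ lam :=
          Finset.sum_le_sum_of_subset_of_nonneg (Finset.erase_subset _ _) fun u _ _ =>
            Finset.prod_nonneg fun j _ => by positivity
      _ = ∏ j ∈ Finset.range s, (1 + c * (w j : ℝ) ^ lam) := (Finset.prod_one_add _).symm
      _ ≤ ∏ j ∈ Finset.range s, Real.exp (c * (w j : ℝ) ^ lam) :=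
          Finset.prod_le_prod (fun j _ => by positivity) fun j _ => by
            linarith [Real.add_one_le_exp (c * (w j : ℝ) ^ lam)]
      _ = _ := (Real.exp_sum _ _).symm
  rw [weightJ, Finset.sum_congr rfl fun u _ => hterm u]
  refine (Real.rpow_le_rpow (Finset.sum_nonneg fun u _ => Finset.prod_nonneg fun j _ => by
    positivity) hsum (by positivity)).trans_eq ?_
  rw [← Real.exp_mul, ← Finset.mul_sum]
  congr 1
  ring

lemma weightH_le_of_product (hα : 1 ≤ α) (q : ℝ≥0∞) {lam : ℝ} (h0 : 0 < lam) (h1 : lam ≤ 1)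
    (hγ : ∀ u : Finset ℕ, γ u = ∏ j ∈ u, w j) (s : ℕ) :
    weightH α q γ s ≤
      Real.exp ((((α : ℝ) + 1) ^ (1 - (q⁻¹).toReal) * bernoulliConst α) ^ lam / lam *
        ∑ j ∈ Finset.range s, (w j : ℝ) ^ lam) := by
  have hD := bernoulliConst_nonneg hα
  set c : ℝ := ((α : ℝ) + 1) ^ (1 - (q⁻¹).toReal) * bernoulliConst α with hc
  have hc0 : 0 ≤ c := mul_nonneg (by positivity) hD
  have hterm : ∀ u : Finset ℕ, (γ u : ℝ) *
      ((α : ℝ) + 1) ^ ((u.card : ℝ) * (1 - (q⁻¹).toReal)) * bernoulliConst α ^ u.card =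
      ∏ j ∈ u, c * (w j : ℝ) := fun u => by
    rw [hγ, NNReal.coe_prod, Finset.prod_mul_distrib, Finset.prod_const, mul_comm (u.card : ℝ),
      Real.rpow_mul (by positivity), Real.rpow_natCast, hc, mul_pow]
    ring
  rw [weightH, Finset.sum_congr rfl fun u _ => hterm u]
  calc _ = ∏ j ∈ Finset.range s, (1 + c * (w j : ℝ)) := (Finset.prod_one_add _).symm
    _ ≤ ∏ j ∈ Finset.range s, Real.exp ((c * (w j : ℝ)) ^ lam / lam) :=
        Finset.prod_le_prod (fun j _ => by positivity) fun j _ =>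
          one_add_le_exp_rpow_div h0 h1 (by positivity)
    _ = _ := by
      rw [← Real.exp_sum, Finset.mul_sum]
      congr 1
      refine Finset.sum_congr rfl fun j _ => ?_
      rw [Real.mul_rpow hc0 (NNReal.coe_nonneg _)]
      ring

lemma exists_weightJ_add_weightH_le_of_product (hα : 2 ≤ α) (q : ℝ≥0∞) {lam : ℝ}
    (hlam : 1 / (α : ℝ) < lam) (h1 : lam ≤ 1) (hγ : ∀ u : Finset ℕ, γ u = ∏ j ∈ u, w j) :
    ∃ C : ℝ, 0 ≤ C ∧ ∀ s, weightJ b α lam γ s + weightH α q γ s ≤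
      2 * Real.exp (C * ∑ j ∈ Finset.range s, (w j : ℝ) ^ lam) := by
  have h0 : 0 < lam := lt_of_le_of_lt (by positivity) hlam
  refine ⟨max (walshConst b α ^ lam * sumConst b α lam / lam)
    ((((α : ℝ) + 1) ^ (1 - (q⁻¹).toReal) * bernoulliConst α) ^ lam / lam), ?_, fun s => ?_⟩
  · refine le_max_of_le_left (div_nonneg (mul_nonneg (Real.rpow_nonneg ?_ _) ?_) h0.le)
    exacts [walshConst_nonneg hα, sumConst_nonneg (by omega) hlam]
  · have hS : 0 ≤ ∑ j ∈ Finset.range s, (w j : ℝ) ^ lam :=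
      Finset.sum_nonneg fun j _ => by positivity
    rw [two_mul]
    refine add_le_add ((weightJ_le_of_product hα hlam hγ s).trans ?_)
      ((weightH_le_of_product (by omega) q h0 h1 hγ s).trans ?_)
    · exact Real.exp_le_exp.2 (mul_le_mul_of_nonneg_right (le_max_left _ _) hS)
    · exact Real.exp_le_exp.2 (mul_le_mul_of_nonneg_right (le_max_right _ _) hS)

end ProductWeights

theorem mainTheorem5 (b : ℕ) [Fact b.Prime] (α : ℕ) (hα : 2 ≤ α) (γ : Finset ℕ → ℝ≥0) :
    ∃ g : (s : ℕ) → (ZMod b)[X] → Fin s → (ZMod b)[X],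
      (∀ (s : ℕ) (p : (ZMod b)[X]), Irreducible p →
        ∀ j, g s p j ≠ 0 ∧ (g s p j).degree < p.degree) ∧
      ∀ (q : ℝ≥0∞), 1 ≤ q → ∀ lam : ℝ, 1 / (α : ℝ) < lam → lam ≤ 1 →
        -- general weights, bounded quantities
        ((∃ L : ℝ, Tendsto (weightJ b α lam γ) atTop (𝓝 L)) →
          (∃ L : ℝ, Tendsto (weightH α q γ) atTop (𝓝 L)) →
          ∃ K : ℝ, HasErrorBound α γ q g lam fun _ => K) ∧
        -- general weights, polynomially growing quantities
        ((∃ κ : ℝ, 0 < κ ∧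
            limsup (fun s : ℕ => ((weightJ b α lam γ s / (s : ℝ) ^ κ : ℝ) : EReal)) atTop < ⊤ ∧
            limsup (fun s : ℕ => ((weightH α q γ s / (s : ℝ) ^ κ : ℝ) : EReal)) atTop < ⊤) →
          ∃ K t : ℝ, HasErrorBound α γ q g lam fun s => K * (s : ℝ) ^ t) ∧
        -- product weights
        ∀ w : ℕ → ℝ≥0, (∀ u : Finset ℕ, γ u = ∏ j ∈ u, w j) →
          ((Summable fun j : ℕ => (w j : ℝ) ^ lam) →
            ∃ K : ℝ, HasErrorBound α γ q g lam fun _ => K) ∧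
          (limsup (fun s : ℕ =>
              (((∑ j ∈ Finset.range s, (w j : ℝ) ^ lam) / Real.log ((s : ℝ) + 1) : ℝ) : EReal))
              atTop < ⊤ →
            ∃ K t : ℝ, HasErrorBound α γ q g lam fun s => K * (s : ℝ) ^ t) := by
  have hex : ∀ (s : ℕ) (p : (ZMod b)[X]), ∃ g : Fin s → (ZMod b)[X], Irreducible p →
      (∀ j, g j ≠ 0 ∧ (g j).degree < p.degree) ∧ ∀ lam : ℝ, 1 / (α : ℝ) < lam → lam ≤ 1 →
        figureOfMerit α γ p g ≤ ENNReal.ofReal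
          (weightJ b α lam γ s * ((b : ℝ) ^ p.natDegree - 1) ^ (-(1 / lam))) := fun s p => by
    by_cases hp : Irreducible p
    · obtain ⟨g, hg⟩ := exists_generatingVector hα γ s hp
      exact ⟨g, fun _ => hg⟩
    -- A dummy value: reducible moduli are never used.
    · exact ⟨0, fun h => absurd h hp⟩
  choose g hg using hex
  refine ⟨g, fun s p hp => (hg s p hp).1, fun q hq lam hlam hlam1 => ?_⟩
  have hmain := hasErrorBound_of_figureOfMerit_le hα γ hq hlam
    fun s p hp => (hg s p hp).2 lam hlam hlam1
  have hR := rateConst_nonneg b α lam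
  refine ⟨?_, ?_, fun w hw => ?_⟩
  · rintro ⟨L₁, h₁⟩ ⟨L₂, h₂⟩
    obtain ⟨B₁, hB₁⟩ := h₁.bddAbove_range
    obtain ⟨B₂, hB₂⟩ := h₂.bddAbove_range
    exact ⟨rateConst b α lam * (B₁ + B₂), hmain.mono fun s _ => mul_le_mul_of_nonneg_left
      (add_le_add (hB₁ ⟨s, rfl⟩) (hB₂ ⟨s, rfl⟩)) hR⟩
  · rintro ⟨κ, -, h₁, h₂⟩
    have hpos : ∀ s : ℕ, 1 ≤ s → 0 < (s : ℝ) ^ κ := fun s hs =>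
      Real.rpow_pos_of_pos (by exact_mod_cast hs) _
    obtain ⟨B₁, -, hB₁⟩ := exists_le_mul_of_limsup_lt_top hpos h₁
    obtain ⟨B₂, -, hB₂⟩ := exists_le_mul_of_limsup_lt_top hpos h₂
    refine ⟨rateConst b α lam * (B₁ + B₂), κ, hmain.mono fun s hs => ?_⟩
    rw [mul_assoc, add_mul]
    exact mul_le_mul_of_nonneg_left (add_le_add (hB₁ s hs) (hB₂ s hs)) hR
  · obtain ⟨C, hC, hle⟩ :=
      exists_weightJ_add_weightH_le_of_product (b := b) hα q hlam hlam1 hw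
    constructor
    · intro hsum
      refine ⟨rateConst b α lam * (2 * Real.exp (C * ∑' j, (w j : ℝ) ^ lam)),
        hmain.mono fun s _ => mul_le_mul_of_nonneg_left ((hle s).trans ?_) hR⟩
      gcongr
      exact hsum.sum_le_tsum _ fun j _ => by positivity
    · intro hlim
      have hlog : ∀ s : ℕ, 1 ≤ s → 0 < Real.log ((s : ℝ) + 1) := fun s hs =>
        Real.log_pos (by linarith [(Nat.one_le_cast (α := ℝ)).2 hs])
      obtain ⟨B, hB, hle'⟩ := exists_le_mul_of_limsup_lt_top hlog hlim
      -- The exponential of `C B log(s + 1)` is `(s + 1)^{CB} ≤ (2s)^{CB}`, so the degree is `C B`.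
      refine ⟨rateConst b α lam * (2 * 2 ^ (C * B)), C * B, hmain.mono fun s hs => ?_⟩
      have hs1 : (1 : ℝ) ≤ s := Nat.one_le_cast.2 hs
      rw [mul_assoc, mul_assoc]
      refine mul_le_mul_of_nonneg_left ((hle s).trans ?_) hR
      refine mul_le_mul_of_nonneg_left ?_ zero_le_two
      calc Real.exp (C * ∑ j ∈ Finset.range s, (w j : ℝ) ^ lam)
          ≤ Real.exp (C * (B * Real.log ((s : ℝ) + 1))) :=
            Real.exp_le_exp.2 (mul_le_mul_of_nonneg_left (hle' s hs) hC)
        _ = ((s : ℝ) + 1) ^ (C * B) := by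
            rw [Real.rpow_def_of_pos (by positivity)]
            congr 1
            ring
        _ ≤ (2 * (s : ℝ)) ^ (C * B) :=
            Real.rpow_le_rpow (by positivity) (by linarith) (mul_nonneg hC hB)
        _ = 2 ^ (C * B) * (s : ℝ) ^ (C * B) := Real.mul_rpow zero_le_two (by positivity)
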